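/- Let $M$ be a smooth compact connected oriented surface with non-empty boundary and a fixed Riemannian metric, and let $E$ be a smooth Hermitian complex vector bundle over $M$, with restriction $E_\partial$ to $\partial M$. Let $\mathrm{Ell}(E)$ be the set of first order formally self-adjoint elliptic differential operators $A$ with smooth coefficients acting on sections of $E$, with the $C^1$-topology on principal symbols $\sigma_A$ and the $C^0$-topology on free terms (symbols are normalized so that locally $A=-i\sum_j\sigma_A(dy_j)\partial_j+a$). For $A\in\mathrm{Ell}(E)$ and $x\in M$ let $E^{+}_x(A)$, resp. $E^-_x(A)$, be the span of the generalized eigenspaces of $\sigma_A(e_1)^{-1}\sigma_A(e_2)$ for the eigenvalues with positive, resp. negative imaginary part, where $(e_1,e_2)$ is any positively oriented frame of $T^*_xM$. Let $\mathrm{Dir}(E)\subset\mathrm{Ell}(E)$ be the subspace of odd Dirac operators: $\sigma_A(\xi)^2=\|\xi\|^2\,\mathrm{Id}$ for all $\xi\in T^*M$, and $A$ interchanges sections of $E^+(A)$ and $E^-(A)$. Let $\overline{\mathrm{Ell}}(E)$ be the space of pairs $(A,L)$, where $A\in\mathrm{Ell}(E)$ and $L$ is a smooth subbundle of $E_\partial$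 that is Lagrangian, $\sigma_A(n)L=L^\perp$ ($n$ the outward unit conormal), and complementary to both $E^+(A)|_{\partial M}$ and $E^-(A)|_{\partial M}$, with the topology of $\mathrm{Ell}(E)$ on operators and the $C^1$-topology on boundary conditions $L$. Let $\overline{\mathrm{Dir}}(E)$ be the subspace of pairs with $A\in\mathrm{Dir}(E)$. For $(A,L)\in\overline{\mathrm{Ell}}(E)$, $L_x$ is the graph of an isomorphism $R_x\colon E^-_x(A)\to E^+_x(A)$; let $T_x$ be the composition of $i\sigma_A(n_x)R_x$ with the orthogonal projection onto $E^-_x(A)$, and let $F(A,L)\subset E^-(A)|_{\partial M}$ be the subbundle whose fibers $F(A,L)_x$ are spanned by the generalized eigenspaces of $T_x$ for negative eigenvalues. Let $U(E)$ be the group of smooth unitary bundle automorphisms of $E$; it acts on symbols and operators by conjugation and on pairs by $g(A,L)=(gAg^{-1},gL)$. For $g\in U(E)$ and $X$ one of the spaces above, $\Omega_gX$ is the space of continuous paths $\gamma\colon[0,1]\to X$ with $\gamma(1)=g\gamma(0)$, with the compact-open topology. Let $\mathcal E$ be the bundle over $M\times S^1$ obtained from $E\times[0,1]$ by identifying $(u,0)$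 with $(gu,1)$. For such a path $\gamma$ let $\mathcal E^-(\gamma,g)\subset\mathcal E$ be the subbundle glued from the subbundles $E^-(\gamma(t))$, and, for $\gamma\in\Omega_g\overline{\mathrm{Ell}}(E)$, let $\mathcal F(\gamma,g)\subset\mathcal E|_{\partial M\times S^1}$ be the subbundle glued from the subbundles $F(\gamma(t))$. A deformation retraction of a space $X$ onto a subspace $Y$ is a continuous map $H\colon[0,1]\times X\to X$ with $H_0=\mathrm{Id}$, $H_1(X)=Y$ and $H_1|_Y=\mathrm{Id}_Y$. Then the following holds. 1. The inclusion $\mathrm{Dir}(E)\hookrightarrow\mathrm{Ell}(E)$ is a homotopy equivalence. There is a deformation retraction $H$ of $\mathrm{Ell}(E)$ onto a subspace of $\mathrm{Dir}(E)$ such that for all $s\in[0,1]$ and $A\in\mathrm{Ell}(E)$, with $A_s=H_s(A)$: (a) $E^-(A_s)=E^-(A)$; (b) the symbol of $A_s$ depends only on $s$ and $\sigma_A$; (c) the map $\sigma_A\mapsto\sigma_{A_s}$ is $U(E)$-equivariant; (d) if $A\in\mathrm{Dir}(E)$, then $\sigma_{A_s}=\sigma_A$; (e) if $A,B\in\mathrm{im}\,H_1$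 have the same symbol, then $A=B$. 2. The inclusion $\overline{\mathrm{Dir}}(E)\hookrightarrow\overline{\mathrm{Ell}}(E)$ is a homotopy equivalence. There is a deformation retraction of $\overline{\mathrm{Ell}}(E)$ onto a subspace of $\overline{\mathrm{Dir}}(E)$ preserving both $E^-(A)$ and $F(A,L)$. 3. For every $g\in U(E)$ the inclusions $\Omega_g\mathrm{Dir}(E)\hookrightarrow\Omega_g\mathrm{Ell}(E)$ and $\Omega_g\overline{\mathrm{Dir}}(E)\hookrightarrow\Omega_g\overline{\mathrm{Ell}}(E)$ are homotopy equivalences. There is a deformation retraction of $\Omega_g\mathrm{Ell}(E)$ onto a subspace of $\Omega_g\mathrm{Dir}(E)$ preserving $\mathcal E^-(\gamma,g)$, and there is a deformation retraction of $\Omega_g\overline{\mathrm{Ell}}(E)$ onto a subspace of $\Omega_g\overline{\mathrm{Dir}}(E)$ preserving both $\mathcal E^-(\gamma,g)$ and $\mathcal F(\gamma,g)$. -/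

import Mathlib

open scoped Manifold ContDiff Topology
open Bundle MeasureTheory

noncomputable section

namespace BVP

/-! ### The surface -/

/-- The model plane. -/
abbrev Plane : Type := EuclideanSpace ℝ (Fin 2)

section Surface

variable {M : Type*} [TopologicalSpace M] [ChartedSpace (EuclideanHalfSpace 2) M]

/-- The tangent plane `T_x M`. -/
abbrev Tan (x : M) : Type := TangentSpace (𝓡∂ 2) x

variable (M) in
/-- The boundary `∂M`, as a type. -/
abbrev Bdry : Type _ := ((𝓡∂ 2).boundary M : Set M)

variable [IsManifold (𝓡∂ 2) ∞ M]

/-- The coordinate vector field `∂_j` of the chart around `c`, at the point `x` of that chart. -/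
def coordVec (c x : M) (j : Fin 2) : Tan x :=
  (trivializationAt Plane (TangentSpace (𝓡∂ 2)) c).symmL ℝ x (EuclideanSpace.single j 1)

/-- The coordinate covector `dy_j` of the chart around `c`, at the point `x` of that chart. -/
def coordCovec (c x : M) (j : Fin 2) : Tan x →L[ℝ] ℝ :=
  (EuclideanSpace.proj j : Plane →L[ℝ] ℝ).comp
    ((trivializationAt Plane (TangentSpace (𝓡∂ 2)) c).continuousLinearMapAt ℝ x)

/-- The differential `d_x f` of a smooth real function, as a covector. -/
def dAt (f : C^∞⟮𝓡∂ 2, M; ℝ⟯) (x : M) : Tan x →L[ℝ] ℝ :=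
  mfderiv (𝓡∂ 2) 𝓘(ℝ, ℝ) f x

variable (M) in
/-- An orientation of the surface: an orientation of every tangent plane, which is locally constant
in the sense that the frame `(∂_0, ∂_1)` of a chart does not change its sign near the centre of the
chart. -/
structure SurfaceOrientation where
  /-- the orientation of the tangent plane at a point -/
  at_ : ∀ x : M, Orientation ℝ (Tan x) (Fin 2)
  locally_constant : ∀ c : M, ∀ᶠ x in 𝓝 c,
    ((∃ b : Module.Basis (Fin 2) ℝ (Tan x), (∀ j, b j = coordVec c x j) ∧ b.orientation = at_ x) ↔
      (∃ b : Module.Basis (Fin 2) ℝ (Tan c), (∀ j, b j = coordVec c c j) ∧ b.orientation = at_ c))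

/-- `(ξ, η)` is a positively oriented frame of the cotangent plane `T*_x M`: the 2-form `ξ ∧ η` is
positive on positively oriented frames of `T_x M`. -/
def SurfaceOrientation.PosCoframe (o : SurfaceOrientation M) (x : M) (ξ η : Tan x →L[ℝ] ℝ) : Prop :=
  ∃ b : Module.Basis (Fin 2) ℝ (Tan x), b.orientation = o.at_ x ∧
    0 < ξ (b 0) * η (b 1) - ξ (b 1) * η (b 0)

variable [RiemannianBundle (fun x : M => TangentSpace (𝓡∂ 2) x)]

/-- The Riemannian volume density `√(det (g_ij))` in the chart around `c`. -/
def volDensity (c : M) (y : Plane) : ℝ :=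
  Real.sqrt (Matrix.det (Matrix.of fun i j : Fin 2 =>
    inner ℝ (coordVec c ((extChartAt (𝓡∂ 2) c).symm y) i)
      (coordVec c ((extChartAt (𝓡∂ 2) c).symm y) j)))

variable (M) in
/-- The Riemannian volume measure of the surface. In the chart around `c` it is
`√(det (g_ij)) dy_0 dy_1`; these measures on the chart domains agree on overlaps, and the measure
obtained by gluing them is their supremum. -/
def riemannianVolume [MeasurableSpace M] : Measure M :=
  ⨆ c : M, Measure.map (extChartAt (𝓡∂ 2) c).symm
    (((volume : Measure Plane).restrict (extChartAt (𝓡∂ 2) c).target).withDensity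
      fun y => ENNReal.ofReal (volDensity c y))

/-- The outward unit conormal `n_x` at a boundary point. In the chart at `x` the surface is the
half-plane `y_0 ≥ 0`, so that `n_x = - dy_0 / ‖dy_0‖`. -/
def outwardConormal (x : Bdry M) : Tan (x : M) →L[ℝ] ℝ :=
  -((‖coordCovec (x : M) (x : M) 0‖)⁻¹ • coordCovec (x : M) (x : M) 0)

end Surface

/-! ### Linear algebra in one fibre -/

section Fibre

variable {W : Type*} [AddCommGroup W] [Module ℂ W]

open Classical in
/-- The projection of `W` onto `p` along the complementary subspace `q`. -/
def projAlong (p q : Submodule ℂ W) : W →ₗ[ℂ] W :=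
  if h : IsCompl p q then p.projection q h else 0

theorem projAlong_mem (p q : Submodule ℂ W) (w : W) : projAlong p q w ∈ p := by
  unfold projAlong
  split_ifs with h
  · exact Submodule.projection_apply_mem h w
  · exact p.zero_mem

end Fibre

/-! ### The vector bundle -/

section VectorBundle

variable {M : Type*} [TopologicalSpace M] [ChartedSpace (EuclideanHalfSpace 2) M]
  [IsManifold (𝓡∂ 2) ∞ M]
  (V : Type*) [NormedAddCommGroup V] [NormedSpace ℂ V] [FiniteDimensional ℂ V]
  (E : M → Type*) [TopologicalSpace (TotalSpace V E)]
  [∀ x, NormedAddCommGroup (E x)] [∀ x, InnerProductSpace ℂ (E x)]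
  [FiberBundle V E] [VectorBundle ℂ V E] [VectorBundle ℝ V E]
  [ContMDiffVectorBundle ∞ V E (𝓡∂ 2)]

/-- The complex vector space `Γ(E)` of smooth sections of `E`. -/
def Sections : Submodule ℂ (∀ x, E x) where
  carrier := {u | ContMDiff (𝓡∂ 2) ((𝓡∂ 2).prod 𝓘(ℝ, V)) ∞ fun x => TotalSpace.mk' V x (u x)}
  add_mem' hu hv := ContMDiff.add_section hu hv
  zero_mem' := contMDiff_zeroSection ℝ E
  smul_mem' a u hu := by
    intro x
    have hx := hu x
    rw [contMDiffAt_section] at hx ⊢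
    have h2 : ContMDiffAt (𝓡∂ 2) 𝓘(ℝ, V) ∞
        (fun y => a • (trivializationAt V E x ⟨y, u y⟩).2) x :=
      (contDiff_const_smul (𝕜 := ℝ) (F := V) (n := ∞) a).contMDiff.contMDiffAt.comp x hx
    refine h2.congr_of_eventuallyEq ?_
    filter_upwards [(trivializationAt V E x).open_baseSet.mem_nhds
      (mem_baseSet_trivializationAt V E x)] with y hy
    exact ((trivializationAt V E x).linear ℂ hy).map_smul a (u y)

variable {V E}

variable (V E) in
/-- The Hermitian structure on the fibres of `E` is smooth. -/
def IsSmoothHermitian : Prop :=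
  ∀ u ∈ Sections V E, ∀ v ∈ Sections V E,
    ContMDiff (𝓡∂ 2) 𝓘(ℝ, ℂ) ∞ fun x => (inner ℂ (u x) (v x) : ℂ)

/-- The product of a section with a smooth real function. -/
def mulFun (f : C^∞⟮𝓡∂ 2, M; ℝ⟯) (u : Sections V E) : Sections V E :=
  ⟨fun x => f x • (u : ∀ x, E x) x, ContMDiff.smul_section f.contMDiff u.2⟩

/-- The section has its (automatically compact) support in `M \ ∂M`. -/
def SupportedInInterior (u : Sections V E) : Prop :=
  closure {x | (u : ∀ x, E x) x ≠ 0} ⊆ (𝓡∂ 2).interior M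

/-! #### Coordinate expressions -/

variable (V E)

/-- The image in the plane of the common domain of the chart and the local trivialization
around `c`. -/
def coordDomain (c : M) : Set Plane :=
  extChartAt (𝓡∂ 2) c ''
    ((chartAt (EuclideanHalfSpace 2) c).source ∩ (trivializationAt V E c).baseSet)

/-- The compact subsets of `coordDomain`. -/
def coordCompacts (c : M) : Set (Set Plane) := {K | IsCompact K ∧ K ⊆ coordDomain V E c}

/-- The compact subsets of the part `{t | (0, t) ∈ coordDomain}` of the coordinate axis `y_0 = 0`,
which parametrizes the boundary of `M` inside the coordinate domain. -/
def coordBdryCompacts (c : M) : Set (Set ℝ) :=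
  {K | IsCompact K ∧ ∀ t ∈ K, !₂[(0 : ℝ), t] ∈ coordDomain V E c}

variable {E}

/-- The coordinate expression of a section in the chart and local trivialization around `c`. -/
def coordSection (c : M) (u : ∀ x, E x) (y : Plane) : V :=
  (trivializationAt V E c).linearMapAt ℂ ((extChartAt (𝓡∂ 2) c).symm y)
    (u ((extChartAt (𝓡∂ 2) c).symm y))

/-- The matrix of a fibre endomorphism in the local trivialization around `c`. -/
def endInTriv (c x : M) (B : Module.End ℂ (E x)) : V →L[ℂ] V :=
  LinearMap.toContinuousLinearMap
    ((trivializationAt V E c).linearMapAt ℂ x ∘ₗ B ∘ₗ (trivializationAt V E c).symmₗ ℂ x)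

open Classical in
/-- The coordinate expression of a field of fibre endomorphisms over the boundary. -/
def coordBdryEnd (c : M) (B : ∀ x : Bdry M, Module.End ℂ (E x)) (t : ℝ) : V →L[ℂ] V :=
  if h : (extChartAt (𝓡∂ 2) c).symm !₂[(0 : ℝ), t] ∈ (𝓡∂ 2).boundary M then
    endInTriv V c _ (B ⟨_, h⟩) else 0

/-! #### Symbols -/

variable (E) in
/-- Principal symbols: a linear map `T*_x M → End(E_x)` for every `x`. -/
abbrev Symb : Type _ := ∀ x : M, (Tan x →L[ℝ] ℝ) →ₗ[ℝ] Module.End ℂ (E x)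

/-- The component `σ(dy_j)` of a symbol, in coordinates around `c`. -/
def coordSymbol (c : M) (j : Fin 2) (σ : Symb E) (y : Plane) : V →L[ℂ] V :=
  endInTriv V c ((extChartAt (𝓡∂ 2) c).symm y)
    (σ ((extChartAt (𝓡∂ 2) c).symm y) (coordCovec c ((extChartAt (𝓡∂ 2) c).symm y) j))

variable {V}

/-- The operator `Q = σ(ξ)⁻¹ σ(η)` on a fibre. -/
def Qop (σ : Symb E) (x : M) (ξ η : Tan x →L[ℝ] ℝ) : Module.End ℂ (E x) :=
  Ring.inverse (σ x ξ) * σ x η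

/-- `E⁺_x(σ)`: the span of the generalized eigenspaces of `Q = σ(ξ)⁻¹ σ(η)` for the eigenvalues with
positive imaginary part, where `(ξ, η)` is an arbitrary positive frame of `T*_x M`
(for an elliptic symbol it is the same subspace for all these frames). -/
def Eplus (o : SurfaceOrientation M) (σ : Symb E) (x : M) : Submodule ℂ (E x) :=
  ⨆ (ξ : Tan x →L[ℝ] ℝ) (η : Tan x →L[ℝ] ℝ) (_ : o.PosCoframe x ξ η) (z : ℂ) (_ : 0 < z.im),
    (Qop σ x ξ η).maxGenEigenspace z

/-- `E⁻_x(σ)`: the same for the eigenvalues with negative imaginary part. -/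
def Eminus (o : SurfaceOrientation M) (σ : Symb E) (x : M) : Submodule ℂ (E x) :=
  ⨆ (ξ : Tan x →L[ℝ] ℝ) (η : Tan x →L[ℝ] ℝ) (_ : o.PosCoframe x ξ η) (z : ℂ) (_ : z.im < 0),
    (Qop σ x ξ η).maxGenEigenspace z

/-! #### Unitary automorphisms -/

variable (V E) in
/-- `U(E)`: the smooth unitary bundle automorphisms of `E`. -/
structure UAut where
  /-- the action on a fibre -/
  fib : ∀ x, E x ≃ₗᵢ[ℂ] E x
  smooth : ∀ u ∈ Sections V E, (fun x => fib x (u x)) ∈ Sections V E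
  smooth_symm : ∀ u ∈ Sections V E, (fun x => (fib x).symm (u x)) ∈ Sections V E

/-- The action of a unitary automorphism on sections. -/
def UAut.onSections (g : UAut V E) (u : Sections V E) : Sections V E :=
  ⟨fun x => g.fib x ((u : ∀ x, E x) x), g.smooth u u.2⟩

/-- `τ = g σ g⁻¹` for symbols, written as `τ g = g σ`. -/
def UAut.ConjSymb (g : UAut V E) (σ τ : Symb E) : Prop :=
  ∀ (x : M) (ξ : Tan x →L[ℝ] ℝ) (u : E x), τ x ξ (g.fib x u) = g.fib x (σ x ξ u)

end VectorBundle

/-! ### Elliptic operators and boundary value problems -/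

section Operators

variable {M : Type*} [TopologicalSpace M] [ChartedSpace (EuclideanHalfSpace 2) M]
  [IsManifold (𝓡∂ 2) ∞ M] [MeasurableSpace M]
  [RiemannianBundle (fun x : M => TangentSpace (𝓡∂ 2) x)]
  (V : Type*) [NormedAddCommGroup V] [NormedSpace ℂ V] [FiniteDimensional ℂ V]
  (E : M → Type*) [TopologicalSpace (TotalSpace V E)]
  [∀ x, NormedAddCommGroup (E x)] [∀ x, InnerProductSpace ℂ (E x)]
  [FiberBundle V E] [VectorBundle ℂ V E] [VectorBundle ℝ V E]
  [ContMDiffVectorBundle ∞ V E (𝓡∂ 2)]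

/-- `Ell(E)`: the first order formally self-adjoint elliptic differential operators with smooth
coefficients acting on sections of `E`.

A first order differential operator with smooth coefficients is a linear map `A : Γ(E) → Γ(E)` such
that `A (f u) = f A u - i σ(df) u` for smooth real functions `f`, where `σ` is a bundle morphism
from `T*M` to `End(E)`, the symbol of `A` (locally `A = -i ∑ σ(dy_j) ∂_j + a`). The symbol is
determined by the operator and is automatically smooth. -/
structure Ell where
  /-- the operator -/
  op : Sections V E →ₗ[ℂ] Sections V E
  /-- its principal symbol -/
  symb : Symb E
  leibniz : ∀ (f : C^∞⟮𝓡∂ 2, M; ℝ⟯) (u : Sections V E) (x : M),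
    (op (mulFun f u) : ∀ x, E x) x =
      f x • (op u : ∀ x, E x) x - Complex.I • symb x (dAt f x) ((u : ∀ x, E x) x)
  elliptic : ∀ (x : M) (ξ : Tan x →L[ℝ] ℝ), ξ ≠ 0 → IsUnit (symb x ξ)
  formally_selfAdjoint : ∀ u v : Sections V E, SupportedInInterior u → SupportedInInterior v →
    ∫ x, inner ℂ ((op u : ∀ x, E x) x) ((v : ∀ x, E x) x) ∂(riemannianVolume M) =
      ∫ x, inner ℂ ((u : ∀ x, E x) x) ((op v : ∀ x, E x) x) ∂(riemannianVolume M)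

/-- The topology of `Ell(E)`: the `C¹`-topology on symbols (uniform convergence of the components
`σ(dy_j)` and of their first derivatives on compact subsets of coordinate domains) and the
`C⁰`-topology on free terms. Once the symbols `σ` of the operators `A = -i σ ∘ ∇ + a` are
controlled, uniform convergence of the free terms `a` amounts to uniform convergence of `A u` for
every smooth section `u`. -/
instance : TopologicalSpace (Ell V E) :=
  (⨅ (c : M) (j : Fin 2),
    TopologicalSpace.induced (fun A : Ell V E =>
        UniformOnFun.ofFun (coordCompacts V E c) (coordSymbol V c j A.symb)) inferInstance ⊓
      TopologicalSpace.induced (fun A : Ell V E =>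
        UniformOnFun.ofFun (coordCompacts V E c)
          (fderivWithin ℝ (coordSymbol V c j A.symb) (Set.range (𝓡∂ 2)))) inferInstance) ⊓
  ⨅ (c : M) (u : Sections V E),
    TopologicalSpace.induced (fun A : Ell V E =>
      UniformOnFun.ofFun (coordCompacts V E c) (coordSection V c (A.op u : ∀ x, E x))) inferInstance

variable {V E}

/-- `B = g A g⁻¹` for operators, written as `B g = g A`. -/
def UAut.ConjOp (g : UAut V E) (A B : Ell V E) : Prop :=
  ∀ u : Sections V E, B.op (g.onSections u) = g.onSections (A.op u)

variable (V E) in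
/-- `Dir(E)`: the odd Dirac operators, that is the operators `A` with `σ_A(ξ)² = ‖ξ‖² Id` which
interchange sections of `E⁺(A)` and `E⁻(A)`. -/
def Dir (o : SurfaceOrientation M) : Set (Ell V E) :=
  {A | (∀ (x : M) (ξ : Tan x →L[ℝ] ℝ), A.symb x ξ * A.symb x ξ = ((‖ξ‖ ^ 2 : ℝ) : ℂ) • 1) ∧
    (∀ u : Sections V E, (∀ x, (u : ∀ x, E x) x ∈ Eplus o A.symb x) →
      ∀ x, (A.op u : ∀ x, E x) x ∈ Eminus o A.symb x) ∧
    (∀ u : Sections V E, (∀ x, (u : ∀ x, E x) x ∈ Eminus o A.symb x) →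
      ∀ x, (A.op u : ∀ x, E x) x ∈ Eplus o A.symb x)}

variable (V) in
/-- `L` is a smooth subbundle of the restriction of `E` to `∂M`: near every boundary point it has a
frame consisting of restrictions of smooth sections of `E`. -/
def IsSmoothBdrySubbundle (L : ∀ x : Bdry M, Submodule ℂ (E x)) : Prop :=
  ∀ x₀ : Bdry M, ∃ (k : ℕ) (s : Fin k → Sections V E), ∀ᶠ x : Bdry M in 𝓝 x₀,
    LinearIndependent ℂ (fun i => (s i : ∀ x, E x) x) ∧
      Submodule.span ℂ (Set.range fun i => (s i : ∀ x, E x) x) = L x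

variable (V E) in
/-- The space of pairs `(A, L)`, where `A ∈ Ell(E)` and `L` is a smooth Lagrangian subbundle of the
restriction of `E` to `∂M`, i.e. `σ_A(n) L = L^⊥`, which is complementary to both `E⁺(A)` and
`E⁻(A)`. -/
structure EllBar (o : SurfaceOrientation M) where
  /-- the operator -/
  op : Ell V E
  /-- the boundary condition -/
  bc : ∀ x : Bdry M, Submodule ℂ (E x)
  smooth : IsSmoothBdrySubbundle V bc
  lagrangian : ∀ x : Bdry M, (bc x).map (op.symb x (outwardConormal x)) = (bc x)ᗮ
  compl_plus : ∀ x : Bdry M, IsCompl (bc x) (Eplus o op.symb x)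
  compl_minus : ∀ x : Bdry M, IsCompl (bc x) (Eminus o op.symb x)

/-- The topology on pairs `(A, L)`: that of `Ell(E)` on operators and the `C¹`-topology on
boundary conditions. The Grassmannian is embedded into the space of endomorphisms by sending a
subspace to the orthogonal projection on it. -/
instance (o : SurfaceOrientation M) : TopologicalSpace (EllBar V E o) :=
  TopologicalSpace.induced EllBar.op inferInstance ⊓
  ⨅ c : M,
    TopologicalSpace.induced (fun p : EllBar V E o =>
        UniformOnFun.ofFun (coordBdryCompacts V E c)
          (coordBdryEnd V c fun x => projAlong (p.bc x) (p.bc x)ᗮ)) inferInstance ⊓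
      TopologicalSpace.induced (fun p : EllBar V E o =>
        UniformOnFun.ofFun (coordBdryCompacts V E c)
          (deriv (coordBdryEnd V c fun x => projAlong (p.bc x) (p.bc x)ᗮ))) inferInstance

variable (V E) in
/-- The subspace of pairs `(A, L)` with `A` an odd Dirac operator. -/
def DirBar (o : SurfaceOrientation M) : Set (EllBar V E o) := {p | p.op ∈ Dir V E o}

/-- The automorphism `T` of `E⁻_x` that corresponds to the boundary condition `L`. If `L_x` is the
graph of `R : E⁻_x → E⁺_x` (so that `-R` is the projection onto `E⁺_x` along `L_x`), then `T` is the
composition of `i σ(n) R` with the orthogonal projection onto `E⁻_x`.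
Equivalently, `L_x` is the kernel of `P⁺ (1 + i σ(n)⁻¹ T P⁻)`. -/
def EllBar.T {o : SurfaceOrientation M} (p : EllBar V E o) (x : Bdry M) :
    Module.End ℂ (Eminus o p.op.symb (x : M)) :=
  LinearMap.codRestrict _
    (projAlong (Eminus o p.op.symb x) (Eminus o p.op.symb x)ᗮ ∘ₗ
      (Complex.I • p.op.symb x (outwardConormal x)) ∘ₗ
      (-projAlong (Eplus o p.op.symb x) (p.bc x)) ∘ₗ (Eminus o p.op.symb x).subtype)
    (fun _ => projAlong_mem _ _ _)

/-- `F(A, L)_x`: the span of the generalized eigenspaces of `T_x` for negative eigenvalues. -/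
def EllBar.F {o : SurfaceOrientation M} (p : EllBar V E o) (x : Bdry M) : Submodule ℂ (E x) :=
  (⨆ (t : ℝ) (_ : t < 0), (p.T x).maxGenEigenspace (t : ℂ)).map (Eminus o p.op.symb (x : M)).subtype

/-! ### Paths with conjugate ends -/

/-- `Ω_g Ell(E)`: the continuous paths `γ` in `Ell(E)` with `γ(1) = g γ(0)`, with the compact-open
topology. -/
abbrev PathEll (g : UAut V E) : Type _ := {γ : C(unitInterval, Ell V E) // g.ConjOp (γ 0) (γ 1)}

/-- The paths `γ` of pairs `(A, L)` with `γ(1) = g γ(0)`, with the compact-open topology. -/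
abbrev PathEllBar (o : SurfaceOrientation M) (g : UAut V E) : Type _ :=
  {γ : C(unitInterval, EllBar V E o) // g.ConjOp (γ 0).op (γ 1).op ∧
    ∀ x : Bdry M, (γ 1).bc x = ((γ 0).bc x).map (g.fib x).toLinearEquiv.toLinearMap}

/-- `Ω_g Dir(E)` as a subspace of `Ω_g Ell(E)`. -/
def PathDir (o : SurfaceOrientation M) (g : UAut V E) : Set (PathEll g) :=
  {γ | ∀ t, γ.1 t ∈ Dir V E o}

/-- The paths of Dirac pairs, as a subspace of `PathEllBar`. -/
def PathDirBar (o : SurfaceOrientation M) (g : UAut V E) : Set (PathEllBar o g) :=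
  {γ | ∀ t, γ.1 t ∈ DirBar V E o}

variable (V E) in
/-- The total space of the bundle over `M × S¹` glued from `E × [0,1]` with the help of `g`:
the points `(u, 0)` and `(g u, 1)` are identified. -/
def Glued (g : UAut V E) : Type _ :=
  Quot (fun p q : TotalSpace V E × unitInterval =>
    p.2 = 0 ∧ q.2 = 1 ∧ q.1 = ⟨p.1.proj, g.fib p.1.proj p.1.snd⟩)

/-- The subbundle of the glued bundle that is glued from the subbundles `E⁻(γ(t))` of `E`. -/
def gluedEminus (o : SurfaceOrientation M) (g : UAut V E) (γ : unitInterval → Ell V E) :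
    Set (Glued V E g) :=
  Quot.mk _ '' {p | p.1.snd ∈ Eminus o (γ p.2).symb p.1.proj}

/-- The subbundle (over `∂M × S¹`) of the glued bundle that is glued from the subbundles
`F(γ(t))`. -/
def gluedF {o : SurfaceOrientation M} (g : UAut V E) (γ : unitInterval → EllBar V E o) :
    Set (Glued V E g) :=
  Quot.mk _ '' {p | ∃ h : p.1.proj ∈ (𝓡∂ 2).boundary M, p.1.snd ∈ (γ p.2).F ⟨p.1.proj, h⟩}

end Operators

/-! ### Homotopy -/

section Homotopy

variable {X : Type*} [TopologicalSpace X]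

/-- The inclusion of the subspace `Y` into `X` is a homotopy equivalence. -/
def InclusionIsHomotopyEquiv (Y : Set X) : Prop :=
  ∃ e : ContinuousMap.HomotopyEquiv Y X, ∀ y : Y, e.toFun y = (y : X)

/-- `H` is a deformation retraction of `X` onto the subspace `Y`: a homotopy from the identity map
to a retraction of `X` onto `Y`. -/
def IsDeformationRetraction (H : C(unitInterval × X, X)) (Y : Set X) : Prop :=
  (∀ x, H (0, x) = x) ∧ (∀ x, H (1, x) ∈ Y) ∧ ∀ y ∈ Y, H (1, y) = y

end Homotopy

end BVP

end

/-! The symbol at a point. Let `J` be the rotation of the cotangent plane and Q = σ(ξ)⁻¹σ(Jξ). Since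
σ(ξ)Q = σ(Jξ) is symmetric, Q is self-adjoint for the Hermitian form ⟨σ(ξ)·,·⟩, so generalized
eigenspaces pair non-trivially only for conjugate eigenvalues. Hence E⁺ and E⁻ are isotropic for
every σ(ξ), and each has half the dimension of the fibre. With respect to E⁻ ⊕ (E⁻)ᗮ the symbol has
a zero block on E⁻, an off-diagonal block X(ξ) from E⁻ to (E⁻)ᗮ with its adjoint, and a block T(ξ)
on (E⁻)ᗮ. Write X = M + N with M(Jξ) = iM(ξ) and N(Jξ) = -iN(ξ). The spectrum of Q on E⁻ lies in the
lower half-plane; after a Cayley transform this says that N dominates M (`part_comparison`). So T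
and M can be scaled to zero, and afterwards N can be replaced by N B^(-1/2) with B = N*N/‖ξ‖² on E⁻,
without losing ellipticity (`deform_isEllSymb`) or moving E⁻ (`lowSp_deform`). B does not depend on
ξ, so a single factor makes the symbol Dirac (`deform_one_isDirac`). Dirac symbols have M = 0, T = 0
and B = 1 and stay fixed (`deform_dirac`). Everything is canonical, hence equivariant.

From symbols to operators. A continuous right inverse Op of the symbol map with formally
self-adjoint values is needed. It is built from a single operator A₀ in Ell(E), so neither a
connection nor Green's formula enters; if Ell(E) is empty there is nothing to prove. The trace form
Tr(σ₀(ξ)σ₀(η)) is positive definite, and inverting it gives finitely many functions and sections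
with τ(ξ)u = ∑ ⟨q, σ₀(ξ)z⟩⟨r, u⟩ τ(df)p for all τ (`isRepr_one`). Replacing σ₀(ξ) by A₀ in this
identity and symmetrizing gives Op(τ). The homotopy is A_s = Op(σ_s) + (1-s)(A - Op(σ)) - s·(even
part of Op(σ_1)), where the even part is the part preserving E⁻ and (E⁻)ᗮ. It has order zero because
the diagonal blocks of σ_1 vanish. At s = 1 the result is odd and is determined by σ_1. The homotopy
keeps Dir(E) inside itself, so A ↦ A_1 is a homotopy inverse of the inclusion.

Boundary conditions. Two symbols with the same E⁻ are related by a canonical fibre automorphism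
`transport`, the identity on E⁻, which maps E⁺ to E⁺ and one form ⟨σ(n)·,·⟩ to the other. It carries
Lagrangian complements to Lagrangian complements and leaves T, hence F(A, L), unchanged.

Paths. Op depends on auxiliary data `Q` and is not equivariant. On a path the data are interpolated
between `Q` at t = 0 and its conjugate by g at t = 1, which keeps the condition γ(1) = gγ(0)
(`homotopyEll_conj`).

Continuity. The topologies amount to joint continuity of coordinate expressions, with first
derivatives for symbols and boundary conditions (`RegOn`), and this class is closed under smooth
maps. Spectral projections and inverse square roots are circle integrals of resolvents
(`circInt_spectral`, `isUnit_circ₂_and_circInt₂`), and orthogonal projections come from oblique ones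
by p(p + p* - 1)⁻¹, so all ingredients are smooth functions of the symbol. -/

open scoped Manifold ContDiff Topology
open Bundle MeasureTheory

set_option linter.unusedSectionVars false

noncomputable section

namespace BVP

/-! ### Splitting by the sign of the imaginary part of eigenvalues. -/

section SpectralSplitting

variable {W : Type*} [AddCommGroup W] [Module ℂ W]

/-- The sum of the generalized eigenspaces for eigenvalues in the upper half-plane. -/
def specHigh (Q : Module.End ℂ W) : Submodule ℂ W :=
  ⨆ (z : ℂ) (_ : 0 < z.im), Q.maxGenEigenspace z

/-- The sum of the generalized eigenspaces for eigenvalues in the lower half-plane. -/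
def specLow (Q : Module.End ℂ W) : Submodule ℂ W :=
  ⨆ (z : ℂ) (_ : z.im < 0), Q.maxGenEigenspace z

theorem maxGenEigenspace_eq_bot_of_no_eigenvector {Q : Module.End ℂ W} {z : ℂ}
    (h : ∀ v, Q v = z • v → v = 0) : Q.maxGenEigenspace z = ⊥ := by
  rw [eq_bot_iff]
  intro v hv
  rw [Module.End.mem_maxGenEigenspace] at hv
  obtain ⟨k, hk⟩ := hv
  induction k with
  | zero => simpa using hk
  | succ k ih =>
    apply ih
    apply h
    rw [pow_succ', Module.End.mul_apply] at hk
    simpa [sub_eq_zero] using hk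

/-- Generalized eigenspaces are independent and, over ℂ, span the space. The hypothesis removes
exactly those of real eigenvalues, and the rest fall into the two groups. -/
theorem isCompl_specHigh_specLow [FiniteDimensional ℂ W] {Q : Module.End ℂ W}
    (hQ : ∀ (t : ℝ) v, Q v = (t : ℂ) • v → v = 0) : IsCompl (specHigh Q) (specLow Q) := by
  refine IsCompl.of_eq ?_ ?_
  · rw [← disjoint_iff]
    have := iSupIndep.disjoint_biSup_biSup (f := Q.maxGenEigenspace)
      Q.independent_maxGenEigenspace (s := {z : ℂ | 0 < z.im}) (t := {z : ℂ | z.im < 0})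
      (by rw [Set.disjoint_left]; intro z (h1 : 0 < z.im) (h2 : z.im < 0); linarith)
    exact this
  · rw [eq_top_iff, ← Module.End.iSup_maxGenEigenspace_eq_top Q]
    refine iSup_le fun z => ?_
    rcases lt_trichotomy z.im 0 with h | h | h
    · exact le_trans (le_iSup₂ (f := fun (z : ℂ) (_ : z.im < 0) => Q.maxGenEigenspace z) z h)
        le_sup_right
    · rw [maxGenEigenspace_eq_bot_of_no_eigenvector]
      · exact bot_le
      · intro v hv
        apply hQ z.re v
        rw [hv]
        congr 1
        apply Complex.ext <;> simp [h]
    · exact le_trans (le_iSup₂ (f := fun (z : ℂ) (_ : 0 < z.im) => Q.maxGenEigenspace z) z h)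
        le_sup_left

theorem specLow_invariant (Q : Module.End ℂ W) {v : W} (hv : v ∈ specLow Q) :
    Q v ∈ specLow Q := by
  have : specLow Q ≤ (specLow Q).comap Q := by
    refine iSup₂_le fun z hz w hw => ?_
    exact (le_iSup₂ (f := fun (z : ℂ) (_ : z.im < 0) => Q.maxGenEigenspace z) z hz)
      (Module.End.mapsTo_maxGenEigenspace_of_comm (Commute.refl Q) z hw)
  exact this hv

theorem specHigh_invariant (Q : Module.End ℂ W) {v : W} (hv : v ∈ specHigh Q) :
    Q v ∈ specHigh Q := by
  have : specHigh Q ≤ (specHigh Q).comap Q := by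
    refine iSup₂_le fun z hz w hw => ?_
    exact (le_iSup₂ (f := fun (z : ℂ) (_ : 0 < z.im) => Q.maxGenEigenspace z) z hz)
      (Module.End.mapsTo_maxGenEigenspace_of_comm (Commute.refl Q) z hw)
  exact this hv

/-- An invariant subspace is the sum of its intersections with the generalized eigenspaces. If such
an intersection is non-zero, the last non-vanishing iterate of Q - z on one of its vectors is an
eigenvector that still lies in `U`, so only eigenvalues in the lower half-plane occur. -/
theorem le_specLow [FiniteDimensional ℂ W] {Q : Module.End ℂ W} {U : Submodule ℂ W}
    (hU : ∀ v ∈ U, Q v ∈ U) (h : ∀ v ∈ U, v ≠ 0 → ∀ z : ℂ, Q v = z • v → z.im < 0) :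
    U ≤ specLow Q := by
  rw [Submodule.eq_iSup_inf_genEigenspace (f := Q) (p := U) ⊤ hU
    (Module.End.iSup_maxGenEigenspace_eq_top Q)]
  refine iSup_le fun z => ?_
  by_cases hz : z.im < 0
  · exact inf_le_right.trans
      (le_iSup₂ (f := fun (z : ℂ) (_ : z.im < 0) => Q.maxGenEigenspace z) z hz)
  · rintro v ⟨hvU, hv⟩
    have hv' : v ∈ Q.maxGenEigenspace z := hv
    rw [Module.End.mem_maxGenEigenspace] at hv'
    obtain ⟨k, hk⟩ := hv'
    suffices v = 0 by rw [this]; exact zero_mem _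
    clear hv
    induction k with
    | zero => simpa using hk
    | succ k ih =>
      apply ih
      have hmem : ∀ k, ((Q - z • (1 : Module.End ℂ W)) ^ k) v ∈ U := by
        intro k
        induction k with
        | zero => simpa using hvU
        | succ k ih =>
          rw [pow_succ', Module.End.mul_apply]
          simp only [LinearMap.sub_apply, LinearMap.smul_apply, Module.End.one_apply]
          exact U.sub_mem (hU _ ih) (U.smul_mem _ ih)
      by_contra hne
      rw [pow_succ', Module.End.mul_apply] at hk
      exact hz (h _ (hmem k) hne z (by simpa [sub_eq_zero] using hk))

/-- An eigenvector in the lower spectral subspace has its eigenvalue in the lower half-plane. -/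
theorem im_neg_of_mem_specLow {Q : Module.End ℂ W} {v : W} (hv : v ∈ specLow Q) (hv0 : v ≠ 0)
    {z : ℂ} (hz : Q v = z • v) : z.im < 0 := by
  by_contra hn
  have h1 : v ∈ Q.maxGenEigenspace z := by
    rw [Module.End.mem_maxGenEigenspace]
    exact ⟨1, by simp [hz]⟩
  have := iSupIndep.disjoint_biSup (t := Q.maxGenEigenspace)
    Q.independent_maxGenEigenspace (x := z) (y := {z : ℂ | z.im < 0}) hn
  exact hv0 ((Submodule.disjoint_def.1 this) v h1 hv)

theorem im_pos_of_mem_specHigh {Q : Module.End ℂ W} {v : W} (hv : v ∈ specHigh Q) (hv0 : v ≠ 0)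
    {z : ℂ} (hz : Q v = z • v) : 0 < z.im := by
  by_contra hn
  have h1 : v ∈ Q.maxGenEigenspace z := by
    rw [Module.End.mem_maxGenEigenspace]
    exact ⟨1, by simp [hz]⟩
  have := iSupIndep.disjoint_biSup (t := Q.maxGenEigenspace)
    Q.independent_maxGenEigenspace (x := z) (y := {z : ℂ | 0 < z.im}) hn
  exact hv0 ((Submodule.disjoint_def.1 this) v h1 hv)

/-- If `Q - λ = k G (Q' - z)` with `G` commuting with `Q'`, the generalized eigenspace of `Q'` for
`z` is contained in that of `Q` for `λ`. -/
theorem maxGenEigenspace_le_of_factor {Q Q' G : Module.End ℂ W} {z l k : ℂ}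
    (hG : Commute G Q') (h : Q - l • 1 = k • (G * (Q' - z • 1))) :
    Q'.maxGenEigenspace z ≤ Q.maxGenEigenspace l := by
  intro v hv
  rw [Module.End.mem_maxGenEigenspace] at hv ⊢
  obtain ⟨m, hm⟩ := hv
  refine ⟨m, ?_⟩
  have hc : Commute G (Q' - z • (1 : Module.End ℂ W)) :=
    hG.sub_right ((Commute.one_right G).smul_right z)
  rw [h, smul_pow, hc.mul_pow, LinearMap.smul_apply, Module.End.mul_apply, hm]
  simp

end SpectralSplitting

/-! ### Isotropy of the spectral subspaces for an indefinite form. -/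

section Isotropy

variable {W : Type*} [NormedAddCommGroup W] [InnerProductSpace ℂ W] [FiniteDimensional ℂ W]

/-- Moving (Q - z)^k across the form turns it into (Q - z̄)^k, which is invertible on the
generalized eigenspace of any z' ≠ z̄. So w can be written as (Q - z̄)^k u, and the pairing equals
⟨S (Q - z)^k v, u⟩, which is zero. -/
theorem inner_eq_zero_of_maxGenEigenspace {S Q : Module.End ℂ W}
    (hQ : ∀ v w, inner ℂ (S (Q v)) w = inner ℂ (S v) (Q w)) {z z' : ℂ}
    (hz : (starRingEnd ℂ) z ≠ z') {v w : W} (hv : v ∈ Q.maxGenEigenspace z)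
    (hw : w ∈ Q.maxGenEigenspace z') : inner ℂ (S v) w = 0 := by
  rw [Module.End.mem_maxGenEigenspace] at hv
  obtain ⟨k, hk⟩ := hv
  have hpow : ∀ (k : ℕ) v w, inner ℂ (S (((Q - z • (1 : Module.End ℂ W)) ^ k) v)) w =
      inner ℂ (S v) (((Q - (starRingEnd ℂ) z • (1 : Module.End ℂ W)) ^ k) w) := by
    intro k
    induction k with
    | zero => intro v w; simp
    | succ k ih =>
      intro v w
      rw [pow_succ, Module.End.mul_apply, ih, pow_succ', Module.End.mul_apply]
      simp [inner_sub_left, inner_sub_right, hQ, inner_smul_left, inner_smul_right, mul_comm]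
  set B := (Q - (starRingEnd ℂ) z • (1 : Module.End ℂ W)) ^ k with hB
  have hcomm : Commute Q B := by
    refine Commute.pow_right ?_ k
    exact (Commute.refl Q).sub_right ((Commute.one_right Q).smul_right _)
  have hmaps : ∀ u ∈ Q.maxGenEigenspace z', B u ∈ Q.maxGenEigenspace z' := fun u hu =>
    Module.End.mapsTo_maxGenEigenspace_of_comm hcomm z' hu
  have hinj : Function.Injective (B.restrict hmaps) := by
    rw [injective_iff_map_eq_zero]
    rintro ⟨u, hu⟩ h0
    have h0' : B u = 0 := congrArg Subtype.val h0
    have h1 : u ∈ Q.maxGenEigenspace ((starRingEnd ℂ) z) := by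
      rw [Module.End.mem_maxGenEigenspace]
      exact ⟨k, h0'⟩
    have := Q.independent_maxGenEigenspace.pairwiseDisjoint hz
    exact Subtype.ext ((Submodule.disjoint_def.1 this) u h1 hu)
  obtain ⟨⟨u, hu⟩, huw⟩ := (LinearMap.injective_iff_surjective.1 hinj) ⟨w, hw⟩
  have huw' : B u = w := congrArg Subtype.val huw
  rw [← huw', ← hpow, hk]
  simp

/-- Two numbers in the lower half-plane are never complex conjugate to each other. -/
theorem specLow_isotropic {S Q : Module.End ℂ W}
    (hQ : ∀ v w, inner ℂ (S (Q v)) w = inner ℂ (S v) (Q w)) {v w : W}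
    (hv : v ∈ specLow Q) (hw : w ∈ specLow Q) : inner ℂ (S v) w = 0 := by
  have h1 : specLow Q ≤ (specLow Q).orthogonal.comap S := by
    refine iSup₂_le fun z hz v hv => ?_
    rw [Submodule.mem_comap, Submodule.mem_orthogonal']
    intro w hw
    have h2 : specLow Q ≤ LinearMap.ker (innerₛₗ ℂ (S v)) := by
      refine iSup₂_le fun z' hz' w hw => ?_
      rw [LinearMap.mem_ker, innerₛₗ_apply_apply]
      refine inner_eq_zero_of_maxGenEigenspace hQ ?_ hv hw
      intro h
      rw [← h, Complex.conj_im] at hz'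
      linarith
    exact h2 hw
  exact (Submodule.mem_orthogonal' _ _).1 (h1 hv) w hw

theorem specHigh_isotropic {S Q : Module.End ℂ W}
    (hQ : ∀ v w, inner ℂ (S (Q v)) w = inner ℂ (S v) (Q w)) {v w : W}
    (hv : v ∈ specHigh Q) (hw : w ∈ specHigh Q) : inner ℂ (S v) w = 0 := by
  have h1 : specHigh Q ≤ (specHigh Q).orthogonal.comap S := by
    refine iSup₂_le fun z hz v hv => ?_
    rw [Submodule.mem_comap, Submodule.mem_orthogonal']
    intro w hw
    have h2 : specHigh Q ≤ LinearMap.ker (innerₛₗ ℂ (S v)) := by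
      refine iSup₂_le fun z' hz' w hw => ?_
      rw [LinearMap.mem_ker, innerₛₗ_apply_apply]
      refine inner_eq_zero_of_maxGenEigenspace hQ ?_ hv hw
      intro h
      rw [← h, Complex.conj_im] at hz'
      linarith
    exact h2 hw
  exact (Submodule.mem_orthogonal' _ _).1 (h1 hv) w hw

end Isotropy

/-! ### Orthogonal projections. -/

section OrthogonalProjection

variable {W : Type*} [NormedAddCommGroup W] [InnerProductSpace ℂ W] [FiniteDimensional ℂ W]

theorem projAlong_of_mem {p q : Submodule ℂ W} (h : IsCompl p q) {w : W} (hw : w ∈ p) :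
    projAlong p q w = w := by
  unfold projAlong
  rw [dif_pos h]
  exact Submodule.projection_apply_left h ⟨w, hw⟩

theorem projAlong_of_mem_right {p q : Submodule ℂ W} (h : IsCompl p q) {w : W} (hw : w ∈ q) :
    projAlong p q w = 0 := by
  unfold projAlong
  rw [dif_pos h]
  exact (Submodule.projection_apply_eq_zero_iff h).2 hw

theorem sub_projAlong_mem {p q : Submodule ℂ W} (h : IsCompl p q) (w : W) :
    w - projAlong p q w ∈ q := by
  obtain ⟨a, ha, b, hb, rfl⟩ := Submodule.mem_sup.1 (show w ∈ p ⊔ q by rw [h.sup_eq_top]; trivial)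
  rw [map_add, projAlong_of_mem h ha, projAlong_of_mem_right h hb]
  simpa using hb

/-- The orthogonal projection on a subspace, as a linear endomorphism. -/
def orthP (U : Submodule ℂ W) : Module.End ℂ W := projAlong U Uᗮ

variable (U : Submodule ℂ W)

theorem orthP_mem (w : W) : orthP U w ∈ U := projAlong_mem _ _ _

variable {U}

theorem orthP_of_mem {w : W} (hw : w ∈ U) : orthP U w = w :=
  projAlong_of_mem U.isCompl_orthogonal hw

theorem orthP_of_mem_orthogonal {w : W} (hw : w ∈ Uᗮ) : orthP U w = 0 :=
  projAlong_of_mem_right U.isCompl_orthogonal hw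

variable (U)

theorem sub_orthP_mem (w : W) : w - orthP U w ∈ Uᗮ := sub_projAlong_mem U.isCompl_orthogonal w

theorem orthP_mul_self : orthP U * orthP U = orthP U := by
  ext w
  exact orthP_of_mem (orthP_mem U w)

theorem orthP_isSymmetric : (orthP U).IsSymmetric := by
  intro v w
  have h1 : inner ℂ (orthP U v) (w - orthP U w) = 0 :=
    (Submodule.mem_orthogonal _ _).1 (sub_orthP_mem U w) _ (orthP_mem U v)
  have h2 : inner ℂ (v - orthP U v) (orthP U w) = 0 :=
    (Submodule.mem_orthogonal' _ _).1 (sub_orthP_mem U v) _ (orthP_mem U w)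
  rw [inner_sub_right, sub_eq_zero] at h1
  rw [inner_sub_left, sub_eq_zero] at h2
  rw [h1, h2]

theorem star_orthP : star (orthP U) = orthP U := by
  rw [LinearMap.star_eq_adjoint]
  exact ((LinearMap.isSymmetric_iff_isSelfAdjoint _).1 (orthP_isSymmetric U)).star_eq

theorem one_sub_orthP_eq_self_iff {w : W} : (1 - orthP U) w = w ↔ w ∈ Uᗮ := by
  constructor
  · intro h
    rw [← h]
    exact sub_orthP_mem U w
  · intro h
    simp [orthP_of_mem_orthogonal h]

end OrthogonalProjection

/-! ### Inverse square roots of positive operators. -/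

section InverseSquareRoot

variable {W : Type*} [NormedAddCommGroup W] [InnerProductSpace ℂ W] [FiniteDimensional ℂ W]

/-- Both squares are inverse to `B`, hence equal, and a positive square root is unique. -/
theorem isPositive_unique_of_mul_self_mul_eq_one {B R R' : Module.End ℂ W} (hR : R.IsPositive)
    (hR' : R'.IsPositive) (h : R * R * B = 1) (h' : R' * R' * B = 1) : R = R' := by
  haveI : CompleteSpace W := FiniteDimensional.complete ℂ W
  have h1 : R' * R' = R * R := by
    have h2 : B * (R * R) = 1 := mul_eq_one_comm.1 h
    calc R' * R' = R' * R' * (B * (R * R)) := by rw [h2, mul_one]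
      _ = R * R := by rw [← mul_assoc, h', one_mul]
  let t := Module.End.toContinuousLinearMap (𝕜 := ℂ) W
  have hpos : ∀ {R : Module.End ℂ W}, R.IsPositive → 0 ≤ t R := by
    intro R hR
    rw [ContinuousLinearMap.nonneg_iff_isPositive]
    exact (LinearMap.isPositive_toContinuousLinearMap_iff R).2 hR
  have e1 : CFC.sqrt (t (R * R)) = t R := CFC.sqrt_unique (map_mul t R R).symm (hpos hR)
  have e2 : CFC.sqrt (t (R' * R')) = t R' := CFC.sqrt_unique (map_mul t R' R').symm (hpos hR')
  rw [h1] at e2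
  exact t.injective (e1.symm.trans e2)

/-- `R` is the inverse of the positive root s of `B`; it is positive because s⁻¹ = s⁻¹ s s⁻¹ is a
conjugate of s. -/
theorem exists_isPositive_mul_self_mul_eq_one {B : Module.End ℂ W} (hB : B.IsPositive)
    (hu : IsUnit B) : ∃ R : Module.End ℂ W, R.IsPositive ∧ R * R * B = 1 := by
  haveI : CompleteSpace W := FiniteDimensional.complete ℂ W
  let t := Module.End.toContinuousLinearMap (𝕜 := ℂ) W
  have ha : 0 ≤ t B := by
    rw [ContinuousLinearMap.nonneg_iff_isPositive]
    exact (LinearMap.isPositive_toContinuousLinearMap_iff B).2 hB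
  obtain ⟨s, hs⟩ : IsUnit (CFC.sqrt (t B)) := (CFC.isUnit_sqrt_iff (t B) ha).2 (hu.map t)
  have hs0 : (0 : W →L[ℂ] W) ≤ s := hs ▸ CFC.sqrt_nonneg (t B)
  have hss : (s : W →L[ℂ] W) * s = t B := by rw [hs]; exact CFC.sqrt_mul_sqrt_self (t B) ha
  refine ⟨t.symm (↑s⁻¹ : W →L[ℂ] W), ?_, ?_⟩
  · rw [← LinearMap.isPositive_toContinuousLinearMap_iff]
    have hsa : star (s : W →L[ℂ] W) = s := (IsSelfAdjoint.of_nonneg hs0).star_eq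
    have hsi : star (↑s⁻¹ : W →L[ℂ] W) = ↑s⁻¹ := by
      rw [← Units.coe_star, star_inv]
      congr 2
      exact Units.ext hsa
    have h2 : (0 : W →L[ℂ] W) ≤ (↑s⁻¹ : W →L[ℂ] W) := by
      have h3 := star_left_conjugate_nonneg hs0 (↑s⁻¹ : W →L[ℂ] W)
      rw [hsi] at h3
      simpa using h3
    exact (ContinuousLinearMap.nonneg_iff_isPositive _).1 h2
  · apply t.injective
    rw [map_mul, map_mul, AlgEquiv.apply_symm_apply, map_one, ← hss]
    simp [mul_assoc]

open Classical in
/-- The inverse of the positive square root of a positive invertible endomorphism. -/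
def invSqrt (B : Module.End ℂ W) : Module.End ℂ W :=
  if h : ∃ R : Module.End ℂ W, R.IsPositive ∧ R * R * B = 1 then h.choose else 0

theorem invSqrt_spec {B : Module.End ℂ W} (hB : B.IsPositive) (hu : IsUnit B) :
    (invSqrt B).IsPositive ∧ invSqrt B * invSqrt B * B = 1 := by
  have h := exists_isPositive_mul_self_mul_eq_one hB hu
  unfold invSqrt
  rw [dif_pos h]
  exact h.choose_spec

theorem invSqrt_eq {B R : Module.End ℂ W} (hR : R.IsPositive) (h : R * R * B = 1) :
    invSqrt B = R := by
  have h' : ∃ R : Module.End ℂ W, R.IsPositive ∧ R * R * B = 1 := ⟨R, hR, h⟩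
  have := h'.choose_spec
  unfold invSqrt
  rw [dif_pos h']
  exact isPositive_unique_of_mul_self_mul_eq_one this.1 hR this.2 h

theorem invSqrt_one : invSqrt (1 : Module.End ℂ W) = 1 :=
  invSqrt_eq LinearMap.isPositive_one (by simp)

theorem invSqrt_conj {W' : Type*} [NormedAddCommGroup W'] [InnerProductSpace ℂ W']
    [FiniteDimensional ℂ W'] (g : W ≃ₗᵢ[ℂ] W') {B : Module.End ℂ W} {B' : Module.End ℂ W'}
    (h : ∀ w, B' (g w) = g (B w)) (hB : B.IsPositive) (hu : IsUnit B) (w : W) :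
    invSqrt B' (g w) = g (invSqrt B w) := by
  obtain ⟨h1, h2⟩ := invSqrt_spec hB hu
  have h3 : invSqrt B' = g.toLinearEquiv.conj (invSqrt B) := by
    apply invSqrt_eq
    · have := (LinearMap.isPositive_linearIsometryEquiv_conj_iff g).2 h1
      exact this
    · have : B' = g.toLinearEquiv.conj B := by
        ext w
        obtain ⟨w, rfl⟩ := g.surjective w
        rw [h]
        simp [LinearEquiv.conj_apply]
      rw [this]
      ext w
      have := congrArg (fun f : Module.End ℂ W => g (f (g.symm w))) h2
      simpa [LinearEquiv.conj_apply] using this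
  rw [h3]
  simp [LinearEquiv.conj_apply]

/-- The reflection r = 2P - 1 is a self-adjoint involution commuting with `B`, so rRr is again a
positive inverse root of `B`. By uniqueness rRr = R, and commuting with r is the same as commuting
with P. -/
theorem invSqrt_commute_orthP {B : Module.End ℂ W} (hB : B.IsPositive) (hu : IsUnit B)
    {U : Submodule ℂ W} (hc : Commute B (orthP U)) : Commute (invSqrt B) (orthP U) := by
  obtain ⟨h1, h2⟩ := invSqrt_spec hB hu
  set P := orthP U with hP
  set R := invSqrt B with hR
  have hPP : P * P = P := orthP_mul_self U
  set r : Module.End ℂ W := 2 * P - 1 with hr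
  have hrr : r * r = 1 := by
    simp only [hr, mul_sub, sub_mul, mul_one, one_mul]
    rw [show 2 * P * (2 * P) = 4 * (P * P) by noncomm_ring, hPP]
    noncomm_ring
  have hrB : r * B = B * r := by
    simp only [hr, mul_sub, sub_mul, mul_one, one_mul]
    rw [mul_assoc, ← hc.eq]
    noncomm_ring
  have hadj : LinearMap.adjoint r = r := by
    rw [← LinearMap.star_eq_adjoint, hr, star_sub, star_mul, hP, star_orthP]
    simp only [star_ofNat, star_one]
    noncomm_ring
  have h3 : R = r * R * r := by
    rw [hR]
    refine invSqrt_eq ?_ ?_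
    · have := h1.conj_adjoint r
      rw [hadj] at this
      exact this
    · calc r * R * r * (r * R * r) * B = r * R * (r * r) * R * (r * B) := by noncomm_ring
        _ = r * (R * R * B) * r := by rw [hrr, hrB]; noncomm_ring
        _ = 1 := by rw [h2, mul_one, hrr]
  have h4 : r * R = R * r := by
    calc r * R = r * (r * R * r) := by rw [← h3]
      _ = (r * r) * R * r := by noncomm_ring
      _ = R * r := by rw [hrr, one_mul]
  have h5 : (2 : ℂ) • (P * R) = (2 : ℂ) • (R * P) := by
    have : 2 * (P * R) = 2 * (R * P) := by
      simp only [hr, mul_sub, sub_mul, mul_one, one_mul] at h4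
      have h6 := sub_left_inj.1 h4
      calc 2 * (P * R) = 2 * P * R := by noncomm_ring
        _ = R * (2 * P) := h6
        _ = 2 * (R * P) := by noncomm_ring
    simpa [two_smul, two_mul] using this
  exact (smul_right_injective _ (two_ne_zero (α := ℂ)) h5).symm

end InverseSquareRoot

/-! ### The orthogonal projection onto the range of an idempotent. -/

section KovarikFormula

variable {W : Type*} [NormedAddCommGroup W] [InnerProductSpace ℂ W] [FiniteDimensional ℂ W]

/-- An idempotent `p` with range `U` determines the orthogonal projection on `U`. -/
theorem orthP_mul_eq_of_idempotent {U : Submodule ℂ W} {p : Module.End ℂ W}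
    (h1 : ∀ w, p w ∈ U) (h2 : ∀ w ∈ U, p w = w) : orthP U * (p + star p - 1) = p := by
  have e1 : orthP U * p = p := by ext w; exact orthP_of_mem (h1 w)
  have e2 : p * orthP U = orthP U := by ext w; exact h2 _ (orthP_mem U w)
  have e3 : orthP U * star p = orthP U := by
    rw [← star_orthP U, ← star_mul, e2]
  rw [mul_sub, mul_add, e1, e3, mul_one]
  abel

/-- If (p + p* - 1)w = 0, the factorization gives pw = 0, hence p*w = w and ⟨w, w⟩ = ⟨p*w, w⟩ = ⟨w,
pw⟩ = 0. -/
theorem isUnit_add_star_sub_one {U : Submodule ℂ W} {p : Module.End ℂ W}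
    (h1 : ∀ w, p w ∈ U) (h2 : ∀ w ∈ U, p w = w) : IsUnit (p + star p - 1) := by
  rw [LinearMap.isUnit_iff_ker_eq_bot, LinearMap.ker_eq_bot']
  intro w hw
  have e := congrArg (fun f : Module.End ℂ W => f w) (orthP_mul_eq_of_idempotent h1 h2)
  simp only [Module.End.mul_apply, hw, map_zero] at e
  have e2 : star p w = w := by
    simp only [LinearMap.sub_apply, LinearMap.add_apply, ← e, zero_add, Module.End.one_apply] at hw
    exact sub_eq_zero.1 hw
  have e3 : inner ℂ w w = 0 := by
    calc inner ℂ w w = inner ℂ (star p w) w := by rw [e2]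
      _ = inner ℂ w (p w) := by rw [LinearMap.star_eq_adjoint, LinearMap.adjoint_inner_left]
      _ = 0 := by rw [← e, inner_zero_right]
  exact inner_self_eq_zero.1 e3

/-- The right side uses only algebraic operations and the adjoint, so smoothness and continuity pass
from oblique projections to orthogonal ones. -/
theorem orthP_eq_of_idempotent {U : Submodule ℂ W} {p : Module.End ℂ W}
    (h1 : ∀ w, p w ∈ U) (h2 : ∀ w ∈ U, p w = w) :
    orthP U = p * Ring.inverse (p + star p - 1) := by
  have hu := isUnit_add_star_sub_one h1 h2
  have := orthP_mul_eq_of_idempotent h1 h2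
  calc orthP U = orthP U * (p + star p - 1) * Ring.inverse (p + star p - 1) := by
        rw [mul_assoc, Ring.mul_inverse_cancel _ hu, mul_one]
    _ = _ := by rw [this]

end KovarikFormula

/-! ### Self-adjoint elliptic symbols at one point. -/

section SymbolAtAPoint

variable {T : Type*} [AddCommGroup T] [Module ℝ T]

/-- A real plane with a complex structure `J`, the orientation given by its positive frames and a
norm `nn` that is invariant under `J`. -/
structure IsConfPlane (pos : T → T → Prop) (J : T →ₗ[ℝ] T) (nn : T → ℝ) : Prop where
  J_J : ∀ ξ, J (J ξ) = -ξ
  span : ∀ ξ, ξ ≠ 0 → ∀ η, ∃ a b : ℝ, η = a • ξ + b • J ξ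
  pos_iff : ∀ ξ, ξ ≠ 0 → ∀ a b c d : ℝ,
    (pos (a • ξ + b • J ξ) (c • ξ + d • J ξ) ↔ 0 < a * d - b * c)
  nn_pos : ∀ ξ, ξ ≠ 0 → 0 < nn ξ
  nn_comb : ∀ ξ (a b : ℝ), nn (a • ξ + b • J ξ) ^ 2 = (a ^ 2 + b ^ 2) * nn ξ ^ 2
  nontriv : ∃ ξ : T, ξ ≠ 0

namespace IsConfPlane

variable {pos : T → T → Prop} {J : T →ₗ[ℝ] T} {nn : T → ℝ} (C : IsConfPlane pos J nn)
include C

theorem J_ne_zero {ξ : T} (hξ : ξ ≠ 0) : J ξ ≠ 0 := by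
  intro h
  have := C.J_J ξ
  rw [h, map_zero] at this
  exact hξ (neg_eq_zero.1 this.symm)

theorem comb_ne_zero {ξ : T} (hξ : ξ ≠ 0) {a b : ℝ} (h : a ≠ 0 ∨ b ≠ 0) :
    a • ξ + b • J ξ ≠ 0 := by
  intro h0
  have h1 := C.nn_comb ξ a b
  have h2 := C.nn_comb ξ 0 0
  rw [h0] at h1
  simp only [zero_smul, add_zero] at h2
  rw [h2] at h1
  have h3 := pow_pos (C.nn_pos ξ hξ) 2
  have h4 : 0 < a ^ 2 + b ^ 2 := by
    rcases h with h | h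
    · have := sq_pos_of_ne_zero h; positivity
    · have := sq_pos_of_ne_zero h; positivity
  have := mul_pos h4 h3
  simp at h1
  rcases h1 with h1 | h1
  · linarith
  · rw [h1] at h3; simp at h3

end IsConfPlane

variable {W : Type*} [NormedAddCommGroup W] [InnerProductSpace ℂ W] [FiniteDimensional ℂ W]

/-- A self-adjoint elliptic symbol at a point. -/
structure IsEllSymb (S : T →ₗ[ℝ] Module.End ℂ W) : Prop where
  sym : ∀ ξ, (S ξ).IsSymmetric
  unit : ∀ ξ, ξ ≠ 0 → IsUnit (S ξ)

/-- The span of the generalized eigenspaces of `S(ξ)⁻¹ S(η)` for the eigenvalues with negative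
imaginary part, for all positive frames. -/
def lowSp (pos : T → T → Prop) (S : T →ₗ[ℝ] Module.End ℂ W) : Submodule ℂ W :=
  ⨆ (ξ : T) (η : T) (_ : pos ξ η) (z : ℂ) (_ : z.im < 0),
    (Ring.inverse (S ξ) * S η).maxGenEigenspace z

/-- The same for the eigenvalues with positive imaginary part. -/
def highSp (pos : T → T → Prop) (S : T →ₗ[ℝ] Module.End ℂ W) : Submodule ℂ W :=
  ⨆ (ξ : T) (η : T) (_ : pos ξ η) (z : ℂ) (_ : 0 < z.im),
    (Ring.inverse (S ξ) * S η).maxGenEigenspace z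

/-- The operator `Q = S(ξ)⁻¹ S(Jξ)`. -/
def qop (J : T →ₗ[ℝ] T) (S : T →ₗ[ℝ] Module.End ℂ W) (ξ : T) : Module.End ℂ W :=
  Ring.inverse (S ξ) * S (J ξ)

variable {pos : T → T → Prop} {J : T →ₗ[ℝ] T} {nn : T → ℝ} {S : T →ₗ[ℝ] Module.End ℂ W}

namespace IsEllSymb

variable (hS : IsEllSymb S)
include hS

theorem injective {ξ : T} (hξ : ξ ≠ 0) {v : W} (h : S ξ v = 0) : v = 0 := by
  have := (LinearMap.isUnit_iff_ker_eq_bot _).1 (hS.unit ξ hξ)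
  exact LinearMap.ker_eq_bot'.1 this v h

theorem apply_qop {ξ : T} (hξ : ξ ≠ 0) (v : W) : S ξ (qop J S ξ v) = S (J ξ) v := by
  have h := Ring.mul_inverse_cancel _ (hS.unit ξ hξ)
  calc S ξ (qop J S ξ v) = (S ξ * Ring.inverse (S ξ)) (S (J ξ) v) := rfl
    _ = S (J ξ) v := by rw [h]; rfl

theorem qop_eq_smul_iff {ξ : T} (hξ : ξ ≠ 0) {v : W} {z : ℂ} :
    qop J S ξ v = z • v ↔ S (J ξ) v = z • S ξ v := by
  rw [← hS.apply_qop hξ]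
  constructor
  · intro h
    rw [h, map_smul]
  · intro h
    rw [← sub_eq_zero]
    apply hS.injective hξ
    rw [map_sub, h, map_smul, sub_self]

/-- Both sides reduce to ⟨S(Jξ)v, w⟩ by symmetry of `S ξ` and `S (J ξ)`: Q is self-adjoint for the
form ⟨S(ξ)·,·⟩, which is what the isotropy results require. -/
theorem inner_qop {ξ : T} (hξ : ξ ≠ 0) (v w : W) :
    inner ℂ (S ξ (qop J S ξ v)) w = inner ℂ (S ξ v) (qop J S ξ w) := by
  rw [hS.apply_qop hξ, hS.sym, hS.sym ξ v, hS.apply_qop hξ]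

variable (C : IsConfPlane pos J nn)
include C

/-- A real eigenvalue t puts v in the kernel of S(Jξ - tξ), and the covector Jξ - tξ is non-zero. -/
theorem qop_no_real {ξ : T} (hξ : ξ ≠ 0) (t : ℝ) (v : W) (h : qop J S ξ v = (t : ℂ) • v) :
    v = 0 := by
  rw [hS.qop_eq_smul_iff hξ] at h
  have hne : (-t) • ξ + (1 : ℝ) • J ξ ≠ 0 := C.comb_ne_zero hξ (Or.inr one_ne_zero)
  apply hS.injective hne
  rw [map_add, map_smul, map_smul, LinearMap.add_apply, LinearMap.smul_apply,
    LinearMap.smul_apply, h]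
  simp [← Complex.coe_smul]

/-- A change of frame acts on Q by the real Möbius transformation Q' = (a + bQ)⁻¹(c + dQ). For
frames of the same orientation its determinant is positive and it preserves the half-planes.
Therefore a single frame already spans E⁺ and E⁻. -/
theorem genEigenspace_frame {ξ₀ ξ η : T} (h0 : ξ₀ ≠ 0) (hpos : pos ξ η) (z : ℂ) (hz : z.im ≠ 0) :
    ∃ l : ℂ, 0 < l.im * z.im ∧
      (Ring.inverse (S ξ) * S η).maxGenEigenspace z ≤ (qop J S ξ₀).maxGenEigenspace l := by
  obtain ⟨a, b, rfl⟩ := C.span ξ₀ h0 ξ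
  obtain ⟨c, d, rfl⟩ := C.span ξ₀ h0 η
  rw [C.pos_iff ξ₀ h0] at hpos
  have hden : (d : ℂ) - b * z ≠ 0 := by
    intro h
    have him := congrArg Complex.im h
    have hre := congrArg Complex.re h
    simp at him hre
    rcases him with hb | hb
    · subst hb; simp at hre; subst hre; simp at hpos
    · exact hz hb
  have hξ : a • ξ₀ + b • J ξ₀ ≠ 0 := by
    apply C.comb_ne_zero h0
    by_contra hcon
    push Not at hcon
    rw [hcon.1, hcon.2] at hpos
    simp at hpos
  -- The preimage of z under l ↦ (c + dl)/(a + bl).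
  refine ⟨(a * z - c) / (d - b * z), ?_, ?_⟩
  · have hn : 0 < Complex.normSq ((d : ℂ) - b * z) := Complex.normSq_pos.2 hden
    have : ((a * z - c) / (d - b * z) : ℂ).im = (a * d - b * c) * z.im /
        Complex.normSq ((d : ℂ) - b * z) := by
      rw [Complex.div_im]
      simp
      field_simp
      ring
    rw [this]
    have h2 : 0 < z.im * z.im := mul_self_pos.2 hz
    have h3 : 0 < (a * d - b * c) * (z.im * z.im) / Complex.normSq ((d : ℂ) - b * z) := by
      positivity
    calc 0 < _ := h3
      _ = _ := by ring
  · set Q := qop J S ξ₀ with hQ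
    set ξ := a • ξ₀ + b • J ξ₀ with hξdef
    set η := c • ξ₀ + d • J ξ₀ with hηdef
    set Q' := Ring.inverse (S ξ) * S η with hQ'
    set G : Module.End ℂ W := (a : ℂ) • 1 + (b : ℂ) • Q with hG
    have hSG : ∀ (a b : ℝ), S (a • ξ₀ + b • J ξ₀) = S ξ₀ * ((a : ℂ) • 1 + (b : ℂ) • Q) := by
      intro a b
      ext v
      simp [hQ, hS.apply_qop h0, ← Complex.coe_smul]
    have hinv := Ring.inverse_mul_cancel _ (hS.unit ξ₀ h0)
    -- Since S(ξ) = S(ξ₀)G and S(η) = S(ξ₀)(c + dQ), cancelling S(ξ₀) gives GQ' = c + dQ; as a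
    -- polynomial in Q this commutes with G.
    have hGQ' : G * Q' = (c : ℂ) • 1 + (d : ℂ) • Q := by
      have h1 : S ξ₀ * (G * Q') = S ξ₀ * ((c : ℂ) • 1 + (d : ℂ) • Q) := by
        rw [← hSG c d, ← mul_assoc, hG, ← hSG a b, hQ', ← mul_assoc,
          Ring.mul_inverse_cancel _ (hS.unit ξ hξ), one_mul]
      calc G * Q' = Ring.inverse (S ξ₀) * (S ξ₀ * (G * Q')) := by
            rw [← mul_assoc (Ring.inverse (S ξ₀)), hinv, one_mul]
        _ = _ := by rw [h1, ← mul_assoc, hinv, one_mul]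
    have hGu : IsUnit G := by
      have h1 : G = Ring.inverse (S ξ₀) * S ξ := by
        rw [hSG a b, ← mul_assoc, hinv, one_mul]
      rw [h1]
      exact ((hS.unit ξ₀ h0).ringInverse).mul (hS.unit ξ hξ)
    have hcomm : Commute G Q' := by
      have h1 : Commute G (G * Q') := by
        rw [hGQ', hG]
        refine Commute.add_left ?_ ?_
        · exact (Commute.one_left _).smul_left _
        · refine Commute.smul_left ?_ _
          refine Commute.add_right ?_ ?_
          · exact (Commute.one_right _).smul_right _
          · exact (Commute.refl _).smul_right _
      have h2 : G * (G * Q') = G * (Q' * G) := by rw [h1.eq, mul_assoc]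
      exact hGu.mul_left_cancel h2
    refine maxGenEigenspace_le_of_factor (k := (d - b * z)⁻¹) hcomm ?_
    rw [mul_sub, hGQ', hG]
    ext v
    simp only [LinearMap.sub_apply, LinearMap.smul_apply, LinearMap.add_apply,
      Module.End.mul_apply, Module.End.one_apply, map_smul]
    have : Q v - ((a * z - c) / (d - b * z)) • v =
        (d - b * z : ℂ)⁻¹ • ((d - b * z : ℂ) • Q v - (a * z - c) • v) := by
      rw [smul_sub, smul_smul, inv_mul_cancel₀ hden, one_smul, smul_smul, div_eq_inv_mul]
    rw [this]
    congr 1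
    module

theorem lowSp_eq {ξ : T} (hξ : ξ ≠ 0) : lowSp pos S = specLow (qop J S ξ) := by
  apply le_antisymm
  · refine iSup_le fun ξ' => iSup_le fun η' => iSup_le fun hp => iSup₂_le fun z hz => ?_
    obtain ⟨l, hl, hle⟩ := hS.genEigenspace_frame C hξ hp z hz.ne
    refine hle.trans ?_
    exact le_iSup₂ (f := fun (z : ℂ) (_ : z.im < 0) => (qop J S ξ).maxGenEigenspace z) l
      (by nlinarith)
  · refine iSup₂_le fun z hz => ?_
    have hp : pos ξ (J ξ) := by
      have := (C.pos_iff ξ hξ 1 0 0 1).2 (by norm_num)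
      simpa using this
    exact le_iSup_of_le ξ <| le_iSup_of_le (J ξ) <| le_iSup_of_le hp <|
      le_iSup₂ (f := fun (z : ℂ) (_ : z.im < 0) =>
        (Ring.inverse (S ξ) * S (J ξ)).maxGenEigenspace z) z hz

theorem highSp_eq {ξ : T} (hξ : ξ ≠ 0) : highSp pos S = specHigh (qop J S ξ) := by
  apply le_antisymm
  · refine iSup_le fun ξ' => iSup_le fun η' => iSup_le fun hp => iSup₂_le fun z hz => ?_
    obtain ⟨l, hl, hle⟩ := hS.genEigenspace_frame C hξ hp z hz.ne'
    refine hle.trans ?_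
    exact le_iSup₂ (f := fun (z : ℂ) (_ : 0 < z.im) => (qop J S ξ).maxGenEigenspace z) l
      (by nlinarith)
  · refine iSup₂_le fun z hz => ?_
    have hp : pos ξ (J ξ) := by
      have := (C.pos_iff ξ hξ 1 0 0 1).2 (by norm_num)
      simpa using this
    exact le_iSup_of_le ξ <| le_iSup_of_le (J ξ) <| le_iSup_of_le hp <|
      le_iSup₂ (f := fun (z : ℂ) (_ : 0 < z.im) =>
        (Ring.inverse (S ξ) * S (J ξ)).maxGenEigenspace z) z hz

theorem isCompl : IsCompl (highSp pos S) (lowSp pos S) := by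
  obtain ⟨ξ, hξ⟩ := C.nontriv
  rw [hS.lowSp_eq C hξ, hS.highSp_eq C hξ]
  exact isCompl_specHigh_specLow (hS.qop_no_real C hξ)

theorem inner_low (ξ : T) {v w : W} (hv : v ∈ lowSp pos S) (hw : w ∈ lowSp pos S) :
    inner ℂ (S ξ v) w = 0 := by
  by_cases hξ : ξ = 0
  · simp [hξ]
  rw [hS.lowSp_eq C hξ] at hv hw
  exact specLow_isotropic (hS.inner_qop hξ) hv hw

theorem inner_high (ξ : T) {v w : W} (hv : v ∈ highSp pos S) (hw : w ∈ highSp pos S) :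
    inner ℂ (S ξ v) w = 0 := by
  by_cases hξ : ξ = 0
  · simp [hξ]
  rw [hS.highSp_eq C hξ] at hv hw
  exact specHigh_isotropic (hS.inner_qop hξ) hv hw

omit C in
theorem finrank_map {ξ : T} (hξ : ξ ≠ 0) (U : Submodule ℂ W) :
    Module.finrank ℂ (U.map (S ξ)) = Module.finrank ℂ U :=
  (Submodule.equivMapOfInjective (S ξ)
    (LinearMap.ker_eq_bot.1 ((LinearMap.isUnit_iff_ker_eq_bot _).1 (hS.unit ξ hξ))) U).finrank_eq.symm

theorem map_low_le (ξ : T) : (lowSp pos S).map (S ξ) ≤ (lowSp pos S)ᗮ := by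
  rintro _ ⟨v, hv, rfl⟩
  rw [Submodule.mem_orthogonal']
  intro w hw
  exact hS.inner_low C ξ hv hw

theorem map_high_le (ξ : T) : (highSp pos S).map (S ξ) ≤ (highSp pos S)ᗮ := by
  rintro _ ⟨v, hv, rfl⟩
  rw [Submodule.mem_orthogonal']
  intro w hw
  exact hS.inner_high C ξ hv hw

/-- S(ξ) injects each of the two subspaces into its own orthogonal complement, so each has at most
half the dimension. They are complementary, so equality holds for both. -/
theorem two_mul_finrank_low :
    2 * Module.finrank ℂ (lowSp pos S) = Module.finrank ℂ W ∧
      2 * Module.finrank ℂ (highSp pos S) = Module.finrank ℂ W := by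
  obtain ⟨ξ, hξ⟩ := C.nontriv
  have h1 := Submodule.finrank_mono (hS.map_low_le C ξ)
  have h2 := Submodule.finrank_mono (hS.map_high_le C ξ)
  rw [hS.finrank_map hξ] at h1 h2
  have h3 := (lowSp pos S).finrank_add_finrank_orthogonal
  have h4 := (highSp pos S).finrank_add_finrank_orthogonal
  have h5 := Submodule.finrank_add_eq_of_isCompl (hS.isCompl C)
  omega

theorem map_low {ξ : T} (hξ : ξ ≠ 0) : (lowSp pos S).map (S ξ) = (lowSp pos S)ᗮ := by
  apply Submodule.eq_of_le_of_finrank_eq (hS.map_low_le C ξ)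
  rw [hS.finrank_map hξ]
  have h3 := (lowSp pos S).finrank_add_finrank_orthogonal
  have := (hS.two_mul_finrank_low C).1
  omega

/-- A recognition criterion for the lower spectral subspace. -/
theorem lowSp_eq_of {U : Submodule ℂ W} {ξ : T} (hξ : ξ ≠ 0)
    (h1 : ∀ η, ∀ v ∈ U, S η v ∈ Uᗮ) (h2 : 2 * Module.finrank ℂ U = Module.finrank ℂ W)
    (h3 : ∀ v ∈ U, v ≠ 0 → ∀ z : ℂ, S (J ξ) v = z • S ξ v → z.im < 0) : lowSp pos S = U := by
  -- The dimension count makes S(ξ) map U onto Uᗮ, while S(Jξ) maps U into Uᗮ; so Q = S(ξ)⁻¹S(Jξ)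
  -- preserves U and the criterion for invariant subspaces applies.
  have hmap : U.map (S ξ) = Uᗮ := by
    apply Submodule.eq_of_le_of_finrank_eq
    · rintro _ ⟨v, hv, rfl⟩
      exact h1 ξ v hv
    · rw [hS.finrank_map hξ]
      have h3 := U.finrank_add_finrank_orthogonal
      omega
  symm
  apply Submodule.eq_of_le_of_finrank_eq
  · rw [hS.lowSp_eq C hξ]
    apply le_specLow
    · intro v hv
      have h4 : S (J ξ) v ∈ U.map (S ξ) := hmap ▸ h1 (J ξ) v hv
      obtain ⟨w, hw, hwv⟩ := h4
      rw [← hS.apply_qop hξ] at hwv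
      have h5 : w = qop J S ξ v := by
        rw [← sub_eq_zero]
        apply hS.injective hξ
        rw [map_sub, hwv, sub_self]
      exact h5 ▸ hw
    · intro v hv hv0 z hz
      exact h3 v hv hv0 z ((hS.qop_eq_smul_iff hξ).1 hz)
  · have := (hS.two_mul_finrank_low C).1
    omega

end IsEllSymb

end SymbolAtAPoint

/-! ### Deformation of an elliptic symbol at a point to a Dirac symbol. -/

section Deformation

/-- The first cut-off function of the deformation. -/
def cutA (s : ℝ) : ℝ := max 0 (1 - 2 * s)

/-- The second cut-off function of the deformation. -/
def cutB (s : ℝ) : ℝ := max 0 (2 * s - 1)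

/-- The deformation has two stages: up to s = 1/2 the unwanted parts of the symbol are scaled to
zero, and only after that is the remaining part normalized. The stages never interact. -/
theorem cutA_eq_zero_or_cutB_eq_zero (s : ℝ) : cutA s = 0 ∨ cutB s = 0 := by
  unfold cutA cutB
  rcases le_total (1 - 2 * s) 0 with h | h
  · exact Or.inl (max_eq_left h)
  · exact Or.inr (max_eq_left (by linarith))

theorem cutA_nonneg (s : ℝ) : 0 ≤ cutA s := le_max_left _ _
theorem cutB_nonneg (s : ℝ) : 0 ≤ cutB s := le_max_left _ _
theorem cutA_le_one {s : ℝ} (hs : 0 ≤ s) : cutA s ≤ 1 := max_le zero_le_one (by linarith)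
theorem cutB_le_one {s : ℝ} (hs : s ≤ 1) : cutB s ≤ 1 := max_le zero_le_one (by linarith)
theorem cutA_zero : cutA 0 = 1 := by simp [cutA]
theorem cutB_zero : cutB 0 = 0 := by simp [cutB]
theorem cutA_one : cutA 1 = 0 := by unfold cutA; exact max_eq_left (by norm_num)
theorem cutB_one : cutB 1 = 1 := by unfold cutB; rw [max_eq_right (by norm_num)]; norm_num

variable {T : Type*} [AddCommGroup T] [Module ℝ T]
variable {W : Type*} [NormedAddCommGroup W] [InnerProductSpace ℂ W] [FiniteDimensional ℂ W]
variable (pos : T → T → Prop) (J : T →ₗ[ℝ] T) (nn : T → ℝ) (S : T →ₗ[ℝ] Module.End ℂ W)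

/-- The orthogonal projection on the lower spectral subspace. -/
def lowP : Module.End ℂ W := orthP (lowSp pos S)

/-- The `J`-antilinear part of the off-diagonal component of the symbol. -/
def partN (ξ : T) : Module.End ℂ W :=
  (1 / 2 : ℂ) • ((1 - lowP pos S) * (S ξ + Complex.I • S (J ξ)) * lowP pos S)

/-- The `J`-linear part of the off-diagonal component of the symbol. -/
def partM (ξ : T) : Module.End ℂ W :=
  (1 / 2 : ℂ) • ((1 - lowP pos S) * (S ξ - Complex.I • S (J ξ)) * lowP pos S)

/-- The positive operator whose inverse square root normalizes `partN`. -/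
def normOp (ξ₀ : T) : Module.End ℂ W :=
  (((nn ξ₀ ^ 2)⁻¹ : ℝ) : ℂ) • (star (partN pos J S ξ₀) * partN pos J S ξ₀) + (1 - lowP pos S)

/-- The normalizing factor at the time `s`. -/
def normFactor (ξ₀ : T) (s : ℝ) : Module.End ℂ W :=
  ((1 - cutB s : ℝ) : ℂ) • 1 + (cutB s : ℂ) • invSqrt (normOp pos J nn S ξ₀)

/-- The off-diagonal component of the deformed symbol. -/
def halfSymb (ξ₀ : T) (s : ℝ) (ξ : T) : Module.End ℂ W :=
  (cutA s : ℂ) • partM pos J S ξ + partN pos J S ξ * normFactor pos J nn S ξ₀ s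

theorem partN_add (ξ η : T) : partN pos J S (ξ + η) = partN pos J S ξ + partN pos J S η := by
  simp only [partN, map_add, smul_add, mul_add, add_mul]
  abel

theorem partM_add (ξ η : T) : partM pos J S (ξ + η) = partM pos J S ξ + partM pos J S η := by
  simp only [partM, map_add, smul_add, mul_add, add_mul, mul_sub, sub_mul, smul_sub]
  abel

theorem partN_smul (a : ℝ) (ξ : T) : partN pos J S (a • ξ) = (a : ℂ) • partN pos J S ξ := by
  simp only [partN, map_smul]
  rw [smul_comm Complex.I a, ← smul_add, mul_smul_comm, smul_mul_assoc, smul_comm, Complex.coe_smul]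

theorem partM_smul (a : ℝ) (ξ : T) : partM pos J S (a • ξ) = (a : ℂ) • partM pos J S ξ := by
  simp only [partM, map_smul]
  rw [smul_comm Complex.I a, ← smul_sub, mul_smul_comm, smul_mul_assoc, smul_comm, Complex.coe_smul]

theorem halfSymb_add (ξ₀ : T) (s : ℝ) (ξ η : T) : halfSymb pos J nn S ξ₀ s (ξ + η) =
    halfSymb pos J nn S ξ₀ s ξ + halfSymb pos J nn S ξ₀ s η := by
  simp only [halfSymb, partN_add, partM_add, smul_add, add_mul]
  abel

theorem halfSymb_smul (ξ₀ : T) (s : ℝ) (a : ℝ) (ξ : T) : halfSymb pos J nn S ξ₀ s (a • ξ) =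
    (a : ℂ) • halfSymb pos J nn S ξ₀ s ξ := by
  simp only [halfSymb, partN_smul, partM_smul, smul_add, smul_mul_assoc]
  rw [smul_comm]

/-- The deformation of a symbol to a Dirac symbol. -/
def deform (ξ₀ : T) (s : ℝ) : T →ₗ[ℝ] Module.End ℂ W where
  -- Block form over E⁻ ⊕ (E⁻)ᗮ. There is no block on E⁻ because E⁻ is isotropic, the block on (E⁻)ᗮ
  -- is scaled away, and the off-diagonal block comes with its adjoint to keep the symbol symmetric.
  toFun ξ := (cutA s : ℂ) • ((1 - lowP pos S) * S ξ * (1 - lowP pos S)) +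
    (halfSymb pos J nn S ξ₀ s ξ + star (halfSymb pos J nn S ξ₀ s ξ))
  map_add' ξ η := by
    simp only [halfSymb_add, map_add, mul_add, add_mul, smul_add, star_add]
    abel
  map_smul' a ξ := by
    simp only [halfSymb_smul, map_smul, mul_smul_comm, smul_mul_assoc, RingHom.id_apply, smul_add,
      star_smul, Complex.star_def, Complex.conj_ofReal, Complex.coe_smul, star_trivial]
    rw [smul_comm]

theorem deform_apply (ξ₀ : T) (s : ℝ) (ξ : T) : deform pos J nn S ξ₀ s ξ =
    (cutA s : ℂ) • ((1 - lowP pos S) * S ξ * (1 - lowP pos S)) +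
    (halfSymb pos J nn S ξ₀ s ξ + star (halfSymb pos J nn S ξ₀ s ξ)) := rfl

variable {pos J nn S}

theorem lowP_mul_self : lowP pos S * lowP pos S = lowP pos S := orthP_mul_self _

theorem lowP_mul_one_sub : lowP pos S * (1 - lowP pos S) = 0 := by
  rw [mul_sub, mul_one, lowP_mul_self, sub_self]

theorem one_sub_mul_lowP : (1 - lowP pos S) * lowP pos S = 0 := by
  rw [sub_mul, one_mul, lowP_mul_self, sub_self]

theorem one_sub_mul_one_sub : (1 - lowP pos S) * (1 - lowP pos S) = 1 - lowP pos S := by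
  rw [mul_sub, mul_one, one_sub_mul_lowP, sub_zero]

theorem star_lowP : star (lowP pos S) = lowP pos S := star_orthP _

theorem star_one_sub_lowP : star (1 - lowP pos S) = 1 - lowP pos S := by
  rw [star_sub, star_one, star_lowP]

theorem partN_mul_lowP (ξ : T) : partN pos J S ξ * lowP pos S = partN pos J S ξ := by
  rw [partN, smul_mul_assoc, mul_assoc, lowP_mul_self]

theorem partM_mul_lowP (ξ : T) : partM pos J S ξ * lowP pos S = partM pos J S ξ := by
  rw [partM, smul_mul_assoc, mul_assoc, lowP_mul_self]

theorem lowP_mul_partN (ξ : T) : lowP pos S * partN pos J S ξ = 0 := by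
  rw [partN, mul_smul_comm, ← mul_assoc, ← mul_assoc, lowP_mul_one_sub]
  simp

theorem lowP_mul_partM (ξ : T) : lowP pos S * partM pos J S ξ = 0 := by
  rw [partM, mul_smul_comm, ← mul_assoc, ← mul_assoc, lowP_mul_one_sub]
  simp

theorem lowP_mul_star_partN (ξ : T) :
    lowP pos S * star (partN pos J S ξ) = star (partN pos J S ξ) := by
  conv_rhs => rw [← partN_mul_lowP, star_mul, star_lowP]

theorem normOp_isPositive (ξ₀ : T) : (normOp pos J nn S ξ₀).IsPositive := by
  refine LinearMap.IsPositive.add ?_ ?_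
  · refine LinearMap.IsPositive.smul_of_nonneg ?_ ?_
    · exact LinearMap.isPositive_adjoint_comp_self (partN pos J S ξ₀)
    · exact_mod_cast inv_nonneg.2 (sq_nonneg (nn ξ₀))
  · have := LinearMap.isPositive_adjoint_comp_self (1 - lowP pos S)
    rw [← LinearMap.star_eq_adjoint, star_one_sub_lowP] at this
    have h2 : (1 - lowP pos S) ∘ₗ (1 - lowP pos S) = 1 - lowP pos S := one_sub_mul_one_sub
    rwa [h2] at this

theorem normOp_mul_lowP (ξ₀ : T) : normOp pos J nn S ξ₀ * lowP pos S =
    (((nn ξ₀ ^ 2)⁻¹ : ℝ) : ℂ) • (star (partN pos J S ξ₀) * partN pos J S ξ₀) := by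
  rw [normOp, add_mul, one_sub_mul_lowP, add_zero, smul_mul_assoc, mul_assoc, partN_mul_lowP]

theorem lowP_mul_normOp (ξ₀ : T) : lowP pos S * normOp pos J nn S ξ₀ =
    (((nn ξ₀ ^ 2)⁻¹ : ℝ) : ℂ) • (star (partN pos J S ξ₀) * partN pos J S ξ₀) := by
  rw [normOp, mul_add, lowP_mul_one_sub, add_zero, mul_smul_comm, ← mul_assoc, lowP_mul_star_partN]

theorem normOp_commute (ξ₀ : T) : Commute (normOp pos J nn S ξ₀) (lowP pos S) := by
  rw [Commute, SemiconjBy, normOp_mul_lowP, lowP_mul_normOp]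

theorem partN_J (C : IsConfPlane pos J nn) (ξ : T) :
    partN pos J S (J ξ) = (-Complex.I) • partN pos J S ξ := by
  have : S (J ξ) + Complex.I • S (J (J ξ)) = (-Complex.I) • (S ξ + Complex.I • S (J ξ)) := by
    rw [C.J_J, map_neg, smul_add, smul_smul]
    simp [add_comm]
  rw [partN, this, mul_smul_comm, smul_mul_assoc, smul_comm]
  rfl

theorem partM_J (C : IsConfPlane pos J nn) (ξ : T) :
    partM pos J S (J ξ) = Complex.I • partM pos J S ξ := by
  have : S (J ξ) - Complex.I • S (J (J ξ)) = Complex.I • (S ξ - Complex.I • S (J ξ)) := by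
    rw [C.J_J, map_neg, smul_sub, smul_smul]
    simp [add_comm]
  rw [partM, this, mul_smul_comm, smul_mul_assoc, smul_comm]
  rfl

theorem halfSymb_J (C : IsConfPlane pos J nn) (ξ₀ : T) (s : ℝ) (ξ : T) :
    halfSymb pos J nn S ξ₀ s (J ξ) = Complex.I • ((cutA s : ℂ) • partM pos J S ξ) -
      Complex.I • (partN pos J S ξ * normFactor pos J nn S ξ₀ s) := by
  rw [halfSymb, partN_J C, partM_J C, smul_mul_assoc, neg_smul, smul_comm, sub_eq_add_neg]

section Elliptic

variable (hS : IsEllSymb S) (C : IsConfPlane pos J nn)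
include hS C

theorem lowP_apply_symb (ξ : T) {v : W} (hv : v ∈ lowSp pos S) : lowP pos S (S ξ v) = 0 :=
  orthP_of_mem_orthogonal (hS.map_low_le C ξ (Submodule.mem_map_of_mem hv))

theorem partN_apply {ξ : T} (hξ : ξ ≠ 0) {v : W} (hv : v ∈ lowSp pos S) :
    partN pos J S ξ v = (1 / 2 : ℂ) • S ξ (v + Complex.I • qop J S ξ v) := by
  have h1 : lowP pos S v = v := orthP_of_mem hv
  simp only [partN, LinearMap.smul_apply, Module.End.mul_apply, h1, LinearMap.add_apply,
    LinearMap.sub_apply, Module.End.one_apply, map_add, map_smul, lowP_apply_symb hS C _ hv,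
    hS.apply_qop hξ]
  simp

theorem partM_apply {ξ : T} (hξ : ξ ≠ 0) {v : W} (hv : v ∈ lowSp pos S) :
    partM pos J S ξ v = (1 / 2 : ℂ) • S ξ (v - Complex.I • qop J S ξ v) := by
  have h1 : lowP pos S v = v := orthP_of_mem hv
  simp only [partM, LinearMap.smul_apply, Module.End.mul_apply, h1, map_sub,
    LinearMap.sub_apply, Module.End.one_apply, map_smul, lowP_apply_symb hS C _ hv,
    hS.apply_qop hξ]
  simp

/-- On E⁻ one has N(ξ)v = ½ S(ξ)(v + iQv). A vector in the kernel would be an eigenvector of Q for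
i, whereas on E⁻ all eigenvalues have negative imaginary part. -/
theorem partN_injective {ξ : T} (hξ : ξ ≠ 0) {v : W} (hv : v ∈ lowSp pos S)
    (h : partN pos J S ξ v = 0) : v = 0 := by
  rw [partN_apply hS C hξ hv, smul_eq_zero_iff_right (by norm_num)] at h
  have h1 := hS.injective hξ h
  by_contra hv0
  have h2 : qop J S ξ v = Complex.I • v := by
    have h3 : Complex.I • (v + Complex.I • qop J S ξ v) = 0 := by rw [h1, smul_zero]
    rw [smul_add, smul_smul, Complex.I_mul_I, neg_smul, one_smul, ← sub_eq_add_neg] at h3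
    exact (sub_eq_zero.1 h3).symm
  rw [hS.lowSp_eq C hξ] at hv
  have := im_neg_of_mem_specLow hv hv0 h2
  simp at this
  linarith

/-- On E⁻ the operator is a positive multiple of N*N with N injective, and on (E⁻)ᗮ it is the
identity. -/
theorem normOp_isUnit {ξ₀ : T} (h0 : ξ₀ ≠ 0) : IsUnit (normOp pos J nn S ξ₀) := by
  rw [LinearMap.isUnit_iff_ker_eq_bot, LinearMap.ker_eq_bot']
  intro w hw
  have h1 : lowP pos S w = w := by
    have : (1 - lowP pos S) (normOp pos J nn S ξ₀ w) = (1 - lowP pos S) w := by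
      have e : (1 - lowP pos S) * normOp pos J nn S ξ₀ = 1 - lowP pos S := by
        rw [sub_mul, one_mul, lowP_mul_normOp, normOp, add_sub_cancel_left]
      exact congrArg (fun f : Module.End ℂ W => f w) e
    rw [hw, map_zero] at this
    exact (sub_eq_zero.1 (by simpa using this.symm)).symm
  have h2 : (normOp pos J nn S ξ₀ * lowP pos S) w = 0 := by
    rw [Module.End.mul_apply, h1, hw]
  rw [normOp_mul_lowP, LinearMap.smul_apply, smul_eq_zero] at h2
  rcases h2 with h2 | h2
  · have := C.nn_pos ξ₀ h0
    simp [this.ne'] at h2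
  · have h3 : inner ℂ (partN pos J S ξ₀ w) (partN pos J S ξ₀ w) = 0 := by
      rw [← LinearMap.adjoint_inner_left, ← LinearMap.star_eq_adjoint]
      rw [Module.End.mul_apply] at h2
      rw [h2, inner_zero_left]
    exact partN_injective hS C h0 (h1 ▸ orthP_mem _ _) (inner_self_eq_zero.1 h3)

/-- N(aξ₀ + bJξ₀) = (a - ib)N(ξ₀), and ‖·‖² is multiplied by the same number a² + b² as N*N. So
N(ξ)*N(ξ)/‖ξ‖² does not depend on ξ, which is why one factor normalizes N(ξ) for all ξ
simultaneously. -/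
theorem star_partN_mul_partN {ξ₀ : T} (h0 : ξ₀ ≠ 0) (ξ : T) :
    star (partN pos J S ξ) * partN pos J S ξ =
      ((nn ξ ^ 2 : ℝ) : ℂ) • (normOp pos J nn S ξ₀ * lowP pos S) := by
  obtain ⟨a, b, rfl⟩ := C.span ξ₀ h0 ξ
  have h1 : partN pos J S (a • ξ₀ + b • J ξ₀) = ((a : ℂ) - b * Complex.I) • partN pos J S ξ₀ := by
    rw [partN_add, partN_smul, partN_smul, partN_J C]
    module
  rw [h1, star_smul, smul_mul_smul_comm, normOp_mul_lowP, smul_smul, C.nn_comb]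
  congr 1
  have hn : ((nn ξ₀ : ℝ) : ℂ) ≠ 0 := by exact_mod_cast (C.nn_pos ξ₀ h0).ne'
  simp
  field_simp
  ring_nf
  simp

/-- The normalizing operator does not depend on the auxiliary covector. -/
theorem normOp_indep {ξ₀ ξ₁ : T} (h0 : ξ₀ ≠ 0) (h1 : ξ₁ ≠ 0) :
    normOp pos J nn S ξ₁ = normOp pos J nn S ξ₀ := by
  have e : ∀ ξ : T, normOp pos J nn S ξ =
      normOp pos J nn S ξ * lowP pos S + (1 - lowP pos S) := by
    intro ξ
    rw [normOp_mul_lowP]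
    rfl
  rw [e ξ₁, e ξ₀]
  congr 1
  have := star_partN_mul_partN hS C h0 ξ₁
  rw [star_partN_mul_partN hS C h1 ξ₁] at this
  have hn : ((nn ξ₁ ^ 2 : ℝ) : ℂ) ≠ 0 := by exact_mod_cast (pow_pos (C.nn_pos ξ₁ h1) 2).ne'
  exact smul_right_injective _ hn this

theorem deform_indep {ξ₀ ξ₁ : T} (h0 : ξ₀ ≠ 0) (h1 : ξ₁ ≠ 0) (s : ℝ) :
    deform pos J nn S ξ₁ s = deform pos J nn S ξ₀ s := by
  ext ξ : 1
  simp only [deform_apply, halfSymb, normFactor, normOp_indep hS C h0 h1]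

theorem invSqrt_normOp {ξ₀ : T} (h0 : ξ₀ ≠ 0) :
    (invSqrt (normOp pos J nn S ξ₀)).IsPositive ∧
    invSqrt (normOp pos J nn S ξ₀) * invSqrt (normOp pos J nn S ξ₀) * normOp pos J nn S ξ₀ = 1 ∧
    Commute (invSqrt (normOp pos J nn S ξ₀)) (lowP pos S) :=
  ⟨(invSqrt_spec (normOp_isPositive ξ₀) (normOp_isUnit hS C h0)).1,
    (invSqrt_spec (normOp_isPositive ξ₀) (normOp_isUnit hS C h0)).2,
    invSqrt_commute_orthP (normOp_isPositive ξ₀) (normOp_isUnit hS C h0) (normOp_commute ξ₀)⟩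

theorem normFactor_commute {ξ₀ : T} (h0 : ξ₀ ≠ 0) (s : ℝ) :
    Commute (normFactor pos J nn S ξ₀ s) (lowP pos S) :=
  ((Commute.one_left _).smul_left _).add_left ((invSqrt_normOp hS C h0).2.2.smul_left _)

theorem normFactor_mem {ξ₀ : T} (h0 : ξ₀ ≠ 0) (s : ℝ) {v : W} (hv : v ∈ lowSp pos S) :
    normFactor pos J nn S ξ₀ s v ∈ lowSp pos S := by
  have h1 : lowP pos S v = v := orthP_of_mem hv
  rw [← h1]
  have := congrArg (fun f : Module.End ℂ W => f v) (normFactor_commute hS C h0 s).eq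
  simp only [Module.End.mul_apply] at this
  rw [this]
  exact orthP_mem _ _

/-- The factor is a convex combination of the identity and a positive invertible operator: ⟨Fv, v⟩
is bounded below by (1 - b)‖v‖², and at b = 1 the factor is the inverse root itself. -/
theorem normFactor_injective {ξ₀ : T} (h0 : ξ₀ ≠ 0) {s : ℝ} (hs1 : s ≤ 1) {v : W}
    (h : normFactor pos J nn S ξ₀ s v = 0) : v = 0 := by
  obtain ⟨hR, hRB, -⟩ := invSqrt_normOp hS C h0
  set R := invSqrt (normOp pos J nn S ξ₀)
  have h1 : (1 - cutB s) * ‖v‖ ^ 2 + cutB s * RCLike.re (inner ℂ (R v) v) = 0 := by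
    have h2 := congrArg (fun w => RCLike.re (inner ℂ w v)) h
    simp only [normFactor, LinearMap.add_apply, LinearMap.smul_apply, Module.End.one_apply,
      inner_add_left, inner_smul_left, Complex.conj_ofReal, map_add, inner_zero_left, map_zero,
      inner_self_eq_norm_sq_to_K] at h2
    rw [← h2]
    congr 1
    · change _ = Complex.re (((1 - cutB s : ℝ) : ℂ) * ((‖v‖ : ℝ) : ℂ) ^ 2)
      rw [Complex.re_ofReal_mul, ← Complex.ofReal_pow, Complex.ofReal_re]
    · exact (Complex.re_ofReal_mul _ _).symm
  have h3 := hR.2 v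
  have h4 := cutB_nonneg s
  have h5 := cutB_le_one hs1
  rcases eq_or_lt_of_le h5 with h6 | h6
  · have h7 : R v = 0 := by
      simpa [normFactor, h6] using h
    have hu : IsUnit R := by
      have : R * (R * normOp pos J nn S ξ₀) = 1 := by rw [← mul_assoc, hRB]
      exact IsUnit.of_mul_eq_one _ this
    exact LinearMap.ker_eq_bot'.1 ((LinearMap.isUnit_iff_ker_eq_bot _).1 hu) v h7
  · have h7 : 0 ≤ cutB s * RCLike.re (inner ℂ (R v) v) := mul_nonneg h4 h3
    have h8 : (1 - cutB s) * ‖v‖ ^ 2 = 0 := by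
      have : 0 ≤ (1 - cutB s) * ‖v‖ ^ 2 := mul_nonneg (by linarith) (sq_nonneg _)
      linarith
    have h9 : ‖v‖ ^ 2 = 0 := by
      rcases mul_eq_zero.1 h8 with h | h
      · linarith
      · exact h
    simpa using h9

/-- The comparison of the two parts of the off-diagonal component. -/
theorem part_comparison {ξ₀ : T} (h0 : ξ₀ ≠ 0) {s : ℝ} (hs0 : 0 ≤ s) (hs1 : s ≤ 1) {ξ : T}
    (hξ : ξ ≠ 0) {v : W} (hv : v ∈ lowSp pos S) (hv0 : v ≠ 0) {α β : ℂ}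
    (h : (α * cutA s) • partM pos J S ξ v =
      β • partN pos J S ξ (normFactor pos J nn S ξ₀ s v)) : β = 0 ∨ ‖β‖ < ‖α‖ := by
  -- In the second stage the left side of `h` is zero and β must vanish by injectivity; in the first
  -- stage the normalizing factor is 1 and the spectrum of Q decides.
  rcases cutA_eq_zero_or_cutB_eq_zero s with hA | hB
  · left
    rw [hA] at h
    simp only [Complex.ofReal_zero, mul_zero, zero_smul] at h
    rcases smul_eq_zero.1 h.symm with h | h
    · exact h
    · exact absurd (normFactor_injective hS C h0 hs1
        (partN_injective hS C hξ (normFactor_mem hS C h0 s hv) h)) hv0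
  · have h1 : normFactor pos J nn S ξ₀ s v = v := by simp [normFactor, hB]
    rw [h1, partN_apply hS C hξ hv, partM_apply hS C hξ hv, smul_comm, smul_comm β] at h
    have h2 := smul_right_injective _ (show (1 / 2 : ℂ) ≠ 0 by norm_num) h
    have h3 : (α * cutA s) • (v - Complex.I • qop J S ξ v) =
        β • (v + Complex.I • qop J S ξ v) := by
      rw [← sub_eq_zero]
      apply hS.injective hξ
      rw [map_sub, map_smul, map_smul]
      exact sub_eq_zero.2 h2
    set γ : ℂ := α * cutA s with hγ
    set q := qop J S ξ v with hq
    have h4 : (γ - β) • v = (Complex.I * (γ + β)) • q := by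
      have : (γ - β) • v - (Complex.I * (γ + β)) • q =
          γ • (v - Complex.I • q) - β • (v + Complex.I • q) := by module
      rw [← sub_eq_zero, this, h3, sub_self]
    by_cases h5 : γ + β = 0
    · left
      rw [h5, mul_zero, zero_smul, smul_eq_zero_iff_left hv0] at h4
      have : (2 : ℂ) * β = 0 := by linear_combination h5 - h4
      simpa using this
    · right
      -- So v is an eigenvector of Q with eigenvalue (γ - β)/(i(γ + β)). This Cayley transform lies
      -- in the lower half-plane exactly when |β| < |γ|, and |γ| ≤ |α| because the cut-off is at
      -- most 1.
      have h6 : q = ((Complex.I * (γ + β))⁻¹ * (γ - β)) • v := by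
        rw [mul_smul, h4, smul_smul, inv_mul_cancel₀ (mul_ne_zero Complex.I_ne_zero h5), one_smul]
      have hv' := hv
      rw [hS.lowSp_eq C hξ] at hv'
      have h7 := im_neg_of_mem_specLow hv' hv0 h6
      have h8 : ((Complex.I * (γ + β))⁻¹ * (γ - β)).im =
          (‖β‖ ^ 2 - ‖γ‖ ^ 2) / Complex.normSq (γ + β) := by
        rw [mul_inv, Complex.inv_I, ← Complex.normSq_eq_norm_sq, ← Complex.normSq_eq_norm_sq]
        simp [Complex.inv_re, Complex.inv_im, Complex.normSq_apply]
        have : (γ.re + β.re) * (γ.re + β.re) + (γ.im + β.im) * (γ.im + β.im) ≠ 0 := by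
          have := (Complex.normSq_pos.2 h5).ne'
          simpa [Complex.normSq_apply] using this
        field_simp
        ring
      rw [h8, div_neg_iff] at h7
      have hpos : 0 < Complex.normSq (γ + β) := Complex.normSq_pos.2 h5
      have h9 : ‖β‖ ^ 2 < ‖γ‖ ^ 2 := by
        rcases h7 with h7 | h7
        · linarith [h7.2]
        · linarith [h7.1]
      have h10 : ‖β‖ < ‖γ‖ := lt_of_pow_lt_pow_left₀ 2 (norm_nonneg _) h9
      refine h10.trans_le ?_
      rw [hγ, norm_mul, Complex.norm_real, Real.norm_eq_abs, abs_of_nonneg (cutA_nonneg s)]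
      exact mul_le_of_le_one_right (norm_nonneg _) (cutA_le_one hs0)

/-- For a kernel vector the two parts are opposite, so the comparison with α = 1 and β = -1 would
give -1 = 0 or 1 < 1. -/
theorem halfSymb_injective {ξ₀ : T} (h0 : ξ₀ ≠ 0) {s : ℝ} (hs0 : 0 ≤ s) (hs1 : s ≤ 1) {ξ : T}
    (hξ : ξ ≠ 0) {v : W} (hv : v ∈ lowSp pos S) (h : halfSymb pos J nn S ξ₀ s ξ v = 0) :
    v = 0 := by
  by_contra hv0
  have := part_comparison hS C h0 hs0 hs1 hξ hv hv0 (α := 1) (β := -1) (by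
    rw [halfSymb] at h
    simp only [LinearMap.add_apply, LinearMap.smul_apply, Module.End.mul_apply] at h
    rw [one_mul, neg_smul, one_smul]
    exact eq_neg_of_add_eq_zero_left h)
  simp at this

omit hS C in
theorem lowP_mul_halfSymb (ξ₀ : T) (s : ℝ) (ξ : T) :
    lowP pos S * halfSymb pos J nn S ξ₀ s ξ = 0 := by
  rw [halfSymb, mul_add, mul_smul_comm, lowP_mul_partM, ← mul_assoc, lowP_mul_partN]
  simp

theorem halfSymb_mul_lowP {ξ₀ : T} (h0 : ξ₀ ≠ 0) (s : ℝ) (ξ : T) :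
    halfSymb pos J nn S ξ₀ s ξ * lowP pos S = halfSymb pos J nn S ξ₀ s ξ := by
  rw [halfSymb, add_mul, smul_mul_assoc, partM_mul_lowP, mul_assoc,
    (normFactor_commute hS C h0 s).eq, ← mul_assoc, partN_mul_lowP]

omit hS C in
theorem star_halfSymb_apply (ξ₀ : T) (s : ℝ) (ξ : T) {v : W} (hv : v ∈ lowSp pos S) :
    star (halfSymb pos J nn S ξ₀ s ξ) v = 0 := by
  have h1 := congrArg star (lowP_mul_halfSymb (pos := pos) (J := J) (nn := nn) (S := S) ξ₀ s ξ)
  rw [star_mul, star_lowP, star_zero] at h1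
  have h2 := congrArg (fun f : Module.End ℂ W => f v) h1
  have h3 : lowP pos S v = v := orthP_of_mem hv
  simpa [h3] using h2

omit hS C in
theorem deform_apply_low (ξ₀ : T) (s : ℝ) (ξ : T) {v : W} (hv : v ∈ lowSp pos S) :
    deform pos J nn S ξ₀ s ξ v = halfSymb pos J nn S ξ₀ s ξ v := by
  have h3 : lowP pos S v = v := orthP_of_mem hv
  rw [deform_apply]
  simp [star_halfSymb_apply ξ₀ s ξ hv, h3]

/-- The off-diagonal block X maps E⁻ isomorphically onto (E⁻)ᗮ by injectivity and dimension. If the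
symbol annihilates w, its E⁻-component gives X*w = 0, so w is orthogonal to X(E⁻) = (E⁻)ᗮ and lies
in E⁻; there the symbol acts as the injective X. -/
theorem deform_isEllSymb {ξ₀ : T} (h0 : ξ₀ ≠ 0) {s : ℝ} (hs0 : 0 ≤ s) (hs1 : s ≤ 1) :
    IsEllSymb (deform pos J nn S ξ₀ s) where
  sym ξ := by
    rw [LinearMap.isSymmetric_iff_isSelfAdjoint]
    have hsa : star (S ξ) = S ξ := ((LinearMap.isSymmetric_iff_isSelfAdjoint _).1 (hS.sym ξ)).star_eq
    change star _ = _
    rw [deform_apply, star_add, star_add, star_star, star_smul, star_mul, star_mul,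
      star_one_sub_lowP, hsa, add_comm (star _)]
    simp [mul_assoc]
  unit ξ hξ := by
    rw [LinearMap.isUnit_iff_ker_eq_bot, LinearMap.ker_eq_bot']
    intro w hw
    set U := lowSp pos S
    set X := halfSymb pos J nn S ξ₀ s ξ with hX
    set P := lowP pos S with hP
    have hPX : P * X = 0 := lowP_mul_halfSymb ξ₀ s ξ
    have hXP : X * P = X := halfSymb_mul_lowP hS C h0 s ξ
    have hmap : U.map X = Uᗮ := by
      apply Submodule.eq_of_le_of_finrank_eq
      · rintro _ ⟨v, hv, rfl⟩
        rw [← one_sub_orthP_eq_self_iff]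
        have := congrArg (fun f : Module.End ℂ W => f v) hPX
        simp only [Module.End.mul_apply] at this
        change X v - P (X v) = X v
        rw [this]; simp
      · have h1 : Module.finrank ℂ (U.map X) = Module.finrank ℂ U := by
          have hinj : Function.Injective (X.domRestrict U) := by
            rw [injective_iff_map_eq_zero]
            rintro ⟨v, hv⟩ hv0
            exact Subtype.ext (halfSymb_injective hS C h0 hs0 hs1 hξ hv hv0)
          have := LinearMap.finrank_range_of_inj hinj
          rwa [LinearMap.range_domRestrict] at this
        have h3 := U.finrank_add_finrank_orthogonal
        have h4 : 2 * Module.finrank ℂ U = _ := (hS.two_mul_finrank_low C).1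
        omega
    have hstar : star X w = 0 := by
      have h1 := congrArg (fun u => P u) hw
      rw [deform_apply] at h1
      have hPsX : P * star X = star X := by
        conv_rhs => rw [← hXP, star_mul, hP, star_lowP]
      have e : P * ((cutA s : ℂ) • ((1 - P) * S ξ * (1 - P)) + (X + star X)) = star X := by
        rw [mul_add, mul_add, hPX, hPsX, mul_smul_comm, ← mul_assoc, ← mul_assoc, hP,
          lowP_mul_one_sub]
        simp
      have h2 := congrArg (fun f : Module.End ℂ W => f w) e
      simp only [Module.End.mul_apply] at h2
      rw [← h2, map_zero] at *
      exact h1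
    have hw' : w ∈ U := by
      rw [← Submodule.orthogonal_orthogonal U, ← hmap, Submodule.mem_orthogonal']
      rintro _ ⟨v, hv, rfl⟩
      rw [← LinearMap.adjoint_inner_left, ← LinearMap.star_eq_adjoint, hstar, inner_zero_left]
    rw [deform_apply_low ξ₀ s ξ hw'] at hw
    exact halfSymb_injective hS C h0 hs0 hs1 hξ hw' hw

/-- The old E⁻ is still isotropic of half dimension for the new symbol, so only the location of the
eigenvalues on it has to be checked. -/
theorem lowSp_deform {ξ₀ : T} (h0 : ξ₀ ≠ 0) {s : ℝ} (hs0 : 0 ≤ s) (hs1 : s ≤ 1) :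
    lowSp pos (deform pos J nn S ξ₀ s) = lowSp pos S := by
  refine (deform_isEllSymb hS C h0 hs0 hs1).lowSp_eq_of C h0 ?_ (hS.two_mul_finrank_low C).1 ?_
  · intro η v hv
    rw [deform_apply_low ξ₀ s η hv, ← one_sub_orthP_eq_self_iff]
    have := congrArg (fun f : Module.End ℂ W => f v)
      (lowP_mul_halfSymb (pos := pos) (J := J) (nn := nn) (S := S) ξ₀ s η)
    simp only [Module.End.mul_apply] at this
    change _ - lowP pos S _ = _
    rw [this]; simp
  · intro v hv hv0 z hz
    rw [deform_apply_low ξ₀ s _ hv, deform_apply_low ξ₀ s _ hv, halfSymb_J C, halfSymb] at hz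
    simp only [LinearMap.add_apply, LinearMap.sub_apply, LinearMap.smul_apply,
      Module.End.mul_apply] at hz
    set m := partM pos J S ξ₀ v
    set n := partN pos J S ξ₀ (normFactor pos J nn S ξ₀ s v)
    -- Since M and N are multiplied by i and -i under J, the eigenvalue equation reads (i - z)aMv =
    -- (z + i)NFv. Either z = -i, or z is closer to -i than to i; in both cases Im z < 0.
    have h1 := part_comparison hS C h0 hs0 hs1 h0 hv hv0 (α := Complex.I - z)
      (β := z + Complex.I) (by
        rw [← sub_eq_zero] at hz ⊢
        rw [← hz]
        module)
    rcases h1 with h1 | h1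
    · rw [eq_neg_of_add_eq_zero_left h1]
      simp
    · have h2 : ‖z + Complex.I‖ ^ 2 < ‖Complex.I - z‖ ^ 2 :=
        pow_lt_pow_left₀ h1 (norm_nonneg _) two_ne_zero
      rw [← Complex.normSq_eq_norm_sq, ← Complex.normSq_eq_norm_sq] at h2
      simp [Complex.normSq_apply] at h2
      nlinarith

/-- At s = 0 the parts M and N recombine to (1 - P)S(ξ)P, and the block PS(ξ)P missing from the
formula is zero by isotropy. -/
theorem deform_zero {ξ₀ : T} : deform pos J nn S ξ₀ 0 = S := by
  ext ξ : 1
  have hsa : star (S ξ) = S ξ := ((LinearMap.isSymmetric_iff_isSelfAdjoint _).1 (hS.sym ξ)).star_eq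
  have h1 : lowP pos S * S ξ * lowP pos S = 0 := by
    ext v
    exact lowP_apply_symb hS C ξ (orthP_mem _ v)
  have h2 : halfSymb pos J nn S ξ₀ 0 ξ = (1 - lowP pos S) * S ξ * lowP pos S := by
    rw [halfSymb, normFactor, cutA_zero, cutB_zero, partN, partM]
    simp only [Complex.ofReal_one, one_smul, sub_zero, Complex.ofReal_zero, zero_smul, add_zero,
      mul_one]
    rw [← smul_add, ← add_mul, ← mul_add]
    rw [show S ξ - Complex.I • S (J ξ) + (S ξ + Complex.I • S (J ξ)) = (2 : ℂ) • S ξ by module]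
    rw [mul_smul_comm, smul_mul_assoc, smul_smul]
    norm_num
  rw [deform_apply, h2, cutA_zero, star_mul, star_mul, star_lowP, star_one_sub_lowP, hsa]
  have : S ξ = (1 - lowP pos S) * S ξ * (1 - lowP pos S) +
      ((1 - lowP pos S) * S ξ * lowP pos S + lowP pos S * S ξ * (1 - lowP pos S)) +
      lowP pos S * S ξ * lowP pos S := by noncomm_ring
  rw [h1, add_zero] at this
  conv_rhs => rw [this]
  simp [mul_assoc]

end Elliptic

end Deformation

/-! ### Dirac symbols: the end of the deformation and its fixed points. -/

section DiracSymbols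

variable {T : Type*} [AddCommGroup T] [Module ℝ T]
variable {W : Type*} [NormedAddCommGroup W] [InnerProductSpace ℂ W] [FiniteDimensional ℂ W]
variable {pos : T → T → Prop} {J : T →ₗ[ℝ] T} {nn : T → ℝ} {S : T →ₗ[ℝ] Module.End ℂ W}

/-- Dirac symbols. -/
def IsDiracSymb (nn : T → ℝ) (S : T →ₗ[ℝ] Module.End ℂ W) : Prop :=
  ∀ ξ, S ξ * S ξ = ((nn ξ ^ 2 : ℝ) : ℂ) • 1

variable (hS : IsEllSymb S) (C : IsConfPlane pos J nn)
include hS C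

/-- At s = 1 only X + X* with X = N(ξ)B^(-1/2) is left. The choice of B gives X*X = ‖ξ‖²P, and X² =
0 because X maps E⁻ to (E⁻)ᗮ and kills the latter. -/
theorem deform_one_isDirac {ξ₀ : T} (h0 : ξ₀ ≠ 0) :
    IsDiracSymb nn (deform pos J nn S ξ₀ 1) := by
  intro ξ
  by_cases hξ : ξ = 0
  · have := C.nn_comb ξ₀ 0 0
    simp only [zero_smul, add_zero] at this
    rw [hξ, this]
    simp
  obtain ⟨hR, hRB, hRP⟩ := invSqrt_normOp hS C h0
  set P := lowP pos S with hP
  set B := normOp pos J nn S ξ₀ with hB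
  set R := invSqrt B with hRdef
  set X := halfSymb pos J nn S ξ₀ 1 ξ with hX
  set c : ℂ := ((nn ξ ^ 2 : ℝ) : ℂ) with hc
  have hXN : X = partN pos J S ξ * R := by
    rw [hX, halfSymb, normFactor, cutA_one, cutB_one]
    simp [hRdef, hB]
  have hD : deform pos J nn S ξ₀ 1 ξ = X + star X := by
    rw [deform_apply, cutA_one]
    simp [hX]
  have hPX : P * X = 0 := lowP_mul_halfSymb ξ₀ 1 ξ
  have hXP : X * P = X := halfSymb_mul_lowP hS C h0 1 ξ
  have hsXP : star X * P = 0 := by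
    have := congrArg star hPX
    rwa [star_mul, hP, star_lowP, star_zero] at this
  have hPsX : P * star X = star X := by
    conv_rhs => rw [← hXP, star_mul, hP, star_lowP]
  have hXX : X * X = 0 := by
    calc X * X = X * P * X := by rw [hXP]
      _ = 0 := by rw [mul_assoc, hPX, mul_zero]
  have hsXX : star X * star X = 0 := by rw [← star_mul, hXX, star_zero]
  have hRu : IsUnit R := by
    have : R * (R * B) = 1 := by rw [← mul_assoc, hRB]
    exact IsUnit.of_mul_eq_one _ this
  have hBRR : B * (R * R) = 1 := mul_eq_one_comm.1 hRB
  have hRBR : R * B * R = 1 := by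
    apply hRu.mul_left_injective
    change R * B * R * R = 1 * R
    rw [mul_assoc, mul_assoc, hBRR, mul_one, one_mul]
  have hRsa : star R = R := hR.adjoint_eq
  have h1 : star X * X = c • P := by
    rw [hXN, star_mul, hRsa]
    calc R * star (partN pos J S ξ) * (partN pos J S ξ * R)
        = R * (star (partN pos J S ξ) * partN pos J S ξ) * R := by noncomm_ring
      _ = R * (c • (B * P)) * R := by rw [star_partN_mul_partN hS C h0 ξ]
      _ = c • (R * B * (P * R)) := by
          rw [mul_smul_comm, smul_mul_assoc, ← mul_assoc R, mul_assoc (R * B)]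
      _ = c • P := by rw [← hRP.eq, ← mul_assoc, hRBR, one_mul]
  -- The other product follows from the first: (XX* - c(1 - P))(X + X*) = 0, and X + X* is
  -- invertible by ellipticity.
  have h2 : X * star X = c • (1 - P) := by
    rw [← sub_eq_zero]
    have hu : IsUnit (X + star X) := by
      rw [← hD]
      exact (deform_isEllSymb hS C h0 zero_le_one le_rfl).unit ξ hξ
    apply hu.mul_left_injective
    change (X * star X - c • (1 - P)) * (X + star X) = 0 * (X + star X)
    have e1 : X * star X * X = c • X := by rw [mul_assoc, h1, mul_smul_comm, hXP]
    have e2 : X * star X * star X = 0 := by rw [mul_assoc, hsXX, mul_zero]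
    have e3 : (c • (1 - P)) * X = c • X := by
      rw [smul_mul_assoc, sub_mul, one_mul, hPX, sub_zero]
    have e4 : (c • (1 - P)) * star X = 0 := by
      rw [smul_mul_assoc, sub_mul, one_mul, hPsX, sub_self, smul_zero]
    rw [sub_mul, mul_add, mul_add, e1, e2, e3, e4, zero_mul, sub_self]
  rw [hD, mul_add, add_mul, add_mul, hXX, hsXX, h1, h2, zero_add, add_zero, ← smul_add]
  congr 1
  abel

variable (hD : IsDiracSymb nn S)
include hD

omit hS in
-- Polarization of the Clifford identity, using ‖ξ + Jξ‖² = ‖ξ‖² + ‖Jξ‖².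
theorem dirac_anticommute (ξ : T) : S ξ * S (J ξ) + S (J ξ) * S ξ = 0 := by
  have h1 := hD (ξ + J ξ)
  have h2 := C.nn_comb ξ 1 1
  have h3 := C.nn_comb ξ 0 1
  simp only [one_smul, zero_smul, zero_add] at h2 h3
  rw [map_add, mul_add, add_mul, add_mul, hD ξ, hD (J ξ), h2, h3] at h1
  rw [show ((1 : ℝ) ^ 2 + 1 ^ 2) * nn ξ ^ 2 = nn ξ ^ 2 + nn ξ ^ 2 by ring,
    show ((0 : ℝ) ^ 2 + 1 ^ 2) * nn ξ ^ 2 = nn ξ ^ 2 by ring, Complex.ofReal_add, add_smul] at h1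
  set n : Module.End ℂ W := ((nn ξ ^ 2 : ℝ) : ℂ) • 1
  have : S ξ * S (J ξ) + S (J ξ) * S ξ =
      n + S (J ξ) * S ξ + (S ξ * S (J ξ) + n) - (n + n) := by abel
  rw [this, h1, sub_self]

theorem dirac_qop_qop {ξ : T} (hξ : ξ ≠ 0) (v : W) : qop J S ξ (qop J S ξ v) = -v := by
  rw [← sub_eq_zero]
  apply hS.injective hξ
  apply hS.injective (C.J_ne_zero hξ)
  have h := congrArg (fun f : Module.End ℂ W => f v) (dirac_anticommute C hD ξ)
  have h1 := congrArg (fun f : Module.End ℂ W => f (qop J S ξ v)) (hD (J ξ))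
  have h2 := congrArg (fun f : Module.End ℂ W => f (qop J S ξ v)) (hD ξ)
  have h3 := C.nn_comb ξ 0 1
  simp only [one_smul, zero_smul, zero_add] at h3
  simp only [LinearMap.add_apply, LinearMap.smul_apply, Module.End.mul_apply, LinearMap.zero_apply,
    Module.End.one_apply] at h h1 h2
  rw [hS.apply_qop hξ] at h2
  rw [h2] at h
  rw [sub_neg_eq_add, map_add, map_add, hS.apply_qop hξ, h1, h3, ← h]
  simp

/-- Here Q² = -1, so Qv + iv satisfies Q(Qv + iv) = i(Qv + iv). It lies in E⁻, where i is not an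
eigenvalue, so it vanishes. -/
theorem dirac_low {v : W} (hv : v ∈ lowSp pos S) (ξ : T) :
    S (J ξ) v = (-Complex.I) • S ξ v := by
  by_cases hξ : ξ = 0
  · simp [hξ]
  rw [← hS.qop_eq_smul_iff hξ]
  rw [hS.lowSp_eq C hξ] at hv
  by_contra hne
  have hw : qop J S ξ v + Complex.I • v ≠ 0 := by
    intro h
    exact hne (by rw [eq_neg_of_add_eq_zero_left h, neg_smul])
  have hmem : qop J S ξ v + Complex.I • v ∈ specLow (qop J S ξ) :=
    Submodule.add_mem _ (specLow_invariant _ hv) (Submodule.smul_mem _ _ hv)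
  have := im_neg_of_mem_specLow hmem hw (z := Complex.I) (by
    rw [map_add, map_smul, dirac_qop_qop hS C hD hξ, smul_add, smul_smul, Complex.I_mul_I]
    simp [add_comm])
  simp at this
  linarith

theorem dirac_high {v : W} (hv : v ∈ highSp pos S) (ξ : T) :
    S (J ξ) v = Complex.I • S ξ v := by
  by_cases hξ : ξ = 0
  · simp [hξ]
  rw [← hS.qop_eq_smul_iff hξ]
  rw [hS.highSp_eq C hξ] at hv
  by_contra hne
  have hw : qop J S ξ v - Complex.I • v ≠ 0 := by
    intro h
    exact hne (sub_eq_zero.1 h)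
  have hmem : qop J S ξ v - Complex.I • v ∈ specHigh (qop J S ξ) :=
    Submodule.sub_mem _ (specHigh_invariant _ hv) (Submodule.smul_mem _ _ hv)
  have := im_pos_of_mem_specHigh hmem hw (z := -Complex.I) (by
    rw [map_sub, map_smul, dirac_qop_qop hS C hD hξ, smul_sub, smul_smul]
    simp
    abel)
  simp at this
  linarith

/-- ⟨S(Jξ)v, S(Jξ)w⟩ equals ‖ξ‖²⟨v, w⟩ by the Clifford identity, and equals -‖ξ‖²⟨v, w⟩ because
S(Jξ) acts as -iS(ξ) on v and as iS(ξ) on w. Thus ⟨v, w⟩ = 0, and dimensions agree. -/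
theorem dirac_high_eq : highSp pos S = (lowSp pos S)ᗮ := by
  apply Submodule.eq_of_le_of_finrank_eq
  · intro w hw
    rw [Submodule.mem_orthogonal]
    intro v hv
    obtain ⟨ξ, hξ⟩ := C.nontriv
    have hsq : ∀ η : T, inner ℂ (S η v) (S η w) = ((nn η ^ 2 : ℝ) : ℂ) * inner ℂ v w := by
      intro η
      have h2 := congrArg (fun f : Module.End ℂ W => f w) (hD η)
      simp only [LinearMap.smul_apply, Module.End.mul_apply, Module.End.one_apply] at h2
      rw [hS.sym, h2, inner_smul_right]
    have h1 := hsq (J ξ)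
    have h3 := C.nn_comb ξ 0 1
    simp only [one_smul, zero_smul, zero_add] at h3
    rw [dirac_low hS C hD hv, dirac_high hS C hD hw, inner_smul_left, inner_smul_right, hsq ξ, h3]
      at h1
    have hn : ((nn ξ ^ 2 : ℝ) : ℂ) ≠ 0 := by exact_mod_cast (pow_pos (C.nn_pos ξ hξ) 2).ne'
    have h4 : ((nn ξ ^ 2 : ℝ) : ℂ) * inner ℂ v w = 0 := by
      simp only [map_neg, Complex.conj_I, neg_neg, ← mul_assoc, Complex.I_mul_I] at h1
      push_cast at h1 ⊢
      linear_combination (-1 / 2 : ℂ) * h1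
    exact (mul_eq_zero.1 h4).resolve_left hn
  · have h1 := hS.two_mul_finrank_low C
    have h2 := (lowSp pos S).finrank_add_finrank_orthogonal
    omega

/-- For a Dirac symbol S(Jξ) = -iS(ξ) on E⁻, so M = 0, N = SP and B = 1. The block on (E⁻)ᗮ = E⁺
vanishes since E⁺ is isotropic. Hence both stages do nothing. -/
theorem deform_dirac {ξ₀ : T} (h0 : ξ₀ ≠ 0) (s : ℝ) : deform pos J nn S ξ₀ s = S := by
  set P := lowP pos S with hP
  have hPm : ∀ w, P w ∈ lowSp pos S := fun w => orthP_mem _ w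
  have hsa : ∀ ξ, star (S ξ) = S ξ := fun ξ =>
    ((LinearMap.isSymmetric_iff_isSelfAdjoint _).1 (hS.sym ξ)).star_eq
  have hPSP : ∀ ξ, P * (S ξ * P) = 0 := fun ξ => by
    ext v; exact lowP_apply_symb hS C ξ (hPm v)
  have hJ : ∀ ξ, S (J ξ) * P = (-Complex.I) • (S ξ * P) := fun ξ => by
    ext v; exact dirac_low hS C hD (hPm v) ξ
  have hM : ∀ ξ, partM pos J S ξ = 0 := fun ξ => by
    have : (S ξ - Complex.I • S (J ξ)) * P = 0 := by
      rw [sub_mul, smul_mul_assoc, hJ, smul_smul]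
      simp
    rw [partM, mul_assoc, ← hP, this]
    simp
  have hN : ∀ ξ, partN pos J S ξ = S ξ * P := fun ξ => by
    have : (S ξ + Complex.I • S (J ξ)) * P = (2 : ℂ) • (S ξ * P) := by
      rw [add_mul, smul_mul_assoc, hJ, smul_smul, two_smul]
      simp
    rw [partN, mul_assoc, ← hP, this, mul_smul_comm, smul_smul, sub_mul, one_mul, hPSP, sub_zero]
    norm_num
  have hB : normOp pos J nn S ξ₀ = 1 := by
    have hn : ((nn ξ₀ : ℝ) : ℂ) ≠ 0 := by exact_mod_cast (C.nn_pos ξ₀ h0).ne'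
    rw [normOp, hN, star_mul, hsa, ← hP]
    have : star P * S ξ₀ * (S ξ₀ * P) = ((nn ξ₀ ^ 2 : ℝ) : ℂ) • P := by
      rw [hP, star_lowP, ← hP, mul_assoc, ← mul_assoc (S ξ₀), hD, smul_mul_assoc, one_mul,
        mul_smul_comm, hP, lowP_mul_self]
    rw [this, smul_smul]
    push_cast
    rw [inv_mul_cancel₀ (pow_ne_zero 2 hn), one_smul, add_sub_cancel]
  have hF : normFactor pos J nn S ξ₀ s = 1 := by
    rw [normFactor, hB, invSqrt_one, ← add_smul]
    push_cast
    simp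
  ext ξ : 1
  have hT : (1 - P) * S ξ * (1 - P) = 0 := by
    ext w
    have h1 : (1 - P) w ∈ highSp pos S := by
      rw [dirac_high_eq hS C hD]
      exact sub_orthP_mem _ w
    have h2 : S ξ ((1 - P) w) ∈ (highSp pos S)ᗮ :=
      hS.map_high_le C ξ (Submodule.mem_map_of_mem h1)
    rw [dirac_high_eq hS C hD, Submodule.orthogonal_orthogonal] at h2
    have h3 : P (S ξ ((1 - P) w)) = S ξ ((1 - P) w) := orthP_of_mem h2
    simp only [Module.End.mul_apply, LinearMap.zero_apply]
    conv_lhs => rw [LinearMap.sub_apply, Module.End.one_apply, h3, sub_self]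
  rw [deform_apply, ← hP, hT, smul_zero, zero_add, halfSymb, hM, hN, hF, smul_zero, zero_add,
    mul_one, star_mul, hsa, hP, star_lowP, ← hP]
  have e : (1 - P) * S ξ * (1 - P) = S ξ - (S ξ * P + P * S ξ) + P * (S ξ * P) := by noncomm_ring
  rw [hPSP, add_zero, hT] at e
  exact (sub_eq_zero.1 e.symm).symm

end DiracSymbols

/-! ### Equivariance of the pointwise deformation under unitary maps. -/

section Naturality

variable {T : Type*} [AddCommGroup T] [Module ℝ T]
variable {W : Type*} [NormedAddCommGroup W] [InnerProductSpace ℂ W] [FiniteDimensional ℂ W]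
variable {W' : Type*} [NormedAddCommGroup W'] [InnerProductSpace ℂ W'] [FiniteDimensional ℂ W']

/-- The unitary map `g` intertwines two endomorphisms. -/
def Intertwines (g : W ≃ₗᵢ[ℂ] W') (B : Module.End ℂ W) (B' : Module.End ℂ W') : Prop :=
  ∀ w, B' (g w) = g (B w)

namespace Intertwines

variable {g : W ≃ₗᵢ[ℂ] W'} {B D : Module.End ℂ W} {B' D' : Module.End ℂ W'}

theorem one : Intertwines g 1 1 := fun _ => rfl

theorem add (h : Intertwines g B B') (h' : Intertwines g D D') :
    Intertwines g (B + D) (B' + D') := fun w => by simp [h w, h' w]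

theorem sub (h : Intertwines g B B') (h' : Intertwines g D D') :
    Intertwines g (B - D) (B' - D') := fun w => by simp [h w, h' w]

theorem smul (h : Intertwines g B B') (a : ℂ) : Intertwines g (a • B) (a • B') :=
  fun w => by simp [h w]

theorem mul (h : Intertwines g B B') (h' : Intertwines g D D') :
    Intertwines g (B * D) (B' * D') := fun w => by
  rw [Module.End.mul_apply, h' w, h, Module.End.mul_apply]

theorem star (h : Intertwines g B B') : Intertwines g (star B) (star B') := fun w => by
  refine ext_inner_right ℂ fun w' => ?_
  obtain ⟨v, rfl⟩ := g.surjective w'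
  rw [LinearMap.star_eq_adjoint, LinearMap.adjoint_inner_left, h v, g.inner_map_map,
    g.inner_map_map, LinearMap.star_eq_adjoint, LinearMap.adjoint_inner_left]

end Intertwines

variable {pos : T → T → Prop} {J : T →ₗ[ℝ] T} {nn : T → ℝ}
  {S : T →ₗ[ℝ] Module.End ℂ W} {S' : T →ₗ[ℝ] Module.End ℂ W'} {g : W ≃ₗᵢ[ℂ] W'}

theorem specLow_map_le {Q : Module.End ℂ W} {Q' : Module.End ℂ W'} (h : Intertwines g Q Q') :
    (specLow Q).map g.toLinearEquiv.toLinearMap ≤ specLow Q' := by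
  rw [Submodule.map_le_iff_le_comap]
  refine iSup₂_le fun z hz v hv => ?_
  refine (le_iSup₂ (f := fun (z : ℂ) (_ : z.im < 0) => Q'.maxGenEigenspace z) z hz) ?_
  rw [Module.End.mem_maxGenEigenspace] at hv ⊢
  obtain ⟨k, hk⟩ := hv
  refine ⟨k, ?_⟩
  have hpow : ∀ k : ℕ, Intertwines g ((Q - z • 1) ^ k) ((Q' - z • 1) ^ k) := by
    intro k
    induction k with
    | zero => exact Intertwines.one
    | succ k ih => rw [pow_succ, pow_succ]; exact ih.mul (h.sub (Intertwines.one.smul z))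
  have := hpow k v
  rw [hk, map_zero] at this
  exact this

theorem specHigh_map_le {Q : Module.End ℂ W} {Q' : Module.End ℂ W'} (h : Intertwines g Q Q') :
    (specHigh Q).map g.toLinearEquiv.toLinearMap ≤ specHigh Q' := by
  rw [Submodule.map_le_iff_le_comap]
  refine iSup₂_le fun z hz v hv => ?_
  refine (le_iSup₂ (f := fun (z : ℂ) (_ : 0 < z.im) => Q'.maxGenEigenspace z) z hz) ?_
  rw [Module.End.mem_maxGenEigenspace] at hv ⊢
  obtain ⟨k, hk⟩ := hv
  refine ⟨k, ?_⟩
  have hpow : ∀ k : ℕ, Intertwines g ((Q - z • 1) ^ k) ((Q' - z • 1) ^ k) := by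
    intro k
    induction k with
    | zero => exact Intertwines.one
    | succ k ih => rw [pow_succ, pow_succ]; exact ih.mul (h.sub (Intertwines.one.smul z))
  have := hpow k v
  rw [hk, map_zero] at this
  exact this

variable (hS : IsEllSymb S) (hS' : IsEllSymb S') (C : IsConfPlane pos J nn)
  (h : ∀ ξ, Intertwines g (S ξ) (S' ξ))
include hS hS' C h

omit C in
theorem intertwines_qop {ξ : T} (hξ : ξ ≠ 0) : Intertwines g (qop J S ξ) (qop J S' ξ) := fun w => by
  rw [← sub_eq_zero]
  apply hS'.injective hξ
  rw [map_sub, hS'.apply_qop hξ, h, h, hS.apply_qop hξ, sub_self]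

theorem lowSp_map : lowSp pos S' = (lowSp pos S).map g.toLinearEquiv.toLinearMap := by
  obtain ⟨ξ, hξ⟩ := C.nontriv
  symm
  apply Submodule.eq_of_le_of_finrank_eq
  · rw [hS.lowSp_eq C hξ, hS'.lowSp_eq C hξ]
    exact specLow_map_le (intertwines_qop hS hS' h hξ)
  · have h1 := (hS.two_mul_finrank_low C).1
    have h2 := (hS'.two_mul_finrank_low C).1
    have h3 := LinearEquiv.finrank_map_eq g.toLinearEquiv (lowSp pos S)
    have h4 := g.toLinearEquiv.finrank_eq
    have h5 : Module.finrank ℂ ((lowSp pos S).map g.toLinearEquiv.toLinearMap) =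
      Module.finrank ℂ (lowSp pos S) := h3
    omega

theorem highSp_map : highSp pos S' = (highSp pos S).map g.toLinearEquiv.toLinearMap := by
  obtain ⟨ξ, hξ⟩ := C.nontriv
  symm
  apply Submodule.eq_of_le_of_finrank_eq
  · rw [hS.highSp_eq C hξ, hS'.highSp_eq C hξ]
    exact specHigh_map_le (intertwines_qop hS hS' h hξ)
  · have h1 := (hS.two_mul_finrank_low C).2
    have h2 := (hS'.two_mul_finrank_low C).2
    have h3 := LinearEquiv.finrank_map_eq g.toLinearEquiv (highSp pos S)
    have h4 := g.toLinearEquiv.finrank_eq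
    have h5 : Module.finrank ℂ ((highSp pos S).map g.toLinearEquiv.toLinearMap) =
      Module.finrank ℂ (highSp pos S) := h3
    omega

omit hS hS' C h in
theorem intertwines_orthP (U : Submodule ℂ W) :
    Intertwines g (orthP U) (orthP (U.map g.toLinearEquiv.toLinearMap)) := fun w => by
  have h1 : w = orthP U w + (w - orthP U w) := by abel
  have h2 : g (w - orthP U w) ∈ (U.map g.toLinearEquiv.toLinearMap)ᗮ := by
    rw [Submodule.mem_orthogonal]
    rintro _ ⟨u, hu, rfl⟩
    change inner ℂ (g u) _ = 0
    rw [g.inner_map_map]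
    exact (Submodule.mem_orthogonal _ _).1 (sub_orthP_mem U w) u hu
  conv_lhs => rw [h1, map_add, map_add, orthP_of_mem_orthogonal h2, add_zero]
  exact orthP_of_mem ⟨_, orthP_mem U w, rfl⟩

theorem intertwines_lowP : Intertwines g (lowP pos S) (lowP pos S') := by
  rw [lowP, lowP, lowSp_map hS hS' C h]
  exact intertwines_orthP _

theorem intertwines_deform {ξ₀ : T} (h0 : ξ₀ ≠ 0) (s : ℝ) (ξ : T) :
    Intertwines g (deform pos J nn S ξ₀ s ξ) (deform pos J nn S' ξ₀ s ξ) := by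
  have hP := intertwines_lowP hS hS' C h
  have hP' := (Intertwines.one (g := g)).sub hP
  have hN : ∀ ξ, Intertwines g (partN pos J S ξ) (partN pos J S' ξ) := fun ξ =>
    ((hP'.mul ((h ξ).add ((h (J ξ)).smul Complex.I))).mul hP).smul _
  have hM : ∀ ξ, Intertwines g (partM pos J S ξ) (partM pos J S' ξ) := fun ξ =>
    ((hP'.mul ((h ξ).sub ((h (J ξ)).smul Complex.I))).mul hP).smul _
  have hB : Intertwines g (normOp pos J nn S ξ₀) (normOp pos J nn S' ξ₀) :=
    (((hN ξ₀).star.mul (hN ξ₀)).smul _).add hP'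
  have hR : Intertwines g (invSqrt (normOp pos J nn S ξ₀)) (invSqrt (normOp pos J nn S' ξ₀)) :=
    invSqrt_conj g hB (normOp_isPositive ξ₀) (normOp_isUnit hS C h0)
  have hF : Intertwines g (normFactor pos J nn S ξ₀ s) (normFactor pos J nn S' ξ₀ s) :=
    (Intertwines.one.smul _).add (hR.smul _)
  have hH : Intertwines g (halfSymb pos J nn S ξ₀ s ξ) (halfSymb pos J nn S' ξ₀ s ξ) :=
    ((hM ξ).smul _).add ((hN ξ).mul hF)
  exact (((hP'.mul (h ξ)).mul hP').smul _).add (hH.add hH.star)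

end Naturality

/-! ### Smooth dependence of integrals on a parameter. -/

section ParametricIntegral

open Set

variable {P F : Type*} [NormedAddCommGroup P] [NormedSpace ℝ P] [NormedAddCommGroup F]
  [NormedSpace ℝ F] [CompleteSpace F]

/-- The integral is the value at 0 of the convolution of the indicator of (0, b] with the reflected
integrand, cut off to have compact support; smoothness is then that of convolutions with a
parameter. -/
theorem contDiffOn_intervalIntegral {G : P → ℝ → F} {U : Set P} (hU : IsOpen U)
    (hG : ContDiffOn ℝ ∞ (fun q : P × ℝ => G q.1 q.2) (U ×ˢ univ)) {b : ℝ} (hb : 0 ≤ b) :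
    ContDiffOn ℝ ∞ (fun p => ∫ φ in (0 : ℝ)..b, G p φ) U := by
  -- Equal to 1 on the ball of radius b + 1, so the cut-off is invisible on (0, b].
  let χ : ContDiffBump (0 : ℝ) := ⟨b + 1, b + 2, by linarith, by linarith⟩
  have h1 := contDiffOn_convolution_right_with_param (𝕜 := ℝ) (n := ⊤) (μ := volume)
    (f := (Ioc 0 b).indicator (fun _ => (1 : ℝ))) (ContinuousLinearMap.lsmul ℝ ℝ : ℝ →L[ℝ] F →L[ℝ] F)
    (g := fun p u => χ (-u) • G p (-u)) (s := U) (k := Metric.closedBall 0 (b + 2)) hU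
    (isCompact_closedBall _ _)
    (by
      intro p x _ hx
      have : χ (-x) = 0 := by
        apply χ.zero_of_le_dist
        simp only [Metric.mem_closedBall, not_le] at hx
        simpa using hx.le
      rw [this, zero_smul])
    (by
      apply Integrable.locallyIntegrable
      rw [integrable_indicator_iff measurableSet_Ioc]
      simp)
    (by
      have e : ContDiff ℝ ∞ (fun q : P × ℝ => (q.1, -q.2)) := contDiff_fst.prodMk contDiff_snd.neg
      have h2 : ContDiffOn ℝ ∞ (fun q : P × ℝ => G q.1 (-q.2)) (U ×ˢ univ) :=
        hG.comp e.contDiffOn (fun q hq => ⟨hq.1, mem_univ _⟩)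
      exact ((χ.contDiff.comp contDiff_snd.neg).contDiffOn).smul h2)
  have h2 : ContDiffOn ℝ ∞ (fun p : P => ((p, (0 : ℝ)) : P × ℝ)) U :=
    (contDiff_id.prodMk contDiff_const).contDiffOn
  have h3 := h1.comp h2 (fun p hp => ⟨hp, mem_univ _⟩)
  refine h3.congr fun p _ => ?_
  simp only [Function.comp, convolution_def]
  rw [intervalIntegral.integral_of_le hb, ← integral_indicator measurableSet_Ioc]
  congr 1
  ext t
  by_cases ht : t ∈ Ioc 0 b
  · have : χ t = 1 := by
      apply χ.one_of_mem_closedBall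
      rw [Metric.mem_closedBall, Real.dist_eq, sub_zero, abs_of_pos ht.1]
      change t ≤ b + 1
      linarith [ht.2]
    simp [ht, this]
  · simp [ht]

end ParametricIntegral

/-! ### Spectral projections and inverse square roots as circle integrals. -/

section SpectralIntegral

open Set Real

variable {𝒜 : Type*} [NormedRing 𝒜] [NormedAlgebra ℝ 𝒜] [CompleteSpace 𝒜]

/-- The circle `cos φ + sin φ Q` of operators. -/
def circ (Q : 𝒜) (φ : ℝ) : 𝒜 := cos φ • 1 + sin φ • Q

/-- The integral `∫ (cos φ + sin φ Q)⁻¹ (- sin φ + cos φ Q) dφ` over the circle. -/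
def circInt (Q : 𝒜) : 𝒜 :=
  ∫ φ in (0 : ℝ)..(2 * π), Ring.inverse (circ Q φ) * ((-sin φ) • 1 + cos φ • Q)

/-- The integral `∫ (cos² φ + sin² φ B)⁻¹ dφ` over the circle. -/
def circInt₂ (B : 𝒜) : 𝒜 :=
  ∫ φ in (0 : ℝ)..(2 * π), Ring.inverse ((cos φ ^ 2) • 1 + (sin φ ^ 2) • B)

/-- Periodicity reduces the condition to a compact interval of angles, where it is open by
compactness. -/
theorem isOpen_forall_isUnit {P : Type*} [TopologicalSpace P] {c : P → ℝ → 𝒜}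
    (hc : Continuous fun q : P × ℝ => c q.1 q.2) (hper : ∀ p, Function.Periodic (c p) (2 * π)) :
    IsOpen {p | ∀ φ, IsUnit (c p φ)} := by
  rw [isOpen_iff_mem_nhds]
  intro p hp
  have h1 : ∀ᶠ q in 𝓝 p, ∀ φ ∈ Icc 0 (2 * π), IsUnit (c q φ) := by
    apply isCompact_Icc.eventually_forall_of_forall_eventually
    intro φ _
    exact hc.continuousAt.eventually_mem (Units.isOpen.mem_nhds (show c p φ ∈ {x | IsUnit x} from hp φ))
  filter_upwards [h1] with q hq φ
  obtain ⟨y, hy, hyφ⟩ := (hper q).exists_mem_Ico₀ (by positivity) φ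
  rw [hyφ]
  exact hq y ⟨hy.1, hy.2.le⟩

theorem continuous_circ : Continuous fun q : 𝒜 × ℝ => circ q.1 q.2 := by
  unfold circ
  fun_prop

theorem periodic_circ (Q : 𝒜) : Function.Periodic (circ Q) (2 * π) := by
  intro φ
  simp [circ]

theorem isOpen_circ : IsOpen {Q : 𝒜 | ∀ φ, IsUnit (circ Q φ)} :=
  isOpen_forall_isUnit continuous_circ periodic_circ

theorem isOpen_circ₂ :
    IsOpen {B : 𝒜 | ∀ φ : ℝ, IsUnit ((cos φ ^ 2) • (1 : 𝒜) + (sin φ ^ 2) • B)} :=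
  isOpen_forall_isUnit (c := fun B φ => (cos φ ^ 2) • (1 : 𝒜) + (sin φ ^ 2) • B) (by fun_prop)
    (fun B φ => by simp)

theorem contDiffOn_circInt : ContDiffOn ℝ ∞ (circInt : 𝒜 → 𝒜) {Q | ∀ φ, IsUnit (circ Q φ)} := by
  refine contDiffOn_intervalIntegral isOpen_circ ?_ (by positivity)
  have hc : ContDiff ℝ ∞ (fun q : 𝒜 × ℝ => cos q.2) := contDiff_cos.comp contDiff_snd
  have hs : ContDiff ℝ ∞ (fun q : 𝒜 × ℝ => sin q.2) := contDiff_sin.comp contDiff_snd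
  have h1 : ContDiff ℝ ∞ (fun q : 𝒜 × ℝ => circ q.1 q.2) :=
    (hc.smul contDiff_const).add (hs.smul contDiff_fst)
  have h2 : ContDiff ℝ ∞ (fun q : 𝒜 × ℝ => (-sin q.2) • (1 : 𝒜) + cos q.2 • q.1) :=
    (hs.neg.smul contDiff_const).add (hc.smul contDiff_fst)
  refine ContDiffOn.mul ?_ h2.contDiffOn
  intro q hq
  obtain ⟨u, hu⟩ := hq.1 q.2
  have h3 := contDiffAt_ringInverse ℝ (n := ∞) u
  rw [hu] at h3
  exact (h3.comp q h1.contDiffAt).contDiffWithinAt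

theorem contDiffOn_circInt₂ : ContDiffOn ℝ ∞ (circInt₂ : 𝒜 → 𝒜)
    {B : 𝒜 | ∀ φ : ℝ, IsUnit ((cos φ ^ 2) • (1 : 𝒜) + (sin φ ^ 2) • B)} := by
  refine contDiffOn_intervalIntegral isOpen_circ₂ ?_ (by positivity)
  have hc : ContDiff ℝ ∞ (fun q : 𝒜 × ℝ => cos q.2) := contDiff_cos.comp contDiff_snd
  have hs : ContDiff ℝ ∞ (fun q : 𝒜 × ℝ => sin q.2) := contDiff_sin.comp contDiff_snd
  have h1 : ContDiff ℝ ∞ (fun q : 𝒜 × ℝ => (cos q.2 ^ 2) • (1 : 𝒜) + (sin q.2 ^ 2) • q.1) :=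
    ((hc.pow 2).smul contDiff_const).add ((hs.pow 2).smul contDiff_fst)
  intro q hq
  obtain ⟨u, hu⟩ := hq.1 q.2
  have h3 := contDiffAt_ringInverse ℝ (n := ∞) u
  rw [hu] at h3
  exact (h3.comp q h1.contDiffAt).contDiffWithinAt

set_option synthInstance.maxHeartbeats 200000 in
theorem hasDerivAt_ringInverse_comp {c : ℝ → 𝒜} {c' : 𝒜} {t : ℝ} (h : HasDerivAt c c' t)
    (hu : IsUnit (c t)) : HasDerivAt (fun t => Ring.inverse (c t))
      (-(Ring.inverse (c t) * c' * Ring.inverse (c t))) t := by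
  obtain ⟨u, hu⟩ := hu
  have h1 := hasFDerivAt_ringInverse (𝕜 := ℝ) u
  rw [hu] at h1
  have h2 := h1.comp_hasDerivAt t h
  rw [← hu, Ring.inverse_unit]
  exact h2.congr_deriv (by simp)

/-- Along Q + tH with H commuting with Q, the t-derivative of the integrand is c⁻²H, where c is the
circle of operators. This is also the φ-derivative of sin φ · c⁻¹H, which vanishes at both ends, so
the integral does not depend on t. -/
theorem circInt_homotopy {Q H : 𝒜} (hc : Commute Q H)
    (hu : ∀ t ∈ Icc (0 : ℝ) 1, ∀ φ, IsUnit (circ (Q + t • H) φ)) :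
    circInt Q = circInt (Q + H) := by
  let q : ℝ → 𝒜 := fun t => Q + t • H
  let g : ℝ → ℝ → 𝒜 := fun t φ => Ring.inverse (circ (q t) φ) * ((-sin φ) • 1 + cos φ • q t)
  -- The common value of the two derivatives.
  let D : ℝ → ℝ → 𝒜 := fun t φ => Ring.inverse (circ (q t) φ) * Ring.inverse (circ (q t) φ) * H
  have hq : ∀ t, Commute (q t) H := fun t => hc.add_left ((Commute.refl H).smul_left t)
  have hcircH : ∀ t φ, Commute (circ (q t) φ) H := fun t φ =>
    ((Commute.one_left H).smul_left _).add_left ((hq t).smul_left _)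
  have hcircq : ∀ t φ, Commute (circ (q t) φ) (q t) := fun t φ =>
    ((Commute.one_left _).smul_left _).add_left ((Commute.refl _).smul_left _)
  have hqc : Continuous q := by fun_prop
  have hcont : ContinuousOn (fun p : ℝ × ℝ => circ (q p.1) p.2) (Icc 0 1 ×ˢ univ) :=
    (continuous_circ.comp ((hqc.comp continuous_fst).prodMk continuous_snd)).continuousOn
  have hinv : ContinuousOn (fun p : ℝ × ℝ => Ring.inverse (circ (q p.1) p.2))
      (Icc 0 1 ×ˢ univ) := by
    intro p hp
    obtain ⟨u, hu⟩ := hu p.1 hp.1 p.2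
    have h3 := (contDiffAt_ringInverse ℝ (n := 0) u).continuousAt
    rw [hu] at h3
    exact ContinuousAt.comp_continuousWithinAt (f := fun p : ℝ × ℝ => circ (q p.1) p.2) h3
      (hcont p hp)
  have hDcont : ContinuousOn (fun p : ℝ × ℝ => D p.1 p.2) (Icc 0 1 ×ˢ univ) :=
    (hinv.mul hinv).mul continuousOn_const
  have hgcont : ContinuousOn (fun p : ℝ × ℝ => g p.1 p.2) (Icc 0 1 ×ˢ univ) := by
    refine hinv.mul (Continuous.continuousOn ?_)
    fun_prop
  have hslice : ∀ {f : ℝ → ℝ → 𝒜}, ContinuousOn (fun p : ℝ × ℝ => f p.1 p.2) (Icc 0 1 ×ˢ univ) →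
      ∀ t ∈ Icc (0 : ℝ) 1, Continuous (f t) := by
    intro f hf t ht
    have := hf.comp (f := fun φ : ℝ => (t, φ)) (s := univ) (by fun_prop)
      (fun φ _ => ⟨ht, mem_univ _⟩)
    exact continuousOn_univ.1 this
  have hslice' : ∀ {f : ℝ → ℝ → 𝒜}, ContinuousOn (fun p : ℝ × ℝ => f p.1 p.2) (Icc 0 1 ×ˢ univ) →
      ∀ φ, ContinuousOn (fun t => f t φ) (Icc 0 1) := by
    intro f hf φ
    exact hf.comp (f := fun t : ℝ => (t, φ)) (by fun_prop) (fun t ht => ⟨ht, mem_univ _⟩)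
  -- With c' the φ-derivative of c, this is cos φ · c - sin φ · c' = 1; it turns both derivatives
  -- into c⁻²H.
  have key : ∀ t φ, cos φ • circ (q t) φ - sin φ • ((-sin φ) • 1 + cos φ • q t) = 1 := by
    intro t φ
    have h1 : cos φ • circ (q t) φ - sin φ • ((-sin φ) • 1 + cos φ • q t) =
        (cos φ ^ 2 + sin φ ^ 2) • (1 : 𝒜) := by
      unfold circ
      module
    rw [h1, cos_sq_add_sin_sq, one_smul]
  have hcircd : ∀ t φ, Commute (circ (q t) φ) ((-sin φ) • 1 + cos φ • q t) := fun t φ =>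
    ((Commute.one_right _).smul_right _).add_right ((hcircq t φ).smul_right _)
  have hinvc : ∀ {t φ} {x : 𝒜}, IsUnit (circ (q t) φ) → Commute (circ (q t) φ) x →
      Commute (Ring.inverse (circ (q t) φ)) x := fun hu hx => by
    obtain ⟨u, hu⟩ := hu
    rw [← hu, Ring.inverse_unit]
    rw [← hu] at hx
    exact hx.units_inv_left
  have hder1 : ∀ t ∈ Icc (0 : ℝ) 1, ∀ φ, HasDerivAt
      (fun φ => sin φ • (Ring.inverse (circ (q t) φ) * H)) (D t φ) φ := by
    intro t ht φ
    have hunit := hu t ht φ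
    have h1 : HasDerivAt (circ (q t)) ((-sin φ) • 1 + cos φ • q t) φ :=
      ((hasDerivAt_cos φ).smul_const (1 : 𝒜)).add ((hasDerivAt_sin φ).smul_const (q t))
    have h2 := (hasDerivAt_ringInverse_comp h1 hunit).mul_const H
    have h3 := (hasDerivAt_sin φ).smul h2
    refine h3.congr_deriv ?_
    set i := Ring.inverse (circ (q t) φ) with hi
    set d := (-sin φ) • (1 : 𝒜) + cos φ • q t with hd
    have hic : i * circ (q t) φ = 1 := Ring.inverse_mul_cancel _ hunit
    have hid : i * d = d * i := (hinvc hunit (hcircd t φ)).eq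
    calc sin φ • (-(i * d * i) * H) + cos φ • (i * H)
        = i * (cos φ • (i * circ (q t) φ)  - sin φ • (d * i)) * H := by
          rw [hic]
          simp only [mul_sub, sub_mul, mul_smul_comm, smul_mul_assoc, mul_one, neg_mul, smul_neg,
            mul_assoc]
          abel
      _ = i * (i * (cos φ • circ (q t) φ  - sin φ • d)) * H := by
          rw [← hid]
          simp only [mul_sub, mul_smul_comm]
      _ = D t φ := by rw [key, mul_one]
  have hder2 : ∀ t ∈ Icc (0 : ℝ) 1, ∀ φ, HasDerivAt (fun t => g t φ) (D t φ) t := by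
    intro t ht φ
    have hunit := hu t ht φ
    have hq' : HasDerivAt q H t := by
      exact (((hasDerivAt_id t).smul_const H).const_add Q).congr_deriv (one_smul ℝ H)
    have h1 : HasDerivAt (fun t => circ (q t) φ) (sin φ • H) t := by
      have := (hq'.const_smul (sin φ)).const_add (cos φ • (1 : 𝒜))
      exact this
    have h2 : HasDerivAt (fun t => (-sin φ) • (1 : 𝒜) + cos φ • q t) (cos φ • H) t :=
      (hq'.const_smul (cos φ)).const_add _
    have h3 := (hasDerivAt_ringInverse_comp h1 hunit).mul h2
    refine h3.congr_deriv ?_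
    set i := Ring.inverse (circ (q t) φ) with hi
    set d := (-sin φ) • (1 : 𝒜) + cos φ • q t with hd
    have hic : i * circ (q t) φ = 1 := Ring.inverse_mul_cancel _ hunit
    have hHd : Commute H d := ((Commute.one_right H).smul_right _).add_right
      ((hq t).symm.smul_right _)
    have hiH : i * H = H * i := (hinvc hunit (hcircH t φ)).eq
    calc -(i * (sin φ • H) * i) * d + i * (cos φ • H)
        = i * (cos φ • (i * circ (q t) φ) - sin φ • (i * d)) * H := by
          have e1 : i * H * i * d = i * (i * d) * H := by
            rw [mul_assoc i H i, ← hiH, mul_assoc, mul_assoc, hHd.eq, mul_assoc, mul_assoc]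
          rw [hic]
          simp only [mul_sub, sub_mul, mul_smul_comm, smul_mul_assoc, mul_one, neg_mul, e1]
          abel
      _ = i * (i * (cos φ • circ (q t) φ - sin φ • d)) * H := by
          simp only [mul_sub, mul_smul_comm]
      _ = D t φ := by rw [key, mul_one]
  have h01 : Icc (0 : ℝ) 1 = uIcc 0 1 := (uIcc_of_le zero_le_one).symm
  have hint : ∀ φ, ∫ t in (0 : ℝ)..1, D t φ = g 1 φ - g 0 φ := fun φ =>
    intervalIntegral.integral_eq_sub_of_hasDerivAt (fun t ht => hder2 t (h01 ▸ ht) φ)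
      ((hslice' hDcont φ).intervalIntegrable_of_Icc zero_le_one)
  have hzero : ∀ t ∈ Icc (0 : ℝ) 1, ∫ φ in (0 : ℝ)..(2 * π), D t φ = 0 := by
    intro t ht
    rw [intervalIntegral.integral_eq_sub_of_hasDerivAt (fun φ _ => hder1 t ht φ)
      ((hslice hDcont t ht).intervalIntegrable _ _)]
    simp
  -- By Fubini the change of the integral from t = 0 to t = 1 is the t-integral of quantities that
  -- vanish for each t.
  have hswap : ∫ φ in (0 : ℝ)..(2 * π), ∫ t in (0 : ℝ)..1, D t φ =
      ∫ t in (0 : ℝ)..1, ∫ φ in (0 : ℝ)..(2 * π), D t φ := by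
    simp only [intervalIntegral.integral_of_le zero_le_one,
      intervalIntegral.integral_of_le (show (0 : ℝ) ≤ 2 * π by positivity)]
    apply integral_integral_swap
    rw [Measure.prod_restrict]
    have h1 : IntegrableOn (fun p : ℝ × ℝ => D p.2 p.1) (Icc 0 (2 * π) ×ˢ Icc 0 1)
        (volume.prod volume) := by
      apply ContinuousOn.integrableOn_compact (isCompact_Icc.prod isCompact_Icc)
      exact hDcont.comp (f := fun p : ℝ × ℝ => (p.2, p.1)) (by fun_prop)
        (fun p hp => ⟨hp.2, mem_univ _⟩)
    exact h1.mono_set (prod_mono Ioc_subset_Icc_self Ioc_subset_Icc_self)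
  have hfin : ∫ φ in (0 : ℝ)..(2 * π), (g 1 φ - g 0 φ) = 0 := by
    simp_rw [← hint]
    rw [hswap]
    rw [intervalIntegral.integral_congr (g := fun _ => (0 : 𝒜)) (fun t ht => hzero t (h01 ▸ ht))]
    simp
  rw [intervalIntegral.integral_sub ((hslice hgcont 1 (by simp)).intervalIntegrable _ _)
    ((hslice hgcont 0 (by simp)).intervalIntegrable _ _), sub_eq_zero] at hfin
  have e0 : q 0 = Q := by simp [q]
  have e1 : q 1 = Q + H := by simp [q]
  simp only [g, e0, e1] at hfin
  exact hfin.symm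

section Comparison

variable {W : Type*} [NormedAddCommGroup W] [InnerProductSpace ℂ W] [FiniteDimensional ℂ W]
  {ℬ : Type*} [NormedRing ℬ] [NormedAlgebra ℂ ℬ] [CompleteSpace ℬ]
  (Ψ : Module.End ℂ W ≃ₐ[ℂ] ℬ)

theorem isUnit_circ_of_no_real {Q : Module.End ℂ W}
    (h : ∀ (r : ℝ) (w : W), Q w = (r : ℂ) • w → w = 0) (φ : ℝ) : IsUnit (circ (Ψ Q) φ) := by
  have e : circ (Ψ Q) φ = Ψ ((cos φ : ℂ) • 1 + (sin φ : ℂ) • Q) := by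
    simp only [circ, map_add, map_smul, map_one]
    rfl
  rw [e]
  refine IsUnit.map Ψ ((LinearMap.isUnit_iff_ker_eq_bot _).2 ?_)
  rw [LinearMap.ker_eq_bot']
  intro w hw
  have hw' : (cos φ : ℂ) • w + (sin φ : ℂ) • Q w = 0 := by simpa using hw
  by_cases hs : sin φ = 0
  · have hc : cos φ ≠ 0 := by
      intro hc
      have := cos_sq_add_sin_sq φ
      rw [hc, hs] at this
      norm_num at this
    rw [hs] at hw'
    simpa [← Complex.ofReal_cos, hc] using hw'
  · apply h (-(cos φ) / sin φ)
    have hs' : (sin φ : ℂ) ≠ 0 := by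
      exact_mod_cast hs
    have h2 : (sin φ : ℂ) • Q w = -((cos φ : ℂ) • w) := by
      rw [eq_neg_iff_add_eq_zero, add_comm]; exact hw'
    rw [← inv_smul_smul₀ hs' (Q w), h2, ← neg_smul, smul_smul]
    congr 1
    push_cast
    field_simp

/-- Q is joined linearly to i(2p - 1) through operators commuting with it. On the range of p the
eigenvalues stay in the upper half-plane and on its kernel in the lower one, so no real eigenvalue
appears and the integral is constant. For i(2p - 1) the integrand itself is the constant i(2p - 1).
-/
theorem circInt_spectral {Q p : Module.End ℂ W} (hp : p * p = p) (hc : Commute p Q)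
    (h1 : ∀ (z : ℂ) (w : W), p w = w → Q w = z • w → w ≠ 0 → 0 < z.im)
    (h2 : ∀ (z : ℂ) (w : W), p w = 0 → Q w = z • w → w ≠ 0 → z.im < 0) :
    (∀ φ, IsUnit (circ (Ψ Q) φ)) ∧
      circInt (Ψ Q) = (2 * π * Complex.I : ℂ) • Ψ (2 * p - 1) := by
  have hpp : ∀ w, p (p w) = p w := fun w => LinearMap.congr_fun hp w
  have hpQ : ∀ w, p (Q w) = Q (p w) := fun w => LinearMap.congr_fun hc w
  set U : Module.End ℂ W := 2 * p - 1 with hU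
  have hUU : U * U = 1 := by
    have : U * U = 4 * (p * p) - 4 * p + 1 := by rw [hU]; noncomm_ring
    rw [this, hp]; noncomm_ring
  have hUc : Commute U Q := by
    have : Commute (2 * p) Q := (Nat.cast_commute 2 Q).mul_left hc
    exact this.sub_left (Commute.one_left _)
  let H : Module.End ℂ W := Complex.I • U - Q
  have hun : ∀ t ∈ Icc (0 : ℝ) 1, ∀ φ, IsUnit (circ (Ψ Q + t • Ψ H) φ) := by
    intro t ht φ
    have e : Ψ Q + t • Ψ H = Ψ (Q + (t : ℂ) • H) := by
      rw [map_add, map_smul]; rfl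
    rw [e]
    apply isUnit_circ_of_no_real
    intro r w hw
    have hw' : Q w + (t : ℂ) • (Complex.I • (2 • p w - w) - Q w) = (r : ℂ) • w := by
      have : U w = 2 • p w - w := by
        simp [hU, two_mul, two_smul]
      simpa [H, this] using hw
    have a1 : p w = 0 := by
      -- If the component pw is non-zero, it is an eigenvector of Q with eigenvalue (r - ti)/(1 -
      -- t), whose imaginary part is not positive.
      by_contra hne
      have h3 := congrArg p hw'
      simp only [map_add, map_smul, map_sub, hpp, hpQ, map_nsmul] at h3
      have h4 : ((1 - t : ℝ) : ℂ) • Q (p w) = ((r : ℂ) - t * Complex.I) • p w := by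
        have h5 : ((1 - t : ℝ) : ℂ) • Q (p w) =
          (Q (p w) + (t : ℂ) • (Complex.I • (2 • p w - p w) - Q (p w))) -
            ((t : ℂ) * Complex.I) • p w := by
          push_cast
          module
        rw [h5, h3]
        module
      rcases eq_or_lt_of_le ht.2 with ht1 | ht1
      · subst ht1
        simp only [sub_self, Complex.ofReal_zero, zero_smul] at h4
        rcases smul_eq_zero.1 h4.symm with h6 | h6
        · have := congrArg Complex.im h6
          simp at this
        · exact hne h6
      · have ht0 : (0 : ℝ) < 1 - t := by linarith
        have ht' : ((1 - t : ℝ) : ℂ) ≠ 0 := by exact_mod_cast ht0.ne'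
        have h6 : Q (p w) = ((((1 - t)⁻¹ : ℝ) : ℂ) * ((r : ℂ) - t * Complex.I)) • p w := by
          rw [← smul_smul, ← h4, smul_smul, Complex.ofReal_inv, inv_mul_cancel₀ ht', one_smul]
        have h7 := h1 _ _ (hpp w) h6 hne
        rw [Complex.im_ofReal_mul] at h7
        have : 0 ≤ (1 - t)⁻¹ * t := mul_nonneg (by positivity) ht.1
        simp at h7
        linarith
    have a2 : w = 0 := by
      by_contra hne
      rw [a1] at hw'
      have h4 : ((1 - t : ℝ) : ℂ) • Q w = ((r : ℂ) + t * Complex.I) • w := by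
        have h5 : ((1 - t : ℝ) : ℂ) • Q w =
          (Q w + (t : ℂ) • (Complex.I • (2 • (0 : W) - w) - Q w)) +
            ((t : ℂ) * Complex.I) • w := by
          push_cast
          module
        rw [h5, hw']
        module
      rcases eq_or_lt_of_le ht.2 with ht1 | ht1
      · subst ht1
        simp only [sub_self, Complex.ofReal_zero, zero_smul] at h4
        rcases smul_eq_zero.1 h4.symm with h6 | h6
        · have := congrArg Complex.im h6
          simp at this
        · exact hne h6
      · have ht0 : (0 : ℝ) < 1 - t := by linarith
        have ht' : ((1 - t : ℝ) : ℂ) ≠ 0 := by exact_mod_cast ht0.ne'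
        have h6 : Q w = ((((1 - t)⁻¹ : ℝ) : ℂ) * ((r : ℂ) + t * Complex.I)) • w := by
          rw [← smul_smul, ← h4, smul_smul, Complex.ofReal_inv, inv_mul_cancel₀ ht', one_smul]
        have h7 := h2 _ _ a1 h6 hne
        rw [Complex.im_ofReal_mul] at h7
        have : 0 ≤ (1 - t)⁻¹ * t := mul_nonneg (by positivity) ht.1
        simp at h7
        linarith
    exact a2
  refine ⟨fun φ => by simpa using hun 0 (by simp) φ, ?_⟩
  have hcom : Commute (Ψ Q) (Ψ H) :=
    Commute.map ((hUc.symm.smul_right _).sub_right (Commute.refl Q)) Ψ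
  rw [circInt_homotopy hcom hun, ← map_add]
  have e : Q + H = Complex.I • U := by simp [H]
  rw [e]
  have hcv : ∀ φ : ℝ, Ring.inverse (circ (Ψ (Complex.I • U)) φ) *
      ((-sin φ) • 1 + cos φ • Ψ (Complex.I • U)) = Complex.I • Ψ U := by
    intro φ
    have hinv : IsUnit (circ (Ψ (Complex.I • U)) φ) := by
      have := hun 1 (by simp) φ
      rwa [one_smul, ← map_add, e] at this
    -- Because (iU)² = -1, multiplying cos φ + sin φ · iU by iU differentiates it in φ.
    have h5 : circ (Ψ (Complex.I • U)) φ * (Complex.I • Ψ U) =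
        ((-sin φ) • 1 + cos φ • Ψ (Complex.I • U)) := by
      have h6 : Ψ U * Ψ U = 1 := by rw [← map_mul, hUU, map_one]
      have r1 : ∀ (r : ℝ) (x : ℬ), r • x = (r : ℂ) • x := fun r x => rfl
      simp only [circ, r1, add_mul, map_smul, smul_mul_assoc, one_mul, mul_smul_comm, h6, smul_smul]
      match_scalars
      · ring
      · push_cast; linear_combination Complex.sin φ * Complex.I_sq
    rw [← h5, ← mul_assoc, Ring.inverse_mul_cancel _ hinv, one_mul]
  unfold circInt
  simp_rw [hcv]
  have r1 : ∀ (r : ℝ) (x : ℬ), r • x = (r : ℂ) • x := fun r x => rfl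
  rw [intervalIntegral.integral_const, sub_zero, r1, smul_smul]
  push_cast
  rfl

/-- With D = B^(1/2), cos² φ + sin² φ B = (cos φ + i sin φ D)(cos φ - i sin φ D). By partial
fractions, 2iD times its inverse is the difference of the integrands of `circInt` for iD and -iD,
whose integrals are 2πi and -2πi. -/
theorem isUnit_circ₂_and_circInt₂ {B : Module.End ℂ W} (hB : B.IsPositive) (hu : IsUnit B) :
    (∀ φ : ℝ, IsUnit ((cos φ ^ 2) • (1 : ℬ) + (sin φ ^ 2) • Ψ B)) ∧
      circInt₂ (Ψ B) = (2 * π : ℂ) • Ψ (invSqrt B) := by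
  obtain ⟨hR, hRB⟩ := invSqrt_spec hB hu
  set R := invSqrt B
  have hRu : IsUnit R := IsUnit.of_mul_eq_one _ (by rw [← mul_assoc]; exact hRB)
  set D := Ring.inverse R with hD
  have hDR : D * R = 1 := Ring.inverse_mul_cancel _ hRu
  have hRD : R * D = 1 := Ring.mul_inverse_cancel _ hRu
  have hDD : D * D = B := by
    calc D * D = D * D * (R * R * B) := by rw [hRB, mul_one]
      _ = D * (D * R) * R * B := by noncomm_ring
      _ = B := by rw [hDR, mul_one, hDR, one_mul]
  have hpos : ∀ (z : ℂ) (w : W), D w = z • w → w ≠ 0 → 0 < z.re := by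
    intro z w hw hne
    have h1 : w = z • R w := by
      rw [← map_smul, ← hw]
      exact (LinearMap.congr_fun hRD w).symm
    have h2 : inner ℂ w w = z * inner ℂ w (R w) := by
      conv_lhs => rw [h1]
      rw [← inner_smul_right, ← h1]
    have h3 : (inner ℂ w (R w)).im = 0 := by
      have := hR.isSymmetric.im_inner_apply_self w
      rw [← inner_conj_symm, Complex.conj_im]
      exact neg_eq_zero.2 this
    have h4 : 0 ≤ (inner ℂ w (R w)).re := by
      rw [← inner_conj_symm, Complex.conj_re]
      exact hR.re_inner_nonneg_left w
    have h5 := congrArg Complex.re h2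
    rw [Complex.mul_re, h3, mul_zero, sub_zero, inner_self_eq_norm_sq_to_K] at h5
    have h6 : 0 < z.re * (inner ℂ w (R w)).re := by
      rw [← h5]
      have h7 : 0 < ‖w‖ ^ 2 := pow_pos (norm_pos_iff.2 hne) 2
      exact_mod_cast h7
    exact pos_of_mul_pos_left h6 h4
  -- D has positive eigenvalues, so all the spectrum of iD lies in the upper half-plane (p = 1) and
  -- all that of -iD in the lower one (p = 0).
  have k1 := circInt_spectral Ψ (Q := Complex.I • D) (p := 1) (by simp) (Commute.one_left _)
    (fun z w _ h hw => by
      have := hpos (-Complex.I * z) w (by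
        rw [mul_smul, ← h]
        simp [smul_smul]) hw
      simpa using this)
    (fun z w h _ hw => absurd h hw)
  have k2 := circInt_spectral Ψ (Q := (-Complex.I) • D) (p := 0) (by simp) (Commute.zero_left _)
    (fun z w h _ hw => absurd h.symm hw)
    (fun z w _ h hw => by
      have := hpos (Complex.I * z) w (by
        rw [mul_smul, ← h]
        simp [smul_smul]) hw
      simp at this
      exact this)
  have hfac : ∀ φ : ℝ, (cos φ ^ 2) • (1 : ℬ) + (sin φ ^ 2) • Ψ B =
      circ (Ψ (Complex.I • D)) φ * circ (Ψ ((-Complex.I) • D)) φ := by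
    intro φ
    rw [← hDD]
    have r1 : ∀ (r : ℝ) (x : ℬ), r • x = (r : ℂ) • x := fun r x => rfl
    simp only [circ, r1, map_smul, map_mul, mul_add, add_mul, smul_mul_assoc, mul_smul_comm,
      one_mul, mul_one, smul_smul]
    match_scalars
    · push_cast; ring
    · push_cast; linear_combination Complex.sin φ ^ 2 * Complex.I_sq
    · ring
  have hun : ∀ φ : ℝ, IsUnit ((cos φ ^ 2) • (1 : ℬ) + (sin φ ^ 2) • Ψ B) := fun φ => by
    rw [hfac]; exact (k1.1 φ).mul (k2.1 φ)
  refine ⟨hun, ?_⟩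
  have hI : ∀ φ : ℝ, Ring.inverse (circ (Ψ (Complex.I • D)) φ) *
        ((-sin φ) • 1 + cos φ • Ψ (Complex.I • D)) -
      Ring.inverse (circ (Ψ ((-Complex.I) • D)) φ) *
        ((-sin φ) • 1 + cos φ • Ψ ((-Complex.I) • D)) =
      Ring.inverse ((cos φ ^ 2) • (1 : ℬ) + (sin φ ^ 2) • Ψ B) * ((2 * Complex.I) • Ψ D) := by
    intro φ
    have c1 : Commute (circ (Ψ (Complex.I • D)) φ) (circ (Ψ ((-Complex.I) • D)) φ) := by
      have : Commute (Ψ (Complex.I • D)) (Ψ ((-Complex.I) • D)) :=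
        Commute.map (((Commute.refl D).smul_left _).smul_right _) Ψ
      exact ((Commute.one_left _).smul_left _).add_left
        ((((Commute.one_right _).smul_right _).add_right (this.smul_right _)).smul_left _)
    have e1 := Ring.inverse_mul_cancel _ (k1.1 φ)
    have e2 := Ring.inverse_mul_cancel _ (k2.1 φ)
    have e3 := Ring.inverse_mul_cancel _ (hun φ)
    rw [hfac] at e3 ⊢
    set a := circ (Ψ (Complex.I • D)) φ
    set b := circ (Ψ ((-Complex.I) • D)) φ
    set x := (-sin φ) • (1 : ℬ) + cos φ • Ψ (Complex.I • D) with hx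
    set y := (-sin φ) • (1 : ℬ) + cos φ • Ψ ((-Complex.I) • D) with hy
    have f1 : Ring.inverse a = Ring.inverse (a * b) * b := by
      have : Ring.inverse (a * b) * b * a = 1 := by rw [mul_assoc, ← c1.eq, e3]
      rw [← mul_one (Ring.inverse (a * b) * b), ← Ring.mul_inverse_cancel _ (k1.1 φ), ← mul_assoc,
        this, one_mul]
    have f2 : Ring.inverse b = Ring.inverse (a * b) * a := by
      have : Ring.inverse (a * b) * a * b = 1 := by rw [mul_assoc, e3]
      rw [← mul_one (Ring.inverse (a * b) * a), ← Ring.mul_inverse_cancel _ (k2.1 φ), ← mul_assoc,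
        this, one_mul]
    have f3 : b * x - a * y = (2 * Complex.I) • Ψ D := by
      have r1 : ∀ (r : ℝ) (x : ℬ), r • x = (r : ℂ) • x := fun r x => rfl
      have r2 := Complex.sin_sq_add_cos_sq φ
      simp only [a, b, x, y, circ, r1, map_smul, mul_add, add_mul, smul_mul_assoc, mul_smul_comm,
        one_mul, mul_one, smul_smul]
      match_scalars
      · push_cast; ring
      · push_cast; linear_combination 2 * Complex.I * r2
      · ring
    rw [f1, f2, mul_assoc, mul_assoc, ← mul_sub, f3]
  have hint : ∀ Q : ℬ, (∀ φ, IsUnit (circ Q φ)) → IntervalIntegrable (fun φ =>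
      Ring.inverse (circ Q φ) * ((-sin φ) • 1 + cos φ • Q)) volume 0 (2 * π) := by
    intro Q hQ
    refine Continuous.intervalIntegrable ?_ _ _
    refine Continuous.mul ?_ (by fun_prop)
    rw [continuous_iff_continuousAt]
    intro φ
    obtain ⟨u, hu⟩ := hQ φ
    have h3 := (contDiffAt_ringInverse ℝ (n := 0) u).continuousAt
    rw [hu] at h3
    exact ContinuousAt.comp (f := circ Q) h3
      (continuous_circ.comp (continuous_const.prodMk continuous_id)).continuousAt
  have hsub := intervalIntegral.integral_sub (hint _ k1.1) (hint _ k2.1)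
  simp_rw [hI] at hsub
  change _ = circInt _ - circInt _ at hsub
  have hint₂ : IntervalIntegrable (fun φ => Ring.inverse ((cos φ ^ 2) • (1 : ℬ) + (sin φ ^ 2) • Ψ B))
      volume 0 (2 * π) := by
    refine Continuous.intervalIntegrable ?_ _ _
    rw [continuous_iff_continuousAt]
    intro φ
    obtain ⟨u, hu⟩ := hun φ
    have h3 := (contDiffAt_ringInverse ℝ (n := 0) u).continuousAt
    rw [hu] at h3
    exact ContinuousAt.comp (f := fun φ : ℝ => (cos φ ^ 2) • (1 : ℬ) + (sin φ ^ 2) • Ψ B) h3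
      (by fun_prop)
  have hmul := ((ContinuousLinearMap.mul ℝ ℬ).flip
    ((2 * Complex.I) • Ψ D)).intervalIntegral_comp_comm hint₂
  simp only [ContinuousLinearMap.flip_apply, ContinuousLinearMap.mul_apply'] at hmul
  rw [k1.2, k2.2, hmul] at hsub
  change circInt₂ (Ψ B) * _ = _ at hsub
  have h1 : circInt₂ (Ψ B) * Ψ D = (2 * π : ℂ) • 1 := by
    have h2 : (2 * Complex.I) • (circInt₂ (Ψ B) * Ψ D) =
        (2 * Complex.I) • ((2 * π : ℂ) • (1 : ℬ)) := by
      rw [← mul_smul_comm, hsub]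
      rw [show (2 * 1 - 1 : Module.End ℂ W) = 1 by noncomm_ring,
        show (2 * 0 - 1 : Module.End ℂ W) = -1 by noncomm_ring, map_neg, map_one]
      module
    exact smul_right_injective _ (by simp : (2 * Complex.I) ≠ 0) h2
  calc circInt₂ (Ψ B) = circInt₂ (Ψ B) * Ψ D * Ψ R := by
        rw [mul_assoc, ← map_mul, hDR, map_one, mul_one]
    _ = _ := by rw [h1, smul_mul_assoc, one_mul]

end Comparison

end SpectralIntegral

/-! ### Transport of boundary conditions between symbols with the same E⁻. -/

section BoundaryTransport

variable {T : Type*} [AddCommGroup T] [Module ℝ T]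
variable {W : Type*} [NormedAddCommGroup W] [InnerProductSpace ℂ W] [FiniteDimensional ℂ W]
variable (pos : T → T → Prop)

/-- The projection onto `E⁺` along `E⁻`. -/
def specP (S : T →ₗ[ℝ] Module.End ℂ W) : Module.End ℂ W := projAlong (highSp pos S) (lowSp pos S)

/-- For two symbols `S` and `S'` with the same `E⁻`, the automorphism of the fibre that is the
identity on `E⁻`, maps `E⁺(S)` to `E⁺(S')` and takes the form `S(n)` to `S'(n)`. -/
def transport (S S' : T →ₗ[ℝ] Module.End ℂ W) (n : T) : Module.End ℂ W :=
  (1 - specP pos S) +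
    specP pos S' * Ring.inverse (S' n) * orthP (lowSp pos S) * S n * specP pos S

variable {pos} {J : T →ₗ[ℝ] T} {nn : T → ℝ} {S S' : T →ₗ[ℝ] Module.End ℂ W}

/-- Only the line spanned by the covector matters, so the conormal can be replaced by a coordinate
covector, which varies smoothly in a chart. -/
theorem transport_smul (hS' : IsEllSymb S') {n : T} (hn : n ≠ 0) {a : ℝ} (ha : a ≠ 0) :
    transport pos S S' (a • n) = transport pos S S' n := by
  have hu := hS'.unit n hn
  have h1 : Ring.inverse (S' (a • n)) = ((a : ℂ)⁻¹) • Ring.inverse (S' n) := by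
    have ha' : (a : ℂ) ≠ 0 := by exact_mod_cast ha
    have e : S' (a • n) = (a : ℂ) • S' n := by rw [map_smul]; rfl
    have e1 : ((a : ℂ)⁻¹ • Ring.inverse (S' n)) * S' (a • n) = 1 := by
      rw [e, smul_mul_smul_comm, inv_mul_cancel₀ ha', Ring.inverse_mul_cancel _ hu, one_smul]
    have e2 := Ring.mul_inverse_cancel _ (hS'.unit (a • n) (smul_ne_zero ha hn))
    calc _ = ((a : ℂ)⁻¹ • Ring.inverse (S' n)) * S' (a • n) * Ring.inverse (S' (a • n)) := by
          rw [e1, one_mul]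
      _ = _ := by rw [mul_assoc, e2, mul_one]
  have e : S (a • n) = (a : ℂ) • S n := by rw [map_smul]; rfl
  have ha' : (a : ℂ) ≠ 0 := by exact_mod_cast ha
  rw [transport, h1, e, transport]
  simp only [mul_smul_comm, smul_mul_assoc, smul_smul, mul_inv_cancel₀ ha', one_smul]

section

variable (hS : IsEllSymb S) (hS' : IsEllSymb S') (C : IsConfPlane pos J nn)
  (hU : lowSp pos S' = lowSp pos S)

include hS C in
theorem specP_of_low {v : W} (hv : v ∈ lowSp pos S) : specP pos S v = 0 :=
  projAlong_of_mem_right (hS.isCompl C) hv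

include hS C in
theorem specP_of_high {v : W} (hv : v ∈ highSp pos S) : specP pos S v = v :=
  projAlong_of_mem (hS.isCompl C) hv

theorem specP_mem (v : W) : specP pos S v ∈ highSp pos S := projAlong_mem _ _ _

include hS C in
theorem sub_specP_mem (v : W) : v - specP pos S v ∈ lowSp pos S :=
  sub_projAlong_mem (hS.isCompl C) v

include hS C in
theorem specP_mul_self : specP pos S * specP pos S = specP pos S :=
  LinearMap.ext fun v => specP_of_high hS C (specP_mem v)

include hS C in
theorem transport_of_low (n : T) {v : W} (hv : v ∈ lowSp pos S) : transport pos S S' n v = v := by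
  simp [transport, specP_of_low hS C hv]

include hS C in
theorem transport_of_high (n : T) {v : W} (hv : v ∈ highSp pos S) : transport pos S S' n v =
    specP pos S' (Ring.inverse (S' n) (orthP (lowSp pos S) (S n v))) := by
  simp [transport, specP_of_high hS C hv]

include hS C in
theorem transport_of_high_mem (n : T) {v : W} (hv : v ∈ highSp pos S) :
    transport pos S S' n v ∈ highSp pos S' := by
  rw [transport_of_high hS C n hv]
  exact specP_mem _

include hS hS' C hU

/-- The transport of v is the E⁺(S')-component of S'(n)⁻¹ applied to the E⁻-part of S(n)v. Dropping
the E⁻-component is harmless because S'(n) maps E⁻ into (E⁻)ᗮ. -/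
theorem symb_transport_of_high {n : T} (hn : n ≠ 0) {v : W} (hv : v ∈ highSp pos S) :
    orthP (lowSp pos S) (S' n (transport pos S S' n v)) = orthP (lowSp pos S) (S n v) := by
  rw [transport_of_high hS C n hv]
  set y := Ring.inverse (S' n) (orthP (lowSp pos S) (S n v)) with hy
  have h1 : S' n y = orthP (lowSp pos S) (S n v) :=
    LinearMap.congr_fun (Ring.mul_inverse_cancel _ (hS'.unit n hn)) _
  have h2 : orthP (lowSp pos S) (S' n (y - specP pos S' y)) = 0 := by
    apply orthP_of_mem_orthogonal
    rw [← hU]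
    exact hS'.map_low_le C n ⟨_, sub_specP_mem hS' C y, rfl⟩
  rw [map_sub, map_sub, sub_eq_zero] at h2
  rw [← h2, h1, orthP_of_mem (orthP_mem _ _)]

/-- E⁺ and E⁻ are isotropic for both forms, so only mixed pairings count. These see S(n)v for v in
E⁺ only through its E⁻-part, which transport preserves. -/
theorem inner_symb_transport {n : T} (hn : n ≠ 0) (v w : W) :
    inner ℂ (S' n (transport pos S S' n v)) (transport pos S S' n w) = inner ℂ (S n v) w := by
  have low_high : ∀ u ∈ lowSp pos S, ∀ h ∈ highSp pos S,
      inner ℂ (S' n u) (transport pos S S' n h) = inner ℂ (S n u) h := by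
    intro u hu h hh
    have e : ∀ z, inner ℂ u z = inner ℂ u (orthP (lowSp pos S) z) := by
      intro z
      have := (Submodule.mem_orthogonal _ _).1 (sub_orthP_mem (lowSp pos S) z) u hu
      rwa [inner_sub_right, sub_eq_zero] at this
    rw [hS'.sym, hS.sym, e, symb_transport_of_high hS hS' C hU hn hh, ← e]
  have high_low : ∀ h ∈ highSp pos S, ∀ u ∈ lowSp pos S,
      inner ℂ (S' n (transport pos S S' n h)) u = inner ℂ (S n h) u := by
    intro h hh u hu
    rw [hS'.sym, hS.sym, ← inner_conj_symm, low_high u hu h hh, inner_conj_symm]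
  obtain ⟨a, ha, b, hb, rfl⟩ := Submodule.mem_sup.1
    (show v ∈ highSp pos S ⊔ lowSp pos S by rw [(hS.isCompl C).sup_eq_top]; trivial)
  obtain ⟨c, hc, d, hd, rfl⟩ := Submodule.mem_sup.1
    (show w ∈ highSp pos S ⊔ lowSp pos S by rw [(hS.isCompl C).sup_eq_top]; trivial)
  have e1 := low_high b hb c hc
  have e2 := high_low a ha d hd
  have e3 := hS'.inner_high C n (transport_of_high_mem (S' := S') hS C n ha)
    (transport_of_high_mem (S' := S') hS C n hc)
  have hb' : b ∈ lowSp pos S' := by rw [hU]; exact hb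
  have hd' : d ∈ lowSp pos S' := by rw [hU]; exact hd
  have e4 := hS'.inner_low C n hb' hd'
  have e5 := transport_of_low (S' := S') hS C n hb
  have e6 := transport_of_low (S' := S') hS C n hd
  rw [map_add (transport pos S S' n), map_add (transport pos S S' n), e5, e6, map_add, map_add, inner_add_left, inner_add_right,
    inner_add_right, inner_add_left, inner_add_right, inner_add_right, e1, e2, e3, e4,
    hS.inner_high C n ha hc, hS.inner_low C n hb hd]

theorem transport_injective {n : T} (hn : n ≠ 0) :
    Function.Injective (transport pos S S' n) := by
  rw [injective_iff_map_eq_zero]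
  intro v hv
  apply hS.injective hn
  refine ext_inner_right ℂ fun w => ?_
  rw [← inner_symb_transport hS hS' C hU hn, hv, map_zero, inner_zero_left, inner_zero_left]

theorem transport_isUnit {n : T} (hn : n ≠ 0) : IsUnit (transport pos S S' n) :=
  (LinearMap.isUnit_iff_ker_eq_bot _).2
    (LinearMap.ker_eq_bot.2 (transport_injective hS hS' C hU hn))

theorem finrank_map_transport {n : T} (hn : n ≠ 0) (L : Submodule ℂ W) :
    Module.finrank ℂ (L.map (transport pos S S' n)) = Module.finrank ℂ L :=
  (Submodule.equivMapOfInjective _ (transport_injective hS hS' C hU hn) L).finrank_eq.symm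

theorem map_transport_low {n : T} (_hn : n ≠ 0) :
    (lowSp pos S).map (transport pos S S' n) = lowSp pos S' := by
  rw [hU]
  ext v
  constructor
  · rintro ⟨u, hu, rfl⟩
    rw [transport_of_low hS C n hu]; exact hu
  · intro hv
    exact ⟨v, hv, transport_of_low hS C n hv⟩

theorem map_transport_high {n : T} (hn : n ≠ 0) :
    (highSp pos S).map (transport pos S S' n) = highSp pos S' := by
  apply Submodule.eq_of_le_of_finrank_eq
  · rintro _ ⟨v, hv, rfl⟩
    exact transport_of_high_mem hS C n hv
  · rw [finrank_map_transport hS hS' C hU hn]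
    have h1 := (hS.two_mul_finrank_low C).2
    have h2 := (hS'.two_mul_finrank_low C).2
    omega

theorem isCompl_map_transport {n : T} (hn : n ≠ 0) {L U : Submodule ℂ W} (h : IsCompl L U) :
    IsCompl (L.map (transport pos S S' n)) (U.map (transport pos S S' n)) := by
  let e := LinearEquiv.ofInjectiveEndo _ (transport_injective hS hS' C hU hn)
  exact h.map (Submodule.orderIsoMapComap e)

theorem map_symb_map_transport {n : T} (hn : n ≠ 0) {L : Submodule ℂ W}
    (hL : L.map (S n) = Lᗮ) :
    (L.map (transport pos S S' n)).map (S' n) = (L.map (transport pos S S' n))ᗮ := by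
  apply Submodule.eq_of_le_of_finrank_eq
  · rintro _ ⟨_, ⟨v, hv, rfl⟩, rfl⟩
    rw [Submodule.mem_orthogonal']
    rintro _ ⟨w, hw, rfl⟩
    rw [inner_symb_transport hS hS' C hU hn]
    have : S n v ∈ Lᗮ := hL ▸ ⟨v, hv, rfl⟩
    exact (Submodule.mem_orthogonal' _ _).1 this w hw
  · have h1 := Submodule.finrank_add_finrank_orthogonal (K := L.map (transport pos S S' n))
    have h2 := Submodule.finrank_add_finrank_orthogonal (K := L)
    rw [hS'.finrank_map hn]
    rw [← hL, hS.finrank_map hn] at h2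
    rw [finrank_map_transport hS hS' C hU hn] at h1 ⊢
    omega

end

/-- If x is the transport of a ∈ E⁺, then S(n)(x - a) lies in (E⁻)ᗮ = S(n)E⁻, so x - a belongs to E⁺
∩ E⁻ = 0. -/
theorem transport_self (hS : IsEllSymb S) (C : IsConfPlane pos J nn) {n : T} (hn : n ≠ 0) :
    transport pos S S n = 1 := by
  ext v
  obtain ⟨a, ha, b, hb, rfl⟩ := Submodule.mem_sup.1
    (show v ∈ highSp pos S ⊔ lowSp pos S by rw [(hS.isCompl C).sup_eq_top]; trivial)
  rw [map_add, transport_of_low hS C n hb, Module.End.one_apply]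
  congr 1
  set x := transport pos S S n a with hx
  have h1 : x ∈ highSp pos S := transport_of_high_mem hS C n ha
  have h2 := symb_transport_of_high hS hS C rfl hn ha
  rw [← hx, ← sub_eq_zero, ← map_sub, ← map_sub] at h2
  have h3 : S n (x - a) ∈ (lowSp pos S)ᗮ := by
    have := sub_orthP_mem (lowSp pos S) (S n (x - a))
    rwa [h2, sub_zero] at this
  rw [← hS.map_low C hn] at h3
  obtain ⟨u, hu, hux⟩ := h3
  have h4 := sub_eq_zero.1 (hS.injective hn (v := u - (x - a)) (by rw [map_sub, hux, sub_self]))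
  have h5 : x - a ∈ highSp pos S ⊓ lowSp pos S := ⟨Submodule.sub_mem _ h1 ha, h4 ▸ hu⟩
  rw [(hS.isCompl C).inf_eq_bot] at h5
  exact sub_eq_zero.1 h5

section Naturality

variable {W' : Type*} [NormedAddCommGroup W'] [InnerProductSpace ℂ W'] [FiniteDimensional ℂ W']
  {g : W ≃ₗᵢ[ℂ] W'}

theorem Intertwines.inverse {B : Module.End ℂ W} {B' : Module.End ℂ W'} (h : Intertwines g B B')
    (hB : IsUnit B) (hB' : IsUnit B') : Intertwines g (Ring.inverse B) (Ring.inverse B') := by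
  intro w
  have h1 : B (Ring.inverse B w) = w := LinearMap.congr_fun (Ring.mul_inverse_cancel _ hB) w
  have h2 := LinearMap.congr_fun (Ring.inverse_mul_cancel _ hB') (g (Ring.inverse B w))
  rw [Module.End.mul_apply, h, h1] at h2
  exact h2

variable {R R' : T →ₗ[ℝ] Module.End ℂ W'}

theorem intertwines_specP (hS : IsEllSymb S) (hR : IsEllSymb R) (C : IsConfPlane pos J nn)
    (h : ∀ ξ, Intertwines g (S ξ) (R ξ)) : Intertwines g (specP pos S) (specP pos R) := by
  intro w
  obtain ⟨a, ha, b, hb, rfl⟩ := Submodule.mem_sup.1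
    (show w ∈ highSp pos S ⊔ lowSp pos S by rw [(hS.isCompl C).sup_eq_top]; trivial)
  have h1 : g a ∈ highSp pos R := by rw [highSp_map hS hR C h]; exact ⟨a, ha, rfl⟩
  have h2 : g b ∈ lowSp pos R := by rw [lowSp_map hS hR C h]; exact ⟨b, hb, rfl⟩
  rw [map_add, map_add, map_add, specP_of_low hS C hb, specP_of_high hS C ha,
    specP_of_low hR C h2, specP_of_high hR C h1, add_zero, add_zero]

theorem intertwines_transport (hS : IsEllSymb S) (hS' : IsEllSymb S') (hR : IsEllSymb R)
    (hR' : IsEllSymb R') (C : IsConfPlane pos J nn) (h : ∀ ξ, Intertwines g (S ξ) (R ξ))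
    (h' : ∀ ξ, Intertwines g (S' ξ) (R' ξ)) {n : T} (hn : n ≠ 0) :
    Intertwines g (transport pos S S' n) (transport pos R R' n) := by
  have h1 := intertwines_specP hS hR C h
  have h2 := intertwines_specP hS' hR' C h'
  have h3 : Intertwines g (orthP (lowSp pos S)) (orthP (lowSp pos R)) :=
    intertwines_lowP hS hR C h
  exact (Intertwines.one.sub h1).add
    ((((h2.mul ((h' n).inverse (hS'.unit n hn) (hR'.unit n hn))).mul h3).mul (h n)).mul h1)

end Naturality

end BoundaryTransport

/-! ### Invariance of the negative spectral subbundle over the boundary. -/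

section BoundaryAutomorphism

variable {W : Type*} [NormedAddCommGroup W] [InnerProductSpace ℂ W] [FiniteDimensional ℂ W]

/-- The span of the generalized eigenspaces for negative eigenvalues of the automorphism of `Em`
that corresponds to the boundary condition `L`. -/
def negBdrySpace (Em Ep L : Submodule ℂ W) (B : Module.End ℂ W) : Submodule ℂ W :=
  (⨆ (t : ℝ) (_ : t < 0), Module.End.maxGenEigenspace (LinearMap.codRestrict Em
    (projAlong Em Emᗮ ∘ₗ (Complex.I • B) ∘ₗ (-projAlong Ep L) ∘ₗ Em.subtype)
    (fun _ => projAlong_mem _ _ _) : Module.End ℂ Em) (t : ℂ)).map Em.subtype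

theorem negBdrySpace_congr {Em Em' Ep Ep' L L' : Submodule ℂ W} {B B' : Module.End ℂ W}
    (h : Em' = Em) (hv : ∀ v ∈ Em, orthP Em (B' (projAlong Ep' L' v)) =
      orthP Em (B (projAlong Ep L v))) :
    negBdrySpace Em' Ep' L' B' = negBdrySpace Em Ep L B := by
  subst h
  unfold negBdrySpace
  congr! 6 with t ht
  refine LinearMap.ext fun v => ?_
  change orthP Em' (Complex.I • B' (-projAlong Ep' L' v)) =
    orthP Em' (Complex.I • B (-projAlong Ep L v))
  rw [map_neg, map_neg, map_smul, map_smul, map_neg, map_neg, hv v v.2]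

variable {T : Type*} [AddCommGroup T] [Module ℝ T]
variable {pos : T → T → Prop} {J : T →ₗ[ℝ] T} {nn : T → ℝ} {S S' : T →ₗ[ℝ] Module.End ℂ W}

/-- Transport carries the splitting of v ∈ E⁻ along E⁺ ⊕ L to its splitting for the new data and
keeps the E⁻-part of the image under the symbol. So the automorphism of E⁻ itself, not only its
negative part, is unchanged. -/
theorem negBdrySpace_transport (hS : IsEllSymb S) (hS' : IsEllSymb S') (C : IsConfPlane pos J nn)
    (hU : lowSp pos S' = lowSp pos S) {n : T} (hn : n ≠ 0) {L : Submodule ℂ W}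
    (hL : IsCompl L (highSp pos S)) :
    negBdrySpace (lowSp pos S') (highSp pos S') (L.map (transport pos S S' n)) (S' n) =
      negBdrySpace (lowSp pos S) (highSp pos S) L (S n) := by
  refine negBdrySpace_congr hU fun v hv => ?_
  set R := projAlong (highSp pos S) L v with hR
  have h1 : R ∈ highSp pos S := projAlong_mem _ _ _
  have h2 : v - R ∈ L := sub_projAlong_mem hL.symm v
  have h3 : projAlong (highSp pos S') (L.map (transport pos S S' n)) v =
      transport pos S S' n R := by
    have hc : IsCompl (highSp pos S') (L.map (transport pos S S' n)) := by
      rw [← map_transport_high hS hS' C hU hn]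
      exact (isCompl_map_transport hS hS' C hU hn hL).symm
    have e : v = transport pos S S' n R + transport pos S S' n (v - R) := by
      rw [← map_add, add_sub_cancel, transport_of_low hS C n hv]
    conv_lhs => rw [e]
    rw [map_add, projAlong_of_mem hc (transport_of_high_mem hS C n h1),
      projAlong_of_mem_right hc ⟨_, h2, rfl⟩, add_zero]
  rw [h3, symb_transport_of_high hS hS' C hU hn h1]

end BoundaryAutomorphism

/-! ### Families of functions that are C¹-continuous in a parameter. -/

section RegularFamilies

open Set

variable {X : Type*} [TopologicalSpace X] {P : Type*} [NormedAddCommGroup P] [NormedSpace ℝ P]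
  {F : Type*} [NormedAddCommGroup F] [NormedSpace ℝ F]
  {G : Type*} [NormedAddCommGroup G] [NormedSpace ℝ G]
  {K : Type*} [NormedAddCommGroup K] [NormedSpace ℝ K]

/-- `D` is a relatively open subset of the set `S` of unique differentiability. -/
structure IsRelOpen (S D : Set P) : Prop where
  unique : UniqueDiffOn ℝ S
  subset : D ⊆ S
  nhds : ∀ y ∈ D, D ∈ 𝓝[S] y

/-- A family of `C^k` functions on `D` that is continuous in the `C¹`-sense with respect to the
parameter. -/
structure RegOn (k : ℕ∞) (S D : Set P) (g : X → P → F) : Prop where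
  smooth : ∀ a, ∀ y ∈ D, ContDiffWithinAt ℝ k (g a) S y
  cont : ContinuousOn (fun z : X × P => g z.1 z.2) (univ ×ˢ D)
  dcont : ContinuousOn (fun z : X × P => fderivWithin ℝ (g z.1) S z.2) (univ ×ˢ D)

namespace RegOn

variable {k : ℕ∞} {S D : Set P} {g : X → P → F} {h : X → P → G}

theorem of_smooth (hD : IsRelOpen S D) (hk : 1 ≤ k) {f : P → F}
    (hf : ∀ y ∈ D, ContDiffWithinAt ℝ k f S y) :
    RegOn k S D (fun _ : X => f) where
  smooth _ := hf
  cont := by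
    have : ContinuousOn f D := fun y hy => (hf y hy).continuousWithinAt.mono hD.subset
    exact this.comp continuousOn_snd (fun z hz => hz.2)
  dcont := by
    have : ContinuousOn (fderivWithin ℝ f S) D := fun y hy =>
      (((hf y hy).fderivWithin_right (m := 0) hD.unique (by simpa using mod_cast hk)
        (hD.subset hy)).continuousWithinAt).mono hD.subset
    exact this.comp continuousOn_snd (fun z hz => hz.2)

theorem of_param {f : X → F} (hf : Continuous f) : RegOn k S D (fun a _ => f a) where
  smooth _ _ _ := contDiffWithinAt_const
  cont := (hf.comp continuous_fst).continuousOn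
  dcont := by
    simp only [fderivWithin_fun_const]
    exact continuousOn_const

theorem congr (hD : IsRelOpen S D) (hg : RegOn k S D g) {g' : X → P → F}
    (h : ∀ a, ∀ y ∈ D, g' a y = g a y) : RegOn k S D g' where
  smooth a y hy := (hg.smooth a y hy).congr_of_eventuallyEq
    (Filter.eventually_of_mem (hD.nhds y hy) (h a)) (h a y hy)
  cont := hg.cont.congr fun z hz => h z.1 z.2 hz.2
  dcont := hg.dcont.congr fun z hz => Filter.EventuallyEq.fderivWithin_eq
    (Filter.eventually_of_mem (hD.nhds z.2 hz.2) (h z.1)) (h z.1 z.2 hz.2)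

theorem reparam (hg : RegOn k S D g) {Y : Type*} [TopologicalSpace Y] {r : Y → X}
    (hr : Continuous r) : RegOn k S D (fun b => g (r b)) where
  smooth b := hg.smooth (r b)
  cont := hg.cont.comp (f := fun z : Y × P => (r z.1, z.2)) (by fun_prop) (fun z hz => ⟨trivial, hz.2⟩)
  dcont := hg.dcont.comp (f := fun z : Y × P => (r z.1, z.2)) (by fun_prop)
    (fun z hz => ⟨trivial, hz.2⟩)

theorem mono (hD : IsRelOpen S D) (hg : RegOn k S D g) {D' : Set P} (h : D' ⊆ D) :
    RegOn k S D' g where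
  smooth a y hy := hg.smooth a y (h hy)
  cont := hg.cont.mono (prod_mono le_rfl h)
  dcont := hg.dcont.mono (prod_mono le_rfl h)

theorem differentiableWithinAt (hk : 1 ≤ k) (hg : RegOn k S D g) (a : X) {y : P} (hy : y ∈ D) :
    DifferentiableWithinAt ℝ (g a) S y :=
  (hg.smooth a y hy).differentiableWithinAt (by
    intro h
    have h' : k = 0 := by exact_mod_cast h
    simp [h'] at hk)

/-- By the chain rule the derivative of the composite is jointly continuous. All fibrewise
constructions below are compositions of this kind. -/
theorem comp (hD : IsRelOpen S D) (hk : 1 ≤ k) (hg : RegOn k S D g) {U : Set F} (hU : IsOpen U)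
    {Φ : F → G} (hΦ : ContDiffOn ℝ ∞ Φ U) (hm : ∀ a, ∀ y ∈ D, g a y ∈ U) :
    RegOn k S D (fun a y => Φ (g a y)) where
  smooth a y hy := by
    have h1 : ContDiffAt ℝ k Φ (g a y) :=
      ((hΦ.contDiffAt (hU.mem_nhds (hm a y hy))).of_le (by exact_mod_cast le_top))
    exact h1.comp_contDiffWithinAt y (hg.smooth a y hy)
  cont := hΦ.continuousOn.comp hg.cont fun z hz => hm z.1 z.2 hz.2
  dcont := by
    have h1 : ContinuousOn (fun z : X × P => (fderiv ℝ Φ (g z.1 z.2)).comp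
        (fderivWithin ℝ (g z.1) S z.2)) (univ ×ˢ D) := by
      refine ContinuousOn.clm_comp ?_ hg.dcont
      have h2 : ContinuousOn (fderiv ℝ Φ) U := hΦ.continuousOn_fderiv_of_isOpen hU (by simp)
      exact h2.comp hg.cont fun z hz => hm z.1 z.2 hz.2
    refine h1.congr fun z hz => ?_
    have h3 : DifferentiableAt ℝ Φ (g z.1 z.2) :=
      (hΦ.contDiffAt (hU.mem_nhds (hm z.1 z.2 hz.2))).differentiableAt (by simp)
    exact fderiv_comp_fderivWithin z.2 h3 (hg.differentiableWithinAt hk z.1 hz.2)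
      (hD.unique z.2 (hD.subset hz.2))

theorem prodMk (hD : IsRelOpen S D) (hk : 1 ≤ k) (hg : RegOn k S D g) (hh : RegOn k S D h) :
    RegOn k S D (fun a y => (g a y, h a y)) where
  smooth a y hy := (hg.smooth a y hy).prodMk (hh.smooth a y hy)
  cont := hg.cont.prodMk hh.cont
  dcont := by
    have h1 : ContinuousOn (fun z : X × P => (fderivWithin ℝ (g z.1) S z.2).prod
        (fderivWithin ℝ (h z.1) S z.2)) (univ ×ˢ D) :=
      (ContinuousLinearMap.prodₗᵢ ℝ).continuous.comp_continuousOn (hg.dcont.prodMk hh.dcont)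
    refine h1.congr fun z hz => ?_
    exact DifferentiableWithinAt.fderivWithin_prodMk (hg.differentiableWithinAt hk z.1 hz.2)
      (hh.differentiableWithinAt hk z.1 hz.2) (hD.unique z.2 (hD.subset hz.2))

theorem map (hD : IsRelOpen S D) (hk : 1 ≤ k) (hg : RegOn k S D g) {Φ : F → G}
    (hΦ : ContDiff ℝ ∞ Φ) : RegOn k S D (fun a y => Φ (g a y)) :=
  hg.comp hD hk isOpen_univ hΦ.contDiffOn fun _ _ _ => mem_univ _

theorem map₂ (hD : IsRelOpen S D) (hk : 1 ≤ k) (hg : RegOn k S D g) (hh : RegOn k S D h)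
    {Φ : F × G → K} (hΦ : ContDiff ℝ ∞ Φ) : RegOn k S D (fun a y => Φ (g a y, h a y)) :=
  (hg.prodMk hD hk hh).map hD hk hΦ

theorem add (hD : IsRelOpen S D) (hk : 1 ≤ k) {g' : X → P → F} (hg : RegOn k S D g)
    (hg' : RegOn k S D g') : RegOn k S D (fun a y => g a y + g' a y) :=
  hg.map₂ hD hk hg' (contDiff_fst.add contDiff_snd)

theorem smul (hD : IsRelOpen S D) (hk : 1 ≤ k) {r : X → P → ℝ} (hr : RegOn k S D r)
    (hg : RegOn k S D g) : RegOn k S D (fun a y => r a y • g a y) :=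
  hr.map₂ hD hk hg (contDiff_fst.smul contDiff_snd)

theorem csmul (hD : IsRelOpen S D) (hk : 1 ≤ k) [NormedSpace ℂ F]
    {r : X → P → ℂ} (hr : RegOn k S D r)
    (hg : RegOn k S D g) : RegOn k S D (fun a y => r a y • g a y) :=
  hr.map₂ hD hk hg (contDiff_fst.smul contDiff_snd)

theorem const_csmul (hD : IsRelOpen S D) (hk : 1 ≤ k) [NormedSpace ℂ F]
    (r : ℂ) (hg : RegOn k S D g) : RegOn k S D (fun a y => r • g a y) :=
  hg.map hD hk (contDiff_id.const_smul r)

section Algebra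

variable {𝒜 : Type*} [NormedRing 𝒜] [NormedAlgebra ℝ 𝒜] {u v : X → P → 𝒜}

theorem mul (hD : IsRelOpen S D) (hk : 1 ≤ k) (hu : RegOn k S D u) (hv : RegOn k S D v) :
    RegOn k S D (fun a y => u a y * v a y) :=
  hu.map₂ hD hk hv (contDiff_fst.mul contDiff_snd)

variable [CompleteSpace 𝒜]

theorem inverse (hD : IsRelOpen S D) (hk : 1 ≤ k) (hu : RegOn k S D u)
    (h : ∀ a, ∀ y ∈ D, IsUnit (u a y)) : RegOn k S D (fun a y => Ring.inverse (u a y)) := by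
  refine hu.comp hD hk (U := {x | IsUnit x}) Units.isOpen ?_ h
  rintro _ ⟨x, rfl⟩
  exact (contDiffAt_ringInverse ℝ x).contDiffWithinAt

theorem circInt (hD : IsRelOpen S D) (hk : 1 ≤ k) (hu : RegOn k S D u)
    (h : ∀ a, ∀ y ∈ D, ∀ φ, IsUnit (circ (u a y) φ)) :
    RegOn k S D (fun a y => circInt (u a y)) :=
  hu.comp hD hk isOpen_circ contDiffOn_circInt h

theorem circInt₂ (hD : IsRelOpen S D) (hk : 1 ≤ k) (hu : RegOn k S D u)
    (h : ∀ a, ∀ y ∈ D, ∀ φ : ℝ,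
      IsUnit ((Real.cos φ ^ 2) • (1 : 𝒜) + (Real.sin φ ^ 2) • u a y)) :
    RegOn k S D (fun a y => circInt₂ (u a y)) :=
  hu.comp hD hk isOpen_circ₂ contDiffOn_circInt₂ h

end Algebra

end RegOn

/-- The restriction of a regular family to a curve. -/
theorem RegOn.comp_affine {P' : Type*} [NormedAddCommGroup P'] [NormedSpace ℝ P'] {k : ℕ∞}
    (hk : 1 ≤ k) {S D : Set P} (hD : IsRelOpen S D) {S' D' : Set P'} (hD' : IsRelOpen S' D')
    {g : X → P → F} (hg : RegOn k S D g) (c : P' →L[ℝ] P) (hS : MapsTo c S' S)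
    (hc : MapsTo c D' D) : RegOn k S' D' (fun a t => g a (c t)) where
  smooth a y hy := (hg.smooth a (c y) (hc hy)).comp y c.contDiff.contDiffWithinAt hS
  cont := hg.cont.comp (f := fun z : X × P' => (z.1, c z.2)) (by fun_prop)
    (fun z hz => ⟨trivial, hc hz.2⟩)
  dcont := by
    have h1 : ContinuousOn (fun z : X × P' => (fderivWithin ℝ (g z.1) S (c z.2)).comp c)
        (univ ×ˢ D') := by
      refine ContinuousOn.clm_comp ?_ continuousOn_const
      exact hg.dcont.comp (f := fun z : X × P' => (z.1, c z.2)) (by fun_prop)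
        (fun z hz => ⟨trivial, hc hz.2⟩)
    refine h1.congr fun z hz => ?_
    have h2 := fderivWithin_comp z.2 (hg.differentiableWithinAt hk z.1 (hc hz.2))
      c.differentiableAt.differentiableWithinAt hS (hD'.unique z.2 (hD'.subset hz.2))
    rw [c.fderivWithin (hD'.unique z.2 (hD'.subset hz.2))] at h2
    exact h2

section UniformConvergence

variable {Y : Type*} [TopologicalSpace Y] {β : Type*} [UniformSpace β]

/-- Joint continuity is uniform over a compact set of the second variable. -/
theorem continuous_ofFun {𝔖 : Set (Set Y)} {D : Set Y} (h𝔖 : ∀ s ∈ 𝔖, IsCompact s ∧ s ⊆ D)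
    {f : X → Y → β} (hf : ContinuousOn (fun z : X × Y => f z.1 z.2) (univ ×ˢ D)) :
    Continuous fun a => UniformOnFun.ofFun 𝔖 (f a) := by
  rw [continuous_iff_continuousAt]
  intro a
  rw [ContinuousAt, UniformOnFun.tendsto_iff_tendstoUniformlyOn]
  intro s hs u hu
  obtain ⟨v, hv, h⟩ := (h𝔖 s hs).1.mem_uniformity_of_prod (f := f) (s := univ)
    (hf.mono (prod_mono le_rfl (h𝔖 s hs).2)) (mem_univ a) (symm_le_uniformity hu)
  rw [nhdsWithin_univ] at hv
  filter_upwards [hv] with b hb y hy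
  exact h b hb y hy

/-- The converse passage: near a point of `D` one member of the family of sets is a neighbourhood,
and a locally uniform limit of continuous functions may be evaluated at varying points. Together the
two results translate the topologies of operators and boundary conditions into joint continuity. -/
theorem continuousOn_of_continuous_ofFun {𝔖 : Set (Set Y)} {D : Set Y}
    (h𝔖 : ∀ y ∈ D, ∃ s ∈ 𝔖, s ∈ 𝓝[D] y) {f : X → Y → β}
    (hf : Continuous fun a => UniformOnFun.ofFun 𝔖 (f a)) (hc : ∀ a, ContinuousOn (f a) D) :
    ContinuousOn (fun z : X × Y => f z.1 z.2) (univ ×ˢ D) := by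
  rintro ⟨a, y⟩ ⟨-, hy⟩
  obtain ⟨s, hs, hsy⟩ := h𝔖 y hy
  have h1 := hf.continuousAt (x := a)
  rw [ContinuousAt, UniformOnFun.tendsto_iff_tendstoUniformlyOn] at h1
  have h2 := h1 s hs
  rw [ContinuousWithinAt, Uniform.tendsto_nhds_right, nhdsWithin_prod_eq, nhdsWithin_univ]
  intro u hu
  obtain ⟨w, hw, hwu⟩ := comp_mem_uniformity_sets hu
  have h3 := h2 w hw
  have h4 : ∀ᶠ y' in 𝓝[D] y, (f a y, f a y') ∈ w :=
    Uniform.tendsto_nhds_right.1 (hc a y hy) hw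
  have h5 : ∀ᶠ y' in 𝓝[D] y, y' ∈ s := hsy
  rw [Filter.mem_map]
  filter_upwards [h3.prod_mk (h4.and h5)] with z hz
  exact hwu ⟨f a z.2, hz.2.1, hz.1 z.2 hz.2.2⟩

end UniformConvergence

end RegularFamilies

/-! ### Coordinate expressions and extension of local sections. -/

section Charts

open Set

variable {M : Type*} [TopologicalSpace M] [ChartedSpace (EuclideanHalfSpace 2) M]
  [IsManifold (𝓡∂ 2) ∞ M]

/-- The point of the surface with the coordinates `y` in the chart around `c`. -/
abbrev pt (c : M) (y : Plane) : M := (extChartAt (𝓡∂ 2) c).symm y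

theorem isRelOpen_target (c : M) :
    IsRelOpen (range (𝓡∂ 2)) (extChartAt (𝓡∂ 2) c).target where
  unique := (𝓡∂ 2).uniqueDiffOn
  subset := extChartAt_target_subset_range c
  nhds y hy := by
    have h := extChartAt_target_mem_nhdsWithin' (I := 𝓡∂ 2) ((extChartAt (𝓡∂ 2) c).map_target hy)
    rwa [(extChartAt (𝓡∂ 2) c).right_inv hy] at h

variable {F : Type*} [NormedAddCommGroup F] [NormedSpace ℝ F]

theorem contDiffWithinAt_chart_iff {f : M → F} {c : M} {y : Plane}
    (hy : y ∈ (extChartAt (𝓡∂ 2) c).target) :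
    ContDiffWithinAt ℝ ∞ (fun z => f (pt c z)) (range (𝓡∂ 2)) y ↔
      ContMDiffAt (𝓡∂ 2) 𝓘(ℝ, F) ∞ f (pt c y) := by
  have hs : pt c y ∈ (chartAt (EuclideanHalfSpace 2) c).source := by
    rw [← extChartAt_source (𝓡∂ 2)]
    exact (extChartAt (𝓡∂ 2) c).map_target hy
  rw [contMDiffAt_iff_of_mem_source (y := f (pt c y)) hs (by simp)]
  rw [(extChartAt (𝓡∂ 2) c).right_inv hy]
  constructor
  · intro h
    refine ⟨?_, h⟩
    have h1 : ContinuousWithinAt (fun z => f (pt c z)) (range (𝓡∂ 2)) y := h.continuousWithinAt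
    have h2 : ContinuousAt (extChartAt (𝓡∂ 2) c) (pt c y) := continuousAt_extChartAt' (by
      rwa [extChartAt_source])
    have h3 : ContinuousAt (fun x => f (pt c (extChartAt (𝓡∂ 2) c x))) (pt c y) := by
      have h4 : Filter.Tendsto (extChartAt (𝓡∂ 2) c) (𝓝 (pt c y)) (𝓝[range (𝓡∂ 2)] y) := by
        refine tendsto_nhdsWithin_iff.2 ⟨?_, ?_⟩
        · rw [ContinuousAt, (extChartAt (𝓡∂ 2) c).right_inv hy] at h2
          exact h2
        · exact Filter.Eventually.of_forall fun x => by simp [mem_range_self]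
      have h5 := h1.tendsto.comp h4
      rw [ContinuousAt, (extChartAt (𝓡∂ 2) c).right_inv hy]
      exact h5
    refine h3.congr ?_
    filter_upwards [(chartAt (EuclideanHalfSpace 2) c).open_source.mem_nhds hs] with x hx
    rw [pt, (extChartAt (𝓡∂ 2) c).left_inv (by rwa [extChartAt_source])]
  · exact fun h => h.2

/-- A smooth function on a neighbourhood coincides near the point with a globally smooth one. -/
theorem exists_contMDiffMap_eventuallyEq [T2Space M] {f : M → ℝ} {u : Set M} (hu : IsOpen u)
    {x₀ : M} (hx : x₀ ∈ u) (hf : ContMDiffOn (𝓡∂ 2) 𝓘(ℝ, ℝ) ∞ f u) :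
    ∃ g : C^∞⟮𝓡∂ 2, M; ℝ⟯, g =ᶠ[𝓝 x₀] f := by
  obtain ⟨χ, -, hχ⟩ := (SmoothBumpFunction.nhds_basis_tsupport (I := 𝓡∂ 2) x₀).mem_iff.1
    (hu.mem_nhds hx)
  refine ⟨⟨fun x => χ x • f x, ?_⟩, ?_⟩
  · refine contMDiff_of_tsupport fun x hxs => ?_
    have h1 : x ∈ u := hχ (tsupport_smul_subset_left χ f hxs)
    exact (χ.contMDiff x).smul (hf.contMDiffAt (hu.mem_nhds h1))
  · filter_upwards [χ.eventuallyEq_one] with x hx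
    change χ x • f x = f x
    rw [hx]; simp

variable {V : Type*} [NormedAddCommGroup V] [NormedSpace ℂ V] [FiniteDimensional ℂ V]
  {E : M → Type*} [TopologicalSpace (TotalSpace V E)]
  [∀ x, NormedAddCommGroup (E x)] [∀ x, InnerProductSpace ℂ (E x)]
  [FiberBundle V E] [VectorBundle ℂ V E] [VectorBundle ℝ V E]
  [ContMDiffVectorBundle ∞ V E (𝓡∂ 2)]

theorem exists_section_eventuallyEq [T2Space M]
    {s : ∀ x, E x} {u : Set M} (hu : IsOpen u) {x₀ : M} (hx : x₀ ∈ u)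
    (hs : ContMDiffOn (𝓡∂ 2) ((𝓡∂ 2).prod 𝓘(ℝ, V)) ∞ (fun x => TotalSpace.mk' V x (s x)) u) :
    ∃ t : Sections V E, ∀ᶠ x in 𝓝 x₀, (t : ∀ x, E x) x = s x := by
  obtain ⟨χ, -, hχ⟩ := (SmoothBumpFunction.nhds_basis_tsupport (I := 𝓡∂ 2) x₀).mem_iff.1
    (hu.mem_nhds hx)
  refine ⟨⟨(χ : M → ℝ) • s, ?_⟩, ?_⟩
  · exact ContMDiffOn.smul_section_of_tsupport χ.contMDiff.contMDiffOn hu hχ hs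
  · filter_upwards [χ.eventuallyEq_one] with x hx
    change χ x • s x = s x
    rw [hx]; simp

theorem mem_coordDomain {c : M} {y : Plane} : y ∈ coordDomain V E c ↔
    y ∈ (extChartAt (𝓡∂ 2) c).target ∧ pt c y ∈ (trivializationAt V E c).baseSet := by
  unfold coordDomain
  constructor
  · rintro ⟨x, ⟨hx, hb⟩, rfl⟩
    have hx' : x ∈ (extChartAt (𝓡∂ 2) c).source := by rwa [extChartAt_source]
    refine ⟨(extChartAt (𝓡∂ 2) c).map_source hx', ?_⟩
    rwa [pt, (extChartAt (𝓡∂ 2) c).left_inv hx']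
  · rintro ⟨h1, h2⟩
    refine ⟨pt c y, ⟨?_, h2⟩, (extChartAt (𝓡∂ 2) c).right_inv h1⟩
    rw [← extChartAt_source (𝓡∂ 2)]
    exact (extChartAt (𝓡∂ 2) c).map_target h1

theorem isRelOpen_coordDomain (c : M) : IsRelOpen (range (𝓡∂ 2)) (coordDomain V E c) where
  unique := (𝓡∂ 2).uniqueDiffOn
  subset y hy := extChartAt_target_subset_range c (mem_coordDomain.1 hy).1
  nhds y hy := by
    obtain ⟨h1, h2⟩ := mem_coordDomain.1 hy
    have h3 : ContinuousWithinAt (extChartAt (𝓡∂ 2) c).symm (extChartAt (𝓡∂ 2) c).target y :=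
      continuousOn_extChartAt_symm c y h1
    have h4 := h3.eventually_mem ((trivializationAt V E c).open_baseSet.mem_nhds h2)
    have h5 := (isRelOpen_target c).nhds y h1
    have h6 : 𝓝[(extChartAt (𝓡∂ 2) c).target] y = 𝓝[range (𝓡∂ 2)] y :=
      le_antisymm (nhdsWithin_mono _ (isRelOpen_target c).subset)
        (nhdsWithin_le_of_mem h5)
    rw [h6] at h4
    filter_upwards [h4, h5] with z hz hz'
    exact mem_coordDomain.2 ⟨hz', hz⟩

theorem mem_coordDomain_self (x : M) : extChartAt (𝓡∂ 2) x x ∈ coordDomain V E x := by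
  refine mem_coordDomain.2 ⟨mem_extChartAt_target x, ?_⟩
  rw [pt, extChartAt_to_inv]
  exact mem_baseSet_trivializationAt V E x

theorem coordSection_eq (c : M) (u : ∀ x, E x) {y : Plane} (hy : y ∈ coordDomain V E c) :
    coordSection V c u y = (trivializationAt V E c ⟨pt c y, u (pt c y)⟩).2 := by
  rw [coordSection, Bundle.Trivialization.coe_linearMapAt_of_mem _ (mem_coordDomain.1 hy).2]

theorem contDiffWithinAt_coordSection_iff (c : M) (u : ∀ x, E x) {y : Plane}
    (hy : y ∈ coordDomain V E c) :
    ContDiffWithinAt ℝ ∞ (coordSection V c u) (range (𝓡∂ 2)) y ↔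
      ContMDiffAt (𝓡∂ 2) ((𝓡∂ 2).prod 𝓘(ℝ, V)) ∞ (fun x => TotalSpace.mk' V x (u x))
        (pt c y) := by
  rw [(trivializationAt V E c).contMDiffAt_section_iff (mem_coordDomain.1 hy).2,
    ← contDiffWithinAt_chart_iff (mem_coordDomain.1 hy).1]
  have h : ∀ z ∈ coordDomain V E c, coordSection V c u z =
    (fun z => (trivializationAt V E c ⟨pt c z, u (pt c z)⟩).2) z := fun z hz =>
      coordSection_eq c u hz
  have h2 : coordSection V c u =ᶠ[𝓝[range (𝓡∂ 2)] y]
      (fun z => (trivializationAt V E c ⟨pt c z, u (pt c z)⟩).2) :=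
    Filter.eventually_of_mem ((isRelOpen_coordDomain (V := V) (E := E) c).nhds y hy) h
  exact ⟨fun k => k.congr_of_eventuallyEq h2.symm (h y hy).symm,
    fun k => k.congr_of_eventuallyEq h2 (h y hy)⟩

theorem coordSection_smooth (c : M) (u : Sections V E) {y : Plane} (hy : y ∈ coordDomain V E c) :
    ContDiffWithinAt ℝ ∞ (coordSection V c (u : ∀ x, E x)) (range (𝓡∂ 2)) y :=
  (contDiffWithinAt_coordSection_iff c _ hy).2 (u.2 _)

theorem mem_sections_of_coordSection {u : ∀ x, E x}
    (h : ∀ c, ∀ y ∈ coordDomain V E c,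
      ContDiffWithinAt ℝ ∞ (coordSection V c u) (range (𝓡∂ 2)) y) : u ∈ Sections V E := by
  intro x
  have h1 := (contDiffWithinAt_coordSection_iff x u (mem_coordDomain_self x)).1
    (h x _ (mem_coordDomain_self x))
  rwa [pt, extChartAt_to_inv] at h1

/-- The constant vectors of a local trivialization extend to global sections. -/
theorem exists_section_symm [T2Space M] (c : M) (v : V) {x₀ : M}
    (hx : x₀ ∈ (trivializationAt V E c).baseSet) :
    ∃ t : Sections V E, ∀ᶠ x in 𝓝 x₀, (t : ∀ x, E x) x = (trivializationAt V E c).symm x v := by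
  refine exists_section_eventuallyEq (trivializationAt V E c).open_baseSet hx ?_
  intro x hx
  refine ContMDiffAt.contMDiffWithinAt ?_
  rw [(trivializationAt V E c).contMDiffAt_section_iff hx]
  refine (contMDiffAt_const (c := v)).congr_of_eventuallyEq ?_
  filter_upwards [(trivializationAt V E c).open_baseSet.mem_nhds hx] with z hz
  change (trivializationAt V E c ⟨z, (trivializationAt V E c).symm z v⟩).2 = v
  rw [(trivializationAt V E c).apply_mk_symm hz]

end Charts

/-! ### The dual of an oriented Euclidean plane. -/

section OrientedPlane

variable {T : Type*} [NormedAddCommGroup T] [InnerProductSpace ℝ T] [Fact (Module.finrank ℝ T = 2)]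
  (o : Orientation ℝ T (Fin 2))

theorem orientation_eq_iff_areaForm_pos (b : Module.Basis (Fin 2) ℝ T) :
    b.orientation = o ↔ 0 < o.areaForm (b 0) (b 1) := by
  let e := o.finOrthonormalBasis (by norm_num) (Fact.out : Module.finrank ℝ T = 2)
  have he : e.toBasis.orientation = o := o.finOrthonormalBasis_orientation _ _
  have hb : (![b 0, b 1] : Fin 2 → T) = b := by
    ext i; fin_cases i <;> rfl
  rw [o.areaForm_to_volumeForm, o.volumeForm_robust e he, hb,
    ← Module.Basis.orientation_eq_iff_det_pos, he, eq_comm]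

/-- The rotation by the right angle of the dual of an oriented Euclidean plane. -/
def dualRot : (T →L[ℝ] ℝ) →ₗ[ℝ] (T →L[ℝ] ℝ) where
  toFun ξ := -(ξ.comp (o.rightAngleRotation.toContinuousLinearEquiv : T →L[ℝ] T))
  map_add' ξ η := by ext v; simp [add_comm]
  map_smul' a ξ := by ext v; simp

theorem dualRot_apply (ξ : T →L[ℝ] ℝ) (v : T) : dualRot o ξ v = -ξ (o.rightAngleRotation v) := rfl

/-- The sign in `dualRot` is chosen so that the Riesz isomorphism intertwines the rotations of
vectors and covectors. -/
theorem dualRot_innerSL (v : T) : dualRot o (innerSL ℝ v) = innerSL ℝ (o.rightAngleRotation v) := by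
  ext w
  rw [dualRot_apply, innerSL_apply_apply, innerSL_apply_apply, o.inner_rightAngleRotation_right,
    o.inner_rightAngleRotation_left, neg_neg]

theorem exists_eq_innerSL (ξ : T →L[ℝ] ℝ) : ∃ v : T, ξ = innerSL ℝ v := by
  haveI : FiniteDimensional ℝ T := .of_fact_finrank_eq_two
  haveI : CompleteSpace T := FiniteDimensional.complete ℝ T
  exact ⟨(InnerProductSpace.toDual ℝ T).symm ξ, by ext w; simp⟩

/-- Everything is transferred to vectors by the Riesz isomorphism; orientation is governed by (aξ +
bJξ) ∧ (cξ + dJξ) = (ad - bc)‖ξ‖² times the area form. -/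
theorem isConfPlane_dual : IsConfPlane (fun ξ η : T →L[ℝ] ℝ =>
    ∃ b : Module.Basis (Fin 2) ℝ T, b.orientation = o ∧ 0 < ξ (b 0) * η (b 1) - ξ (b 1) * η (b 0))
    (dualRot o) (fun ξ => ‖ξ‖) where
  J_J ξ := by
    ext v
    simp [dualRot_apply]
  span ξ hξ η := by
    obtain ⟨v, rfl⟩ := exists_eq_innerSL ξ
    obtain ⟨w, rfl⟩ := exists_eq_innerSL η
    have hv : v ≠ 0 := by rintro rfl; exact hξ (map_zero _)
    have h := (o.basisRightAngleRotation v hv).sum_repr w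
    rw [Fin.sum_univ_two, o.coe_basisRightAngleRotation] at h
    refine ⟨(o.basisRightAngleRotation v hv).repr w 0, (o.basisRightAngleRotation v hv).repr w 1, ?_⟩
    rw [dualRot_innerSL, ← map_smul, ← map_smul, ← map_add]
    exact congrArg _ h.symm
  pos_iff ξ hξ a b c d := by
    obtain ⟨v, rfl⟩ := exists_eq_innerSL ξ
    have hv : v ≠ 0 := by rintro rfl; exact hξ (map_zero _)
    have key : ∀ x y : T, (a • innerSL ℝ v + b • dualRot o (innerSL ℝ v)) x *
        (c • innerSL ℝ v + d • dualRot o (innerSL ℝ v)) y -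
        (a • innerSL ℝ v + b • dualRot o (innerSL ℝ v)) y *
        (c • innerSL ℝ v + d • dualRot o (innerSL ℝ v)) x =
        (a * d - b * c) * (‖v‖ ^ 2 * o.areaForm x y) := by
      intro x y
      rw [← o.inner_mul_areaForm_sub v x y, dualRot_innerSL]
      simp only [add_apply, smul_apply, innerSL_apply_apply, o.inner_rightAngleRotation_left,
        smul_eq_mul]
      ring
    simp only [key]
    constructor
    · rintro ⟨e, he, h⟩
      have h1 := (orientation_eq_iff_areaForm_pos o e).1 he
      have h2 : 0 < ‖v‖ ^ 2 * o.areaForm (e 0) (e 1) :=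
        mul_pos (pow_pos (norm_pos_iff.2 hv) 2) h1
      exact pos_of_mul_pos_left h h2.le
    · intro h
      let e := o.finOrthonormalBasis (by norm_num) (Fact.out : Module.finrank ℝ T = 2)
      have he : e.toBasis.orientation = o := o.finOrthonormalBasis_orientation _ _
      refine ⟨e.toBasis, he, mul_pos h (mul_pos (pow_pos (norm_pos_iff.2 hv) 2) ?_)⟩
      exact (orientation_eq_iff_areaForm_pos o e.toBasis).1 he
  nn_pos ξ hξ := norm_pos_iff.2 hξ
  nn_comb ξ a b := by
    obtain ⟨v, rfl⟩ := exists_eq_innerSL ξ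
    rw [dualRot_innerSL, ← map_smul, ← map_smul, ← map_add, innerSL_apply_norm, innerSL_apply_norm,
      ← real_inner_self_eq_norm_sq, ← real_inner_self_eq_norm_sq]
    simp only [inner_add_left, inner_add_right, inner_smul_left, inner_smul_right,
      o.inner_rightAngleRotation_left, o.inner_rightAngleRotation_right, o.areaForm_apply_self,
      o.areaForm_rightAngleRotation_right]
    simp
    ring
  nontriv := by
    have : Nontrivial T := Module.nontrivial_of_finrank_pos (R := ℝ) (by
      rw [(Fact.out : Module.finrank ℝ T = 2)]; norm_num)
    obtain ⟨v, hv⟩ := exists_ne (0 : T)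
    refine ⟨innerSL ℝ v, fun h => hv ?_⟩
    have := congrArg (fun ξ : T →L[ℝ] ℝ => ξ v) h
    simpa using this

/-- The conformal structure is expressed through the Gram coefficients of a basis and its signed
area alone. These are smooth functions in a chart, and so the rotation will be smooth. -/
theorem dualRot_dual_basis {v₀ v₁ : T} {d₀ d₁ : T →L[ℝ] ℝ} (h00 : d₀ v₀ = 1) (h01 : d₀ v₁ = 0)
    (h10 : d₁ v₀ = 0) (h11 : d₁ v₁ = 1)
    (hext : ∀ v : T, v = d₀ v • v₀ + d₁ v • v₁) :
    0 < inner ℝ v₀ v₀ * inner ℝ v₁ v₁ - inner ℝ v₀ v₁ ^ 2 ∧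
    0 < inner ℝ v₁ v₁ ∧
    (o.areaForm v₀ v₁) ^ 2 = inner ℝ v₀ v₀ * inner ℝ v₁ v₁ - inner ℝ v₀ v₁ ^ 2 ∧
    ‖d₀‖ ^ 2 = inner ℝ v₁ v₁ / (inner ℝ v₀ v₀ * inner ℝ v₁ v₁ - inner ℝ v₀ v₁ ^ 2) ∧
    dualRot o d₀ =
      (o.areaForm v₀ v₁ / (inner ℝ v₀ v₀ * inner ℝ v₁ v₁ - inner ℝ v₀ v₁ ^ 2) *
        inner ℝ v₀ v₁) • d₀ +
      (o.areaForm v₀ v₁ / (inner ℝ v₀ v₀ * inner ℝ v₁ v₁ - inner ℝ v₀ v₁ ^ 2) *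
        inner ℝ v₁ v₁) • d₁ := by
  set a := inner ℝ v₀ v₀ with ha
  set b := inner ℝ v₀ v₁ with hb
  set c := inner ℝ v₁ v₁ with hc
  set w := o.areaForm v₀ v₁ with hw
  have hw2 : w ^ 2 = a * c - b ^ 2 := by
    have := o.inner_sq_add_areaForm_sq v₀ v₁
    rw [← real_inner_self_eq_norm_sq, ← real_inner_self_eq_norm_sq] at this
    linarith
  have hv1 : v₁ ≠ 0 := by rintro rfl; simp at h11
  have hc0 : 0 < c := by rw [hc, real_inner_self_eq_norm_sq]; exact pow_pos (norm_pos_iff.2 hv1) 2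
  have hba : inner ℝ v₁ v₀ = b := real_inner_comm _ _
  have hdet : 0 < a * c - b ^ 2 := by
    rcases (sq_nonneg w).lt_or_eq with h | h
    · rwa [hw2] at h
    · exfalso
      have h0 : w ^ 2 = 0 := h.symm
      have h1 : c • v₀ - b • v₁ = 0 := by
        rw [← inner_self_eq_zero (𝕜 := ℝ)]
        simp only [inner_sub_left, inner_sub_right, inner_smul_left, inner_smul_right, ← ha, ← hb,
          ← hc, hba]
        simp
        rw [hw2] at h0
        linear_combination c * h0
      have := congrArg d₀ h1
      simp [h00, h01] at this
      exact hc0.ne' this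
  set D := a * c - b ^ 2 with hD
  -- The Riesz representative of d₀, from the inverse of the Gram matrix with entries a, b, b, c.
  have e0 : d₀ = innerSL ℝ ((c / D) • v₀ - (b / D) • v₁) := by
    ext v
    rw [hext v]
    simp only [map_add, map_smul, h00, h01, innerSL_apply_apply, inner_sub_left, inner_add_right,
      inner_smul_left, inner_smul_right, hba, ← ha, ← hb, ← hc, smul_eq_mul]
    simp
    field_simp
    rw [hD]; ring
  refine ⟨hdet, hc0, hw2, ?_, ?_⟩
  · conv_lhs => rw [e0]
    rw [innerSL_apply_norm, ← real_inner_self_eq_norm_sq]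
    simp only [inner_sub_left, inner_sub_right, inner_smul_left, inner_smul_right, hba, ← ha, ← hb,
      ← hc]
    simp
    field_simp
    rw [hD]; ring
  · conv_lhs => rw [e0]
    rw [dualRot_innerSL]
    ext v
    rw [hext v]
    have hsw : o.areaForm v₁ v₀ = -w := by rw [o.areaForm_swap]
    simp only [innerSL_apply_apply, o.inner_rightAngleRotation_left, map_sub, map_smul, map_add,
      sub_apply, LinearMap.sub_apply, LinearMap.smul_apply, add_apply, smul_apply, h00, h01, h10, h11,
      o.areaForm_apply_self, hsw, ← hw, smul_eq_mul]
    ring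

end OrientedPlane

/-! ### The Riemannian metric and the rotation of covectors in coordinates. -/

section ConformalStructure

open Set

variable {M : Type*} [TopologicalSpace M] [ChartedSpace (EuclideanHalfSpace 2) M]
  [IsManifold (𝓡∂ 2) ∞ M]

theorem coordVec_eq {c x : M} (hx : x ∈ (chartAt (EuclideanHalfSpace 2) c).source) (j : Fin 2) :
    (trivializationAt Plane (TangentSpace (𝓡∂ 2)) c ⟨x, coordVec c x j⟩).2 =
      EuclideanSpace.single j 1 := by
  have hb : x ∈ (trivializationAt Plane (TangentSpace (𝓡∂ 2)) c).baseSet := hx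
  have h := (trivializationAt Plane (TangentSpace (𝓡∂ 2)) c).continuousLinearMapAt_symmL
    (R := ℝ) hb (EuclideanSpace.single j 1)
  rwa [Trivialization.continuousLinearMapAt_apply,
    Bundle.Trivialization.coe_linearMapAt_of_mem _ hb] at h

theorem coordCovec_coordVec {c x : M} (hx : x ∈ (chartAt (EuclideanHalfSpace 2) c).source)
    (i j : Fin 2) : coordCovec c x i (coordVec c x j) = if i = j then 1 else 0 := by
  have hb : x ∈ (trivializationAt Plane (TangentSpace (𝓡∂ 2)) c).baseSet := hx
  have h := (trivializationAt Plane (TangentSpace (𝓡∂ 2)) c).continuousLinearMapAt_symmL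
    (R := ℝ) hb (EuclideanSpace.single j 1)
  have h2 := congrArg (EuclideanSpace.proj i : Plane →L[ℝ] ℝ) h
  refine h2.trans ?_
  simp [EuclideanSpace.single_apply]

theorem eq_sum_coordVec {c x : M} (hx : x ∈ (chartAt (EuclideanHalfSpace 2) c).source)
    (v : Tan x) : v = coordCovec c x 0 v • coordVec c x 0 + coordCovec c x 1 v • coordVec c x 1 := by
  have hb : x ∈ (trivializationAt Plane (TangentSpace (𝓡∂ 2)) c).baseSet := hx
  have h := (trivializationAt Plane (TangentSpace (𝓡∂ 2)) c).symmL_continuousLinearMapAt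
    (R := ℝ) hb v
  conv_lhs => rw [← h]
  rw [coordVec, coordVec, ← map_smul, ← map_smul, ← map_add]
  congr 1
  ext i
  fin_cases i <;> simp [coordCovec]

theorem eq_sum_coordCovec {c x : M} (hx : x ∈ (chartAt (EuclideanHalfSpace 2) c).source)
    (ξ : Tan x →L[ℝ] ℝ) :
    ξ = ξ (coordVec c x 0) • coordCovec c x 0 + ξ (coordVec c x 1) • coordCovec c x 1 := by
  ext v
  conv_lhs => rw [eq_sum_coordVec hx v]
  simp
  ring

theorem coordCovec_ne_zero {c x : M} (hx : x ∈ (chartAt (EuclideanHalfSpace 2) c).source)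
    (j : Fin 2) : coordCovec c x j ≠ 0 := by
  intro h
  have := coordCovec_coordVec hx j j
  rw [h] at this
  simp at this

theorem coordVec_contMDiffAt {c x : M} (hx : x ∈ (chartAt (EuclideanHalfSpace 2) c).source)
    (j : Fin 2) : ContMDiffAt (𝓡∂ 2) ((𝓡∂ 2).prod 𝓘(ℝ, Plane)) ∞
      (fun x => TotalSpace.mk' Plane (E := TangentSpace (𝓡∂ 2)) x (coordVec c x j)) x := by
  rw [(trivializationAt Plane (TangentSpace (𝓡∂ 2)) c).contMDiffAt_section_iff hx]
  refine (contMDiffAt_const (c := EuclideanSpace.single j 1)).congr_of_eventuallyEq ?_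
  filter_upwards [(chartAt (EuclideanHalfSpace 2) c).open_source.mem_nhds hx] with z hz
  exact coordVec_eq hz j

theorem coordCovec_coordVec_contMDiffAt {c c' x : M}
    (hx : x ∈ (chartAt (EuclideanHalfSpace 2) c).source)
    (hx' : x ∈ (chartAt (EuclideanHalfSpace 2) c').source) (i j : Fin 2) :
    ContMDiffAt (𝓡∂ 2) 𝓘(ℝ, ℝ) ∞ (fun x => coordCovec c x i (coordVec c' x j)) x := by
  have h := coordVec_contMDiffAt hx' j
  rw [(trivializationAt Plane (TangentSpace (𝓡∂ 2)) c).contMDiffAt_section_iff hx] at h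
  have h2 := ((EuclideanSpace.proj i : Plane →L[ℝ] ℝ).contDiff (n := ∞)).contMDiff.contMDiffAt.comp x h
  refine h2.congr_of_eventuallyEq ?_
  filter_upwards [(chartAt (EuclideanHalfSpace 2) c).open_source.mem_nhds hx] with z hz
  have h3 : (trivializationAt Plane (TangentSpace (𝓡∂ 2)) c).continuousLinearMapAt ℝ z
      (coordVec c' z j) =
        (trivializationAt Plane (TangentSpace (𝓡∂ 2)) c ⟨z, coordVec c' z j⟩).2 := by
    rw [Trivialization.continuousLinearMapAt_apply,
      Bundle.Trivialization.coe_linearMapAt_of_mem _ hz]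
  exact congrArg (EuclideanSpace.proj i : Plane →L[ℝ] ℝ) h3

/-- The differential of a function in coordinates. -/
theorem dAt_coordVec (f : C^∞⟮𝓡∂ 2, M; ℝ⟯) {c : M} {y : Plane}
    (hy : y ∈ (extChartAt (𝓡∂ 2) c).target) (j : Fin 2) :
    dAt f (pt c y) (coordVec c (pt c y) j) =
      fderivWithin ℝ (fun z => f (pt c z)) (range (𝓡∂ 2)) y (EuclideanSpace.single j 1) := by
  have hx : pt c y ∈ (chartAt (EuclideanHalfSpace 2) c).source := by
    rw [← extChartAt_source (𝓡∂ 2)]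
    exact (extChartAt (𝓡∂ 2) c).map_target hy
  have hr := (extChartAt (𝓡∂ 2) c).right_inv hy
  have hyr : y ∈ range (𝓡∂ 2) := extChartAt_target_subset_range c hy
  rw [coordVec, TangentBundle.symmL_trivializationAt hx]
  have h1 := mfderiv_comp_mfderivWithin (I := 𝓘(ℝ, Plane)) (I' := 𝓡∂ 2) (I'' := 𝓘(ℝ, ℝ)) y
    (s := range (𝓡∂ 2)) (g := f) (f := (extChartAt (𝓡∂ 2) c).symm)
    ((f.contMDiff.mdifferentiable (by simp)) _)
    (mdifferentiableWithinAt_extChartAt_symm hy)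
    ((𝓡∂ 2).uniqueMDiffOn y hyr)
  rw [mfderivWithin_eq_fderivWithin] at h1
  rw [hr]
  exact (DFunLike.congr_fun h1 (EuclideanSpace.single j 1)).symm

variable [RiemannianBundle (fun x : M => TangentSpace (𝓡∂ 2) x)]

instance finrank_tangent (x : M) : Fact (Module.finrank ℝ (Tan x) = 2) :=
  ⟨by change Module.finrank ℝ Plane = 2; simp⟩

/-- The conformal rotation of the cotangent plane. -/
def SurfaceOrientation.J (o : SurfaceOrientation M) (x : M) :
    (Tan x →L[ℝ] ℝ) →ₗ[ℝ] (Tan x →L[ℝ] ℝ) := dualRot (o.at_ x)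

theorem SurfaceOrientation.isConfPlane (o : SurfaceOrientation M) (x : M) :
    IsConfPlane (o.PosCoframe x) (o.J x) (fun ξ => ‖ξ‖) :=
  isConfPlane_dual (o.at_ x)

/-- The Riemannian metric in coordinates. -/
def metricCoeff (c x : M) (i j : Fin 2) : ℝ := inner ℝ (coordVec c x i) (coordVec c x j)

/-- The signed Riemannian area of the coordinate frame. -/
def SurfaceOrientation.area (o : SurfaceOrientation M) (c x : M) : ℝ :=
  (o.at_ x).areaForm (coordVec c x 0) (coordVec c x 1)

/-- The determinant of the metric in coordinates. -/
def metricDet (c x : M) : ℝ :=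
  metricCoeff c x 0 0 * metricCoeff c x 1 1 - metricCoeff c x 0 1 ^ 2

theorem conformal_coordinates (o : SurfaceOrientation M) {c x : M}
    (hx : x ∈ (chartAt (EuclideanHalfSpace 2) c).source) :
    0 < metricDet c x ∧ 0 < metricCoeff c x 1 1 ∧ o.area c x ^ 2 = metricDet c x ∧
      ‖coordCovec c x 0‖ ^ 2 = metricCoeff c x 1 1 / metricDet c x ∧
      o.J x (coordCovec c x 0) =
        (o.area c x / metricDet c x * metricCoeff c x 0 1) • coordCovec c x 0 +
        (o.area c x / metricDet c x * metricCoeff c x 1 1) • coordCovec c x 1 :=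
  dualRot_dual_basis (o.at_ x) (by simp [coordCovec_coordVec hx])
    (by simp [coordCovec_coordVec hx]) (by simp [coordCovec_coordVec hx])
    (by simp [coordCovec_coordVec hx]) (eq_sum_coordVec hx)

theorem metricCoeff_contMDiffAt
    [IsContMDiffRiemannianBundle (𝓡∂ 2) ∞ Plane (fun x : M => TangentSpace (𝓡∂ 2) x)] {c x : M}
    (hx : x ∈ (chartAt (EuclideanHalfSpace 2) c).source) (i j : Fin 2) :
    ContMDiffAt (𝓡∂ 2) 𝓘(ℝ, ℝ) ∞ (fun x => metricCoeff c x i j) x :=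
  ContMDiffAt.inner_bundle (coordVec_contMDiffAt hx i) (coordVec_contMDiffAt hx j)

/-- The coordinate frame as a basis. -/
def coordBasis {c x : M} (hx : x ∈ (chartAt (EuclideanHalfSpace 2) c).source) :
    Module.Basis (Fin 2) ℝ (Tan x) :=
  Module.Basis.mk (v := coordVec c x) (by
    rw [Fintype.linearIndependent_iff]
    intro g hg i
    have := congrArg (coordCovec c x i) hg
    fin_cases i <;> simpa [coordCovec_coordVec hx] using this)
    (by
      intro v _
      rw [eq_sum_coordVec hx v]
      exact Submodule.add_mem _ (Submodule.smul_mem _ _ (Submodule.subset_span ⟨0, rfl⟩))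
        (Submodule.smul_mem _ _ (Submodule.subset_span ⟨1, rfl⟩)))

theorem SurfaceOrientation.area_pos_iff (o : SurfaceOrientation M) {c x : M}
    (hx : x ∈ (chartAt (EuclideanHalfSpace 2) c).source) :
    0 < o.area c x ↔ ∃ b : Module.Basis (Fin 2) ℝ (Tan x), (∀ j, b j = coordVec c x j) ∧
      b.orientation = o.at_ x := by
  constructor
  · intro h
    have h0 : ∀ j, coordBasis hx j = coordVec c x j := fun j => by simp [coordBasis]
    refine ⟨coordBasis hx, h0, ?_⟩
    rw [orientation_eq_iff_areaForm_pos, h0, h0]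
    exact h
  · rintro ⟨b, hb, ho⟩
    rw [orientation_eq_iff_areaForm_pos, hb, hb] at ho
    exact ho

theorem SurfaceOrientation.area_change (o : SurfaceOrientation M) {c c' x : M}
    (hx' : x ∈ (chartAt (EuclideanHalfSpace 2) c').source) :
    o.area c x = (coordCovec c' x 0 (coordVec c x 0) * coordCovec c' x 1 (coordVec c x 1) -
      coordCovec c' x 1 (coordVec c x 0) * coordCovec c' x 0 (coordVec c x 1)) * o.area c' x := by
  unfold SurfaceOrientation.area
  conv_lhs => rw [eq_sum_coordVec hx' (coordVec c x 0), eq_sum_coordVec hx' (coordVec c x 1)]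
  simp only [map_add, map_smul, LinearMap.add_apply, LinearMap.smul_apply,
    (o.at_ x).areaForm_apply_self, (o.at_ x).areaForm_swap (coordVec c' x 1) (coordVec c' x 0),
    smul_eq_mul]
  ring

variable [IsContMDiffRiemannianBundle (𝓡∂ 2) ∞ Plane (fun x : M => TangentSpace (𝓡∂ 2) x)]

theorem metricDet_contMDiffAt {c x : M}
    (hx : x ∈ (chartAt (EuclideanHalfSpace 2) c).source) :
    ContMDiffAt (𝓡∂ 2) 𝓘(ℝ, ℝ) ∞ (metricDet c) x :=
  ((metricCoeff_contMDiffAt hx 0 0).mul (metricCoeff_contMDiffAt hx 1 1)).sub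
    ((metricCoeff_contMDiffAt hx 0 1).pow 2)

/-- The area squares to the metric determinant, so in the chart centred at the point it is a locally
constant sign times a smooth root; this is where local constancy of the orientation enters. Any
other chart differs by a smooth Jacobian determinant. -/
theorem SurfaceOrientation.area_contMDiffAt (o : SurfaceOrientation M) {c x : M}
    (hx : x ∈ (chartAt (EuclideanHalfSpace 2) c).source) :
    ContMDiffAt (𝓡∂ 2) 𝓘(ℝ, ℝ) ∞ (o.area c) x := by
  have hxx : x ∈ (chartAt (EuclideanHalfSpace 2) x).source := mem_chart_source _ _
  have root : ∀ᶠ z in 𝓝 x, o.area x z = SignType.sign (o.area x x) * Real.sqrt (metricDet x z) := by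
    filter_upwards [o.locally_constant x,
      (chartAt (EuclideanHalfSpace 2) x).open_source.mem_nhds hxx] with z hz hzs
    rw [← o.area_pos_iff hzs, ← o.area_pos_iff hxx] at hz
    have h1 := conformal_coordinates o hzs
    have h2 := conformal_coordinates o hxx
    have hne : o.area x z ≠ 0 := by
      intro h; rw [h] at h1; have := h1.2.2.1; have := h1.1; simp_all
    have hne' : o.area x x ≠ 0 := by
      intro h; rw [h] at h2; have := h2.2.2.1; have := h2.1; simp_all
    rw [← h1.2.2.1, Real.sqrt_sq_eq_abs]
    rcases lt_or_gt_of_ne hne' with h | h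
    · have h3 : o.area x z < 0 := lt_of_le_of_ne (not_lt.1 fun h3 => absurd (hz.1 h3) h.not_gt) hne
      rw [sign_neg h, abs_of_neg h3]; simp
    · rw [sign_pos h, abs_of_pos (hz.2 h)]; simp
  have h1 : ContMDiffAt (𝓡∂ 2) 𝓘(ℝ, ℝ) ∞ (fun z => Real.sqrt (metricDet x z)) x :=
    ((Real.contDiffAt_sqrt (conformal_coordinates o hxx).1.ne').contMDiffAt).comp x
      (metricDet_contMDiffAt hxx)
  have h2 : ContMDiffAt (𝓡∂ 2) 𝓘(ℝ, ℝ) ∞ (o.area x) x :=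
    (contMDiffAt_const.mul h1).congr_of_eventuallyEq root
  have h3 := coordCovec_coordVec_contMDiffAt hxx hx
  refine ((((h3 0 0).mul (h3 1 1)).sub ((h3 1 0).mul (h3 0 1))).mul h2).congr_of_eventuallyEq ?_
  filter_upwards [(chartAt (EuclideanHalfSpace 2) x).open_source.mem_nhds hxx] with z hz
  exact o.area_change hz

end ConformalStructure

/-! ### The projection onto E⁺ along E⁻ as a circle integral. -/

section SpectralProjectionIntegral

variable {T : Type*} [AddCommGroup T] [Module ℝ T]
  {W : Type*} [NormedAddCommGroup W] [InnerProductSpace ℂ W] [FiniteDimensional ℂ W]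
  {pos : T → T → Prop} {J : T →ₗ[ℝ] T} {nn : T → ℝ} {S : T →ₗ[ℝ] Module.End ℂ W}
  {ℬ : Type*} [NormedRing ℬ] [NormedAlgebra ℂ ℬ] [CompleteSpace ℬ]

theorem circInt_qop (Ψ : Module.End ℂ W ≃ₐ[ℂ] ℬ) (hS : IsEllSymb S) (C : IsConfPlane pos J nn)
    {ξ : T} (hξ : ξ ≠ 0) : (∀ φ, IsUnit (circ (Ψ (qop J S ξ)) φ)) ∧
      circInt (Ψ (qop J S ξ)) = (2 * Real.pi * Complex.I : ℂ) • Ψ (2 * specP pos S - 1) := by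
  have hlow : ∀ v, specP pos S v = 0 → v ∈ lowSp pos S := fun v hv => by
    have := sub_specP_mem hS C v
    rwa [hv, sub_zero] at this
  refine circInt_spectral Ψ (specP_mul_self hS C) ?_ ?_ ?_
  · refine LinearMap.ext fun v => ?_
    have h1 : qop J S ξ (specP pos S v) ∈ highSp pos S := by
      have := specP_mem (pos := pos) (S := S) v
      rw [hS.highSp_eq C hξ] at this ⊢
      exact specHigh_invariant _ this
    have h2 : qop J S ξ (v - specP pos S v) ∈ lowSp pos S := by
      have := sub_specP_mem hS C v
      rw [hS.lowSp_eq C hξ] at this ⊢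
      exact specLow_invariant _ this
    have h3 : qop J S ξ v = qop J S ξ (specP pos S v) + qop J S ξ (v - specP pos S v) := by
      rw [← map_add, add_sub_cancel]
    rw [Module.End.mul_apply, Module.End.mul_apply]
    conv_lhs => rw [h3]
    rw [map_add, specP_of_high hS C h1, specP_of_low hS C h2, add_zero]
  · intro z w hw hz hne
    have h1 : w ∈ highSp pos S := hw ▸ specP_mem w
    rw [hS.highSp_eq C hξ] at h1
    exact im_pos_of_mem_specHigh h1 hne hz
  · intro z w hw hz hne
    have h1 := hlow w hw
    rw [hS.lowSp_eq C hξ] at h1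
    exact im_neg_of_mem_specLow h1 hne hz

end SpectralProjectionIntegral

/-! ### Fibre endomorphisms and adjoints in a local trivialization. -/

section FibreAlgebra

variable {M : Type*} [TopologicalSpace M] [ChartedSpace (EuclideanHalfSpace 2) M]
  [IsManifold (𝓡∂ 2) ∞ M]
variable {V : Type*} [NormedAddCommGroup V] [NormedSpace ℂ V] [FiniteDimensional ℂ V]
  {E : M → Type*} [TopologicalSpace (TotalSpace V E)]
  [∀ x, NormedAddCommGroup (E x)] [∀ x, InnerProductSpace ℂ (E x)]
  [FiberBundle V E] [VectorBundle ℂ V E] [VectorBundle ℝ V E]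
  [ContMDiffVectorBundle ∞ V E (𝓡∂ 2)]

theorem finiteDimensional_fibre (V : Type*) [NormedAddCommGroup V] [NormedSpace ℂ V]
    [FiniteDimensional ℂ V] {E : M → Type*} [TopologicalSpace (TotalSpace V E)]
    [∀ x, NormedAddCommGroup (E x)] [∀ x, InnerProductSpace ℂ (E x)]
    [FiberBundle V E] [VectorBundle ℂ V E] (x : M) : FiniteDimensional ℂ (E x) :=
  LinearEquiv.finiteDimensional ((trivializationAt V E x).linearEquivAt ℂ x
    (mem_baseSet_trivializationAt V E x)).symm

/-- The local trivialization identifies the endomorphisms of a fibre with those of `V`. -/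
def endAlg {c x : M} (hx : x ∈ (trivializationAt V E c).baseSet) :
    Module.End ℂ (E x) ≃ₐ[ℂ] (V →L[ℂ] V) :=
  (((trivializationAt V E c).linearEquivAt ℂ x hx).conjAlgEquiv ℂ).trans
    (Module.End.toContinuousLinearMap V)

theorem endInTriv_apply_symm {c x : M}
    (B : Module.End ℂ (E x)) (v : V) : endInTriv V c x B v =
      (trivializationAt V E c).linearMapAt ℂ x (B ((trivializationAt V E c).symmₗ ℂ x v)) := rfl

theorem endInTriv_eq {c x : M} (hx : x ∈ (trivializationAt V E c).baseSet)
    (B : Module.End ℂ (E x)) : endInTriv V c x B = endAlg hx B := by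
  ext v
  rw [endInTriv_apply_symm, Bundle.Trivialization.coe_linearMapAt_of_mem _ hx,
    Bundle.Trivialization.coe_symmₗ]
  · rfl
  · exact hx

theorem endInTriv_apply {c x : M} (hx : x ∈ (trivializationAt V E c).baseSet)
    (B : Module.End ℂ (E x)) (u : E x) :
    endInTriv V c x B ((trivializationAt V E c).linearMapAt ℂ x u) =
      (trivializationAt V E c).linearMapAt ℂ x (B u) := by
  have h := (trivializationAt V E c).symmₗ_linearMapAt (R := ℂ) hx u
  change (trivializationAt V E c).linearMapAt ℂ x (B ((trivializationAt V E c).symmₗ ℂ x _)) = _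
  rw [h]

variable (V) in
/-- The Euclidean model of the fibre. -/
abbrev EucModel : Type := EuclideanSpace ℂ (Fin (Module.finrank ℂ V))

variable (V) in
/-- An identification of the model fibre with a Euclidean space. -/
def eucEquiv : V ≃L[ℂ] EucModel V :=
  ContinuousLinearEquiv.ofFinrankEq (by simp)

variable (V) in
/-- The identification of the endomorphisms of the two model fibres. -/
def endEuc : (V →L[ℂ] V) ≃L[ℂ] (EucModel V →L[ℂ] EucModel V) :=
  (eucEquiv V).arrowCongr (eucEquiv V)

variable [∀ x, FiniteDimensional ℂ (E x)]

variable (V) in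
/-- The matrix of the Hermitian metric in the local trivialization around `c`. -/
def gram (c x : M) : EucModel V →L[ℂ] EucModel V :=
  LinearMap.toContinuousLinearMap
    (LinearMap.adjoint ((trivializationAt V E c).symmₗ ℂ x ∘ₗ (eucEquiv V).symm.toLinearMap) ∘ₗ
      ((trivializationAt V E c).symmₗ ℂ x ∘ₗ (eucEquiv V).symm.toLinearMap))

theorem inner_gram (c x : M) (u v : EucModel V) :
    inner ℂ u (gram (E := E) V c x v) =
      inner ℂ ((trivializationAt V E c).symmₗ ℂ x ((eucEquiv V).symm u))
        ((trivializationAt V E c).symmₗ ℂ x ((eucEquiv V).symm v)) := by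
  change inner ℂ u (LinearMap.adjoint ((trivializationAt V E c).symmₗ ℂ x ∘ₗ
    (eucEquiv V).symm.toLinearMap) _) = _
  rw [LinearMap.adjoint_inner_right]
  rfl

theorem gram_isUnit {c x : M} (hx : x ∈ (trivializationAt V E c).baseSet) :
    IsUnit (gram (E := E) V c x) := by
  have h : IsUnit ((gram (E := E) V c x : EucModel V →L[ℂ] EucModel V) :
      EucModel V →ₗ[ℂ] EucModel V) := by
    rw [LinearMap.isUnit_iff_ker_eq_bot, LinearMap.ker_eq_bot']
    intro v hv
    have h1 := inner_gram (E := E) c x v v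
    have h2 : gram (E := E) V c x v = 0 := hv
    rw [h2, inner_zero_right, eq_comm, inner_self_eq_zero] at h1
    have h3 := (trivializationAt V E c).linearMapAt_symmₗ (R := ℂ) hx ((eucEquiv V).symm v)
    rw [h1, map_zero] at h3
    exact (eucEquiv V).symm.map_eq_zero_iff.1 h3.symm
  have h2 := h.map (Module.End.toContinuousLinearMap (𝕜 := ℂ) (EucModel V))
  exact h2

/-- The adjoint of an endomorphism in a local trivialization. -/
theorem endInTriv_star {c x : M} (hx : x ∈ (trivializationAt V E c).baseSet)
    (B : Module.End ℂ (E x)) : endInTriv V c x (star B) =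
      (endEuc V).symm (Ring.inverse (gram (E := E) V c x) *
        star (endEuc V (endInTriv V c x B)) * gram (E := E) V c x) := by
  set τ : EucModel V → E x := fun u => (trivializationAt V E c).symmₗ ℂ x ((eucEquiv V).symm u) with hτ
  have hτB : ∀ (B : Module.End ℂ (E x)) u, τ (endEuc V (endInTriv V c x B) u) = B (τ u) := by
    intro B u
    change (trivializationAt V E c).symmₗ ℂ x ((eucEquiv V).symm ((eucEquiv V)
      (endInTriv V c x B ((eucEquiv V).symm u)))) = _
    rw [ContinuousLinearEquiv.symm_apply_apply, endInTriv_apply_symm,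
      (trivializationAt V E c).symmₗ_linearMapAt hx]
  have hg : ∀ u v, inner ℂ u (gram (E := E) V c x v) = inner ℂ (τ u) (τ v) := inner_gram c x
  -- With G the matrix of the metric, ⟨u, Gv⟩ is the inner product in the fibre, so the fibre
  -- adjoint of B has the matrix G⁻¹B*G.
  have key : gram (E := E) V c x * endEuc V (endInTriv V c x (star B)) =
      star (endEuc V (endInTriv V c x B)) * gram (E := E) V c x := by
    ext1 v
    refine ext_inner_left ℂ fun u => ?_
    change inner ℂ u (gram (E := E) V c x (endEuc V (endInTriv V c x (star B)) v)) =
      inner ℂ u (star (endEuc V (endInTriv V c x B)) (gram (E := E) V c x v))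
    rw [ContinuousLinearMap.star_eq_adjoint, ContinuousLinearMap.adjoint_inner_right, hg, hg, hτB,
      hτB, LinearMap.star_eq_adjoint, LinearMap.adjoint_inner_right]
  rw [ContinuousLinearEquiv.eq_symm_apply, mul_assoc, ← key, ← mul_assoc,
    Ring.inverse_mul_cancel _ (gram_isUnit hx), one_mul]

end FibreAlgebra

/-! ### Regular families of fibre endomorphisms. -/

section RegularEndomorphisms

open Set

variable {M : Type*} [TopologicalSpace M] [ChartedSpace (EuclideanHalfSpace 2) M]
  [IsManifold (𝓡∂ 2) ∞ M]

variable {V : Type*} [NormedAddCommGroup V] [NormedSpace ℂ V] [FiniteDimensional ℂ V]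
  {E : M → Type*} [TopologicalSpace (TotalSpace V E)]
  [∀ x, NormedAddCommGroup (E x)] [∀ x, InnerProductSpace ℂ (E x)]
  [FiberBundle V E] [VectorBundle ℂ V E] [VectorBundle ℝ V E]
  [ContMDiffVectorBundle ∞ V E (𝓡∂ 2)]

variable {P : Type*} [NormedAddCommGroup P] [NormedSpace ℝ P]

variable (V E) in
/-- `p` is a smooth map of the relatively open set `D` to the coordinate domain around `c`. -/
structure IsPlot (c : M) (k : ℕ∞) (S D : Set P) (p : P → M) : Prop where
  one_le : 1 ≤ k
  relOpen : IsRelOpen S D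
  source : ∀ y ∈ D, p y ∈ (chartAt (EuclideanHalfSpace 2) c).source
  base : ∀ y ∈ D, p y ∈ (trivializationAt V E c).baseSet
  smooth : ∀ y ∈ D, ContMDiffWithinAt 𝓘(ℝ, P) (𝓡∂ 2) k p S y

theorem isPlot_pt (c : M) : IsPlot V E c ⊤ (range (𝓡∂ 2)) (coordDomain V E c) (pt c) where
  one_le := le_top
  relOpen := isRelOpen_coordDomain c
  source y hy := by
    rw [← extChartAt_source (𝓡∂ 2)]
    exact (extChartAt (𝓡∂ 2) c).map_target (mem_coordDomain.1 hy).1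
  base y hy := (mem_coordDomain.1 hy).2
  smooth y hy := contMDiffWithinAt_extChartAt_symm_range c (mem_coordDomain.1 hy).1

/-- The inclusion of the coordinate axis. -/
def axis : ℝ →L[ℝ] Plane := ContinuousLinearMap.toSpanSingleton ℝ (EuclideanSpace.single 1 1)

theorem axis_apply (t : ℝ) : axis t = !₂[(0 : ℝ), t] := by
  ext i
  fin_cases i <;> simp [axis]

theorem axis_mem_range (t : ℝ) : axis t ∈ range (𝓡∂ 2) := by
  rw [range_modelWithCornersEuclideanHalfSpace, axis_apply]
  simp

variable (V E) in
/-- The part of the coordinate axis that parametrizes the boundary. -/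
def bdryDomain (c : M) : Set ℝ := axis ⁻¹' coordDomain V E c

theorem isRelOpen_bdryDomain (c : M) : IsRelOpen univ (bdryDomain V E c) where
  unique := uniqueDiffOn_univ
  subset := subset_univ _
  nhds t ht := by
    have h := (isRelOpen_coordDomain (V := V) (E := E) c).nhds _ ht
    have h2 : ContinuousWithinAt axis univ t := axis.continuous.continuousWithinAt
    exact (h2.tendsto_nhdsWithin (t := range (𝓡∂ 2)) fun t _ => axis_mem_range t) h

theorem isPlot_axis (c : M) : IsPlot V E c ⊤ univ (bdryDomain V E c) (fun t => pt c (axis t)) where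
  one_le := le_top
  relOpen := isRelOpen_bdryDomain c
  source t ht := (isPlot_pt c).source _ ht
  base t ht := (isPlot_pt c).base _ ht
  smooth t ht := by
    refine ((isPlot_pt c).smooth _ ht).comp (f := axis) t ?_ fun t _ => axis_mem_range t
    exact axis.contDiff.contMDiff.contMDiffAt.contMDiffWithinAt

theorem IsPlot.comp {c : M} {k : ℕ∞} {S D : Set P} {p : P → M} (hp : IsPlot V E c k S D p)
    {F : Type*} [NormedAddCommGroup F] [NormedSpace ℝ F] {f : M → F} {y : P} (hy : y ∈ D)
    (hf : ContMDiffAt (𝓡∂ 2) 𝓘(ℝ, F) ∞ f (p y)) : ContDiffWithinAt ℝ k (fun y => f (p y)) S y :=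
  contMDiffWithinAt_iff_contDiffWithinAt.1
    ((hf.of_le (by exact_mod_cast le_top)).comp_contMDiffWithinAt y (hp.smooth y hy))

section EndInTriv

theorem endInTriv_add (c x : M) (A B : Module.End ℂ (E x)) :
    endInTriv V c x (A + B) = endInTriv V c x A + endInTriv V c x B := by
  ext v
  simp [endInTriv_apply_symm]

theorem endInTriv_smul (c x : M) (a : ℂ) (B : Module.End ℂ (E x)) :
    endInTriv V c x (a • B) = a • endInTriv V c x B := by
  ext v
  simp [endInTriv_apply_symm]

theorem endInTriv_rsmul (c x : M) (a : ℝ) (B : Module.End ℂ (E x)) :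
    endInTriv V c x (a • B) = a • endInTriv V c x B := endInTriv_smul c x (a : ℂ) B

theorem endInTriv_inverse {c x : M} (hx : x ∈ (trivializationAt V E c).baseSet)
    {B : Module.End ℂ (E x)} (hB : IsUnit B) :
    endInTriv V c x (Ring.inverse B) = Ring.inverse (endInTriv V c x B) := by
  rw [endInTriv_eq hx, endInTriv_eq hx]
  obtain ⟨u, rfl⟩ := hB
  have : (endAlg hx : Module.End ℂ (E x) → V →L[ℂ] V) u =
      (Units.map (endAlg hx : Module.End ℂ (E x) →* (V →L[ℂ] V)) u : (V →L[ℂ] V)ˣ) := rfl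
  rw [this, Ring.inverse_unit, Ring.inverse_unit, ← map_inv]
  rfl

end EndInTriv

variable {X : Type*} [TopologicalSpace X]

variable (V) in
/-- A regular family of fields of endomorphisms of the fibres along a plot. -/
def RegE (c : M) (k : ℕ∞) (S D : Set P) (p : P → M) (B : X → ∀ y, Module.End ℂ (E (p y))) : Prop :=
  RegOn k S D fun a y => endInTriv V c (p y) (B a y)

variable {c : M} {k : ℕ∞} {S D : Set P} {p : P → M} {B B' : X → ∀ y, Module.End ℂ (E (p y))}

namespace RegE

theorem congr (hp : IsPlot V E c k S D p) (hB : RegE V c k S D p B)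
    (h : ∀ a, ∀ y ∈ D, B' a y = B a y) : RegE V c k S D p B' :=
  RegOn.congr hp.relOpen hB fun a y hy => by rw [h a y hy]

theorem add (hp : IsPlot V E c k S D p) (hB : RegE V c k S D p B) (hB' : RegE V c k S D p B') :
    RegE V c k S D p fun a y => B a y + B' a y :=
  RegOn.congr hp.relOpen (RegOn.add hp.relOpen hp.one_le hB hB') fun _ _ _ => endInTriv_add _ _ _ _

theorem csmul (hp : IsPlot V E c k S D p) (z : ℂ) (hB : RegE V c k S D p B) :
    RegE V c k S D p fun a y => z • B a y :=
  RegOn.congr hp.relOpen (RegOn.const_csmul hp.relOpen hp.one_le z hB)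
    fun _ _ _ => endInTriv_smul _ _ _ _

theorem rsmul (hp : IsPlot V E c k S D p) {r : X → P → ℝ} (hr : RegOn k S D r)
    (hB : RegE V c k S D p B) : RegE V c k S D p fun a y => r a y • B a y :=
  RegOn.congr hp.relOpen (RegOn.smul hp.relOpen hp.one_le hr hB)
    fun _ _ _ => endInTriv_rsmul _ _ _ _

theorem neg (hp : IsPlot V E c k S D p) (hB : RegE V c k S D p B) :
    RegE V c k S D p fun a y => -B a y :=
  (hB.csmul hp (-1)).congr hp fun _ _ _ => (neg_one_smul ℂ _).symm

theorem sub (hp : IsPlot V E c k S D p) (hB : RegE V c k S D p B) (hB' : RegE V c k S D p B') :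
    RegE V c k S D p fun a y => B a y - B' a y :=
  (hB.add hp (hB'.neg hp)).congr hp fun _ _ _ => sub_eq_add_neg _ _

theorem mul (hp : IsPlot V E c k S D p) (hB : RegE V c k S D p B) (hB' : RegE V c k S D p B') :
    RegE V c k S D p fun a y => B a y * B' a y :=
  RegOn.congr hp.relOpen (RegOn.mul hp.relOpen hp.one_le hB hB') fun a y hy => by
    simp only [endInTriv_eq (hp.base y hy), map_mul]

theorem one (hp : IsPlot V E c k S D p) :
    RegE V c k S D p (fun (_ : X) y => (1 : Module.End ℂ (E (p y)))) :=
  RegOn.congr hp.relOpen (RegOn.of_param (f := fun _ : X => (1 : V →L[ℂ] V)) continuous_const)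
    fun a y hy => by simp only [endInTriv_eq (hp.base y hy), map_one]

theorem inverse (hp : IsPlot V E c k S D p) (hB : RegE V c k S D p B)
    (h : ∀ a, ∀ y ∈ D, IsUnit (B a y)) : RegE V c k S D p fun a y => Ring.inverse (B a y) := by
  refine RegOn.congr hp.relOpen (RegOn.inverse hp.relOpen hp.one_le hB fun a y hy => ?_)
    fun a y hy => endInTriv_inverse (hp.base y hy) (h a y hy)
  rw [endInTriv_eq (hp.base y hy)]
  exact (h a y hy).map (endAlg (hp.base y hy))

theorem reparam (hB : RegE V c k S D p B) {Y : Type*} [TopologicalSpace Y] {r : Y → X}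
    (hr : Continuous r) : RegE V c k S D p fun a y => B (r a) y :=
  RegOn.reparam hB hr

variable [∀ x, FiniteDimensional ℂ (E x)]

/-- The inverse root is (2π)⁻¹ times a circle integral of inverses, which is a smooth function of
the operator in any trivialization. -/
theorem invSqrt (hp : IsPlot V E c k S D p) (hB : RegE V c k S D p B)
    (h : ∀ a, ∀ y ∈ D, (B a y).IsPositive) (h' : ∀ a, ∀ y ∈ D, IsUnit (B a y)) :
    RegE V c k S D p fun a y => BVP.invSqrt (B a y) := by
  haveI : CompleteSpace V := FiniteDimensional.complete ℂ V
  have key := fun a y (hy : y ∈ D) =>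
    isUnit_circ₂_and_circInt₂ (endAlg (hp.base y hy)) (h a y hy) (h' a y hy)
  have h1 := RegOn.circInt₂ hp.relOpen hp.one_le hB fun a y hy => by
    rw [endInTriv_eq (hp.base y hy)]
    exact (key a y hy).1
  refine RegOn.congr hp.relOpen (RegOn.const_csmul hp.relOpen hp.one_le (2 * Real.pi : ℂ)⁻¹ h1)
    fun a y hy => ?_
  simp only [endInTriv_eq (hp.base y hy)]
  rw [(key a y hy).2, smul_smul, inv_mul_cancel₀ (by simp [Real.pi_ne_zero]), one_smul]

end RegE

section Gram

variable [∀ x, FiniteDimensional ℂ (E x)]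

theorem clm_eq_sum {n : ℕ} (T : EuclideanSpace ℂ (Fin n) →L[ℂ] EuclideanSpace ℂ (Fin n)) :
    T = ∑ i, ∑ j, (inner ℂ (EuclideanSpace.single i 1) (T (EuclideanSpace.single j 1)) : ℂ) •
      (ContinuousLinearMap.toSpanSingleton ℂ (EuclideanSpace.single i 1)).comp
        (EuclideanSpace.proj j : EuclideanSpace ℂ (Fin n) →L[ℂ] ℂ) := by
  refine ContinuousLinearMap.coe_injective
    ((EuclideanSpace.basisFun (Fin n) ℂ).toBasis.ext fun l => ?_)
  ext m
  simp [ContinuousLinearMap.sum_apply, Pi.single_apply, EuclideanSpace.inner_single_left]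

/-- The matrix entries are inner products of smooth sections that extend constant vectors of the
trivialization. -/
theorem gram_contMDiffAt [T2Space M] (hE : IsSmoothHermitian V E) {c x₀ : M}
    (hx : x₀ ∈ (trivializationAt V E c).baseSet) :
    ContMDiffAt (𝓡∂ 2) 𝓘(ℝ, EucModel V →L[ℂ] EucModel V) ∞ (gram (E := E) V c) x₀ := by
  have h1 : ∀ u v : EucModel V, ContMDiffAt (𝓡∂ 2) 𝓘(ℝ, ℂ) ∞
      (fun x => (inner ℂ u (gram (E := E) V c x v) : ℂ)) x₀ := by
    intro u v
    obtain ⟨s, hs⟩ := exists_section_symm (E := E) c ((eucEquiv V).symm u) hx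
    obtain ⟨t, ht⟩ := exists_section_symm (E := E) c ((eucEquiv V).symm v) hx
    refine (hE s s.2 t t.2 x₀).congr_of_eventuallyEq ?_
    filter_upwards [hs, ht, (trivializationAt V E c).open_baseSet.mem_nhds hx] with x hsx htx hx
    rw [inner_gram, hsx, htx, Bundle.Trivialization.symmₗ_apply _ hx,
      Bundle.Trivialization.symmₗ_apply _ hx]
  rw [show gram (E := E) V c = fun x => _ from funext fun x => clm_eq_sum (gram (E := E) V c x)]
  refine ContMDiffAt.sum fun i _ => ContMDiffAt.sum fun j _ => ?_
  refine ContMDiffAt.comp (I' := 𝓘(ℝ, ℂ)) x₀ (g := fun z : ℂ => z • _) ?_ (h1 _ _)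
  exact (contDiff_id.smul contDiff_const).contMDiff.contMDiffAt

theorem RegE.star [T2Space M] (hE : IsSmoothHermitian V E) (hp : IsPlot V E c k S D p)
    (hB : RegE V c k S D p B) : RegE V c k S D p fun a y => star (B a y) := by
  haveI : CompleteSpace V := FiniteDimensional.complete ℂ V
  have hg : RegOn k S D fun (_ : X) y => gram (E := E) V c (p y) :=
    RegOn.of_smooth hp.relOpen hp.one_le fun y hy => hp.comp hy (gram_contMDiffAt hE (hp.base y hy))
  have hgi := hg.inverse hp.relOpen hp.one_le fun a y hy => gram_isUnit (hp.base y hy)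
  have h1 : RegOn k S D fun a y => endEuc V (endInTriv V c (p y) (B a y)) :=
    RegOn.map hp.relOpen hp.one_le hB (Φ := endEuc V)
      ((endEuc V).toContinuousLinearMap.restrictScalars ℝ).contDiff
  have h2 : RegOn k S D fun a y => Star.star (endEuc V (endInTriv V c (p y) (B a y))) :=
    RegOn.map hp.relOpen hp.one_le h1 (Φ := Star.star)
      (starL' ℝ (A := EucModel V →L[ℂ] EucModel V)).contDiff
  refine RegOn.congr hp.relOpen (RegOn.map hp.relOpen hp.one_le (Φ := (endEuc V).symm)
    ((hgi.mul hp.relOpen hp.one_le h2).mul hp.relOpen hp.one_le hg)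
    ((endEuc V).symm.toContinuousLinearMap.restrictScalars ℝ).contDiff) fun a y hy => ?_
  exact endInTriv_star (hp.base y hy) _

theorem RegE.orthP_of_idempotent [T2Space M] (hE : IsSmoothHermitian V E)
    (hp : IsPlot V E c k S D p) (hB : RegE V c k S D p B) {U : X → ∀ y, Submodule ℂ (E (p y))}
    (h1 : ∀ a, ∀ y ∈ D, ∀ w, B a y w ∈ U a y) (h2 : ∀ a, ∀ y ∈ D, ∀ w ∈ U a y, B a y w = w) :
    RegE V c k S D p fun a y => orthP (U a y) :=
  (hB.mul hp (RegE.inverse hp ((hB.add hp (hB.star hE hp)).sub hp (RegE.one hp)) fun a y hy =>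
    isUnit_add_star_sub_one (h1 a y hy) (h2 a y hy))).congr hp fun a y hy =>
      orthP_eq_of_idempotent (h1 a y hy) (h2 a y hy)

end Gram

end RegularEndomorphisms

/-! ### Regular families of symbols. -/

section RegularSymbols

open Set

variable {M : Type*} [TopologicalSpace M] [ChartedSpace (EuclideanHalfSpace 2) M]
  [IsManifold (𝓡∂ 2) ∞ M]

variable {V : Type*} [NormedAddCommGroup V] [NormedSpace ℂ V] [FiniteDimensional ℂ V]
  {E : M → Type*} [TopologicalSpace (TotalSpace V E)]
  [∀ x, NormedAddCommGroup (E x)] [∀ x, InnerProductSpace ℂ (E x)]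
  [FiberBundle V E] [VectorBundle ℂ V E] [VectorBundle ℝ V E]
  [ContMDiffVectorBundle ∞ V E (𝓡∂ 2)]

variable {P : Type*} [NormedAddCommGroup P] [NormedSpace ℝ P] {X : Type*} [TopologicalSpace X]

variable (V) in
/-- A regular family of symbols along a plot. -/
def RegSymb (c : M) (k : ℕ∞) (S D : Set P) (p : P → M)
    (σ : X → ∀ y, (Tan (p y) →L[ℝ] ℝ) →ₗ[ℝ] Module.End ℂ (E (p y))) : Prop :=
  ∀ j, RegE V c k S D p fun a y => σ a y (coordCovec c (p y) j)

variable {c : M} {k : ℕ∞} {S D : Set P} {p : P → M}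
  {σ τ : X → ∀ y, (Tan (p y) →L[ℝ] ℝ) →ₗ[ℝ] Module.End ℂ (E (p y))}

theorem RegSymb.apply (hp : IsPlot V E c k S D p) (hσ : RegSymb V c k S D p σ)
    {ξ : ∀ y, Tan (p y) →L[ℝ] ℝ}
    (hξ : ∀ j, RegOn k S D fun (_ : X) y => ξ y (coordVec c (p y) j)) :
    RegE V c k S D p fun a y => σ a y (ξ y) :=
  (((hσ 0).rsmul hp (hξ 0)).add hp ((hσ 1).rsmul hp (hξ 1))).congr hp fun a y hy => by
    conv_lhs => rw [eq_sum_coordCovec (hp.source y hy) (ξ y)]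
    rw [map_add, map_smul, map_smul]

theorem RegSymb.comp_axis {σ : X → Symb E}
    (hσ : RegSymb V c ⊤ (range (𝓡∂ 2)) (coordDomain V E c) (pt c) fun a y => σ a (pt c y)) :
    RegSymb V c ⊤ univ (bdryDomain V E c) (fun t => pt c (axis t)) fun a t => σ a (pt c (axis t)) :=
  fun j => RegOn.comp_affine (P' := ℝ) le_top (isRelOpen_coordDomain c) (isRelOpen_bdryDomain c)
    (hσ j) axis (fun t _ => axis_mem_range t) (fun _ ht => ht)

variable [RiemannianBundle (fun x : M => TangentSpace (𝓡∂ 2) x)]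
  [IsContMDiffRiemannianBundle (𝓡∂ 2) ∞ Plane (fun x : M => TangentSpace (𝓡∂ 2) x)]
  (o : SurfaceOrientation M)

theorem area_ne_zero {c x : M} (hx : x ∈ (chartAt (EuclideanHalfSpace 2) c).source) :
    o.area c x ≠ 0 := by
  obtain ⟨h1, -, h3, -⟩ := conformal_coordinates o hx
  intro h
  rw [h] at h3
  norm_num at h3
  exact h1.ne h3

/-- The coefficients of `J dy_0`. -/
def rotCoeff (c x : M) (j : Fin 2) : ℝ := o.area c x / metricDet c x * metricCoeff c x j 1

theorem rotCoeff_one_ne_zero {c x : M} (hx : x ∈ (chartAt (EuclideanHalfSpace 2) c).source) :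
    rotCoeff o c x 1 ≠ 0 := by
  obtain ⟨h1, h2, -⟩ := conformal_coordinates o hx
  exact mul_ne_zero (div_ne_zero (area_ne_zero o hx) h1.ne') h2.ne'

theorem J_coordCovec {c x : M} (hx : x ∈ (chartAt (EuclideanHalfSpace 2) c).source) :
    o.J x (coordCovec c x 0) =
      rotCoeff o c x 0 • coordCovec c x 0 + rotCoeff o c x 1 • coordCovec c x 1 :=
  (conformal_coordinates o hx).2.2.2.2

theorem coordCovec_one_eq {c x : M} (hx : x ∈ (chartAt (EuclideanHalfSpace 2) c).source) :
    coordCovec c x 1 = (rotCoeff o c x 1)⁻¹ • o.J x (coordCovec c x 0) -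
      ((rotCoeff o c x 1)⁻¹ * rotCoeff o c x 0) • coordCovec c x 0 := by
  rw [J_coordCovec o hx, smul_add, smul_smul, smul_smul,
    inv_mul_cancel₀ (rotCoeff_one_ne_zero o hx), one_smul, add_sub_cancel_left]

theorem rotCoeff_contMDiffAt {c x : M} (hx : x ∈ (chartAt (EuclideanHalfSpace 2) c).source)
    (j : Fin 2) : ContMDiffAt (𝓡∂ 2) 𝓘(ℝ, ℝ) ∞ (fun x => rotCoeff o c x j) x :=
  (o.area_contMDiffAt hx |>.div₀ (metricDet_contMDiffAt hx)
    (conformal_coordinates o hx).1.ne').mul (metricCoeff_contMDiffAt hx j 1)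

theorem regOn_rotCoeff (hp : IsPlot V E c k S D p) (j : Fin 2) :
    RegOn k S D fun (_ : X) y => rotCoeff o c (p y) j :=
  RegOn.of_smooth hp.relOpen hp.one_le fun y hy =>
    hp.comp hy (rotCoeff_contMDiffAt o (hp.source y hy) j)

theorem regOn_rotCoeff_inv (hp : IsPlot V E c k S D p) :
    RegOn k S D fun (_ : X) y => (rotCoeff o c (p y) 1)⁻¹ :=
  RegOn.of_smooth hp.relOpen hp.one_le fun y hy =>
    (hp.comp hy (rotCoeff_contMDiffAt o (hp.source y hy) 1)).inv
      (rotCoeff_one_ne_zero o (hp.source y hy))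

include o in
theorem regOn_norm_sq_inv (hp : IsPlot V E c k S D p) :
    RegOn k S D fun (_ : X) y => (‖coordCovec c (p y) 0‖ ^ 2)⁻¹ := by
  refine RegOn.of_smooth hp.relOpen hp.one_le fun y hy => ?_
  have h : ContMDiffAt (𝓡∂ 2) 𝓘(ℝ, ℝ) ∞ (fun x => metricDet c x / metricCoeff c x 1 1) (p y) :=
    (metricDet_contMDiffAt (hp.source y hy)).div₀ (metricCoeff_contMDiffAt (hp.source y hy) 1 1)
      (conformal_coordinates o (hp.source y hy)).2.1.ne'
  refine (hp.comp hy h).congr_of_eventuallyEq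
    (Filter.eventually_of_mem (hp.relOpen.nhds y hy) fun z hz => ?_) ?_
  · simp only [(conformal_coordinates o (hp.source z hz)).2.2.2.1, inv_div]
  · simp only [(conformal_coordinates o (hp.source y hy)).2.2.2.1, inv_div]

theorem RegSymb.apply_J (hp : IsPlot V E c k S D p) (hσ : RegSymb V c k S D p σ) :
    RegE V c k S D p fun a y => σ a y (o.J (p y) (coordCovec c (p y) 0)) :=
  (((hσ 0).rsmul hp (regOn_rotCoeff o hp 0)).add hp
    ((hσ 1).rsmul hp (regOn_rotCoeff o hp 1))).congr hp fun a y hy => by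
    rw [J_coordCovec o (hp.source y hy), map_add, map_smul, map_smul]

/-- dy_1 is a smooth combination of dy_0 and J dy_0. So a symbol is controlled by its values at ξ
and Jξ, the form in which the deformation is given. -/
theorem RegSymb.of_apply_J (hp : IsPlot V E c k S D p)
    (h0 : RegE V c k S D p fun a y => σ a y (coordCovec c (p y) 0))
    (h1 : RegE V c k S D p fun a y => σ a y (o.J (p y) (coordCovec c (p y) 0))) :
    RegSymb V c k S D p σ := by
  intro j
  fin_cases j
  · exact h0
  · refine ((h1.rsmul hp (regOn_rotCoeff_inv o hp)).sub hp (h0.rsmul hp (RegOn.mul hp.relOpen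
      hp.one_le (regOn_rotCoeff_inv o hp) (regOn_rotCoeff o hp 0)))).congr hp fun a y hy => ?_
    change σ a y (coordCovec c (p y) 1) = _
    rw [coordCovec_one_eq o (hp.source y hy), map_sub, map_smul, map_smul]

variable [∀ x, FiniteDimensional ℂ (E x)]

theorem RegSymb.specP (hp : IsPlot V E c k S D p) (hσ : RegSymb V c k S D p σ)
    (hell : ∀ a, ∀ y ∈ D, IsEllSymb (σ a y)) :
    RegE V c k S D p fun a y => BVP.specP (o.PosCoframe (p y)) (σ a y) := by
  haveI : CompleteSpace V := FiniteDimensional.complete ℂ V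
  have hne := fun y (hy : y ∈ D) => coordCovec_ne_zero (hp.source y hy) 0
  have hQ : RegE V c k S D p fun a y => qop (o.J (p y)) (σ a y) (coordCovec c (p y) 0) :=
    ((hσ 0).inverse hp fun a y hy => (hell a y hy).unit _ (hne y hy)).mul hp (hσ.apply_J o hp)
  have key := fun a y (hy : y ∈ D) => circInt_qop (endAlg (hp.base y hy)) (hell a y hy)
    (o.isConfPlane (p y)) (hne y hy)
  have h1 := RegOn.circInt hp.relOpen hp.one_le hQ fun a y hy => by
    rw [endInTriv_eq (hp.base y hy)]
    exact (key a y hy).1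
  -- The circle integral is 2πi(2P - 1), so P is ½(2πi)⁻¹ times it, plus ½.
  have h2 := RegOn.const_csmul hp.relOpen hp.one_le (2⁻¹ * (2 * Real.pi * Complex.I : ℂ)⁻¹) h1
  refine RegOn.congr hp.relOpen (RegOn.add hp.relOpen hp.one_le h2
    (RegOn.of_param (f := fun _ : X => (2⁻¹ : ℂ) • (1 : V →L[ℂ] V)) continuous_const))
    fun a y hy => ?_
  simp only [endInTriv_eq (hp.base y hy)]
  rw [(key a y hy).2, smul_smul, mul_assoc, inv_mul_cancel₀ (by simp [Real.pi_ne_zero]), mul_one,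
    map_sub, map_mul, map_one, map_ofNat, smul_sub, sub_add_cancel, ← smul_mul_assoc]
  have : (2⁻¹ : ℂ) • (2 : V →L[ℂ] V) = 1 := by
    have h : (2 : V →L[ℂ] V) = (2 : ℂ) • 1 := by rw [two_smul, one_add_one_eq_two]
    rw [h, smul_smul]
    norm_num
  rw [this, one_mul]

theorem RegSymb.orthP_lowSp [T2Space M] (hE : IsSmoothHermitian V E) (hp : IsPlot V E c k S D p)
    (hσ : RegSymb V c k S D p σ) (hell : ∀ a, ∀ y ∈ D, IsEllSymb (σ a y)) :
    RegE V c k S D p fun a y => orthP (lowSp (o.PosCoframe (p y)) (σ a y)) :=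
  RegE.orthP_of_idempotent hE hp ((RegE.one hp).sub hp (hσ.specP o hp hell))
    (fun a y hy w => sub_specP_mem (hell a y hy) (o.isConfPlane (p y)) w) fun a y hy w hw => by
      simp [specP_of_low (hell a y hy) (o.isConfPlane (p y)) hw]

theorem RegSymb.transport [T2Space M] (hE : IsSmoothHermitian V E) (hp : IsPlot V E c k S D p)
    (hσ : RegSymb V c k S D p σ) (hell : ∀ a, ∀ y ∈ D, IsEllSymb (σ a y))
    (hτ : RegSymb V c k S D p τ) (hell' : ∀ a, ∀ y ∈ D, IsEllSymb (τ a y)) :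
    RegE V c k S D p fun a y =>
      BVP.transport (o.PosCoframe (p y)) (σ a y) (τ a y) (coordCovec c (p y) 0) :=
  have h1 := hσ.specP o hp hell
  ((RegE.one hp).sub hp h1).add hp (((((hτ.specP o hp hell').mul hp ((hτ 0).inverse hp
    fun a y hy => (hell' a y hy).unit _ (coordCovec_ne_zero (hp.source y hy) 0))).mul hp
      (hσ.orthP_lowSp o hE hp hell)).mul hp (hσ 0)).mul hp h1)

theorem RegSymb.deform [T2Space M] (hE : IsSmoothHermitian V E) (hp : IsPlot V E c k S D p)
    (hσ : RegSymb V c k S D p σ) (hell : ∀ a, ∀ y ∈ D, IsEllSymb (σ a y)) {s : X → ℝ}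
    (hs : Continuous s) :
    RegSymb V c k S D p fun a y => BVP.deform (o.PosCoframe (p y)) (o.J (p y)) (fun ξ => ‖ξ‖)
      (σ a y) (coordCovec c (p y) 0) (s a) := by
  have hA : RegOn k S D fun (a : X) (_ : P) => cutA (s a) :=
    RegOn.of_param (by unfold cutA; fun_prop)
  have hB : RegOn k S D fun (a : X) (_ : P) => cutB (s a) :=
    RegOn.of_param (by unfold cutB; fun_prop)
  have hB' : RegOn k S D fun (a : X) (_ : P) => 1 - cutB (s a) :=
    RegOn.of_param (by unfold cutB; fun_prop)
  have hP : RegE V c k S D p fun a y => lowP (o.PosCoframe (p y)) (σ a y) :=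
    hσ.orthP_lowSp o hE hp hell
  have hP' := (RegE.one (X := X) hp).sub hp hP
  have hS0 := hσ 0
  have hSJ := hσ.apply_J o hp
  have hN : RegE V c k S D p fun a y => partN (o.PosCoframe (p y)) (o.J (p y)) (σ a y)
      (coordCovec c (p y) 0) :=
    ((hP'.mul hp (hS0.add hp (hSJ.csmul hp Complex.I))).mul hp hP).csmul hp _
  have hM : RegE V c k S D p fun a y => partM (o.PosCoframe (p y)) (o.J (p y)) (σ a y)
      (coordCovec c (p y) 0) :=
    ((hP'.mul hp (hS0.sub hp (hSJ.csmul hp Complex.I))).mul hp hP).csmul hp _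
  have hR : RegE V c k S D p fun a y => BVP.invSqrt (normOp (o.PosCoframe (p y)) (o.J (p y))
      (fun ξ => ‖ξ‖) (σ a y) (coordCovec c (p y) 0)) :=
    RegE.invSqrt hp ((((hN.star hE hp).mul hp hN).rsmul hp (regOn_norm_sq_inv o hp)).add hp hP')
      (fun a y hy => normOp_isPositive _) fun a y hy =>
        normOp_isUnit (hell a y hy) (o.isConfPlane (p y)) (coordCovec_ne_zero (hp.source y hy) 0)
  have hF : RegE V c k S D p fun a y => normFactor (o.PosCoframe (p y)) (o.J (p y))
      (fun ξ => ‖ξ‖) (σ a y) (coordCovec c (p y) 0) (s a) :=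
    ((RegE.one hp).rsmul hp hB').add hp (hR.rsmul hp hB)
  have hNF := hN.mul hp hF
  have hH : RegE V c k S D p fun a y => halfSymb (o.PosCoframe (p y)) (o.J (p y))
      (fun ξ => ‖ξ‖) (σ a y) (coordCovec c (p y) 0) (s a) (coordCovec c (p y) 0) :=
    (hM.rsmul hp hA).add hp hNF
  have hH' : RegE V c k S D p fun a y => halfSymb (o.PosCoframe (p y)) (o.J (p y))
      (fun ξ => ‖ξ‖) (σ a y) (coordCovec c (p y) 0) (s a) (o.J (p y) (coordCovec c (p y) 0)) :=
    (((hM.rsmul hp hA).csmul hp Complex.I).sub hp (hNF.csmul hp Complex.I)).congr hp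
      fun a y hy => halfSymb_J (o.isConfPlane (p y)) _ _ _
  exact RegSymb.of_apply_J o hp
    ((((hP'.mul hp hS0).mul hp hP').rsmul hp hA).add hp (hH.add hp (hH.star hE hp)))
    ((((hP'.mul hp hSJ).mul hp hP').rsmul hp hA).add hp (hH'.add hp (hH'.star hE hp)))

end RegularSymbols

/-! ### Regular and jointly continuous families of sections and functions. -/

section RegularSections

open Set

variable {M : Type*} [TopologicalSpace M] [ChartedSpace (EuclideanHalfSpace 2) M]
  [IsManifold (𝓡∂ 2) ∞ M]

variable {V : Type*} [NormedAddCommGroup V] [NormedSpace ℂ V] [FiniteDimensional ℂ V]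
  {E : M → Type*} [TopologicalSpace (TotalSpace V E)]
  [∀ x, NormedAddCommGroup (E x)] [∀ x, InnerProductSpace ℂ (E x)]
  [FiberBundle V E] [VectorBundle ℂ V E] [VectorBundle ℝ V E]
  [ContMDiffVectorBundle ∞ V E (𝓡∂ 2)]

variable {X : Type*} [TopologicalSpace X]

variable (V) in
/-- A family of sections that is regular in every coordinate domain. -/
def RegS (u : X → ∀ x, E x) : Prop :=
  ∀ c, RegOn ⊤ (range (𝓡∂ 2)) (coordDomain V E c) fun a => coordSection V c (u a)

variable (V) in
/-- A jointly continuous family of sections. -/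
def JCont (u : X → ∀ x, E x) : Prop :=
  ∀ c, ContinuousOn (fun z : X × Plane => coordSection V c (u z.1) z.2)
    (univ ×ˢ coordDomain V E c)

variable (V E) in
/-- A family of complex functions that is regular in every coordinate domain. -/
def RegF (h : X → M → ℂ) : Prop :=
  ∀ c, RegOn ⊤ (range (𝓡∂ 2)) (coordDomain V E c) fun a y => h a (pt c y)

variable (V E) in
/-- A jointly continuous family of complex functions. -/
def JContF (h : X → M → ℂ) : Prop :=
  ∀ c, ContinuousOn (fun z : X × Plane => h z.1 (pt c z.2)) (univ ×ˢ coordDomain V E c)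

variable (V) in
/-- A family of symbols that is regular in every coordinate domain. -/
def RegG (σ : X → Symb E) : Prop :=
  ∀ c, RegSymb V c ⊤ (range (𝓡∂ 2)) (coordDomain V E c) (pt c) fun a y => σ a (pt c y)

variable (V) in
/-- A family of fields of endomorphisms that is regular in every coordinate domain. -/
def RegB (B : X → ∀ x, Module.End ℂ (E x)) : Prop :=
  ∀ c, RegE V c ⊤ (range (𝓡∂ 2)) (coordDomain V E c) (pt c) fun a y => B a (pt c y)

theorem coordSection_add (c : M) (u v : ∀ x, E x) (y : Plane) :
    coordSection V c (u + v) y = coordSection V c u y + coordSection V c v y := map_add _ _ _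

theorem coordSection_smul (c : M) (z : ℂ) (u : ∀ x, E x) (y : Plane) :
    coordSection V c (z • u) y = z • coordSection V c u y := map_smul _ _ _

theorem coordSection_fun_smul (c : M) (h : M → ℂ) (u : ∀ x, E x) (y : Plane) :
    coordSection V c (fun x => h x • u x) y = h (pt c y) • coordSection V c u y := map_smul _ _ _

theorem coordSection_end {c : M} (B : ∀ x, Module.End ℂ (E x)) (u : ∀ x, E x) {y : Plane}
    (hy : y ∈ coordDomain V E c) : coordSection V c (fun x => B x (u x)) y =
      endInTriv V c (pt c y) (B (pt c y)) (coordSection V c u y) :=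
  (endInTriv_apply (mem_coordDomain.1 hy).2 _ _).symm

theorem inner_eq_gram [∀ x, FiniteDimensional ℂ (E x)] {c : M} (u v : ∀ x, E x) {y : Plane}
    (hy : y ∈ coordDomain V E c) : (inner ℂ (u (pt c y)) (v (pt c y)) : ℂ) =
      inner ℂ (eucEquiv V (coordSection V c u y))
        (gram (E := E) V c (pt c y) (eucEquiv V (coordSection V c v y))) := by
  rw [inner_gram, ContinuousLinearEquiv.symm_apply_apply, ContinuousLinearEquiv.symm_apply_apply,
    coordSection, coordSection,
    (trivializationAt V E c).symmₗ_linearMapAt (mem_coordDomain.1 hy).2,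
    (trivializationAt V E c).symmₗ_linearMapAt (mem_coordDomain.1 hy).2]

theorem contDiff_apply_end {W : Type*} [NormedAddCommGroup W] [NormedSpace ℂ W] :
    ContDiff ℝ ∞ fun z : (W →L[ℂ] W) × W => z.1 z.2 :=
  (((ContinuousLinearMap.restrictScalarsL ℂ W W ℝ ℝ).contDiff).comp contDiff_fst).clm_apply
    contDiff_snd

namespace RegS

variable {u v : X → ∀ x, E x}

theorem of_section (u : Sections V E) : RegS V fun _ : X => (u : ∀ x, E x) := fun c =>
  RegOn.of_smooth (isRelOpen_coordDomain c) le_top fun _ hy => coordSection_smooth c u hy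

theorem mem (hu : RegS V u) (a : X) : u a ∈ Sections V E :=
  mem_sections_of_coordSection fun c y hy => (hu c).smooth a y hy

theorem jcont (hu : RegS V u) : JCont V u := fun c => (hu c).cont

theorem fsmul (hu : RegS V u) {h : X → M → ℂ} (hh : RegF V E h) :
    RegS V fun a x => h a x • u a x := fun c =>
  RegOn.congr (isRelOpen_coordDomain c)
    (RegOn.csmul (isRelOpen_coordDomain c) le_top (hh c) (hu c))
      fun _ _ _ => coordSection_fun_smul _ _ _ _

theorem fEnd (hu : RegS V u) {B : X → ∀ x, Module.End ℂ (E x)} (hB : RegB V B) :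
    RegS V fun a x => B a x (u a x) := fun c =>
  RegOn.congr (isRelOpen_coordDomain c)
    (RegOn.map₂ (isRelOpen_coordDomain c) le_top (hB c) (hu c) contDiff_apply_end)
      fun _ _ hy => coordSection_end _ _ hy

theorem inner [∀ x, FiniteDimensional ℂ (E x)] [T2Space M] (hE : IsSmoothHermitian V E)
    (hu : RegS V u) (hv : RegS V v) : RegF V E fun a x => inner ℂ (u a x) (v a x) := fun c => by
  have hD := isRelOpen_coordDomain (V := V) (E := E) c
  have hg : RegOn ⊤ (range (𝓡∂ 2)) (coordDomain V E c) fun (_ : X) y => gram (E := E) V c (pt c y) :=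
    RegOn.of_smooth hD le_top fun y hy =>
      (isPlot_pt c).comp hy (gram_contMDiffAt hE ((isPlot_pt c).base y hy))
  have he : ContDiff ℝ ∞ (eucEquiv V) :=
    ((eucEquiv V).toContinuousLinearMap.restrictScalars ℝ).contDiff
  have h1 := RegOn.map₂ hD le_top hg ((hv c).map hD le_top he) contDiff_apply_end
  exact RegOn.congr hD (RegOn.map₂ hD le_top ((hu c).map hD le_top he) h1
    (contDiff_fst.inner ℂ contDiff_snd)) fun _ _ hy => inner_eq_gram _ _ hy

end RegS

theorem RegB.one_sub {B : X → ∀ x, Module.End ℂ (E x)} (hB : RegB V B) :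
    RegB V fun a x => 1 - B a x := fun c => (RegE.one (isPlot_pt c)).sub (isPlot_pt c) (hB c)

theorem RegG.reparam {σ : X → Symb E} (hσ : RegG V σ) {Y : Type*} [TopologicalSpace Y] {r : Y → X}
    (hr : Continuous r) : RegG V fun a => σ (r a) := fun c j => RegOn.reparam (hσ c j) hr

theorem JCont.reparam {u : X → ∀ x, E x} (hu : JCont V u) {Y : Type*} [TopologicalSpace Y]
    {r : Y → X} (hr : Continuous r) : JCont V fun a => u (r a) := fun c =>
  (hu c).comp (f := fun z : Y × Plane => (r z.1, z.2)) (by fun_prop) fun _ hz => ⟨trivial, hz.2⟩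

namespace JCont

variable {u v : X → ∀ x, E x}

theorem add (hu : JCont V u) (hv : JCont V v) : JCont V fun a => u a + v a := fun c =>
  ((hu c).add (hv c)).congr fun _ _ => coordSection_add _ _ _ _

theorem csmul {z : X → ℂ} (hz : Continuous z) (hu : JCont V u) : JCont V fun a => z a • u a :=
  fun c => ((hz.comp continuous_fst).continuousOn.smul (hu c)).congr
    fun _ _ => coordSection_smul _ _ _ _

theorem sum {ι : Type*} (s : Finset ι) {u : ι → X → ∀ x, E x} (hu : ∀ i, JCont V (u i)) :
    JCont V fun a => ∑ i ∈ s, u i a := by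
  classical
  induction s using Finset.induction_on with
  | empty =>
    intro c
    refine (continuousOn_const (c := (0 : V))).congr fun z _ => ?_
    simp only [Finset.sum_empty]
    exact map_zero _
  | insert i s hi ih => simpa only [Finset.sum_insert hi] using (hu i).add ih

theorem fsmul (hu : JCont V u) {h : X → M → ℂ} (hh : JContF V E h) :
    JCont V fun a x => h a x • u a x := fun c =>
  ((hh c).smul (hu c)).congr fun _ _ => coordSection_fun_smul _ _ _ _

theorem fEnd (hu : JCont V u) {B : X → ∀ x, Module.End ℂ (E x)} (hB : RegB V B) :
    JCont V fun a x => B a x (u a x) := fun c =>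
  ((hB c).cont.clm_apply (hu c)).congr fun _ hz => coordSection_end _ _ hz.2

theorem inner [∀ x, FiniteDimensional ℂ (E x)] [T2Space M] (hE : IsSmoothHermitian V E)
    (hu : JCont V u) (hv : JCont V v) : JContF V E fun a x => inner ℂ (u a x) (v a x) := fun c => by
  have hg : ContinuousOn (fun z : X × Plane => gram (E := E) V c (pt c z.2))
      (univ ×ˢ coordDomain V E c) :=
    (RegOn.of_smooth (X := X) (isRelOpen_coordDomain c) le_top fun y hy =>
      (isPlot_pt c).comp hy (gram_contMDiffAt hE ((isPlot_pt c).base y hy))).cont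
  have he : Continuous (eucEquiv V) := (eucEquiv V).continuous
  exact ((he.comp_continuousOn (hu c)).inner (𝕜 := ℂ) (hg.clm_apply (he.comp_continuousOn (hv c)))).congr
    fun _ hz => inner_eq_gram _ _ hz.2

end JCont

section Symbols

variable [RiemannianBundle (fun x : M => TangentSpace (𝓡∂ 2) x)]
  [IsContMDiffRiemannianBundle (𝓡∂ 2) ∞ Plane (fun x : M => TangentSpace (𝓡∂ 2) x)]
  (o : SurfaceOrientation M) [∀ x, FiniteDimensional ℂ (E x)] [T2Space M]

/-- The deformation of a symbol. -/
def deformSymb (σ : Symb E) (s : ℝ) : Symb E := fun x =>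
  deform (o.PosCoframe x) (o.J x) (fun ξ => ‖ξ‖) (σ x) (coordCovec x x 0) s

/-- The auxiliary covector in `deformSymb` comes from the chart at x and may jump with x. As the
deformation does not depend on it, it can be replaced locally by dy_0 of a fixed chart. -/
theorem deformSymb_eq {σ : Symb E} (hσ : ∀ x, IsEllSymb (σ x)) (s : ℝ) {x : M}
    {ξ : Tan x →L[ℝ] ℝ} (hξ : ξ ≠ 0) : deformSymb o σ s x =
      deform (o.PosCoframe x) (o.J x) (fun ξ => ‖ξ‖) (σ x) ξ s :=
  deform_indep (hσ x) (o.isConfPlane x) hξ (coordCovec_ne_zero (mem_chart_source _ x) 0) s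

variable {σ : X → Symb E}

theorem RegG.deformSymb (hE : IsSmoothHermitian V E) (hσ : RegG V σ)
    (hell : ∀ a x, IsEllSymb (σ a x)) {s : X → ℝ} (hs : Continuous s) :
    RegG V fun a => deformSymb o (σ a) (s a) := fun c j =>
  (RegSymb.deform o hE (isPlot_pt c) (hσ c) (fun a y _ => hell a _) hs j).congr (isPlot_pt c)
    fun a y hy => LinearMap.congr_fun (deformSymb_eq o (hell a) (s a)
      (coordCovec_ne_zero ((isPlot_pt c).source y hy) 0)) _

theorem RegG.lowP (hE : IsSmoothHermitian V E) (hσ : RegG V σ) (hell : ∀ a x, IsEllSymb (σ a x)) :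
    RegB V fun a x => lowP (o.PosCoframe x) (σ a x) := fun c =>
  RegSymb.orthP_lowSp o hE (isPlot_pt c) (hσ c) fun a y _ => hell a _

end Symbols

end RegularSections

/-! ### First order operators, their symbols and the topology on them. -/

section OperatorsAndSymbols

open Set

variable {M : Type*} [TopologicalSpace M] [ChartedSpace (EuclideanHalfSpace 2) M]
  [IsManifold (𝓡∂ 2) ∞ M]

variable {V : Type*} [NormedAddCommGroup V] [NormedSpace ℂ V] [FiniteDimensional ℂ V]
  {E : M → Type*} [TopologicalSpace (TotalSpace V E)]
  [∀ x, NormedAddCommGroup (E x)] [∀ x, InnerProductSpace ℂ (E x)]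
  [FiberBundle V E] [VectorBundle ℂ V E] [VectorBundle ℝ V E]
  [ContMDiffVectorBundle ∞ V E (𝓡∂ 2)]

/-- `σ` is the principal symbol of the first order operator `D`. -/
def HasSymb (D : Sections V E →ₗ[ℂ] Sections V E) (σ : Symb E) : Prop :=
  ∀ (f : C^∞⟮𝓡∂ 2, M; ℝ⟯) (u : Sections V E) (x : M), (D (mulFun f u) : ∀ x, E x) x =
    f x • (D u : ∀ x, E x) x - Complex.I • σ x (dAt f x) ((u : ∀ x, E x) x)

theorem exists_dAt_eq_coordCovec [T2Space M] {c x₀ : M}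
    (hx : x₀ ∈ (chartAt (EuclideanHalfSpace 2) c).source) (j : Fin 2) :
    ∃ f : C^∞⟮𝓡∂ 2, M; ℝ⟯, ∀ᶠ x in 𝓝 x₀, dAt f x = coordCovec c x j := by
  have hsm : ContMDiffOn (𝓡∂ 2) 𝓘(ℝ, ℝ) ∞ (fun x => (extChartAt (𝓡∂ 2) c x) j)
      (chartAt (EuclideanHalfSpace 2) c).source := fun x hx =>
    ((EuclideanSpace.proj j : Plane →L[ℝ] ℝ).contDiff.contMDiff.contMDiffAt.comp x
      (contMDiffAt_extChartAt' hx)).contMDiffWithinAt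
  obtain ⟨f, hf⟩ := exists_contMDiffMap_eventuallyEq
    (chartAt (EuclideanHalfSpace 2) c).open_source hx hsm
  refine ⟨f, ?_⟩
  filter_upwards [hf.eventuallyEq_nhds,
    (chartAt (EuclideanHalfSpace 2) c).open_source.mem_nhds hx] with x hfx hxs
  unfold dAt
  rw [hfx.mfderiv_eq]
  have h1 : HasMFDerivAt (𝓡∂ 2) 𝓘(ℝ, Plane) (extChartAt (𝓡∂ 2) c) x
      (mfderiv (𝓡∂ 2) 𝓘(ℝ, Plane) (extChartAt (𝓡∂ 2) c) x) :=
    (mdifferentiableAt_extChartAt hxs).hasMFDerivAt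
  have h2 : HasMFDerivAt 𝓘(ℝ, Plane) 𝓘(ℝ, ℝ) (EuclideanSpace.proj j : Plane →L[ℝ] ℝ)
      (extChartAt (𝓡∂ 2) c x) (EuclideanSpace.proj j : Plane →L[ℝ] ℝ) :=
    (EuclideanSpace.proj j : Plane →L[ℝ] ℝ).hasFDerivAt.hasMFDerivAt
  refine (h2.comp x h1).mfderiv.trans ?_
  rw [coordCovec, TangentBundle.continuousLinearMapAt_trivializationAt hxs]
  rfl

theorem eventually_pt {c : M} {y : Plane} (hy : y ∈ (extChartAt (𝓡∂ 2) c).target) {Q : M → Prop}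
    (h : ∀ᶠ x in 𝓝 (pt c y), Q x) : ∀ᶠ z in 𝓝[range (𝓡∂ 2)] y, Q (pt c z) :=
  (contMDiffWithinAt_extChartAt_symm_range (n := ∞) c hy).continuousWithinAt h

variable (V) in
/-- An operator on `V` with prescribed values on a basis. -/
def clmOfBasis : (Fin (Module.finrank ℂ V) → V) →L[ℂ] (V →L[ℂ] V) :=
  LinearMap.toContinuousLinearMap (LinearMap.toContinuousLinearMap.toLinearMap ∘ₗ
    ((Module.finBasis ℂ V).constr ℂ).toLinearMap)

theorem clmOfBasis_apply (T : V →L[ℂ] V) : clmOfBasis V (fun i => T (Module.finBasis ℂ V i)) = T :=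
  ContinuousLinearMap.coe_injective ((Module.finBasis ℂ V).ext fun i => by
    change (Module.finBasis ℂ V).constr ℂ (fun i => T (Module.finBasis ℂ V i)) _ = _
    rw [Module.Basis.constr_basis]
    rfl)

/-- Symbols are automatically smooth: σ(df)u = i(D(fu) - fDu) is a smooth section, and f may be a
coordinate function and u a member of a local frame. -/
theorem HasSymb.regG [T2Space M] {D : Sections V E →ₗ[ℂ] Sections V E} {σ : Symb E}
    (h : HasSymb D σ) {X : Type*} [TopologicalSpace X] : RegG V fun _ : X => σ := by
  intro c j
  change RegOn ⊤ (range (𝓡∂ 2)) (coordDomain V E c) fun _ : X => coordSymbol V c j σ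
  refine RegOn.of_smooth (isRelOpen_coordDomain (V := V) (E := E) c) le_top fun y hy => ?_
  have hx := (isPlot_pt (V := V) (E := E) c).source y hy
  have hb := (isPlot_pt (V := V) (E := E) c).base y hy
  obtain ⟨f, hf⟩ := exists_dAt_eq_coordCovec hx j
  choose t ht using fun i => exists_section_symm (E := E) c (Module.finBasis ℂ V i) hb
  let w : Fin (Module.finrank ℂ V) → Sections V E := fun i =>
    Complex.I • (D (mulFun f (t i)) - mulFun f (D (t i)))
  have hw : ∀ i x, (w i : ∀ x, E x) x = σ x (dAt f x) ((t i : ∀ x, E x) x) := fun i x => by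
    change Complex.I • ((D (mulFun f (t i)) : ∀ x, E x) x - f x • (D (t i) : ∀ x, E x) x) = _
    rw [h, sub_sub_cancel_left, smul_neg, smul_smul, Complex.I_mul_I, neg_one_smul, neg_neg]
  have h1 : ContDiffWithinAt ℝ ∞ (fun z => clmOfBasis V fun i =>
      coordSection V c (w i : ∀ x, E x) z) (range (𝓡∂ 2)) y :=
    ((clmOfBasis V).restrictScalars ℝ).contDiff.contDiffWithinAt.comp y
      (contDiffWithinAt_pi.2 fun i => coordSection_smooth c (w i) hy) (mapsTo_univ _ _)
  have h2 : ∀ᶠ z in 𝓝[range (𝓡∂ 2)] y, endInTriv V c (pt c z) (σ (pt c z) (coordCovec c (pt c z) j)) =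
      clmOfBasis V fun i => coordSection V c (w i : ∀ x, E x) z := by
    filter_upwards [eventually_pt (mem_coordDomain.1 hy).1 hf,
      eventually_pt (mem_coordDomain.1 hy).1 (Filter.eventually_all.2 ht),
      (isRelOpen_coordDomain (V := V) (E := E) c).nhds y hy] with z hz1 hz2 hz3
    rw [← clmOfBasis_apply (endInTriv V c (pt c z) (σ (pt c z) (coordCovec c (pt c z) j)))]
    congr 1
    ext i
    rw [coordSection, hw, hz1, hz2, endInTriv_apply_symm,
      Bundle.Trivialization.symmₗ_apply _ (mem_coordDomain.1 hz3).2]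
  exact h1.congr_of_eventuallyEq h2 (h2.self_of_nhdsWithin
    ((isRelOpen_coordDomain (V := V) (E := E) c).subset hy))

/-- The Leibniz rule for complex functions in coordinates. -/
theorem HasSymb.coordSection_smul {D : Sections V E →ₗ[ℂ] Sections V E} {σ : Symb E}
    (h : HasSymb D σ) {f : M → ℂ} (hf : ContMDiff (𝓡∂ 2) 𝓘(ℝ, ℂ) ∞ f) (u w : Sections V E)
    (hw : ∀ x, (w : ∀ x, E x) x = f x • (u : ∀ x, E x) x) (c : M) {y : Plane}
    (hy : y ∈ coordDomain V E c) : coordSection V c (D w : ∀ x, E x) y =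
      f (pt c y) • coordSection V c (D u : ∀ x, E x) y - Complex.I • ∑ j : Fin 2,
        fderivWithin ℝ (fun z => f (pt c z)) (range (𝓡∂ 2)) y (EuclideanSpace.single j 1) •
          endInTriv V c (pt c y) (σ (pt c y) (coordCovec c (pt c y) j))
            (coordSection V c (u : ∀ x, E x) y) := by
  let f₁ : C^∞⟮𝓡∂ 2, M; ℝ⟯ := ⟨fun x => (f x).re, Complex.reCLM.contDiff.contMDiff.comp hf⟩
  let f₂ : C^∞⟮𝓡∂ 2, M; ℝ⟯ := ⟨fun x => (f x).im, Complex.imCLM.contDiff.contMDiff.comp hf⟩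
  -- The Leibniz rule is given for real functions only; a complex one is split into real and
  -- imaginary parts.
  have hw' : w = mulFun f₁ u + Complex.I • mulFun f₂ u := by
    ext x
    rw [hw x]
    change f x • (u : ∀ x, E x) x = ((f x).re : ℂ) • (u : ∀ x, E x) x +
      Complex.I • ((f x).im : ℂ) • (u : ∀ x, E x) x
    rw [smul_smul, ← add_smul, mul_comm, Complex.re_add_im]
  have hs := (isPlot_pt (V := V) (E := E) c).source y hy
  have ht := (mem_coordDomain.1 hy).1
  have hd : DifferentiableWithinAt ℝ (fun z => f (pt c z)) (range (𝓡∂ 2)) y :=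
    ((contDiffWithinAt_chart_iff ht).2 (hf _)).differentiableWithinAt (by simp)
  have hu := (𝓡∂ 2).uniqueDiffOn y (extChartAt_target_subset_range c ht)
  have hr : ∀ j, dAt f₁ (pt c y) (coordVec c (pt c y) j) = (fderivWithin ℝ (fun z => f (pt c z))
      (range (𝓡∂ 2)) y (EuclideanSpace.single j 1)).re := fun j => by
    rw [dAt_coordVec _ ht]
    have := (Complex.reCLM.hasFDerivAt.comp_hasFDerivWithinAt y hd.hasFDerivWithinAt).fderivWithin hu
    exact congrArg (fun T : Plane →L[ℝ] ℝ => T (EuclideanSpace.single j 1)) this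
  have hi : ∀ j, dAt f₂ (pt c y) (coordVec c (pt c y) j) = (fderivWithin ℝ (fun z => f (pt c z))
      (range (𝓡∂ 2)) y (EuclideanSpace.single j 1)).im := fun j => by
    rw [dAt_coordVec _ ht]
    have := (Complex.imCLM.hasFDerivAt.comp_hasFDerivWithinAt y hd.hasFDerivWithinAt).fderivWithin hu
    exact congrArg (fun T : Plane →L[ℝ] ℝ => T (EuclideanSpace.single j 1)) this
  have hσ : ∀ (g : C^∞⟮𝓡∂ 2, M; ℝ⟯) (v : E (pt c y)), σ (pt c y) (dAt g (pt c y)) v =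
      ∑ j : Fin 2, ((dAt g (pt c y) (coordVec c (pt c y) j) : ℝ) : ℂ) •
        σ (pt c y) (coordCovec c (pt c y) j) v := fun g v => by
    conv_lhs => rw [eq_sum_coordCovec hs (dAt g (pt c y))]
    rw [map_add, map_smul, map_smul, Fin.sum_univ_two]
    rfl
  have key : (D w : ∀ x, E x) (pt c y) = f (pt c y) • (D u : ∀ x, E x) (pt c y) -
      Complex.I • ∑ j : Fin 2, fderivWithin ℝ (fun z => f (pt c z)) (range (𝓡∂ 2)) y
        (EuclideanSpace.single j 1) • σ (pt c y) (coordCovec c (pt c y) j)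
          ((u : ∀ x, E x) (pt c y)) := by
    rw [hw', map_add, map_smul]
    change (D (mulFun f₁ u) : ∀ x, E x) (pt c y) +
      Complex.I • (D (mulFun f₂ u) : ∀ x, E x) (pt c y) = _
    rw [h, h, hσ, hσ]
    simp only [hr, hi, Fin.sum_univ_two]
    have e : ∀ (z : ℂ) (v : E (pt c y)), z • v = (z.re : ℂ) • v + Complex.I • (z.im : ℂ) • v :=
      fun z v => by rw [smul_smul, ← add_smul, mul_comm, Complex.re_add_im]
    rw [e (f (pt c y)), e (fderivWithin ℝ (fun z => f (pt c z)) (range (𝓡∂ 2)) y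
        (EuclideanSpace.single 0 1)), e (fderivWithin ℝ (fun z => f (pt c z)) (range (𝓡∂ 2)) y
        (EuclideanSpace.single 1 1))]
    have r1 : ∀ (r : ℝ) (v : E (pt c y)), r • v = (r : ℂ) • v := fun _ _ => rfl
    rw [r1, r1]
    change (((f (pt c y)).re : ℂ) • _ - _) + Complex.I • (((f (pt c y)).im : ℂ) • _ - _) = _
    module
  rw [coordSection]
  change (trivializationAt V E c).linearMapAt ℂ (pt c y) ((D w : ∀ x, E x) (pt c y)) = _
  rw [key]
  simp only [map_sub, map_smul, map_sum, coordSection]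
  congr 2
  refine Finset.sum_congr rfl fun j _ => ?_
  rw [← endInTriv_apply (mem_coordDomain.1 hy).2]

/-- D(fu) involves f only through f and its first derivatives. This is why the C¹-topology on
symbols suffices for continuity of quantized operators. -/
theorem HasSymb.jcont_smul [T2Space M] {D : Sections V E →ₗ[ℂ] Sections V E} {σ : Symb E}
    (h : HasSymb D σ) {X : Type*} [TopologicalSpace X] {f : X → M → ℂ} (hf : RegF V E f)
    (hf' : ∀ a, ContMDiff (𝓡∂ 2) 𝓘(ℝ, ℂ) ∞ (f a)) (u : Sections V E) {w : X → Sections V E}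
    (hw : ∀ a x, (w a : ∀ x, E x) x = f a x • (u : ∀ x, E x) x) :
    JCont V fun a => (D (w a) : ∀ x, E x) := by
  intro c
  have h1 : ContinuousOn (fun z : X × Plane => coordSection V c (D u : ∀ x, E x) z.2)
    (univ ×ˢ coordDomain V E c) := (RegS.of_section (X := X) (D u)).jcont c
  have h2 : ContinuousOn (fun z : X × Plane => coordSection V c (u : ∀ x, E x) z.2)
    (univ ×ˢ coordDomain V E c) := (RegS.of_section (X := X) u).jcont c
  have h3 : ∀ j, ContinuousOn (fun z : X × Plane => endInTriv V c (pt c z.2)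
    (σ (pt c z.2) (coordCovec c (pt c z.2) j))) (univ ×ˢ coordDomain V E c) := fun j =>
    (h.regG (X := X) c j).cont
  refine ContinuousOn.congr ?_ fun z hz => h.coordSection_smul (hf' z.1) u (w z.1) (hw z.1) c hz.2
  refine ((hf c).cont.smul h1).sub (continuousOn_const.smul
    (continuousOn_finsetSum _ fun j _ => ?_))
  exact ((hf c).dcont.clm_apply continuousOn_const).smul ((h3 j).clm_apply h2)

section Topology

variable [MeasurableSpace M] [RiemannianBundle (fun x : M => TangentSpace (𝓡∂ 2) x)]

theorem continuous_to_ell {X : Type*} [TopologicalSpace X] {F : X → Ell V E}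
    (h1 : RegG V fun a => (F a).symb) (h2 : ∀ u, JCont V fun a => ((F a).op u : ∀ x, E x)) :
    Continuous F := by
  have hK : ∀ c, ∀ K ∈ coordCompacts V E c, IsCompact K ∧ K ⊆ coordDomain V E c := fun c K hK => hK
  refine continuous_inf_rng.2 ⟨continuous_iInf_rng.2 fun c => continuous_iInf_rng.2 fun j =>
    continuous_inf_rng.2 ⟨continuous_induced_rng.2 ?_, continuous_induced_rng.2 ?_⟩,
    continuous_iInf_rng.2 fun c => continuous_iInf_rng.2 fun u => continuous_induced_rng.2 ?_⟩
  · exact continuous_ofFun (hK c) (h1 c j).cont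
  · exact continuous_ofFun (hK c) (h1 c j).dcont
  · exact continuous_ofFun (hK c) (h2 u c)

theorem exists_coordCompacts (c : M) : ∀ y ∈ coordDomain V E c,
    ∃ K ∈ coordCompacts V E c, K ∈ 𝓝[coordDomain V E c] y := by
  intro y hy
  obtain ⟨ε, hε, h⟩ := Metric.mem_nhdsWithin_iff.1
    ((isRelOpen_coordDomain c).nhds y hy)
  have hε2 : ε / 2 < ε := half_lt_self hε
  refine ⟨Metric.closedBall y (ε / 2) ∩ range (𝓡∂ 2),
    ⟨(isCompact_closedBall y (ε / 2)).inter_right (𝓡∂ 2).isClosed_range,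
      (inter_subset_inter_left _ (Metric.closedBall_subset_ball hε2)).trans h⟩, ?_⟩
  refine nhdsWithin_mono y (isRelOpen_coordDomain c).subset ?_
  exact Filter.inter_mem (mem_nhdsWithin_of_mem_nhds (Metric.closedBall_mem_nhds y (half_pos hε)))
    self_mem_nhdsWithin

theorem Ell.hasSymb (A : Ell V E) : HasSymb A.op A.symb := A.leibniz

/-- The tautological family over Ell(E) is regular. Every continuous family of operators is a
reparametrization of it. -/
theorem regG_symb [T2Space M] : RegG V fun A : Ell V E => A.symb := by
  intro c j
  have hs : ∀ (A : Ell V E), ∀ y ∈ coordDomain V E c,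
      ContDiffWithinAt ℝ ∞ (coordSymbol V c j A.symb) (range (𝓡∂ 2)) y := fun A =>
    (A.hasSymb.regG (X := Unit) c j).smooth ()
  have h1 : Continuous fun A : Ell V E => UniformOnFun.ofFun (coordCompacts V E c)
      (coordSymbol V c j A.symb) := continuous_iff_le_induced.2 (inf_le_left.trans
    ((iInf_le _ c).trans ((iInf_le _ j).trans inf_le_left)))
  have h2 : Continuous fun A : Ell V E => UniformOnFun.ofFun (coordCompacts V E c)
      (fderivWithin ℝ (coordSymbol V c j A.symb) (range (𝓡∂ 2))) :=
    continuous_iff_le_induced.2 (inf_le_left.trans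
      ((iInf_le _ c).trans ((iInf_le _ j).trans inf_le_right)))
  have h3 := continuousOn_of_continuous_ofFun (exists_coordCompacts c) h1 fun A y hy =>
    (hs A y hy).continuousWithinAt.mono (isRelOpen_coordDomain c).subset
  have h4 := continuousOn_of_continuous_ofFun (exists_coordCompacts c) h2 fun A y hy =>
    ((hs A y hy).fderivWithin_right (m := 0) (𝓡∂ 2).uniqueDiffOn (by simp)
      ((isRelOpen_coordDomain c).subset hy)).continuousWithinAt.mono
        (isRelOpen_coordDomain c).subset
  exact ⟨hs, h3, h4⟩

theorem jcont_op (u : Sections V E) : JCont V fun A : Ell V E => (A.op u : ∀ x, E x) := by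
  intro c
  have h1 : Continuous fun A : Ell V E => UniformOnFun.ofFun (coordCompacts V E c)
      (coordSection V c (A.op u : ∀ x, E x)) :=
    continuous_iff_le_induced.2 (inf_le_right.trans ((iInf_le _ c).trans (iInf_le _ u)))
  exact continuousOn_of_continuous_ofFun (exists_coordCompacts c) h1
    fun A y hy => (coordSection_smooth c (A.op u) hy).continuousWithinAt.mono
      (isRelOpen_coordDomain c).subset

end Topology

end OperatorsAndSymbols

/-! ### Operators of order zero and Parseval frames. -/

section OrderZero

open Set

variable {M : Type*} [TopologicalSpace M] [ChartedSpace (EuclideanHalfSpace 2) M]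
  [IsManifold (𝓡∂ 2) ∞ M]

variable {V : Type*} [NormedAddCommGroup V] [NormedSpace ℂ V] [FiniteDimensional ℂ V]
  {E : M → Type*} [TopologicalSpace (TotalSpace V E)]
  [∀ x, NormedAddCommGroup (E x)] [∀ x, InnerProductSpace ℂ (E x)]
  [FiberBundle V E] [VectorBundle ℂ V E] [VectorBundle ℝ V E]
  [ContMDiffVectorBundle ∞ V E (𝓡∂ 2)]

variable (V) in
/-- A field of fibre endomorphisms that maps smooth sections to smooth sections. -/
def IsSmoothEnd (B : ∀ x, Module.End ℂ (E x)) : Prop :=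
  ∀ u ∈ Sections V E, (fun x => B x (u x)) ∈ Sections V E

/-- The action of a smooth field of endomorphisms on sections. -/
def endOp (B : ∀ x, Module.End ℂ (E x)) (hB : IsSmoothEnd V B) :
    Sections V E →ₗ[ℂ] Sections V E where
  toFun u := ⟨fun x => B x ((u : ∀ x, E x) x), hB u u.2⟩
  map_add' u v := Subtype.ext (funext fun x => map_add (B x) _ _)
  map_smul' z u := Subtype.ext (funext fun x => map_smul (B x) z _)

theorem endOp_apply (B : ∀ x, Module.End ℂ (E x)) (hB : IsSmoothEnd V B) (u : Sections V E) (x : M) :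
    (endOp B hB u : ∀ x, E x) x = B x ((u : ∀ x, E x) x) := rfl

theorem RegB.isSmoothEnd {X : Type*} [TopologicalSpace X] {B : X → ∀ x, Module.End ℂ (E x)}
    (hB : RegB V B) (a : X) : IsSmoothEnd V (B a) := fun u hu =>
  ((RegS.of_section (X := X) ⟨u, hu⟩).fEnd hB).mem a

theorem IsSmoothEnd.regB [T2Space M] {B : ∀ x, Module.End ℂ (E x)} (hB : IsSmoothEnd V B)
    {X : Type*} [TopologicalSpace X] : RegB V fun _ : X => B := by
  intro c
  change RegOn ⊤ (range (𝓡∂ 2)) (coordDomain V E c) fun (_ : X) y => endInTriv V c (pt c y) (B (pt c y))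
  refine RegOn.of_smooth (isRelOpen_coordDomain (V := V) (E := E) c) le_top fun y hy => ?_
  have hb := (isPlot_pt (V := V) (E := E) c).base y hy
  choose t ht using fun i => exists_section_symm (E := E) c (Module.finBasis ℂ V i) hb
  have h1 : ContDiffWithinAt ℝ ∞ (fun z => clmOfBasis V fun i =>
      coordSection V c (endOp B hB (t i) : ∀ x, E x) z) (range (𝓡∂ 2)) y :=
    ((clmOfBasis V).restrictScalars ℝ).contDiff.contDiffWithinAt.comp y
      (contDiffWithinAt_pi.2 fun i => coordSection_smooth c (endOp B hB (t i)) hy) (mapsTo_univ _ _)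
  have h2 : ∀ᶠ z in 𝓝[range (𝓡∂ 2)] y, endInTriv V c (pt c z) (B (pt c z)) =
      clmOfBasis V fun i => coordSection V c (endOp B hB (t i) : ∀ x, E x) z := by
    filter_upwards [eventually_pt (mem_coordDomain.1 hy).1 (Filter.eventually_all.2 ht),
      (isRelOpen_coordDomain (V := V) (E := E) c).nhds y hy] with z hz2 hz3
    rw [← clmOfBasis_apply (endInTriv V c (pt c z) (B (pt c z)))]
    congr 1
    ext i
    rw [coordSection, endOp_apply, hz2, endInTriv_apply_symm,
      Bundle.Trivialization.symmₗ_apply _ (mem_coordDomain.1 hz3).2]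
  exact h1.congr_of_eventuallyEq h2 (h2.self_of_nhdsWithin
    ((isRelOpen_coordDomain (V := V) (E := E) c).subset hy))

/-- The symbol `ξ ↦ B S(ξ) B'`. -/
def sandwich {T W : Type*} [AddCommGroup T] [Module ℝ T] [AddCommGroup W] [Module ℂ W]
    (B B' : Module.End ℂ W) (S : T →ₗ[ℝ] Module.End ℂ W) : T →ₗ[ℝ] Module.End ℂ W where
  toFun ξ := B * S ξ * B'
  map_add' ξ η := by rw [map_add, mul_add, add_mul]
  map_smul' r ξ := by
    ext v
    simp only [map_smul, Module.End.mul_apply, RingHom.id_apply]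
    exact map_smul B (r : ℂ) (S ξ (B' v))

namespace HasSymb

variable {D D' : Sections V E →ₗ[ℂ] Sections V E} {σ σ' : Symb E}

theorem add (h : HasSymb D σ) (h' : HasSymb D' σ') : HasSymb (D + D') (σ + σ') := fun f u x => by
  change (D (mulFun f u) : ∀ x, E x) x + (D' (mulFun f u) : ∀ x, E x) x =
    f x • ((D u : ∀ x, E x) x + (D' u : ∀ x, E x) x) -
      Complex.I • (σ x (dAt f x) ((u : ∀ x, E x) x) + σ' x (dAt f x) ((u : ∀ x, E x) x))
  rw [h, h', smul_add, smul_add]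
  abel

theorem smul (h : HasSymb D σ) (z : ℂ) : HasSymb (z • D) (z • σ) := fun f u x => by
  change z • (D (mulFun f u) : ∀ x, E x) x =
    f x • z • (D u : ∀ x, E x) x - Complex.I • z • σ x (dAt f x) ((u : ∀ x, E x) x)
  rw [h, smul_sub, smul_comm z Complex.I, smul_comm z (f x)]

theorem zero : HasSymb (0 : Sections V E →ₗ[ℂ] Sections V E) 0 := fun f u x => by
  change (0 : E x) = f x • (0 : E x) - Complex.I • (0 : E x)
  simp

theorem sum {ι : Type*} (s : Finset ι) {D : ι → Sections V E →ₗ[ℂ] Sections V E} {σ : ι → Symb E}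
    (h : ∀ i, HasSymb (D i) (σ i)) : HasSymb (∑ i ∈ s, D i) (∑ i ∈ s, σ i) := by
  classical
  induction s using Finset.induction_on with
  | empty => exact zero
  | insert i s hi ih =>
    rw [Finset.sum_insert hi, Finset.sum_insert hi]
    exact (h i).add ih

theorem sandwich (h : HasSymb D σ) {B B' : ∀ x, Module.End ℂ (E x)} (hB : IsSmoothEnd V B)
    (hB' : IsSmoothEnd V B') :
    HasSymb (endOp B hB ∘ₗ D ∘ₗ endOp B' hB') fun x => BVP.sandwich (B x) (B' x) (σ x) := by
  intro f u x
  have h1 : endOp B' hB' (mulFun f u) = mulFun f (endOp B' hB' u) :=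
    Subtype.ext (funext fun x => map_smul (B' x) (f x : ℂ) _)
  change B x ((D (endOp B' hB' (mulFun f u)) : ∀ x, E x) x) =
    f x • B x ((D (endOp B' hB' u) : ∀ x, E x) x) -
      Complex.I • B x (σ x (dAt f x) (B' x ((u : ∀ x, E x) x)))
  rw [h1, h, map_sub]
  exact congrArg₂ _ (map_smul (B x) (f x : ℂ) _) (map_smul (B x) Complex.I _)

end HasSymb

/-- The operator `u ↦ ⟨b, u⟩ a` in a fibre. -/
def rk {W : Type*} [NormedAddCommGroup W] [InnerProductSpace ℂ W] (a b : W) : Module.End ℂ W :=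
  (innerSL ℂ b : W →ₗ[ℂ] ℂ).smulRight a

theorem rk_apply {W : Type*} [NormedAddCommGroup W] [InnerProductSpace ℂ W] (a b u : W) :
    rk a b u = (inner ℂ b u : ℂ) • a := rfl

theorem inner_rk {W : Type*} [NormedAddCommGroup W] [InnerProductSpace ℂ W] (a b u v : W) :
    (inner ℂ (rk a b u) v : ℂ) = inner ℂ u (rk b a v) := by
  rw [rk_apply, rk_apply, inner_smul_left, inner_smul_right, inner_conj_symm]
  ring

variable [∀ x, FiniteDimensional ℂ (E x)] [T2Space M]

theorem isSmoothEnd_rk (hE : IsSmoothHermitian V E) (a b : Sections V E) :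
    IsSmoothEnd V fun x => rk ((a : ∀ x, E x) x) ((b : ∀ x, E x) x) := fun u hu =>
  ((RegS.of_section (X := Unit) a).fsmul ((RegS.of_section b).inner hE
    (RegS.of_section ⟨u, hu⟩))).mem ()

/-- The operator `u ↦ ⟨b, u⟩ a` on sections. -/
def rkOp (hE : IsSmoothHermitian V E) (a b : Sections V E) : Sections V E →ₗ[ℂ] Sections V E :=
  endOp _ (isSmoothEnd_rk hE a b)

theorem rkOp_apply (hE : IsSmoothHermitian V E) (a b u : Sections V E) (x : M) :
    (rkOp hE a b u : ∀ x, E x) x =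
      (inner ℂ ((b : ∀ x, E x) x) ((u : ∀ x, E x) x) : ℂ) • (a : ∀ x, E x) x := rfl

theorem inner_rk_sum_eq_zero {W ι : Type*} [NormedAddCommGroup W] [InnerProductSpace ℂ W]
    (s : Finset ι) (e : ι → W) (v : W) (h : (∑ i ∈ s, rk (e i) (e i)) v = 0) :
    ∀ i ∈ s, (inner ℂ (e i) v : ℂ) = 0 := by
  have h1 : (inner ℂ v ((∑ i ∈ s, rk (e i) (e i)) v) : ℂ) =
      ((∑ i ∈ s, ‖(inner ℂ (e i) v : ℂ)‖ ^ 2 : ℝ) : ℂ) := by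
    rw [LinearMap.sum_apply, inner_sum, Complex.ofReal_sum]
    refine Finset.sum_congr rfl fun i _ => ?_
    rw [rk_apply, inner_smul_right, ← inner_conj_symm v (e i), Complex.mul_conj, Complex.normSq_eq_norm_sq]
  rw [h, inner_zero_right] at h1
  have h2 : ∑ i ∈ s, ‖(inner ℂ (e i) v : ℂ)‖ ^ 2 = 0 := by exact_mod_cast h1.symm
  intro i hi
  have := (Finset.sum_eq_zero_iff_of_nonneg fun i _ => sq_nonneg _).1 h2 i hi
  simpa using this

theorem isPositive_rk_sum {W ι : Type*} [NormedAddCommGroup W] [InnerProductSpace ℂ W]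
    (s : Finset ι) (e : ι → W) : (∑ i ∈ s, rk (e i) (e i)).IsPositive := by
  classical
  induction s using Finset.induction_on with
  | empty => exact LinearMap.isPositive_zero
  | insert i s hi ih =>
    rw [Finset.sum_insert hi]
    refine LinearMap.IsPositive.add ⟨fun u v => inner_rk _ _ _ _, fun u => ?_⟩ ih
    rw [rk_apply, inner_smul_left, inner_conj_symm, ← inner_conj_symm, mul_comm, Complex.mul_conj]
    simpa using Complex.normSq_nonneg _

/-- A finite family of sections spanning every fibre. -/
theorem exists_spanning_sections (V : Type*) [NormedAddCommGroup V] [NormedSpace ℂ V]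
    [FiniteDimensional ℂ V] {E : M → Type*} [TopologicalSpace (TotalSpace V E)]
    [∀ x, NormedAddCommGroup (E x)] [∀ x, InnerProductSpace ℂ (E x)]
    [FiberBundle V E] [VectorBundle ℂ V E] [VectorBundle ℝ V E]
    [ContMDiffVectorBundle ∞ V E (𝓡∂ 2)] [CompactSpace M] :
    ∃ (ι : Type) (_ : Fintype ι) (e : ι → Sections V E), ∀ (x : M) (v : E x),
      (∀ i, (inner ℂ ((e i : ∀ x, E x) x) v : ℂ) = 0) → v = 0 := by
  have h1 : ∀ c : M, ∃ t : Fin (Module.finrank ℂ V) → Sections V E, ∀ᶠ x in 𝓝 c, ∀ v : E x,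
      (∀ i, (inner ℂ ((t i : ∀ x, E x) x) v : ℂ) = 0) → v = 0 := by
    intro c
    choose t ht using fun i => exists_section_symm (E := E) c (Module.finBasis ℂ V i)
      (mem_baseSet_trivializationAt V E c)
    refine ⟨t, ?_⟩
    filter_upwards [Filter.eventually_all.2 ht, (trivializationAt V E c).open_baseSet.mem_nhds
      (mem_baseSet_trivializationAt V E c)] with x hx hb v hv
    have h2 : (innerSL ℂ v : E x →ₗ[ℂ] ℂ) ∘ₗ (trivializationAt V E c).symmₗ ℂ x = 0 := by
      refine (Module.finBasis ℂ V).ext fun i => ?_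
      rw [LinearMap.comp_apply, Bundle.Trivialization.symmₗ_apply _ hb, ← hx]
      change (inner ℂ v ((t i : ∀ x, E x) x) : ℂ) = 0
      rw [← inner_conj_symm, hv, map_zero]
    have h3 := LinearMap.congr_fun h2 ((trivializationAt V E c).linearMapAt ℂ x v)
    rw [LinearMap.comp_apply, (trivializationAt V E c).symmₗ_linearMapAt hb] at h3
    exact inner_self_eq_zero.1 (h3 : (inner ℂ v v : ℂ) = 0)
  choose t ht using h1
  obtain ⟨s, -, hs⟩ := isCompact_univ.elim_nhds_subcover _ fun c _ => ht c
  refine ⟨Fin s.card × Fin (Module.finrank ℂ V), inferInstance,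
    fun j => t (s.equivFin.symm j.1) j.2, fun x v hv => ?_⟩
  obtain ⟨c, hc, hx⟩ := mem_iUnion₂.1 (hs (mem_univ x))
  refine hx v fun i => ?_
  simpa using hv (s.equivFin ⟨c, hc⟩, i)

/-- A finite Parseval frame of sections. -/
theorem exists_parseval_frame [CompactSpace M] (hE : IsSmoothHermitian V E) :
    ∃ (ι : Type) (_ : Fintype ι) (s : ι → Sections V E), ∀ (x : M) (v : E x),
      ∑ i, (inner ℂ ((s i : ∀ x, E x) x) v : ℂ) • (s i : ∀ x, E x) x = v := by
  obtain ⟨ι, hι, e, he⟩ := exists_spanning_sections V (E := E)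
  -- The frame operator of a spanning family; the sections K^(-1/2)e_i then form a Parseval frame,
  -- since K^(-1/2) K K^(-1/2) = 1.
  let K : ∀ x, Module.End ℂ (E x) := fun x =>
    ∑ i, rk ((e i : ∀ x, E x) x) ((e i : ∀ x, E x) x)
  have hKp : ∀ x, (K x).IsPositive := fun x => isPositive_rk_sum _ _
  have hKu : ∀ x, IsUnit (K x) := fun x => by
    rw [LinearMap.isUnit_iff_ker_eq_bot, LinearMap.ker_eq_bot']
    exact fun v hv => he x v fun i => inner_rk_sum_eq_zero _ _ v hv i (Finset.mem_univ i)
  have hKs : IsSmoothEnd V K := fun u hu => by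
    have : (fun x => K x (u x)) = ((∑ i, rkOp hE (e i) (e i) ⟨u, hu⟩ : Sections V E) : ∀ x, E x) := by
      ext x
      rw [Submodule.coe_sum, Finset.sum_apply]
      simp only [K, LinearMap.sum_apply]
      rfl
    rw [this]
    exact Subtype.prop _
  let R : ∀ x, Module.End ℂ (E x) := fun x => invSqrt (K x)
  have hR : IsSmoothEnd V R := RegB.isSmoothEnd (X := Unit) (B := fun _ => R)
    (fun c => RegE.invSqrt (isPlot_pt c) (hKs.regB c) (fun _ _ _ => hKp _) fun _ _ _ => hKu _) ()
  refine ⟨ι, hι, fun i => endOp R hR (e i), fun x v => ?_⟩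
  obtain ⟨h1, h2⟩ := invSqrt_spec (hKp x) (hKu x)
  have h3 : R x * K x * R x = 1 := by
    have h4 : R x * (R x * K x) = 1 := by rw [← mul_assoc]; exact h2
    exact mul_eq_one_comm.1 h4
  conv_rhs => rw [← Module.End.one_apply (R := ℂ) v, ← h3, Module.End.mul_apply, Module.End.mul_apply]
  simp only [K, LinearMap.sum_apply, map_sum]
  refine Finset.sum_congr rfl fun i _ => ?_
  rw [rk_apply, map_smul, endOp_apply]
  congr 1
  exact h1.isSymmetric _ _

end OrderZero

/-! ### The trace form of a symbol on covectors. -/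

section TraceForm

variable {W ι : Type*} [NormedAddCommGroup W] [InnerProductSpace ℂ W] [Fintype ι] {s : ι → W}

/-- For symmetric operators the trace form is real and symmetric. -/
theorem parseval_sum_comm (hs : ∀ v, ∑ i, (inner ℂ (s i) v : ℂ) • s i = v) {A B : Module.End ℂ W}
    (hA : A.IsSymmetric) (hB : B.IsSymmetric) :
    ∑ k, (inner ℂ (A (s k)) (B (s k)) : ℂ) = ∑ k, inner ℂ (B (s k)) (A (s k)) := by
  have e : ∀ (C D : Module.End ℂ W) (k), (inner ℂ (C (s k)) (D (s k)) : ℂ) =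
      ∑ m, inner ℂ (s m) (D (s k)) * inner ℂ (C (s k)) (s m) := fun C D k => by
    conv_lhs => rw [← hs (D (s k)), inner_sum]
    exact Finset.sum_congr rfl fun m _ => inner_smul_right _ _ _
  rw [Finset.sum_congr rfl fun k _ => e A B k, Finset.sum_congr rfl fun k _ => e B A k,
    Finset.sum_comm]
  refine Finset.sum_congr rfl fun m _ => Finset.sum_congr rfl fun k _ => ?_
  rw [← hB, hA, mul_comm]

theorem parseval_sum_eq_re (hs : ∀ v, ∑ i, (inner ℂ (s i) v : ℂ) • s i = v) {A B : Module.End ℂ W}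
    (hA : A.IsSymmetric) (hB : B.IsSymmetric) :
    ∑ k, (inner ℂ (A (s k)) (B (s k)) : ℂ) =
      ((∑ k, (inner ℂ (A (s k)) (B (s k)) : ℂ).re : ℝ) : ℂ) := by
  have h : (starRingEnd ℂ) (∑ k, (inner ℂ (A (s k)) (B (s k)) : ℂ)) =
      ∑ k, (inner ℂ (A (s k)) (B (s k)) : ℂ) := by
    rw [map_sum, parseval_sum_comm hs hA hB]
    exact Finset.sum_congr rfl fun k _ => inner_conj_symm _ _
  rw [← Complex.re_sum]
  exact (Complex.conj_eq_iff_re.1 h).symm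

/-- The real trace form of two operators. -/
def traceForm (s : ι → W) (A B : Module.End ℂ W) : ℝ := ∑ k, (inner ℂ (A (s k)) (B (s k)) : ℂ).re

variable {T : Type*} [AddCommGroup T] [Module ℝ T] {S : T →ₗ[ℝ] Module.End ℂ W}

/-- S(ζ) is invertible for ζ ≠ 0, so the form Tr(S(ξ)S(η)), computed in a Parseval frame, is
positive definite on covectors and its Gram determinant is positive. -/
theorem traceForm_det_pos [FiniteDimensional ℂ W] [Nontrivial W]
    (hs : ∀ v, ∑ i, (inner ℂ (s i) v : ℂ) • s i = v)
    (hS : IsEllSymb S) {ξ η : T} (h : ∀ a b : ℝ, a • ξ + b • η = 0 → a = 0 ∧ b = 0) :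
    0 < traceForm s (S ξ) (S ξ) * traceForm s (S η) (S η) -
      traceForm s (S ξ) (S η) * traceForm s (S ξ) (S η) := by
  have pos : ∀ ζ : T, ζ ≠ 0 → 0 < traceForm s (S ζ) (S ζ) := by
    intro ζ hζ
    have h0 : ∀ k, 0 ≤ (inner ℂ (S ζ (s k)) (S ζ (s k)) : ℂ).re := fun k => inner_self_nonneg (𝕜 := ℂ)
    refine lt_of_le_of_ne (Finset.sum_nonneg fun k _ => h0 k) fun h1 => ?_
    have h2 := (Finset.sum_eq_zero_iff_of_nonneg fun k _ => h0 k).1 h1.symm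
    have h3 : ∀ k, s k = 0 := fun k => by
      have h4 := h2 k (Finset.mem_univ k)
      have h5 : S ζ (s k) = 0 := by
        rw [← norm_eq_zero, ← sq_eq_zero_iff, ← inner_self_eq_norm_sq (𝕜 := ℂ)]
        exact h4
      have h6 := LinearMap.congr_fun (Ring.inverse_mul_cancel _ (hS.unit ζ hζ)) (s k)
      rw [Module.End.mul_apply, h5, map_zero] at h6
      exact h6.symm
    obtain ⟨v, hv⟩ := exists_ne (0 : W)
    apply hv
    rw [← hs v]
    simp [h3]
  have symm : traceForm s (S η) (S ξ) = traceForm s (S ξ) (S η) := by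
    unfold traceForm
    rw [← Complex.re_sum, ← Complex.re_sum, parseval_sum_comm hs (hS.sym η) (hS.sym ξ)]
  have bil : ∀ c d : ℝ, traceForm s (S (c • ξ + d • η)) (S (c • ξ + d • η)) =
      c * c * traceForm s (S ξ) (S ξ) + c * d * traceForm s (S ξ) (S η) +
        d * c * traceForm s (S η) (S ξ) + d * d * traceForm s (S η) (S η) := fun c d => by
    have r1 : ∀ (r : ℝ) (v : W), r • v = (r : ℂ) • v := fun _ _ => rfl
    simp only [traceForm, Finset.mul_sum, ← Finset.sum_add_distrib]
    refine Finset.sum_congr rfl fun k _ => ?_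
    rw [map_add, map_smul, map_smul, LinearMap.add_apply, LinearMap.smul_apply,
      LinearMap.smul_apply, r1, r1]
    simp only [inner_add_left, inner_add_right, inner_smul_left, inner_smul_right,
      Complex.conj_ofReal, Complex.add_re, Complex.re_ofReal_mul]
    ring
  have hη : η ≠ 0 := fun h0 => by simpa using (h 0 1 (by simp [h0])).2
  have p1 := pos η hη
  set g := traceForm s (S ξ) (S η) with hg
  set b := traceForm s (S η) (S η) with hb
  set a := traceForm s (S ξ) (S ξ) with ha
  -- The value of the form at bξ - gη is b(ab - g²), with b > 0.
  have hne : b • ξ + (-g) • η ≠ 0 := fun h0 => p1.ne' (h _ _ h0).1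
  have p2 := pos _ hne
  have e : traceForm s (S (b • ξ + (-g) • η)) (S (b • ξ + (-g) • η)) = b * (a * b - g * g) := by
    rw [bil]
    change b * b * a + b * (-g) * g + (-g) * b * traceForm s (S η) (S ξ) + (-g) * (-g) * b = _
    rw [symm]
    ring
  rw [e] at p2
  exact (mul_pos_iff_of_pos_left p1).1 p2

end TraceForm

/-! ### Recovering an arbitrary symbol from that of one elliptic operator. -/

section Representation

open Set

variable {M : Type*} [TopologicalSpace M] [ChartedSpace (EuclideanHalfSpace 2) M]
  [IsManifold (𝓡∂ 2) ∞ M]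

variable {V : Type*} [NormedAddCommGroup V] [NormedSpace ℂ V] [FiniteDimensional ℂ V]
  {E : M → Type*} [TopologicalSpace (TotalSpace V E)]
  [∀ x, NormedAddCommGroup (E x)] [∀ x, InnerProductSpace ℂ (E x)]
  [FiberBundle V E] [VectorBundle ℂ V E] [VectorBundle ℝ V E]
  [ContMDiffVectorBundle ∞ V E (𝓡∂ 2)]

variable [MeasurableSpace M] [RiemannianBundle (fun x : M => TangentSpace (𝓡∂ 2) x)]

theorem contMDiffMap_sum_apply {ι : Type*} (s : Finset ι) (f : ι → C^∞⟮𝓡∂ 2, M; ℝ⟯) (x : M) :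
    (∑ i ∈ s, f i) x = ∑ i ∈ s, f i x := by
  classical
  induction s using Finset.induction_on with
  | empty => rfl
  | insert i s hi ih => rw [Finset.sum_insert hi, Finset.sum_insert hi, ← ih]; rfl

/-- The sum that is used to recover a symbol `τ` from the symbol of a fixed operator. -/
def reprSum (A₀ : Ell V E) {ι : Type} [Fintype ι] (f : ι → C^∞⟮𝓡∂ 2, M; ℝ⟯)
    (p q r z : ι → Sections V E) (x : M) (τ : (Tan x →L[ℝ] ℝ) →ₗ[ℝ] Module.End ℂ (E x))
    (ξ : Tan x →L[ℝ] ℝ) (u : E x) : E x :=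
  ∑ j, (inner ℂ ((q j : ∀ x, E x) x) (A₀.symb x ξ ((z j : ∀ x, E x) x)) *
    inner ℂ ((r j : ∀ x, E x) x) u : ℂ) • τ (dAt (f j) x) ((p j : ∀ x, E x) x)

/-- The function `χ` can be represented by a finite family of sections and functions. -/
def IsRepr (A₀ : Ell V E) (χ : C^∞⟮𝓡∂ 2, M; ℝ⟯) : Prop :=
  ∃ (ι : Type) (_ : Fintype ι) (f : ι → C^∞⟮𝓡∂ 2, M; ℝ⟯) (p q r z : ι → Sections V E),
    ∀ x τ ξ u, reprSum A₀ f p q r z x τ ξ u = χ x • τ ξ u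

namespace IsRepr

variable {A₀ : Ell V E} {χ χ' : C^∞⟮𝓡∂ 2, M; ℝ⟯}

theorem zero : IsRepr A₀ 0 :=
  ⟨Empty, inferInstance, Empty.elim, Empty.elim, Empty.elim, Empty.elim, Empty.elim,
    fun x τ ξ u => by simp [reprSum]⟩

theorem add (h : IsRepr A₀ χ) (h' : IsRepr A₀ χ') : IsRepr A₀ (χ + χ') := by
  obtain ⟨ι, hι, f, p, q, r, z, h⟩ := h
  obtain ⟨ι', hι', f', p', q', r', z', h'⟩ := h'
  refine ⟨ι ⊕ ι', inferInstance, Sum.elim f f', Sum.elim p p', Sum.elim q q', Sum.elim r r',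
    Sum.elim z z', fun x τ ξ u => ?_⟩
  have e := congrArg₂ (· + ·) (h x τ ξ u) (h' x τ ξ u)
  simp only [reprSum] at e
  simp only [reprSum, Fintype.sum_sum_type, Sum.elim_inl, Sum.elim_inr]
  rw [e, ContMDiffMap.coe_add, Pi.add_apply, add_smul]

theorem mul (φ : C^∞⟮𝓡∂ 2, M; ℝ⟯) (h : IsRepr A₀ χ) : IsRepr A₀ (φ * χ) := by
  obtain ⟨ι, hι, f, p, q, r, z, h⟩ := h
  refine ⟨ι, hι, f, p, q, fun j => mulFun φ (r j), z, fun x τ ξ u => ?_⟩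
  rw [ContMDiffMap.coe_mul, Pi.mul_apply, mul_smul, ← h]
  unfold reprSum
  rw [Finset.smul_sum]
  refine Finset.sum_congr rfl fun j _ => ?_
  have e : (inner ℂ ((mulFun φ (r j) : ∀ x, E x) x) u : ℂ) =
      (φ x : ℂ) * inner ℂ ((r j : ∀ x, E x) x) u := by
    have h1 : (mulFun φ (r j) : ∀ x, E x) x = (φ x : ℂ) • (r j : ∀ x, E x) x := rfl
    rw [h1, inner_smul_left, Complex.conj_ofReal]
  have r1 : ∀ (r : ℝ) (v : E x), r • v = (r : ℂ) • v := fun _ _ => rfl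
  rw [e, r1, smul_smul]
  congr 1
  ring

theorem sum {ι : Type*} (s : Finset ι) {χ : ι → C^∞⟮𝓡∂ 2, M; ℝ⟯} (h : ∀ i, IsRepr A₀ (χ i)) :
    IsRepr A₀ (∑ i ∈ s, χ i) := by
  classical
  induction s using Finset.induction_on with
  | empty => exact zero
  | insert i s hi ih =>
    rw [Finset.sum_insert hi]
    exact (h i).add ih

end IsRepr

variable [∀ x, FiniteDimensional ℂ (E x)] [T2Space M] {A₀ : Ell V E}

/-- The trace form of A₀ determines the coefficients of ξ in the basis df_0, df_1 from the traces of
σ₀(df_a)σ₀(ξ), by Cramer's rule. The determinant is multiplied out instead of divided by, and a bump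
function localizes; this yields χ = φ · det. -/
theorem exists_isRepr_local (hE : IsSmoothHermitian V E) (hell : ∀ x, IsEllSymb (A₀.symb x))
    {ι : Type} [Fintype ι] {s : ι → Sections V E} (hs : ∀ (x : M) (v : E x),
      ∑ i, (inner ℂ ((s i : ∀ x, E x) x) v : ℂ) • (s i : ∀ x, E x) x = v) (x₀ : M)
    [Nontrivial (E x₀)] :
    ∃ χ : C^∞⟮𝓡∂ 2, M; ℝ⟯, IsRepr A₀ χ ∧ (∀ x, 0 ≤ χ x) ∧ 0 < χ x₀ := by
  choose f hf using fun j => exists_dAt_eq_coordCovec (mem_chart_source (EuclideanHalfSpace 2) x₀) j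
  have hev : ∀ᶠ x in 𝓝 x₀, (∀ j, dAt (f j) x = coordCovec x₀ x j) ∧
      x ∈ (chartAt (EuclideanHalfSpace 2) x₀).source :=
    (Filter.eventually_all.2 hf).and
      ((chartAt (EuclideanHalfSpace 2) x₀).open_source.mem_nhds (mem_chart_source _ x₀))
  obtain ⟨φ, -, hφ⟩ := (SmoothBumpFunction.nhds_basis_tsupport (I := 𝓡∂ 2) x₀).mem_iff.1 hev
  have hsm : ∀ a, IsSmoothEnd V fun x => A₀.symb x (dAt (f a) x) := fun a u hu => by
    have h1 : (fun x => A₀.symb x (dAt (f a) x) (u x)) =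
        ((Complex.I • (A₀.op (mulFun (f a) ⟨u, hu⟩) - mulFun (f a) (A₀.op ⟨u, hu⟩)) :
          Sections V E) : ∀ x, E x) := by
      ext x
      change _ = Complex.I • ((A₀.op (mulFun (f a) ⟨u, hu⟩) : ∀ x, E x) x -
        f a x • (A₀.op ⟨u, hu⟩ : ∀ x, E x) x)
      rw [A₀.leibniz, sub_sub_cancel_left, smul_neg, smul_smul, Complex.I_mul_I, neg_one_smul,
        neg_neg]
    rw [h1]
    exact Subtype.prop _
  let w : Fin 2 → ι → Sections V E := fun a k => endOp _ (hsm a) (s k)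
  let G : Fin 2 → Fin 2 → C^∞⟮𝓡∂ 2, M; ℝ⟯ := fun a b =>
    ∑ k, ⟨fun x => (inner ℂ ((w a k : ∀ x, E x) x) ((w b k : ∀ x, E x) x) : ℂ).re,
      Complex.reCLM.contDiff.contMDiff.comp (hE _ (w a k).2 _ (w b k).2)⟩
  have hG : ∀ a b x, G a b x = traceForm (fun k => (s k : ∀ x, E x) x)
      (A₀.symb x (dAt (f a) x)) (A₀.symb x (dAt (f b) x)) := fun a b x => by
    exact (contMDiffMap_sum_apply _ _ _).trans rfl
  have hGc : ∀ a b x, ∑ k, (inner ℂ ((w a k : ∀ x, E x) x) ((w b k : ∀ x, E x) x) : ℂ) =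
      (G a b x : ℂ) := fun a b x => by
    rw [hG]
    exact parseval_sum_eq_re (hs x) ((hell x).sym _) ((hell x).sym _)
  have hGs : ∀ x, G 1 0 x = G 0 1 x := fun x => by
    have h1 := parseval_sum_comm (hs x) ((hell x).sym (dAt (f 1) x)) ((hell x).sym (dAt (f 0) x))
    have h2 := ((hGc 1 0 x).symm.trans h1).trans (hGc 0 1 x)
    exact_mod_cast h2
  let φ' : C^∞⟮𝓡∂ 2, M; ℝ⟯ := ⟨φ, φ.contMDiff⟩
  let det : C^∞⟮𝓡∂ 2, M; ℝ⟯ := G 0 0 * G 1 1 - G 0 1 * G 0 1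
  have hdet : ∀ x, det x = G 0 0 x * G 1 1 x - G 0 1 x * G 0 1 x := fun x => rfl
  have hpos : ∀ x, [Nontrivial (E x)] → φ x ≠ 0 → 0 < det x := fun x _ hx => by
    have hx' := hφ (subset_tsupport _ hx)
    rw [hdet, hG, hG, hG]
    refine traceForm_det_pos (hs x) (hell x) fun a b h => ?_
    rw [hx'.1, hx'.1] at h
    have h0 := congrArg (fun ξ : Tan x →L[ℝ] ℝ => ξ (coordVec x₀ x 0)) h
    have h1 := congrArg (fun ξ : Tan x →L[ℝ] ℝ => ξ (coordVec x₀ x 1)) h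
    simpa [coordCovec_coordVec hx'.2] using And.intro h0 h1
  have hnn : ∀ x, φ x ≠ 0 → 0 ≤ det x := fun x hx => by
    rcases subsingleton_or_nontrivial (E x) with h | h
    · have h0 : ∀ a b, G a b x = 0 := fun a b => by
        rw [hG]
        exact Finset.sum_eq_zero fun k _ => by
          rw [Subsingleton.elim (A₀.symb x (dAt (f a) x) _) 0, inner_zero_left, Complex.zero_re]
      rw [hdet, h0, h0, h0]
      norm_num
    · exact (hpos x hx).le
  refine ⟨φ' * det, ?_, fun x => ?_, ?_⟩
  -- The adjugate of the Gram matrix applied to the sections σ₀(df_a)s_k.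
  · let q : Fin 2 → ι → Sections V E := fun a k => if a = 0 then
      mulFun (G 1 1) (w 0 k) - mulFun (G 0 1) (w 1 k) else
      mulFun (G 0 0) (w 1 k) - mulFun (G 0 1) (w 0 k)
    refine ⟨Fin 2 × ι × ι, inferInstance, fun j => f j.1, fun j => s j.2.2, fun j => q j.1 j.2.1,
      fun j => mulFun φ' (s j.2.2), fun j => s j.2.1, fun x τ ξ u => ?_⟩
    have hr : ∀ m, (inner ℂ ((mulFun φ' (s m) : ∀ x, E x) x) u : ℂ) =
        (φ x : ℂ) * inner ℂ ((s m : ∀ x, E x) x) u := fun m => by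
      have h1 : (mulFun φ' (s m) : ∀ x, E x) x = (φ x : ℂ) • (s m : ∀ x, E x) x := rfl
      rw [h1, inner_smul_left, Complex.conj_ofReal]
    -- Summing over the last index is the Parseval expansion of u; summing over the middle one forms
    -- a trace.
    have e1 : reprSum A₀ (fun j : Fin 2 × ι × ι => f j.1) (fun j => s j.2.2)
        (fun j => q j.1 j.2.1) (fun j => mulFun φ' (s j.2.2)) (fun j => s j.2.1) x τ ξ u =
        (φ x : ℂ) • ∑ a, (∑ k, (inner ℂ ((q a k : ∀ x, E x) x)
          (A₀.symb x ξ ((s k : ∀ x, E x) x)) : ℂ)) • τ (dAt (f a) x) u := by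
      unfold reprSum
      rw [Fintype.sum_prod_type, Finset.smul_sum]
      refine Finset.sum_congr rfl fun a _ => ?_
      rw [Fintype.sum_prod_type, Finset.sum_smul, Finset.smul_sum]
      refine Finset.sum_congr rfl fun k _ => ?_
      conv_rhs => rw [← hs x u]
      simp only [map_sum, map_smul, Finset.smul_sum, smul_smul, hr]
      refine Finset.sum_congr rfl fun m _ => ?_
      congr 1
      ring
    rw [e1]
    have r1 : ∀ (r : ℝ) (v : E x), r • v = (r : ℂ) • v := fun _ _ => rfl
    have e2 : (φ' * det) x • τ ξ u = (φ x : ℂ) • (det x : ℂ) • τ ξ u := by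
      rw [smul_smul, ← Complex.ofReal_mul]
      rfl
    rw [e2]
    by_cases hx : φ x = 0
    · rw [hx, Complex.ofReal_zero, zero_smul, zero_smul]
    congr 1
    have hx' := hφ (subset_tsupport _ hx)
    obtain ⟨a, b, hab⟩ : ∃ a b : ℝ, ξ = a • dAt (f 0) x + b • dAt (f 1) x :=
      ⟨_, _, by rw [hx'.1, hx'.1]; exact eq_sum_coordCovec hx'.2 ξ⟩
    have hξ : ∀ k, A₀.symb x ξ ((s k : ∀ x, E x) x) =
        (a : ℂ) • (w 0 k : ∀ x, E x) x + (b : ℂ) • (w 1 k : ∀ x, E x) x := fun k => by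
      rw [hab, map_add, map_smul, map_smul]
      rfl
    have hq0 : ∀ k, (q 0 k : ∀ x, E x) x =
        (G 1 1 x : ℂ) • (w 0 k : ∀ x, E x) x - (G 0 1 x : ℂ) • (w 1 k : ∀ x, E x) x := fun k => rfl
    have hq1 : ∀ k, (q 1 k : ∀ x, E x) x =
        (G 0 0 x : ℂ) • (w 1 k : ∀ x, E x) x - (G 0 1 x : ℂ) • (w 0 k : ∀ x, E x) x := fun k => rfl
    have key : ∀ (c d : ℝ) (i j : Fin 2), ∑ k, (inner ℂ ((c : ℂ) • (w i k : ∀ x, E x) x -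
        (d : ℂ) • (w j k : ∀ x, E x) x) ((a : ℂ) • (w 0 k : ∀ x, E x) x +
          (b : ℂ) • (w 1 k : ∀ x, E x) x) : ℂ) =
        c * (a * G i 0 x + b * G i 1 x) - d * (a * G j 0 x + b * G j 1 x) := fun c d i j => by
      simp only [← hGc, Finset.mul_sum, ← Finset.sum_add_distrib, ← Finset.sum_sub_distrib]
      refine Finset.sum_congr rfl fun k _ => ?_
      simp only [inner_sub_left, inner_add_right, inner_smul_left, inner_smul_right,
        Complex.conj_ofReal]
      ring
    rw [Fin.sum_univ_two]
    simp only [hξ, hq0, hq1]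
    rw [key, key, hGs, hab, map_add, map_smul, map_smul, LinearMap.add_apply, hdet]
    change _ = _ • ((a : ℂ) • τ (dAt (f 0) x) u + (b : ℂ) • τ (dAt (f 1) x) u)
    push_cast
    module
  · change 0 ≤ φ x * det x
    by_cases hx : φ x = 0
    · rw [hx, zero_mul]
    · exact mul_nonneg φ.nonneg (hnn x hx)
  · change 0 < φ x₀ * det x₀
    rw [φ.eq_one, one_mul]
    exact hpos x₀ (by rw [φ.eq_one]; exact one_ne_zero)

/-- By compactness finitely many local representations have a positive sum, and one divides by it.
-/
theorem isRepr_one [CompactSpace M] (hE : IsSmoothHermitian V E)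
    (hell : ∀ x, IsEllSymb (A₀.symb x)) : IsRepr A₀ 1 := by
  have hequiv : ∀ x, Nonempty (E x ≃ V) := fun x =>
    ⟨((trivializationAt V E x).linearEquivAt ℂ x (mem_baseSet_trivializationAt V E x)).toEquiv⟩
  -- The zero bundle is separate: its trace form is degenerate, but there the empty family works.
  rcases subsingleton_or_nontrivial V with hV | hV
  · refine ⟨Empty, inferInstance, Empty.elim, Empty.elim, Empty.elim, Empty.elim, Empty.elim,
      fun x τ ξ u => ?_⟩
    haveI := (hequiv x).some.subsingleton
    exact Subsingleton.elim _ _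
  have hn : ∀ x, Nontrivial (E x) := fun x => (hequiv x).some.nontrivial
  obtain ⟨ι, hι, s, hs⟩ := exists_parseval_frame hE
  choose χ h1 h2 h3 using fun x₀ => exists_isRepr_local hE hell hs x₀
  have hnb : ∀ x₀ ∈ (univ : Set M), {x | 0 < χ x₀ x} ∈ 𝓝 x₀ := fun x₀ _ =>
    ((χ x₀).contMDiff.continuous.tendsto x₀).eventually (lt_mem_nhds (h3 x₀))
  obtain ⟨t, -, ht⟩ := isCompact_univ.elim_nhds_subcover _ hnb
  have hpos : ∀ x, 0 < (∑ i ∈ t, χ i) x := fun x => by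
    rw [contMDiffMap_sum_apply]
    obtain ⟨c, hc, hx⟩ := mem_iUnion₂.1 (ht (mem_univ x))
    exact Finset.sum_pos' (fun i _ => h2 i x) ⟨c, hc, hx⟩
  have h := (IsRepr.sum t h1).mul ⟨fun x => ((∑ i ∈ t, χ i) x)⁻¹,
    (∑ i ∈ t, χ i).contMDiff.inv₀ fun x => (hpos x).ne'⟩
  convert h using 1
  ext x
  exact (inv_mul_cancel₀ (hpos x).ne').symm

end Representation

/-! ### The Riemannian volume is finite and positive on open sets. -/

section Volume

open Set

variable {M : Type*} [TopologicalSpace M] [ChartedSpace (EuclideanHalfSpace 2) M]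
  [IsManifold (𝓡∂ 2) ∞ M]

theorem coordCovec_coordVec_eq {c c' x : M} (hx : x ∈ (chartAt (EuclideanHalfSpace 2) c).source)
    (hx' : x ∈ (chartAt (EuclideanHalfSpace 2) c').source) (i j : Fin 2) :
    coordCovec c' x i (coordVec c x j) =
      tangentCoordChange (𝓡∂ 2) c c' x (EuclideanSpace.single j 1) i := by
  have h1 : coordVec c x j =
      tangentCoordChange (𝓡∂ 2) c x x (EuclideanSpace.single j 1) :=
    congrArg (fun T : Plane →L[ℝ] Plane => T (EuclideanSpace.single j 1))
      ((tangentBundleCore (𝓡∂ 2) M).trivializationAt_symmL (b₀ := c) (b := x) hx)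
  have h2 : ∀ v : Plane,
      (trivializationAt Plane (TangentSpace (𝓡∂ 2)) c').continuousLinearMapAt ℝ x v =
      tangentCoordChange (𝓡∂ 2) x c' x v := fun v =>
    congrArg (fun T : Plane →L[ℝ] Plane => T v)
      ((tangentBundleCore (𝓡∂ 2) M).trivializationAt_continuousLinearMapAt (b₀ := c') (b := x) hx')
  change (trivializationAt Plane (TangentSpace (𝓡∂ 2)) c').continuousLinearMapAt ℝ x
    (coordVec c x j) i = _
  rw [h1]
  refine (congrArg (fun v : Plane => v i) (h2 _)).trans ?_
  refine congrArg (fun v : Plane => v i) (tangentCoordChange_comp (I := 𝓡∂ 2) ⟨⟨?_, ?_⟩, ?_⟩)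
  · rwa [extChartAt_source]
  · exact mem_extChartAt_source x
  · rwa [extChartAt_source]

theorem continuousOn_pt (c : M) : ContinuousOn (pt c) (extChartAt (𝓡∂ 2) c).target :=
  continuousOn_extChartAt_symm c

theorem measurableSet_target (c : M) : MeasurableSet (extChartAt (𝓡∂ 2) c).target := by
  rw [extChartAt_target]
  exact ((𝓡∂ 2).continuous_symm.isOpen_preimage _
    (chartAt (EuclideanHalfSpace 2) c).open_target).measurableSet.inter
      (𝓡∂ 2).isClosed_range.measurableSet

section Area

variable [RiemannianBundle (fun x : M => TangentSpace (𝓡∂ 2) x)] (o : SurfaceOrientation M)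

theorem volDensity_eq (c : M) {y : Plane} (hy : y ∈ (extChartAt (𝓡∂ 2) c).target) :
    volDensity c y = |o.area c (pt c y)| := by
  have hx : pt c y ∈ (chartAt (EuclideanHalfSpace 2) c).source := by
    rw [← extChartAt_source (𝓡∂ 2)]
    exact (extChartAt (𝓡∂ 2) c).map_target hy
  rw [← Real.sqrt_sq_eq_abs, (conformal_coordinates o hx).2.2.1, volDensity, Matrix.det_fin_two]
  simp only [Matrix.of_apply, metricDet, metricCoeff]
  rw [real_inner_comm (coordVec c (pt c y) 0) (coordVec c (pt c y) 1), sq]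

variable [MeasurableSpace M]

variable (M) in
/-- The Riemannian measure in one chart. -/
def chartVolume (c : M) : Measure M := Measure.map (extChartAt (𝓡∂ 2) c).symm
    (((volume : Measure Plane).restrict (extChartAt (𝓡∂ 2) c).target).withDensity
      fun y => ENNReal.ofReal (volDensity c y))

variable [BorelSpace M]

theorem measurableSet_target_inter_preimage (c : M) {A : Set M} (hA : MeasurableSet A) :
    MeasurableSet ((extChartAt (𝓡∂ 2) c).target ∩ pt c ⁻¹' A) := by
  have h1 : MeasurableSet ((extChartAt (𝓡∂ 2) c).target.domRestrict (pt c) ⁻¹' A) :=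
    (continuousOn_iff_continuous_restrict.1 (continuousOn_pt c)).measurable hA
  have h2 := (measurableSet_target c).subtype_image h1
  have h3 : Subtype.val '' ((extChartAt (𝓡∂ 2) c).target.domRestrict (pt c) ⁻¹' A) =
      (extChartAt (𝓡∂ 2) c).target ∩ pt c ⁻¹' A := by
    ext y
    simp [domRestrict, and_comm]
  rwa [h3] at h2

theorem chartVolume_apply (c : M) {A : Set M} (hA : MeasurableSet A) : chartVolume M c A =
    ∫⁻ y in (extChartAt (𝓡∂ 2) c).target ∩ pt c ⁻¹' A, ENNReal.ofReal (volDensity c y) := by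
  have h1 : AEMeasurable (extChartAt (𝓡∂ 2) c).symm
      (((volume : Measure Plane).restrict (extChartAt (𝓡∂ 2) c).target).withDensity
        fun y => ENNReal.ofReal (volDensity c y)) :=
    ((continuousOn_pt c).aemeasurable (measurableSet_target c)).mono_ac
      (withDensity_absolutelyContinuous _ _)
  rw [chartVolume, Measure.map_apply_of_aemeasurable h1 hA, withDensity_apply']
  rw [Measure.restrict_restrict₀']
  · rw [inter_comm]
  · exact (measurableSet_target c).nullMeasurableSet

/-- Change of variables: the Jacobian of the transition map is exactly the ratio of the signed areas
of the two frames. By symmetry the chart measures agree on overlaps. -/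
theorem chartVolume_mono (o : SurfaceOrientation M) (c c' : M) {A : Set M} (hA : MeasurableSet A)
    (h : A ⊆ (extChartAt (𝓡∂ 2) c).source) (h' : A ⊆ (extChartAt (𝓡∂ 2) c').source) :
    chartVolume M c A ≤ chartVolume M c' A := by
  rw [chartVolume_apply c hA, chartVolume_apply c' hA]
  set B := (extChartAt (𝓡∂ 2) c).target ∩ pt c ⁻¹' A with hB
  have hBm : MeasurableSet B :=
    measurableSet_target_inter_preimage c hA
  let φ : Plane → Plane := extChartAt (𝓡∂ 2) c' ∘ (extChartAt (𝓡∂ 2) c).symm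
  have hd : ∀ y ∈ B, HasFDerivWithinAt φ (tangentCoordChange (𝓡∂ 2) c c' (pt c y)) B y := by
    intro y hy
    have h1 := hasFDerivWithinAt_tangentCoordChange (I := 𝓡∂ 2) (x := c) (y := c') (z := pt c y)
      ⟨h hy.2, h' hy.2⟩
    rw [(extChartAt (𝓡∂ 2) c).right_inv hy.1] at h1
    exact h1.mono (inter_subset_left.trans (extChartAt_target_subset_range c))
  have hinj : InjOn φ B := by
    intro y hy z hz hyz
    have h1 := (extChartAt (𝓡∂ 2) c').injOn (h' hy.2) (h' hz.2) hyz
    exact (extChartAt (𝓡∂ 2) c).symm.injOn hy.1 hz.1 h1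
  have him : φ '' B ⊆ (extChartAt (𝓡∂ 2) c').target ∩ pt c' ⁻¹' A := by
    rintro _ ⟨y, hy, rfl⟩
    refine ⟨(extChartAt (𝓡∂ 2) c').map_source (h' hy.2), ?_⟩
    change pt c' (extChartAt (𝓡∂ 2) c' (pt c y)) ∈ A
    rw [pt, (extChartAt (𝓡∂ 2) c').left_inv (h' hy.2)]
    exact hy.2
  refine le_trans (le_of_eq ?_) (lintegral_mono_set him)
  rw [lintegral_image_eq_lintegral_abs_det_fderiv_mul volume hBm hd hinj]
  refine setLIntegral_congr_fun hBm fun y hy => ?_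
  have hs : pt c y ∈ (chartAt (EuclideanHalfSpace 2) c).source := by
    rw [← extChartAt_source (𝓡∂ 2)]; exact h hy.2
  have hs' : pt c y ∈ (chartAt (EuclideanHalfSpace 2) c').source := by
    rw [← extChartAt_source (𝓡∂ 2)]; exact h' hy.2
  have hφ : pt c' (φ y) = pt c y := (extChartAt (𝓡∂ 2) c').left_inv (h' hy.2)
  have hdet : (tangentCoordChange (𝓡∂ 2) c c' (pt c y)).det =
      coordCovec c' (pt c y) 0 (coordVec c (pt c y) 0) *
        coordCovec c' (pt c y) 1 (coordVec c (pt c y) 1) -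
      coordCovec c' (pt c y) 1 (coordVec c (pt c y) 0) *
        coordCovec c' (pt c y) 0 (coordVec c (pt c y) 1) := by
    rw [ContinuousLinearMap.det, ← LinearMap.det_toMatrix (EuclideanSpace.basisFun (Fin 2) ℝ).toBasis,
      Matrix.det_fin_two]
    simp only [LinearMap.toMatrix_apply, coordCovec_coordVec_eq hs hs']
    simp [mul_comm]
  rw [volDensity_eq o c hy.1, volDensity_eq o c' (him (mem_image_of_mem φ hy)).1, hφ,
    o.area_change hs', hdet, abs_mul, ENNReal.ofReal_mul (abs_nonneg _)]

variable [IsContMDiffRiemannianBundle (𝓡∂ 2) ∞ Plane (fun x : M => TangentSpace (𝓡∂ 2) x)]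

theorem chartVolume_lt_top (o : SurfaceOrientation M) (c : M) {K : Set M} (hK : IsCompact K)
    (hKm : MeasurableSet K) (h : K ⊆ (extChartAt (𝓡∂ 2) c).source) : chartVolume M c K < ⊤ := by
  rw [chartVolume_apply c hKm]
  have h1 : (extChartAt (𝓡∂ 2) c).target ∩ pt c ⁻¹' K = extChartAt (𝓡∂ 2) c '' K := by
    ext y
    constructor
    · rintro ⟨hy, hyK⟩
      exact ⟨_, hyK, (extChartAt (𝓡∂ 2) c).right_inv hy⟩
    · rintro ⟨x, hx, rfl⟩
      refine ⟨(extChartAt (𝓡∂ 2) c).map_source (h hx), ?_⟩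
      rwa [mem_preimage, pt, (extChartAt (𝓡∂ 2) c).left_inv (h hx)]
  have h2 : IsCompact ((extChartAt (𝓡∂ 2) c).target ∩ pt c ⁻¹' K) := by
    rw [h1]
    exact hK.image_of_continuousOn ((continuousOn_extChartAt c).mono h)
  have h3 : ContinuousOn (volDensity (M := M) c) ((extChartAt (𝓡∂ 2) c).target ∩ pt c ⁻¹' K) := by
    have h4 : ContinuousOn (fun y => |o.area c (pt c y)|) (extChartAt (𝓡∂ 2) c).target := by
      refine ContinuousOn.abs fun y hy => ?_
      have hx : pt c y ∈ (chartAt (EuclideanHalfSpace 2) c).source := by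
        rw [← extChartAt_source (𝓡∂ 2)]
        exact (extChartAt (𝓡∂ 2) c).map_target hy
      exact (o.area_contMDiffAt hx).continuousAt.comp_continuousWithinAt (continuousOn_pt c y hy)
    exact (h4.mono inter_subset_left).congr fun y hy => volDensity_eq o c hy.1
  exact (h3.integrableOn_compact h2).lintegral_lt_top

/-- Finitely many compact sets inside chart domains cover M. By agreement on overlaps every chart
measure, hence their supremum, is at most the sum of the chart measures restricted to these
compacts. -/
theorem isFiniteMeasure_riemannianVolume [CompactSpace M] [T2Space M] (o : SurfaceOrientation M) :
    IsFiniteMeasure (riemannianVolume M) := by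
  have h1 : ∀ c : M, ∃ K : Set M, K ∈ 𝓝 c ∧ K ⊆ (extChartAt (𝓡∂ 2) c).source ∧ IsCompact K := by
    intro c
    haveI := (𝓡∂ 2).locallyCompactSpace
    haveI := ChartedSpace.locallyCompactSpace (EuclideanHalfSpace 2) M
    obtain ⟨K, hK, hKs, hKc⟩ := local_compact_nhds (extChartAt_source_mem_nhds (I := 𝓡∂ 2) c)
    exact ⟨K, hK, hKs, hKc⟩
  choose K hKn hKs hKc using h1
  obtain ⟨t, -, ht⟩ := isCompact_univ.elim_nhds_subcover K fun c _ => hKn c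
  have hKm : ∀ c, MeasurableSet (K c) := fun c => (hKc c).isClosed.measurableSet
  have hle : ∀ c, chartVolume M c ≤ ∑ i ∈ t, (chartVolume M i).restrict (K i) := by
    intro c
    refine Measure.le_intro fun A hA _ => ?_
    have hsm : MeasurableSet (extChartAt (𝓡∂ 2) c).source :=
      (isOpen_extChartAt_source c).measurableSet
    have e1 : chartVolume M c A = chartVolume M c (A ∩ (extChartAt (𝓡∂ 2) c).source) := by
      rw [chartVolume_apply c hA, chartVolume_apply c (hA.inter hsm)]
      congr 2
      ext y
      constructor
      · rintro ⟨hy, hyA⟩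
        exact ⟨hy, hyA, (extChartAt (𝓡∂ 2) c).map_target hy⟩
      · rintro ⟨hy, hyA, -⟩
        exact ⟨hy, hyA⟩
    have e2 : A ∩ (extChartAt (𝓡∂ 2) c).source ⊆
        ⋃ i ∈ t, (A ∩ K i) ∩ (extChartAt (𝓡∂ 2) c).source := by
      rintro x ⟨hxA, hxs⟩
      obtain ⟨i, hi, hx⟩ := mem_iUnion₂.1 (ht (mem_univ x))
      exact mem_iUnion₂.2 ⟨i, hi, ⟨hxA, hx⟩, hxs⟩
    rw [e1, Measure.finsetSum_apply]
    refine (measure_mono e2).trans ((measure_biUnion_finset_le t _).trans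
      (Finset.sum_le_sum fun i _ => ?_))
    refine (chartVolume_mono o c i ((hA.inter (hKm i)).inter hsm) inter_subset_right
      (inter_subset_left.trans (inter_subset_right.trans (hKs i)))).trans ?_
    rw [Measure.restrict_apply hA]
    exact measure_mono inter_subset_left
  have hle2 : riemannianVolume M ≤ ∑ i ∈ t, (chartVolume M i).restrict (K i) := iSup_le hle
  refine ⟨(hle2 univ).trans_lt ?_⟩
  rw [Measure.finsetSum_apply]
  refine ENNReal.sum_lt_top.2 fun i _ => ?_
  rw [Measure.restrict_apply_univ]
  exact chartVolume_lt_top o i (hKc i) (hKm i) (hKs i)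

/-- A non-empty open set contains, in a chart, an open piece of the interior of the half-plane,
where the density is positive. -/
theorem isOpenPosMeasure_riemannianVolume (o : SurfaceOrientation M) :
    (riemannianVolume M).IsOpenPosMeasure := by
  refine ⟨fun U hU hne h0 => ?_⟩
  obtain ⟨x, hx⟩ := hne
  have h1 : chartVolume M x U = 0 := le_antisymm
    (((le_iSup (fun c => chartVolume M c) x : chartVolume M x ≤ riemannianVolume M) U).trans h0.le)
    bot_le
  rw [chartVolume_apply x hU.measurableSet] at h1
  have h2 : (extChartAt (𝓡∂ 2) x).target ∩ pt x ⁻¹' U ∈ 𝓝[range (𝓡∂ 2)] (extChartAt (𝓡∂ 2) x x) := by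
    refine Filter.inter_mem (extChartAt_target_mem_nhdsWithin x) ?_
    refine eventually_pt (mem_extChartAt_target x) (hU.mem_nhds ?_)
    rwa [pt, extChartAt_to_inv]
  obtain ⟨O, hO, hxO, hOs⟩ := mem_nhdsWithin.1 h2
  obtain ⟨z, hzO, hzi⟩ := mem_closure_iff.1 ((𝓡∂ 2).range_subset_closure_interior
    (mem_range_self (f := (𝓡∂ 2)) (chartAt (EuclideanHalfSpace 2) x x))) O hO hxO
  have hsub : O ∩ interior (range (𝓡∂ 2)) ⊆ (extChartAt (𝓡∂ 2) x).target ∩ pt x ⁻¹' U :=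
    fun y hy => hOs ⟨hy.1, interior_subset hy.2⟩
  have hopen : IsOpen (O ∩ interior (range (𝓡∂ 2))) := hO.inter isOpen_interior
  have hpos := hopen.measure_pos volume ⟨z, hzO, hzi⟩
  have h3 := le_antisymm ((lintegral_mono_set (μ := volume) hsub).trans h1.le) bot_le
  have hc : ContinuousOn (volDensity (M := M) x) (O ∩ interior (range (𝓡∂ 2))) := by
    have h4 : ContinuousOn (fun y => |o.area x (pt x y)|) (extChartAt (𝓡∂ 2) x).target := by
      refine ContinuousOn.abs fun y hy => ?_
      have hx : pt x y ∈ (chartAt (EuclideanHalfSpace 2) x).source := by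
        rw [← extChartAt_source (𝓡∂ 2)]
        exact (extChartAt (𝓡∂ 2) x).map_target hy
      exact (o.area_contMDiffAt hx).continuousAt.comp_continuousWithinAt (continuousOn_pt x y hy)
    exact (h4.mono (hsub.trans inter_subset_left)).congr
      fun y hy => volDensity_eq o x (hsub hy).1
  rw [lintegral_eq_zero_iff' ((hc.aemeasurable hopen.measurableSet).ennreal_ofReal)] at h3
  rw [Filter.EventuallyEq, ae_restrict_iff' hopen.measurableSet] at h3
  refine hpos.ne' (measure_mono_null (fun y hy => ?_) h3)
  intro hy0
  have h5 := hy0 hy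
  have hxs : pt x y ∈ (chartAt (EuclideanHalfSpace 2) x).source := by
    rw [← extChartAt_source (𝓡∂ 2)]
    exact (extChartAt (𝓡∂ 2) x).map_target (hsub hy).1
  rw [volDensity_eq o x (hsub hy).1] at h5
  simp only [Pi.zero_apply, ENNReal.ofReal_eq_zero] at h5
  exact absurd (abs_nonpos_iff.1 h5) (area_ne_zero o hxs)

end Area

end Volume

/-! ### Formal adjoints; formal self-adjointness makes the symbol symmetric. -/

section FormalAdjoint

open Set

variable {M : Type*} [TopologicalSpace M] [ChartedSpace (EuclideanHalfSpace 2) M]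
  [IsManifold (𝓡∂ 2) ∞ M]

theorem exists_interior_mem {O : Set M} (hO : IsOpen O) (hne : O.Nonempty) :
    ∃ x ∈ O, x ∈ (𝓡∂ 2).interior M := by
  obtain ⟨x, hx⟩ := hne
  have h2 : (extChartAt (𝓡∂ 2) x).target ∩ pt x ⁻¹' O ∈ 𝓝[range (𝓡∂ 2)] (extChartAt (𝓡∂ 2) x x) := by
    refine Filter.inter_mem (extChartAt_target_mem_nhdsWithin x) ?_
    refine eventually_pt (mem_extChartAt_target x) (hO.mem_nhds ?_)
    rwa [pt, extChartAt_to_inv]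
  obtain ⟨U, hU, hxU, hUs⟩ := mem_nhdsWithin.1 h2
  obtain ⟨y, hyU, hyi⟩ := mem_closure_iff.1 ((𝓡∂ 2).range_subset_closure_interior
    (mem_range_self (f := (𝓡∂ 2)) (chartAt (EuclideanHalfSpace 2) x x))) U hU hxU
  have hy := hUs ⟨hyU, interior_subset hyi⟩
  refine ⟨pt x y, hy.2, ?_⟩
  have hs : pt x y ∈ (chartAt (EuclideanHalfSpace 2) x).source := by
    rw [← extChartAt_source (𝓡∂ 2)]; exact (extChartAt (𝓡∂ 2) x).map_target hy.1
  refine (ModelWithCorners.isInteriorPoint_iff_of_mem_atlas (n := ∞) (by simp)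
    (chart_mem_atlas (EuclideanHalfSpace 2) x) hs).2 ?_
  change extChartAt (𝓡∂ 2) x (pt x y) ∈ interior (extChartAt (𝓡∂ 2) x).target
  rw [pt, (extChartAt (𝓡∂ 2) x).right_inv hy.1, extChartAt_target]
  rw [interior_inter, ((𝓡∂ 2).continuous_symm.isOpen_preimage _
    (chartAt (EuclideanHalfSpace 2) x).open_target).interior_eq]
  rw [extChartAt_target] at hy
  exact ⟨hy.1.1, hyi⟩

variable {V : Type*} [NormedAddCommGroup V] [NormedSpace ℂ V] [FiniteDimensional ℂ V]
  {E : M → Type*} [TopologicalSpace (TotalSpace V E)]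
  [∀ x, NormedAddCommGroup (E x)] [∀ x, InnerProductSpace ℂ (E x)]
  [FiberBundle V E] [VectorBundle ℂ V E] [VectorBundle ℝ V E]
  [ContMDiffVectorBundle ∞ V E (𝓡∂ 2)]

variable [MeasurableSpace M] [BorelSpace M] [CompactSpace M] [T2Space M]
  [RiemannianBundle (fun x : M => TangentSpace (𝓡∂ 2) x)]
  [IsContMDiffRiemannianBundle (𝓡∂ 2) ∞ Plane (fun x : M => TangentSpace (𝓡∂ 2) x)]

theorem continuous_inner_sections (hE : IsSmoothHermitian V E) (u v : Sections V E) :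
    Continuous fun x => (inner ℂ ((u : ∀ x, E x) x) ((v : ∀ x, E x) x) : ℂ) :=
  (hE u u.2 v v.2).continuous

theorem integrable_inner_sections (o : SurfaceOrientation M) (hE : IsSmoothHermitian V E)
    (u v : Sections V E) :
    Integrable (fun x => (inner ℂ ((u : ∀ x, E x) x) ((v : ∀ x, E x) x) : ℂ))
      (riemannianVolume M) := by
  haveI := isFiniteMeasure_riemannianVolume o
  obtain ⟨C, hC⟩ := isCompact_univ.exists_bound_of_continuousOn
    (continuous_inner_sections hE u v).continuousOn
  haveI : SecondCountableTopology M := by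
    haveI := (𝓡∂ 2).secondCountableTopology
    exact ChartedSpace.secondCountable_of_sigmaCompact (EuclideanHalfSpace 2) M
  exact Integrable.of_bound (continuous_inner_sections hE u v).aestronglyMeasurable C
    (Filter.Eventually.of_forall fun x => hC x (mem_univ x))

/-- `D'` is formally adjoint to `D`. -/
def IsFAdj (D D' : Sections V E →ₗ[ℂ] Sections V E) : Prop :=
  ∀ u v : Sections V E, SupportedInInterior u → SupportedInInterior v →
    ∫ x, inner ℂ ((D u : ∀ x, E x) x) ((v : ∀ x, E x) x) ∂(riemannianVolume M) =
      ∫ x, inner ℂ ((u : ∀ x, E x) x) ((D' v : ∀ x, E x) x) ∂(riemannianVolume M)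

theorem SupportedInInterior.mono {u v : Sections V E} (hu : SupportedInInterior u)
    (h : ∀ x, (u : ∀ x, E x) x = 0 → (v : ∀ x, E x) x = 0) : SupportedInInterior v :=
  (closure_mono fun x hx hu0 => (show (v : ∀ x, E x) x ≠ 0 from hx) (h x hu0)).trans hu

namespace IsFAdj

variable {D D' D₁ D₁' : Sections V E →ₗ[ℂ] Sections V E}

theorem add (o : SurfaceOrientation M) (hE : IsSmoothHermitian V E) (h : IsFAdj D D')
    (h₁ : IsFAdj D₁ D₁') : IsFAdj (D + D₁) (D' + D₁') := by
  intro u v hu hv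
  have e1 : ∀ x, (inner ℂ (((D + D₁) u).1 x) ((v : ∀ x, E x) x) : ℂ) =
      inner ℂ ((D u : ∀ x, E x) x) ((v : ∀ x, E x) x) +
        inner ℂ ((D₁ u : ∀ x, E x) x) ((v : ∀ x, E x) x) := fun x => inner_add_left _ _ _
  have e2 : ∀ x, (inner ℂ ((u : ∀ x, E x) x) (((D' + D₁') v).1 x) : ℂ) =
      inner ℂ ((u : ∀ x, E x) x) ((D' v : ∀ x, E x) x) +
        inner ℂ ((u : ∀ x, E x) x) ((D₁' v : ∀ x, E x) x) := fun x => inner_add_right _ _ _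
  simp only [e1, e2]
  rw [integral_add (integrable_inner_sections o hE _ _) (integrable_inner_sections o hE _ _),
    integral_add (integrable_inner_sections o hE _ _) (integrable_inner_sections o hE _ _),
    h u v hu hv, h₁ u v hu hv]

theorem rsmul (h : IsFAdj D D') (r : ℝ) : IsFAdj ((r : ℂ) • D) ((r : ℂ) • D') := by
  intro u v hu hv
  have e1 : ∀ x, (inner ℂ ((((r : ℂ) • D) u).1 x) ((v : ∀ x, E x) x) : ℂ) =
      (r : ℂ) * inner ℂ ((D u : ∀ x, E x) x) ((v : ∀ x, E x) x) := fun x =>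
    (inner_smul_left _ _ _).trans (by rw [Complex.conj_ofReal])
  have e2 : ∀ x, (inner ℂ ((u : ∀ x, E x) x) ((((r : ℂ) • D') v).1 x) : ℂ) =
      (r : ℂ) * inner ℂ ((u : ∀ x, E x) x) ((D' v : ∀ x, E x) x) := fun x => inner_smul_right _ _ _
  simp only [e1, e2, integral_const_mul, h u v hu hv]

theorem zero : IsFAdj (0 : Sections V E →ₗ[ℂ] Sections V E) 0 := by
  intro u v _ _
  have e1 : ∀ x, (inner ℂ (((0 : Sections V E →ₗ[ℂ] Sections V E) u).1 x)
      ((v : ∀ x, E x) x) : ℂ) = 0 := fun x => inner_zero_left _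
  have e2 : ∀ x, (inner ℂ ((u : ∀ x, E x) x)
      (((0 : Sections V E →ₗ[ℂ] Sections V E) v).1 x) : ℂ) = 0 :=
    fun x => inner_zero_right _
  simp only [e1, e2]

theorem sum (o : SurfaceOrientation M) (hE : IsSmoothHermitian V E) {ι : Type*} (s : Finset ι)
    {D D' : ι → Sections V E →ₗ[ℂ] Sections V E} (h : ∀ i, IsFAdj (D i) (D' i)) :
    IsFAdj (∑ i ∈ s, D i) (∑ i ∈ s, D' i) := by
  classical
  induction s using Finset.induction_on with
  | empty => exact zero
  | insert i s hi ih =>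
    rw [Finset.sum_insert hi, Finset.sum_insert hi]
    exact (h i).add o hE ih

theorem sandwich (h : IsFAdj D D') {B₁ B₂ B₁' B₂' : ∀ x, Module.End ℂ (E x)}
    (h₁ : IsSmoothEnd V B₁) (h₂ : IsSmoothEnd V B₂) (h₁' : IsSmoothEnd V B₁')
    (h₂' : IsSmoothEnd V B₂')
    (ha : ∀ x u v, (inner ℂ (B₁ x u) v : ℂ) = inner ℂ u (B₁' x v))
    (hb : ∀ x u v, (inner ℂ (B₂ x u) v : ℂ) = inner ℂ u (B₂' x v)) :
    IsFAdj (endOp B₁ h₁ ∘ₗ D ∘ₗ endOp B₂ h₂) (endOp B₂' h₂' ∘ₗ D' ∘ₗ endOp B₁' h₁') := by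
  intro u v hu hv
  refine Eq.trans ?_ ((h (endOp B₂ h₂ u) (endOp B₁' h₁' v) (hu.mono fun x hx => ?_)
    (hv.mono fun x hx => ?_)).trans ?_)
  · exact integral_congr_ae (Filter.Eventually.of_forall fun x => ha x _ _)
  · rw [endOp_apply, hx, map_zero]
  · rw [endOp_apply, hx, map_zero]
  · exact integral_congr_ae (Filter.Eventually.of_forall fun x => hb x _ _)

end IsFAdj

theorem exists_section_apply_eq (x : M) (u : E x) : ∃ t : Sections V E, (t : ∀ x, E x) x = u := by
  have hx := mem_baseSet_trivializationAt V E x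
  obtain ⟨t, ht⟩ := exists_section_symm x ((trivializationAt V E x).linearMapAt ℂ x u) hx
  refine ⟨t, ht.self_of_nhds.trans ?_⟩
  rw [← Bundle.Trivialization.symmₗ_apply (R := ℂ) _ hx]
  exact (trivializationAt V E x).symmₗ_linearMapAt hx u

theorem Ell.symb_section (A : Ell V E) (f : C^∞⟮𝓡∂ 2, M; ℝ⟯) (u : Sections V E) (x : M) :
    (Complex.I • (A.op (mulFun f u) - mulFun f (A.op u))).1 x =
      A.symb x (dAt f x) ((u : ∀ x, E x) x) := by
  change Complex.I • ((A.op (mulFun f u) : ∀ x, E x) x - f x • (A.op u : ∀ x, E x) x) = _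
  rw [A.leibniz, sub_sub_cancel_left, smul_neg, smul_smul, Complex.I_mul_I, neg_one_smul, neg_neg]

theorem inner_mulFun_left (f : C^∞⟮𝓡∂ 2, M; ℝ⟯) (u v : Sections V E) (x : M) :
    (inner ℂ ((mulFun f u).1 x) (v.1 x) : ℂ) = f x * inner ℂ (u.1 x) (v.1 x) :=
  (inner_smul_left (𝕜 := ℂ) (u.1 x) (v.1 x) ((f x : ℝ) : ℂ)).trans (by rw [Complex.conj_ofReal])

theorem inner_mulFun_right (f : C^∞⟮𝓡∂ 2, M; ℝ⟯) (u v : Sections V E) (x : M) :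
    (inner ℂ (u.1 x) ((mulFun f v).1 x) : ℂ) = f x * inner ℂ (u.1 x) (v.1 x) :=
  inner_smul_right (𝕜 := ℂ) (u.1 x) (v.1 x) ((f x : ℝ) : ℂ)

theorem SupportedInInterior.mulFun {u : Sections V E} (hu : SupportedInInterior u)
    (f : C^∞⟮𝓡∂ 2, M; ℝ⟯) : SupportedInInterior (mulFun f u) :=
  hu.mono fun x hx => by
    change f x • u.1 x = 0
    rw [hx, smul_zero]

/-- σ(df) = i[A, f]: the commutator of a symmetric operator with multiplication by a real function
is skew, and i makes it symmetric. Formal self-adjointness is used for the pairs (fu, v) and (u,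
fv). -/
theorem Ell.integral_symb (A : Ell V E) (o : SurfaceOrientation M) (hE : IsSmoothHermitian V E)
    (f : C^∞⟮𝓡∂ 2, M; ℝ⟯) {u v : Sections V E} (hu : SupportedInInterior u)
    (hv : SupportedInInterior v) :
    ∫ x, inner ℂ ((Complex.I • (A.op (BVP.mulFun f u) - BVP.mulFun f (A.op u))).1 x) (v.1 x)
        ∂(riemannianVolume M) =
      ∫ x, inner ℂ (u.1 x) ((Complex.I • (A.op (BVP.mulFun f v) - BVP.mulFun f (A.op v))).1 x)
        ∂(riemannianVolume M) := by
  have e1 : ∀ x, (inner ℂ ((Complex.I • (A.op (BVP.mulFun f u) - BVP.mulFun f (A.op u))).1 x)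
      (v.1 x) : ℂ) = -Complex.I * (inner ℂ ((A.op (BVP.mulFun f u)).1 x) (v.1 x) -
        inner ℂ ((A.op u).1 x) ((BVP.mulFun f v).1 x)) := fun x => by
    rw [inner_mulFun_right, ← inner_mulFun_left, ← inner_sub_left]
    exact (inner_smul_left _ _ _).trans (by rw [Complex.conj_I]; rfl)
  have e2 : ∀ x, (inner ℂ (u.1 x)
      ((Complex.I • (A.op (BVP.mulFun f v) - BVP.mulFun f (A.op v))).1 x) : ℂ) =
      Complex.I * (inner ℂ (u.1 x) ((A.op (BVP.mulFun f v)).1 x) -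
        inner ℂ ((BVP.mulFun f u).1 x) ((A.op v).1 x)) := fun x => by
    rw [inner_mulFun_left, ← inner_mulFun_right, ← inner_sub_right]
    exact inner_smul_right _ _ _
  simp only [e1, e2, integral_const_mul]
  rw [integral_sub (integrable_inner_sections o hE _ _) (integrable_inner_sections o hE _ _),
    integral_sub (integrable_inner_sections o hE _ _) (integrable_inner_sections o hE _ _),
    A.formally_selfAdjoint _ _ (hu.mulFun f) hv, A.formally_selfAdjoint _ _ hu (hv.mulFun f)]
  ring

/-- Replacing u by gu with arbitrary smooth g turns the integral identity into one tested against g,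
so the continuous difference vanishes almost everywhere, and therefore everywhere because the volume
charges open sets. -/
theorem Ell.symm_of_supported (A : Ell V E) (o : SurfaceOrientation M) (hE : IsSmoothHermitian V E)
    (f : C^∞⟮𝓡∂ 2, M; ℝ⟯) {u v : Sections V E} (hu : SupportedInInterior u)
    (hv : SupportedInInterior v) (x : M) :
    (inner ℂ (A.symb x (dAt f x) (u.1 x)) (v.1 x) : ℂ) =
      inner ℂ (u.1 x) (A.symb x (dAt f x) (v.1 x)) := by
  haveI := isFiniteMeasure_riemannianVolume o
  haveI := isOpenPosMeasure_riemannianVolume o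
  have e1 : ∀ x, (inner ℂ (A.symb x (dAt f x) (u.1 x)) (v.1 x) : ℂ) =
      inner ℂ ((Complex.I • (A.op (BVP.mulFun f u) - BVP.mulFun f (A.op u))).1 x) (v.1 x) :=
    fun x => by rw [A.symb_section]
  have e2 : ∀ x, (inner ℂ (u.1 x) (A.symb x (dAt f x) (v.1 x)) : ℂ) =
      inner ℂ (u.1 x) ((Complex.I • (A.op (BVP.mulFun f v) - BVP.mulFun f (A.op v))).1 x) :=
    fun x => by rw [A.symb_section]
  have h1 : Continuous fun x => (inner ℂ (A.symb x (dAt f x) (u.1 x)) (v.1 x) : ℂ) -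
      inner ℂ (u.1 x) (A.symb x (dAt f x) (v.1 x)) := by
    simp only [e1, e2]
    exact (continuous_inner_sections hE _ _).sub (continuous_inner_sections hE _ _)
  have h2 := ae_eq_zero_of_integral_contMDiff_smul_eq_zero (𝓡∂ 2) (μ := riemannianVolume M)
    h1.locallyIntegrable fun g hg _ => by
      have h3 := A.integral_symb o hE f (hu.mulFun ⟨g, hg⟩) hv
      have e3 : ∀ x, g x • ((inner ℂ (A.symb x (dAt f x) (u.1 x)) (v.1 x) : ℂ) -
          inner ℂ (u.1 x) (A.symb x (dAt f x) (v.1 x))) =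
          inner ℂ ((Complex.I • (A.op (BVP.mulFun f (BVP.mulFun ⟨g, hg⟩ u)) -
            BVP.mulFun f (A.op (BVP.mulFun ⟨g, hg⟩ u)))).1 x) (v.1 x) -
          inner ℂ ((BVP.mulFun ⟨g, hg⟩ u).1 x)
            ((Complex.I • (A.op (BVP.mulFun f v) - BVP.mulFun f (A.op v))).1 x) := fun x => by
        have e5 := inner_mulFun_left ⟨g, hg⟩ u
          (Complex.I • (A.op (BVP.mulFun f v) - BVP.mulFun f (A.op v))) x
        rw [e5, A.symb_section, A.symb_section]
        have e4 : A.symb x (dAt f x) ((BVP.mulFun ⟨g, hg⟩ u).1 x) =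
            ((g x : ℝ) : ℂ) • A.symb x (dAt f x) (u.1 x) :=
          map_smul (A.symb x (dAt f x)) ((g x : ℝ) : ℂ) (u.1 x)
        rw [e4, inner_smul_left, Complex.conj_ofReal]
        change ((g x : ℝ) : ℂ) * _ = ((g x : ℝ) : ℂ) * _ - ((g x : ℝ) : ℂ) * _
        ring
      simp only [e3]
      rw [integral_sub (integrable_inner_sections o hE _ _) (integrable_inner_sections o hE _ _),
        h3, sub_self]
  have h4 := (h1.ae_eq_iff_eq (riemannianVolume M) (continuous_const (y := (0 : ℂ)))).1 h2
  exact sub_eq_zero.1 (congrFun h4 x)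

/-- Formal self-adjointness concerns sections supported in the interior. A failure of symmetry
anywhere, the boundary included, persists by continuity to a nearby interior point, where the
sections can be cut off. -/
theorem Ell.isSymmetric_symb (A : Ell V E) (o : SurfaceOrientation M) (hE : IsSmoothHermitian V E)
    (x : M) (ξ : Tan x →L[ℝ] ℝ) : (A.symb x ξ).IsSymmetric := by
  have key : ∀ j, (A.symb x (coordCovec x x j)).IsSymmetric := by
    intro j u v
    obtain ⟨f, hf⟩ := exists_dAt_eq_coordCovec (mem_chart_source (EuclideanHalfSpace 2) x) j
    obtain ⟨u', rfl⟩ := exists_section_apply_eq (V := V) x u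
    obtain ⟨v', rfl⟩ := exists_section_apply_eq (V := V) x v
    rw [← hf.self_of_nhds]
    by_contra hne
    have h1 : Continuous fun x => (inner ℂ (A.symb x (dAt f x) (u'.1 x)) (v'.1 x) : ℂ) -
        inner ℂ (u'.1 x) (A.symb x (dAt f x) (v'.1 x)) := by
      simp only [← A.symb_section]
      exact (continuous_inner_sections hE _ _).sub (continuous_inner_sections hE _ _)
    obtain ⟨y, hy, hyi⟩ := exists_interior_mem (h1.isOpen_preimage _ isOpen_compl_singleton)
      ⟨x, sub_ne_zero.2 hne⟩
    obtain ⟨χ, -, hχ⟩ := (SmoothBumpFunction.nhds_basis_tsupport (I := 𝓡∂ 2) y).mem_iff.1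
      (((𝓡∂ 2).isOpen_interior (n := ∞) (by simp)).mem_nhds hyi)
    have hsup : ∀ w : Sections V E, SupportedInInterior (BVP.mulFun ⟨χ, χ.contMDiff⟩ w) :=
      fun w => by
      have h3 : {z | (BVP.mulFun ⟨χ, χ.contMDiff⟩ w).1 z ≠ 0} ⊆ Function.support χ := by
        intro z hz hz0
        refine hz ?_
        change χ z • w.1 z = 0
        rw [hz0, zero_smul]
      exact (closure_mono h3).trans hχ
    have hval : ∀ w : Sections V E, (BVP.mulFun ⟨χ, χ.contMDiff⟩ w).1 y = w.1 y := fun w => by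
      change χ y • w.1 y = w.1 y
      rw [χ.eq_one, one_smul]
    have h2 := A.symm_of_supported o hE f (hsup u') (hsup v') y
    rw [hval, hval] at h2
    exact hy (sub_eq_zero.2 h2)
  rw [eq_sum_coordCovec (mem_chart_source (EuclideanHalfSpace 2) x) ξ, map_add, map_smul, map_smul]
  intro u v
  have r1 : ∀ (r : ℝ) (w : E x), r • w = (r : ℂ) • w := fun _ _ => rfl
  simp only [LinearMap.add_apply, LinearMap.smul_apply, inner_add_left, inner_add_right, r1,
    inner_smul_left, inner_smul_right, Complex.conj_ofReal, key 0 u v, key 1 u v]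

theorem Ell.isEllSymb (A : Ell V E) (o : SurfaceOrientation M) (hE : IsSmoothHermitian V E)
    (x : M) : IsEllSymb (A.symb x) := ⟨A.isSymmetric_symb o hE x, A.elliptic x⟩

end FormalAdjoint

/-! ### Quantization: self-adjoint operators with a prescribed symbol. -/

section Quantization

open Set

variable {M : Type*} [TopologicalSpace M] [ChartedSpace (EuclideanHalfSpace 2) M]
  [IsManifold (𝓡∂ 2) ∞ M]

variable {V : Type*} [NormedAddCommGroup V] [NormedSpace ℂ V] [FiniteDimensional ℂ V]
  {E : M → Type*} [TopologicalSpace (TotalSpace V E)]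
  [∀ x, NormedAddCommGroup (E x)] [∀ x, InnerProductSpace ℂ (E x)]
  [FiberBundle V E] [VectorBundle ℂ V E] [VectorBundle ℝ V E]
  [ContMDiffVectorBundle ∞ V E (𝓡∂ 2)]

variable {X : Type*} [TopologicalSpace X]

theorem regOn_dAt (f : C^∞⟮𝓡∂ 2, M; ℝ⟯) (c : M) (j : Fin 2) :
    RegOn ⊤ (range (𝓡∂ 2)) (coordDomain V E c)
      fun (_ : X) y => dAt f (pt c y) (coordVec c (pt c y) j) := by
  have hD := isRelOpen_coordDomain (V := V) (E := E) c
  have h1 : RegOn ⊤ (range (𝓡∂ 2)) (coordDomain V E c) fun (_ : X) y =>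
      fderivWithin ℝ (fun z => f (pt c z)) (range (𝓡∂ 2)) y (EuclideanSpace.single j 1) := by
    refine RegOn.of_smooth hD le_top fun y hy => ?_
    have h2 : ContDiffWithinAt ℝ ∞ (fun z => f (pt c z)) (range (𝓡∂ 2)) y :=
      (contDiffWithinAt_chart_iff (mem_coordDomain.1 hy).1).2 f.contMDiff.contMDiffAt
    exact (h2.fderivWithin_right (m := ∞) (𝓡∂ 2).uniqueDiffOn le_rfl (hD.subset hy)).clm_apply
      contDiffWithinAt_const
  exact RegOn.congr hD h1 fun _ y hy => dAt_coordVec f (mem_coordDomain.1 hy).1 j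

theorem RegG.apply_dAt {σ : X → Symb E} (hσ : RegG V σ) (f : C^∞⟮𝓡∂ 2, M; ℝ⟯) :
    RegB V fun a x => σ a x (dAt f x) := fun c =>
  RegSymb.apply (isPlot_pt c) (hσ c) fun j => regOn_dAt f c j

theorem HasSymb.congr {D : Sections V E →ₗ[ℂ] Sections V E} {σ τ : Symb E} (h : HasSymb D σ)
    (hστ : ∀ x ξ u, σ x ξ u = τ x ξ u) : HasSymb D τ := fun f u x => by rw [h, hστ]

open Classical in
variable (V) in
/-- The field of vectors `u` as a smooth section. -/
def secOf (u : ∀ x, E x) : Sections V E := if h : u ∈ Sections V E then ⟨u, h⟩ else 0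

theorem secOf_apply {u : ∀ x, E x} (hu : u ∈ Sections V E) : (secOf V u : ∀ x, E x) = u := by
  rw [secOf, dif_pos hu]

variable [MeasurableSpace M] [RiemannianBundle (fun x : M => TangentSpace (𝓡∂ 2) x)]

variable (V E) in
/-- The data of a quantization of symbols: an elliptic operator with a representation of the
identity through its symbol. -/
structure Quantizer where
  /-- the elliptic operator -/
  base : Ell V E
  /-- the index type of the finite families -/
  ι : Type
  fintype : Fintype ι
  /-- the functions -/
  f : ι → C^∞⟮𝓡∂ 2, M; ℝ⟯
  /-- the sections multiplied by the symbol -/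
  p : ι → Sections V E
  /-- the sections paired with the values of the operator -/
  q : ι → Sections V E
  /-- the sections paired with the argument -/
  r : ι → Sections V E
  /-- the sections to which the operator is applied -/
  z : ι → Sections V E
  repr : ∀ x τ ξ u, reprSum base f p q r z x τ ξ u = τ ξ u

attribute [instance] Quantizer.fintype

variable [∀ x, FiniteDimensional ℂ (E x)] [T2Space M]

namespace Quantizer

variable (Q : Quantizer V E) (hE : IsSmoothHermitian V E)

/-- The section `σ(df_j) p_j`. -/
def w (σ : Symb E) (j : Q.ι) : Sections V E :=
  secOf V fun x => σ x (dAt (Q.f j) x) ((Q.p j : ∀ x, E x) x)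

/-- The first half of the quantization of a symbol. -/
def half (σ : Symb E) (j : Q.ι) : Sections V E →ₗ[ℂ] Sections V E :=
  rkOp hE (Q.w σ j) (Q.q j) ∘ₗ Q.base.op ∘ₗ rkOp hE (Q.z j) (Q.r j)

/-- The second half of the quantization of a symbol, formally adjoint to the first one. -/
def half' (σ : Symb E) (j : Q.ι) : Sections V E →ₗ[ℂ] Sections V E :=
  rkOp hE (Q.r j) (Q.z j) ∘ₗ Q.base.op ∘ₗ rkOp hE (Q.q j) (Q.w σ j)

/-- A formally self-adjoint operator with a given symbol. -/
def op (σ : Symb E) : Sections V E →ₗ[ℂ] Sections V E :=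
  ((1 / 2 : ℝ) : ℂ) • ∑ j, (Q.half hE σ j + Q.half' hE σ j)

theorem regS_w {σ : X → Symb E} (hσ : RegG V σ) (j : Q.ι) :
    RegS V fun a => (Q.w (σ a) j : ∀ x, E x) := by
  have h := (RegS.of_section (X := X) (Q.p j)).fEnd (hσ.apply_dAt (Q.f j))
  have e : (fun a => (Q.w (σ a) j : ∀ x, E x)) =
      fun a x => σ a x (dAt (Q.f j) x) ((Q.p j : ∀ x, E x) x) :=
    funext fun a => secOf_apply (h.mem a)
  rwa [e]

theorem w_apply {σ : X → Symb E} (hσ : RegG V σ) (a : X) (j : Q.ι) (x : M) :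
    (Q.w (σ a) j : ∀ x, E x) x = σ a x (dAt (Q.f j) x) ((Q.p j : ∀ x, E x) x) :=
  congrFun (secOf_apply (((RegS.of_section (X := X) (Q.p j)).fEnd (hσ.apply_dAt (Q.f j))).mem a)) x

theorem jcont_op {σ : X → Symb E} (hσ : RegG V σ) {u : X → Sections V E}
    (hu : RegS V fun a => (u a : ∀ x, E x)) :
    JCont V fun a => (Q.op hE (σ a) (u a) : ∀ x, E x) := by
  have hsum : JCont V fun a => ∑ j, ((Q.half hE (σ a) j (u a) : ∀ x, E x) +
      (Q.half' hE (σ a) j (u a) : ∀ x, E x)) := by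
    refine JCont.sum _ fun j => JCont.add ?_ ?_
    · have h1 := Q.base.hasSymb.jcont_smul (X := X)
        (f := fun a x => inner ℂ ((Q.r j : ∀ x, E x) x) ((u a : ∀ x, E x) x))
        ((RegS.of_section (Q.r j)).inner hE hu) (fun a => hE _ (Q.r j).2 _ (u a).2) (Q.z j)
        (w := fun a => rkOp hE (Q.z j) (Q.r j) (u a)) fun a x => rkOp_apply _ _ _ _ _
      exact (Q.regS_w hσ j).jcont.fsmul (JCont.inner hE (RegS.of_section (Q.q j)).jcont h1)
    · have h1 := Q.base.hasSymb.jcont_smul (X := X)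
        (f := fun a x => inner ℂ ((Q.w (σ a) j : ∀ x, E x) x) ((u a : ∀ x, E x) x))
        ((Q.regS_w hσ j).inner hE hu) (fun a => hE _ (Q.w (σ a) j).2 _ (u a).2) (Q.q j)
        (w := fun a => rkOp hE (Q.q j) (Q.w (σ a) j) (u a)) fun a x => rkOp_apply _ _ _ _ _
      exact (RegS.of_section (Q.r j)).jcont.fsmul (JCont.inner hE (RegS.of_section (Q.z j)).jcont h1)
  have e : (fun a => (Q.op hE (σ a) (u a) : ∀ x, E x)) =
      fun a => ((1 / 2 : ℝ) : ℂ) • ∑ j, ((Q.half hE (σ a) j (u a) : ∀ x, E x) +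
        (Q.half' hE (σ a) j (u a) : ∀ x, E x)) := by
    funext a
    simp only [op, LinearMap.smul_apply, LinearMap.sum_apply, LinearMap.add_apply,
      Submodule.coe_smul, AddSubmonoidClass.coe_finset_sum, Submodule.coe_add]
  rw [e]
  exact hsum.csmul continuous_const

variable [BorelSpace M] [CompactSpace M]
  [IsContMDiffRiemannianBundle (𝓡∂ 2) ∞ Plane (fun x : M => TangentSpace (𝓡∂ 2) x)]

/-- The two halves are formally adjoint to each other because A₀ is formally self-adjoint and the
rank-one operators with a, b exchanged are adjoint. -/
theorem isFAdj_op (o : SurfaceOrientation M) (σ : Symb E) : IsFAdj (Q.op hE σ) (Q.op hE σ) := by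
  have h : IsFAdj (∑ j, (Q.half hE σ j + Q.half' hE σ j))
      (∑ j, (Q.half' hE σ j + Q.half hE σ j)) :=
    IsFAdj.sum o hE _ fun j => IsFAdj.add o hE
      (IsFAdj.sandwich Q.base.formally_selfAdjoint _ _ _ _ (fun x u v => inner_rk _ _ _ _)
        fun x u v => inner_rk _ _ _ _)
      (IsFAdj.sandwich Q.base.formally_selfAdjoint _ _ _ _ (fun x u v => inner_rk _ _ _ _)
        fun x u v => inner_rk _ _ _ _)
  simp only [add_comm (Q.half' hE σ _)] at h
  exact h.rsmul _

/-- The symbol of the first halves sums to ∑ rk(w, q)σ₀(ξ)rk(z, r), which is σ(ξ) by the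
representation identity. The second halves give its adjoint, again σ(ξ) by symmetry, and the average
is σ(ξ). -/
theorem hasSymb_op (o : SurfaceOrientation M) {σ : X → Symb E} (hσ : RegG V σ) (a : X)
    (hs : ∀ x ξ, (σ a x ξ).IsSymmetric) : HasSymb (Q.op hE (σ a)) (σ a) := by
  have h1 := HasSymb.smul (HasSymb.sum Finset.univ fun j => HasSymb.add
    (Q.base.hasSymb.sandwich (isSmoothEnd_rk hE (Q.w (σ a) j) (Q.q j))
      (isSmoothEnd_rk hE (Q.z j) (Q.r j)))
    (Q.base.hasSymb.sandwich (isSmoothEnd_rk hE (Q.r j) (Q.z j))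
      (isSmoothEnd_rk hE (Q.q j) (Q.w (σ a) j)))) ((1 / 2 : ℝ) : ℂ)
  refine HasSymb.congr h1 fun x ξ u => ?_
  have e1 : ∀ u : E x, ∑ j, rk ((Q.w (σ a) j : ∀ x, E x) x) ((Q.q j : ∀ x, E x) x)
      (Q.base.symb x ξ (rk ((Q.z j : ∀ x, E x) x) ((Q.r j : ∀ x, E x) x) u)) = σ a x ξ u := by
    intro u
    rw [← Q.repr x (σ a x) ξ u, reprSum]
    refine Finset.sum_congr rfl fun j _ => ?_
    rw [rk_apply, rk_apply, map_smul, inner_smul_right, Q.w_apply hσ, mul_comm]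
  have e2 : ∑ j, rk ((Q.r j : ∀ x, E x) x) ((Q.z j : ∀ x, E x) x)
      (Q.base.symb x ξ (rk ((Q.q j : ∀ x, E x) x) ((Q.w (σ a) j : ∀ x, E x) x) u)) = σ a x ξ u := by
    refine ext_inner_left ℂ fun v => ?_
    rw [← hs x ξ v u, ← e1 v, inner_sum, sum_inner]
    refine Finset.sum_congr rfl fun j _ => ?_
    rw [inner_rk, Q.base.isSymmetric_symb o hE, inner_rk]
  have e3 : ((1 / 2 : ℝ) : ℂ) • (∑ j, (rk ((Q.w (σ a) j : ∀ x, E x) x) ((Q.q j : ∀ x, E x) x)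
      (Q.base.symb x ξ (rk ((Q.z j : ∀ x, E x) x) ((Q.r j : ∀ x, E x) x) u)) +
      rk ((Q.r j : ∀ x, E x) x) ((Q.z j : ∀ x, E x) x)
      (Q.base.symb x ξ (rk ((Q.q j : ∀ x, E x) x) ((Q.w (σ a) j : ∀ x, E x) x) u)))) =
      σ a x ξ u := by
    rw [Finset.sum_add_distrib, e1, e2]
    push_cast
    module
  rw [← e3]
  simp only [Pi.smul_apply, LinearMap.smul_apply, Finset.sum_apply, LinearMap.sum_apply,
    Pi.add_apply, LinearMap.add_apply]
  rfl

end Quantizer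

theorem exists_quantizer [BorelSpace M] [CompactSpace M]
    [IsContMDiffRiemannianBundle (𝓡∂ 2) ∞ Plane (fun x : M => TangentSpace (𝓡∂ 2) x)]
    (o : SurfaceOrientation M) (hE : IsSmoothHermitian V E) [h : Nonempty (Ell V E)] :
    Nonempty (Quantizer V E) := by
  obtain ⟨A⟩ := h
  obtain ⟨ι, hι, f, p, q, r, z, h⟩ := isRepr_one (A₀ := A) hE fun x => A.isEllSymb o hE x
  exact ⟨⟨A, ι, hι, f, p, q, r, z, fun x τ ξ u => (h x τ ξ u).trans (one_smul ℝ _)⟩⟩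

end Quantization

/-! ### The action of unitary automorphisms on operators and quantizers. -/

section Conjugation

open Set

variable {M : Type*} [TopologicalSpace M] [ChartedSpace (EuclideanHalfSpace 2) M]
  [IsManifold (𝓡∂ 2) ∞ M]

variable {V : Type*} [NormedAddCommGroup V] [NormedSpace ℂ V] [FiniteDimensional ℂ V]
  {E : M → Type*} [TopologicalSpace (TotalSpace V E)]
  [∀ x, NormedAddCommGroup (E x)] [∀ x, InnerProductSpace ℂ (E x)]
  [FiberBundle V E] [VectorBundle ℂ V E] [VectorBundle ℝ V E]
  [ContMDiffVectorBundle ∞ V E (𝓡∂ 2)]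

namespace UAut

variable (g : UAut V E)

/-- The unitary automorphism as a field of endomorphisms. -/
def end_ (x : M) : Module.End ℂ (E x) := (g.fib x).toLinearEquiv.toLinearMap

/-- The inverse automorphism. -/
def symm : UAut V E where
  fib x := (g.fib x).symm
  smooth := g.smooth_symm
  smooth_symm := g.smooth

theorem end_mul_symm (x : M) : g.end_ x * g.symm.end_ x = 1 :=
  LinearMap.ext fun u => (g.fib x).apply_symm_apply u

theorem symm_mul_end (x : M) : g.symm.end_ x * g.end_ x = 1 :=
  LinearMap.ext fun u => (g.fib x).symm_apply_apply u

theorem isUnit_end (x : M) : IsUnit (g.end_ x) :=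
  ⟨⟨g.end_ x, g.symm.end_ x, g.end_mul_symm x, g.symm_mul_end x⟩, rfl⟩

theorem inner_end (x : M) (u v : E x) :
    (inner ℂ (g.end_ x u) v : ℂ) = inner ℂ u (g.symm.end_ x v) := by
  conv_lhs => rw [← (g.fib x).apply_symm_apply v]
  exact (g.fib x).inner_map_map _ _

theorem isSmoothEnd : IsSmoothEnd V g.end_ := g.smooth

/-- The action of the automorphism on sections as a linear map. -/
def act : Sections V E →ₗ[ℂ] Sections V E := endOp g.end_ g.isSmoothEnd

theorem act_symm_act (u : Sections V E) : g.symm.act (g.act u) = u :=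
  Subtype.ext (funext fun x => (g.fib x).symm_apply_apply _)

variable [MeasurableSpace M] [RiemannianBundle (fun x : M => TangentSpace (𝓡∂ 2) x)]

theorem ConjOp.conjSymb [BorelSpace M] [CompactSpace M] [T2Space M]
    [IsContMDiffRiemannianBundle (𝓡∂ 2) ∞ Plane (fun x : M => TangentSpace (𝓡∂ 2) x)] {g : UAut V E} {A B : Ell V E}
    (h : g.ConjOp A B) : g.ConjSymb A.symb B.symb := by
  have key : ∀ (f : C^∞⟮𝓡∂ 2, M; ℝ⟯) (x : M) (u : E x),
      B.symb x (dAt f x) (g.fib x u) = g.fib x (A.symb x (dAt f x) u) := by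
    intro f x u
    obtain ⟨u, rfl⟩ := exists_section_apply_eq (V := V) x u
    have e1 : BVP.mulFun f (g.onSections u) = g.onSections (BVP.mulFun f u) :=
      Subtype.ext (funext fun x => (map_smul (g.fib x) ((f x : ℝ) : ℂ) _).symm)
    have e2 := B.symb_section f (g.onSections u) x
    rw [e1, h, h] at e2
    change B.symb x (dAt f x) ((g.onSections u : ∀ x, E x) x) = _
    rw [← e2, ← A.symb_section f u x]
    change Complex.I • (g.fib x ((A.op (BVP.mulFun f u)).1 x) -
      (f x : ℂ) • g.fib x ((A.op u).1 x)) = g.fib x (Complex.I • ((A.op (BVP.mulFun f u)).1 x -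
      (f x : ℂ) • (A.op u).1 x))
    rw [map_smul, map_sub, map_smul]
  intro x ξ u
  choose f hf using exists_dAt_eq_coordCovec (mem_chart_source (EuclideanHalfSpace 2) x)
  have hj : ∀ j, B.symb x (coordCovec x x j) (g.fib x u) =
      g.fib x (A.symb x (coordCovec x x j) u) := fun j => by
    rw [← (hf j).self_of_nhds, key]
  rw [eq_sum_coordCovec (mem_chart_source (EuclideanHalfSpace 2) x) ξ]
  have r1 : ∀ (r : ℝ) (w : E x), r • w = (r : ℂ) • w := fun _ _ => rfl
  simp only [map_add, map_smul, LinearMap.add_apply, LinearMap.smul_apply, r1, hj]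

end UAut

variable [MeasurableSpace M] [BorelSpace M] [CompactSpace M] [T2Space M]
  [RiemannianBundle (fun x : M => TangentSpace (𝓡∂ 2) x)]
  [IsContMDiffRiemannianBundle (𝓡∂ 2) ∞ Plane (fun x : M => TangentSpace (𝓡∂ 2) x)]

/-- The operator `g A g⁻¹`. -/
def Ell.conj (g : UAut V E) (A : Ell V E) : Ell V E where
  op := g.act ∘ₗ A.op ∘ₗ g.symm.act
  symb x := sandwich (g.end_ x) (g.symm.end_ x) (A.symb x)
  leibniz := A.hasSymb.sandwich g.isSmoothEnd g.symm.isSmoothEnd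
  elliptic x ξ hξ := ((g.isUnit_end x).mul (A.elliptic x ξ hξ)).mul (g.symm.isUnit_end x)
  formally_selfAdjoint := IsFAdj.sandwich A.formally_selfAdjoint _ _ _ _ g.inner_end g.symm.inner_end

variable [∀ x, FiniteDimensional ℂ (E x)]

namespace Quantizer

/-- The quantizer conjugated by a unitary automorphism. -/
def conj (g : UAut V E) (Q : Quantizer V E) : Quantizer V E where
  base := Q.base.conj g
  ι := Q.ι
  fintype := Q.fintype
  f := Q.f
  p j := g.act (Q.p j)
  q j := g.act (Q.q j)
  r j := g.act (Q.r j)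
  z j := g.act (Q.z j)
  repr x τ ξ u := by
    have h := congrArg (g.fib x) (Q.repr x (sandwich (g.symm.end_ x) (g.end_ x) τ) ξ
      ((g.fib x).symm u))
    have e : g.fib x (sandwich (g.symm.end_ x) (g.end_ x) τ ξ ((g.fib x).symm u)) = τ ξ u := by
      change g.fib x ((g.fib x).symm (τ ξ (g.fib x ((g.fib x).symm u)))) = _
      rw [LinearIsometryEquiv.apply_symm_apply, LinearIsometryEquiv.apply_symm_apply]
    rw [← e, ← h, reprSum, reprSum, map_sum]
    refine Finset.sum_congr rfl fun j _ => ?_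
    rw [map_smul]
    change (inner ℂ (g.fib x ((Q.q j).1 x)) (g.fib x (Q.base.symb x ξ
      ((g.fib x).symm (g.fib x ((Q.z j).1 x))))) * inner ℂ (g.fib x ((Q.r j).1 x)) u : ℂ) •
      τ (dAt (Q.f j) x) (g.fib x ((Q.p j).1 x)) = (inner ℂ ((Q.q j).1 x) (Q.base.symb x ξ
      ((Q.z j).1 x)) * inner ℂ ((Q.r j).1 x) ((g.fib x).symm u) : ℂ) •
      g.fib x ((g.fib x).symm (τ (dAt (Q.f j) x) (g.fib x ((Q.p j).1 x))))
    rw [LinearIsometryEquiv.apply_symm_apply, LinearIsometryEquiv.symm_apply_apply,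
      LinearIsometryEquiv.inner_map_map]
    congr 2
    exact g.inner_end x _ _

variable (hE : IsSmoothHermitian V E)

theorem rkOp_act (g : UAut V E) (a b u : Sections V E) :
    rkOp hE (g.act a) (g.act b) (g.act u) = g.act (rkOp hE a b u) := by
  refine Subtype.ext (funext fun x => ?_)
  change (inner ℂ (g.fib x (b.1 x)) (g.fib x (u.1 x)) : ℂ) • g.fib x (a.1 x) =
    g.fib x ((inner ℂ (b.1 x) (u.1 x) : ℂ) • a.1 x)
  rw [map_smul, LinearIsometryEquiv.inner_map_map]

/-- A quantization is not equivariant by itself, but conjugating its data together with the symbol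
conjugates the resulting operator. -/
theorem conj_op (g : UAut V E) (Q : Quantizer V E) {X : Type*} [TopologicalSpace X]
    {Y : Type*} [TopologicalSpace Y] {σ : X → Symb E} {τ : Y → Symb E} (hσ : RegG V σ)
    (hτ : RegG V τ) {a : X} {b : Y} (h : g.ConjSymb (σ a) (τ b)) (u : Sections V E) :
    (Q.conj g).op hE (τ b) (g.act u) = g.act (Q.op hE (σ a) u) := by
  have hw : ∀ j : Q.ι, (Q.conj g).w (τ b) j = g.act (Q.w (σ a) j) := fun j => by
    refine Subtype.ext (funext fun x => ?_)
    refine ((Q.conj g).w_apply hτ b j x).trans ?_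
    change _ = g.fib x ((Q.w (σ a) j).1 x)
    rw [Q.w_apply hσ, ← h]
    rfl
  have hb : ∀ u, (Q.base.conj g).op (g.act u) = g.act (Q.base.op u) := fun u => by
    change g.act (Q.base.op (g.symm.act (g.act u))) = _
    rw [g.act_symm_act]
  have h1 : ∀ j : Q.ι, (Q.conj g).half hE (τ b) j (g.act u) = g.act (Q.half hE (σ a) j u) := by
    intro j
    change rkOp hE ((Q.conj g).w (τ b) j) (g.act (Q.q j)) ((Q.base.conj g).op
      (rkOp hE (g.act (Q.z j)) (g.act (Q.r j)) (g.act u))) = _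
    rw [hw, rkOp_act, hb, rkOp_act]
    rfl
  have h2 : ∀ j : Q.ι, (Q.conj g).half' hE (τ b) j (g.act u) = g.act (Q.half' hE (σ a) j u) := by
    intro j
    change rkOp hE (g.act (Q.r j)) (g.act (Q.z j)) ((Q.base.conj g).op
      (rkOp hE (g.act (Q.q j)) ((Q.conj g).w (τ b) j) (g.act u))) = _
    rw [hw, rkOp_act, hb, rkOp_act]
    rfl
  change ((1 / 2 : ℝ) : ℂ) • (∑ j : Q.ι, ((Q.conj g).half hE (τ b) j +
    (Q.conj g).half' hE (τ b) j)) (g.act u) =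
    g.act (((1 / 2 : ℝ) : ℂ) • (∑ j : Q.ι, (Q.half hE (σ a) j + Q.half' hE (σ a) j)) u)
  rw [map_smul, LinearMap.sum_apply, LinearMap.sum_apply, map_sum]
  simp only [LinearMap.add_apply, map_add, h1, h2]

end Quantizer

end Conjugation

/-! ### Vanishing of the diagonal blocks of the final symbol. -/

section FibreOdd

variable {T : Type*} [AddCommGroup T] [Module ℝ T]
variable {W : Type*} [NormedAddCommGroup W] [InnerProductSpace ℂ W] [FiniteDimensional ℂ W]
variable {pos : T → T → Prop} {J : T →ₗ[ℝ] T} {nn : T → ℝ} {S : T →ₗ[ℝ] Module.End ℂ W}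

theorem lowP_deform (hS : IsEllSymb S) (C : IsConfPlane pos J nn) {ξ₀ : T} (h0 : ξ₀ ≠ 0) {s : ℝ}
    (hs0 : 0 ≤ s) (hs1 : s ≤ 1) : lowP pos (deform pos J nn S ξ₀ s) = lowP pos S := by
  rw [lowP, lowP, lowSp_deform hS C h0 hs0 hs1]

theorem low_sandwich_eq_zero (hS : IsEllSymb S) (C : IsConfPlane pos J nn) (ξ : T) (v : W) :
    lowP pos S (S ξ (lowP pos S v)) = 0 := lowP_apply_symb hS C ξ (orthP_mem _ v)

theorem high_sandwich_eq_zero (hS : IsEllSymb S) (C : IsConfPlane pos J nn) {ξ₀ : T} (h0 : ξ₀ ≠ 0)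
    (ξ : T) (v : W) : (1 - lowP pos S) (deform pos J nn S ξ₀ 1 ξ ((1 - lowP pos S) v)) = 0 := by
  have h1 : halfSymb pos J nn S ξ₀ 1 ξ * (1 - lowP pos S) = 0 := by
    rw [mul_sub, mul_one, halfSymb_mul_lowP hS C h0, sub_self]
  have h2 : (1 - lowP pos S) * star (halfSymb pos J nn S ξ₀ 1 ξ) = 0 := by
    have := congrArg star h1
    rwa [star_mul, star_zero, star_one_sub_lowP] at this
  have h3 : (1 - lowP pos S) * deform pos J nn S ξ₀ 1 ξ * (1 - lowP pos S) = 0 := by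
    rw [deform_apply, cutA_one, mul_add, add_mul, mul_add, add_mul]
    rw [h2, mul_assoc (1 - lowP pos S) (halfSymb pos J nn S ξ₀ 1 ξ), h1]
    simp
  exact congrArg (fun f : Module.End ℂ W => f v) h3

end FibreOdd

/-! ### The homotopy on elliptic operators. -/

section Deformation

open Set

variable {M : Type*} [TopologicalSpace M] [ChartedSpace (EuclideanHalfSpace 2) M]
  [IsManifold (𝓡∂ 2) ∞ M]

variable {V : Type*} [NormedAddCommGroup V] [NormedSpace ℂ V] [FiniteDimensional ℂ V]
  {E : M → Type*} [TopologicalSpace (TotalSpace V E)]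
  [∀ x, NormedAddCommGroup (E x)] [∀ x, InnerProductSpace ℂ (E x)]
  [FiberBundle V E] [VectorBundle ℂ V E] [VectorBundle ℝ V E]
  [ContMDiffVectorBundle ∞ V E (𝓡∂ 2)]

variable [MeasurableSpace M] [BorelSpace M] [CompactSpace M] [T2Space M]
  [RiemannianBundle (fun x : M => TangentSpace (𝓡∂ 2) x)]
  [IsContMDiffRiemannianBundle (𝓡∂ 2) ∞ Plane (fun x : M => TangentSpace (𝓡∂ 2) x)]

theorem Ell.ext {A B : Ell V E} (h1 : A.op = B.op) (h2 : A.symb = B.symb) : A = B := by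
  cases A; cases B; cases h1; cases h2; rfl

variable [∀ x, FiniteDimensional ℂ (E x)] (o : SurfaceOrientation M)

section SymbolFacts

variable {σ : Symb E}

theorem base_ne_zero (x : M) : coordCovec x x 0 ≠ 0 := coordCovec_ne_zero (mem_chart_source _ x) 0

theorem deformSymb_zero (hσ : ∀ x, IsEllSymb (σ x)) : deformSymb o σ 0 = σ :=
  funext fun x => deform_zero (hσ x) (o.isConfPlane x)

theorem deformSymb_isEllSymb (hσ : ∀ x, IsEllSymb (σ x)) (s : unitInterval) (x : M) :
    IsEllSymb (deformSymb o σ s x) :=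
  deform_isEllSymb (hσ x) (o.isConfPlane x) (base_ne_zero x) s.2.1 s.2.2

theorem Eminus_deformSymb (hσ : ∀ x, IsEllSymb (σ x)) (s : unitInterval) (x : M) :
    Eminus o (deformSymb o σ s) x = Eminus o σ x :=
  lowSp_deform (hσ x) (o.isConfPlane x) (base_ne_zero x) s.2.1 s.2.2

theorem deformSymb_of_dirac (hσ : ∀ x, IsEllSymb (σ x))
    (hD : ∀ x, IsDiracSymb (fun ξ => ‖ξ‖) (σ x)) (s : ℝ) : deformSymb o σ s = σ :=
  funext fun x => deform_dirac (hσ x) (o.isConfPlane x) (hD x) (base_ne_zero x) s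

theorem deformSymb_one_isDirac (hσ : ∀ x, IsEllSymb (σ x)) (x : M) :
    IsDiracSymb (fun ξ => ‖ξ‖) (deformSymb o σ 1 x) :=
  deform_one_isDirac (hσ x) (o.isConfPlane x) (base_ne_zero x)

theorem deformSymb_conj {g : UAut V E} {τ : Symb E} (hσ : ∀ x, IsEllSymb (σ x))
    (hτ : ∀ x, IsEllSymb (τ x)) (h : g.ConjSymb σ τ) (s : ℝ) :
    g.ConjSymb (deformSymb o σ s) (deformSymb o τ s) := fun x ξ u =>
  intertwines_deform (hσ x) (hτ x) (o.isConfPlane x) (h x) (base_ne_zero x) s ξ u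

end SymbolFacts

variable (hE : IsSmoothHermitian V E)

section Projections

variable {o}

/-- The orthogonal projection to `E⁻(A)` on sections. -/
def Ell.lowOp (o : SurfaceOrientation M) (hE : IsSmoothHermitian V E) (A : Ell V E) :
    Sections V E →ₗ[ℂ] Sections V E :=
  endOp (fun x => lowP (o.PosCoframe x) (A.symb x))
    ((regG_symb.lowP o hE fun A x => A.isEllSymb o hE x).isSmoothEnd A)

/-- The orthogonal projection to the complement of `E⁻(A)` on sections. -/
def Ell.highOp (o : SurfaceOrientation M) (hE : IsSmoothHermitian V E) (A : Ell V E) :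
    Sections V E →ₗ[ℂ] Sections V E :=
  endOp (fun x => 1 - lowP (o.PosCoframe x) (A.symb x))
    ((regG_symb.lowP o hE fun A x => A.isEllSymb o hE x).one_sub.isSmoothEnd A)

/-- The part of an operator preserving `E⁻(A)` and its orthogonal complement. -/
def Ell.evenPart (o : SurfaceOrientation M) (hE : IsSmoothHermitian V E) (A : Ell V E)
    (D : Sections V E →ₗ[ℂ] Sections V E) : Sections V E →ₗ[ℂ] Sections V E :=
  A.lowOp o hE ∘ₗ D ∘ₗ A.lowOp o hE + A.highOp o hE ∘ₗ D ∘ₗ A.highOp o hE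

end Projections

variable (Q₀ Q₁ : Quantizer V E)

/-- The convex combination of two quantizations. -/
def mixOp (t : ℝ) (σ : Symb E) : Sections V E →ₗ[ℂ] Sections V E :=
  ((1 - t : ℝ) : ℂ) • Q₀.op hE σ + (t : ℂ) • Q₁.op hE σ

include o in
-- The weights add up to one, so a convex combination of two operators with symbol σ still has
-- symbol σ.
theorem hasSymb_mixOp {X : Type*} [TopologicalSpace X] {σ : X → Symb E} (hσ : RegG V σ) (a : X)
    (hs : ∀ x, IsEllSymb (σ a x)) (t : ℝ) : HasSymb (mixOp hE Q₀ Q₁ t (σ a)) (σ a) := by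
  refine HasSymb.congr (((Q₀.hasSymb_op hE o hσ a fun x => (hs x).sym).smul _).add
    ((Q₁.hasSymb_op hE o hσ a fun x => (hs x).sym).smul _)) fun x ξ u => ?_
  change ((1 - t : ℝ) : ℂ) • σ a x ξ u + (t : ℂ) • σ a x ξ u = _
  push_cast
  module

include o in
theorem isFAdj_mixOp (t : ℝ) (σ : Symb E) :
    IsFAdj (mixOp hE Q₀ Q₁ t σ) (mixOp hE Q₀ Q₁ t σ) :=
  ((Q₀.isFAdj_op hE o σ).rsmul _).add o hE ((Q₁.isFAdj_op hE o σ).rsmul _)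

theorem jcont_mixOp {X : Type*} [TopologicalSpace X] {t : X → ℝ} (ht : Continuous t)
    {σ : X → Symb E} (hσ : RegG V σ) {u : X → Sections V E}
    (hu : RegS V fun a => (u a : ∀ x, E x)) :
    JCont V fun a => (mixOp hE Q₀ Q₁ (t a) (σ a) (u a) : ∀ x, E x) :=
  ((Q₀.jcont_op hE hσ hu).csmul (z := fun a => ((1 - t a : ℝ) : ℂ)) (by fun_prop)).add
    ((Q₁.jcont_op hE hσ hu).csmul (z := fun a => (t a : ℂ)) (by fun_prop))

theorem inner_lowP (A : Ell V E) (x : M) (u v : E x) :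
    (inner ℂ (lowP (o.PosCoframe x) (A.symb x) u) v : ℂ) =
      inner ℂ u (lowP (o.PosCoframe x) (A.symb x) v) := orthP_isSymmetric _ u v

theorem inner_one_sub_lowP (A : Ell V E) (x : M) (u v : E x) :
    (inner ℂ ((1 - lowP (o.PosCoframe x) (A.symb x)) u) v : ℂ) =
      inner ℂ u ((1 - lowP (o.PosCoframe x) (A.symb x)) v) := by
  rw [LinearMap.sub_apply, LinearMap.sub_apply, inner_sub_left, inner_sub_right, inner_lowP]
  rfl

theorem Ell.isFAdj_evenPart (A : Ell V E) {D : Sections V E →ₗ[ℂ] Sections V E}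
    (hD : IsFAdj D D) : IsFAdj (A.evenPart o hE D) (A.evenPart o hE D) :=
  (hD.sandwich _ _ _ _ (inner_lowP o A) (inner_lowP o A)).add o hE
    (hD.sandwich _ _ _ _ (inner_one_sub_lowP o A) (inner_one_sub_lowP o A))

/-- Both diagonal blocks of the final symbol vanish. So the even part has order zero and can be
subtracted without changing the symbol. -/
theorem Ell.hasSymb_evenPart (A : Ell V E) {D : Sections V E →ₗ[ℂ] Sections V E}
    (hD : HasSymb D (deformSymb o A.symb 1)) : HasSymb (A.evenPart o hE D) 0 := by
  have hP := (regG_symb.lowP o hE fun A x => A.isEllSymb o hE x)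
  refine HasSymb.congr ((hD.sandwich (hP.isSmoothEnd A) (hP.isSmoothEnd A)).add
    (hD.sandwich (hP.one_sub.isSmoothEnd A) (hP.one_sub.isSmoothEnd A))) fun x ξ u => ?_
  have hA := A.isEllSymb o hE x
  have C := o.isConfPlane x
  have h1 := low_sandwich_eq_zero (deform_isEllSymb hA C (base_ne_zero x) zero_le_one le_rfl) C ξ u
  rw [lowP_deform hA C (base_ne_zero x) zero_le_one le_rfl] at h1
  have h2 := high_sandwich_eq_zero hA C (base_ne_zero x) ξ u
  exact (congrArg₂ (· + ·) h1 h2).trans (add_zero _)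

/-- The operators of the homotopy. -/
def homotopyOp (t s : ℝ) (A : Ell V E) : Sections V E →ₗ[ℂ] Sections V E :=
  -- The quantization of the deformed symbol plus a term of order zero, which moves linearly from A
  -- - Op(σ) at s = 0, giving back A, to minus the even part of Op(σ_1) at s = 1, giving an odd
  -- operator.
  mixOp hE Q₀ Q₁ t (deformSymb o A.symb s) +
    (((1 - s : ℝ) : ℂ) • (A.op + ((-1 : ℝ) : ℂ) • mixOp hE Q₀ Q₁ t A.symb) +
      ((-s : ℝ) : ℂ) • A.evenPart o hE (mixOp hE Q₀ Q₁ t (deformSymb o A.symb 1)))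

include hE in
theorem regG_deformSymb {X : Type*} [TopologicalSpace X] {F : X → Ell V E} (hF : Continuous F)
    {s : X → ℝ} (hs : Continuous s) : RegG V fun a => deformSymb o (F a).symb (s a) :=
  (regG_symb.reparam hF).deformSymb o hE (fun a x => (F a).isEllSymb o hE x) hs

/-- The homotopy from the identity to a retraction onto odd Dirac operators. -/
def homotopyEll (t : ℝ) (s : unitInterval) (A : Ell V E) : Ell V E where
  op := homotopyOp o hE Q₀ Q₁ t s A
  symb := deformSymb o A.symb s
  leibniz := by
    have hr := fun s : ℝ => regG_deformSymb o hE (continuous_id (X := Ell V E))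
      (continuous_const (y := s))
    have h1 := hasSymb_mixOp o hE Q₀ Q₁ (hr s) A (deformSymb_isEllSymb o (A.isEllSymb o hE) s) t
    have h2 := hasSymb_mixOp o hE Q₀ Q₁ (hr 1) A
      (deformSymb_isEllSymb o (A.isEllSymb o hE) 1) t
    have h3 := hasSymb_mixOp o hE Q₀ Q₁ regG_symb A (A.isEllSymb o hE) t
    refine HasSymb.congr (h1.add (((A.hasSymb.add (h3.smul ((-1 : ℝ) : ℂ))).smul _).add
      ((A.hasSymb_evenPart o hE h2).smul _))) fun x ξ u => ?_
    change deformSymb o A.symb s x ξ u + (((1 - (s : ℝ) : ℝ) : ℂ) • (A.symb x ξ u +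
      ((-1 : ℝ) : ℂ) • A.symb x ξ u) + ((-(s : ℝ) : ℝ) : ℂ) • (0 : E x)) = _
    push_cast
    module
  elliptic x := (deformSymb_isEllSymb o (A.isEllSymb o hE) s x).unit
  formally_selfAdjoint :=
    (isFAdj_mixOp o hE Q₀ Q₁ t _).add o hE (((IsFAdj.add o hE A.formally_selfAdjoint
      ((isFAdj_mixOp o hE Q₀ Q₁ t _).rsmul _)).rsmul _).add o hE
        ((A.isFAdj_evenPart o hE (isFAdj_mixOp o hE Q₀ Q₁ t _)).rsmul _))

theorem homotopyEll_symb (t : ℝ) (s : unitInterval) (A : Ell V E) :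
    (homotopyEll o hE Q₀ Q₁ t s A).symb = deformSymb o A.symb s := rfl

theorem homotopyEll_zero (t : ℝ) (A : Ell V E) : homotopyEll o hE Q₀ Q₁ t 0 A = A := by
  have h := deformSymb_zero o (A.isEllSymb o hE)
  refine Ell.ext ?_ h
  change homotopyOp o hE Q₀ Q₁ t 0 A = A.op
  rw [homotopyOp, h]
  push_cast
  module

theorem continuous_homotopyEll {X : Type*} [TopologicalSpace X] {t : X → ℝ} (ht : Continuous t)
    {s : X → unitInterval} (hs : Continuous s) {F : X → Ell V E} (hF : Continuous F) :
    Continuous fun a => homotopyEll o hE Q₀ Q₁ (t a) (s a) (F a) := by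
  have hs' : Continuous fun a => (s a : ℝ) := continuous_subtype_val.comp hs
  have hP := ((regG_symb.reparam hF).lowP o hE fun a x => (F a).isEllSymb o hE x)
  refine continuous_to_ell (regG_deformSymb o hE hF hs') fun u => ?_
  have hu : RegS V fun _ : X => (u : ∀ x, E x) := RegS.of_section u
  refine (jcont_mixOp hE Q₀ Q₁ ht (regG_deformSymb o hE hF hs') hu).add (JCont.add ?_ ?_)
  · exact (JCont.add ((BVP.jcont_op u).reparam hF) ((jcont_mixOp hE Q₀ Q₁ ht
      (regG_symb.reparam hF) hu).csmul continuous_const)).csmul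
        (z := fun a => ((1 - s a : ℝ) : ℂ)) (by fun_prop)
  · refine JCont.csmul (z := fun a => ((-s a : ℝ) : ℂ)) (by fun_prop) (JCont.add ?_ ?_)
    · exact (jcont_mixOp hE Q₀ Q₁ ht (regG_deformSymb o hE hF (continuous_const (y := (1 : ℝ))))
        (u := fun a => (F a).lowOp o hE u) (hu.fEnd hP)).fEnd hP
    · exact (jcont_mixOp hE Q₀ Q₁ ht (regG_deformSymb o hE hF (continuous_const (y := (1 : ℝ))))
        (u := fun a => (F a).highOp o hE u) (hu.fEnd hP.one_sub)).fEnd hP.one_sub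

/-- At s = 1 the term containing the original operator has coefficient zero, so only the final
symbol and the projection on E⁻ enter. This yields both idempotency of the retraction and
injectivity of the symbol map on its image. -/
theorem homotopyEll_one_congr (t : ℝ) {A B : Ell V E}
    (h1 : deformSymb o A.symb 1 = deformSymb o B.symb 1)
    (h2 : ∀ x, Eminus o A.symb x = Eminus o B.symb x) :
    homotopyEll o hE Q₀ Q₁ t 1 A = homotopyEll o hE Q₀ Q₁ t 1 B := by
  have h3 : ∀ x, lowP (o.PosCoframe x) (A.symb x) = lowP (o.PosCoframe x) (B.symb x) := fun x =>
    congrArg orthP (h2 x)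
  have h4 : ∀ D, A.evenPart o hE D = B.evenPart o hE D := fun D => by
    simp only [Ell.evenPart, Ell.lowOp, Ell.highOp, h3]
  refine Ell.ext ?_ h1
  change homotopyOp o hE Q₀ Q₁ t 1 A = homotopyOp o hE Q₀ Q₁ t 1 B
  rw [homotopyOp, homotopyOp, h1, h4]
  push_cast
  module

theorem homotopyEll_one_one (t : ℝ) (A : Ell V E) :
    homotopyEll o hE Q₀ Q₁ t 1 (homotopyEll o hE Q₀ Q₁ t 1 A) =
      homotopyEll o hE Q₀ Q₁ t 1 A := by
  have hA := A.isEllSymb o hE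
  refine homotopyEll_one_congr o hE Q₀ Q₁ t ?_ ?_
  · exact deformSymb_of_dirac o (deformSymb_isEllSymb o hA 1) (deformSymb_one_isDirac o hA) 1
  · exact Eminus_deformSymb o hA 1

include hE in
-- For a Dirac symbol E⁺ = (E⁻)ᗮ, so oddness can be stated through E⁻ alone, the subbundle that the
-- homotopy preserves.
theorem mem_Dir_iff {A : Ell V E} : A ∈ Dir V E o ↔
    (∀ x, IsDiracSymb (fun ξ => ‖ξ‖) (A.symb x)) ∧
    (∀ u : Sections V E, (∀ x, u.1 x ∈ (Eminus o A.symb x)ᗮ) →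
      ∀ x, (A.op u).1 x ∈ Eminus o A.symb x) ∧
    (∀ u : Sections V E, (∀ x, u.1 x ∈ Eminus o A.symb x) →
      ∀ x, (A.op u).1 x ∈ (Eminus o A.symb x)ᗮ) := by
  have key : (∀ x, IsDiracSymb (fun ξ => ‖ξ‖) (A.symb x)) →
      ∀ x, Eplus o A.symb x = (Eminus o A.symb x)ᗮ := fun h x =>
    dirac_high_eq (A.isEllSymb o hE x) (o.isConfPlane x) (h x)
  constructor
  · rintro ⟨h1, h2, h3⟩
    have h1' : ∀ x, IsDiracSymb (fun ξ => ‖ξ‖) (A.symb x) := h1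
    simp only [key h1'] at h2 h3
    exact ⟨h1, h2, h3⟩
  · rintro ⟨h1, h2, h3⟩
    simp only [← key h1] at h2 h3
    exact ⟨h1, h2, h3⟩

theorem Ell.sub_evenPart_low (A : Ell V E) (D : Sections V E →ₗ[ℂ] Sections V E)
    {u : Sections V E} (hu : ∀ x, u.1 x ∈ (Eminus o A.symb x)ᗮ) (x : M) :
    (D u).1 x - (A.evenPart o hE D u).1 x ∈ Eminus o A.symb x := by
  have h1 : A.lowOp o hE u = 0 := Subtype.ext (funext fun x => orthP_of_mem_orthogonal (hu x))
  have h2 : A.highOp o hE u = u := Subtype.ext (funext fun x => by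
    change u.1 x - orthP (Eminus o A.symb x) (u.1 x) = u.1 x
    rw [orthP_of_mem_orthogonal (hu x), sub_zero])
  have h3 : (A.evenPart o hE D u).1 x =
      (D u).1 x - lowP (o.PosCoframe x) (A.symb x) ((D u).1 x) := by
    change (A.lowOp o hE (D (A.lowOp o hE u)) + A.highOp o hE (D (A.highOp o hE u))).1 x = _
    rw [h1, h2, map_zero, map_zero, zero_add]
    rfl
  rw [h3, sub_sub_cancel]
  exact orthP_mem _ _

theorem Ell.sub_evenPart_high (A : Ell V E) (D : Sections V E →ₗ[ℂ] Sections V E)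
    {u : Sections V E} (hu : ∀ x, u.1 x ∈ Eminus o A.symb x) (x : M) :
    (D u).1 x - (A.evenPart o hE D u).1 x ∈ (Eminus o A.symb x)ᗮ := by
  have h1 : A.lowOp o hE u = u := Subtype.ext (funext fun x => orthP_of_mem (hu x))
  have h2 : A.highOp o hE u = 0 := Subtype.ext (funext fun x => by
    change u.1 x - orthP (Eminus o A.symb x) (u.1 x) = 0
    rw [orthP_of_mem (hu x), sub_self])
  have h3 : (A.evenPart o hE D u).1 x = lowP (o.PosCoframe x) (A.symb x) ((D u).1 x) := by
    change (A.lowOp o hE (D (A.lowOp o hE u)) + A.highOp o hE (D (A.highOp o hE u))).1 x = _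
    rw [h1, h2, map_zero, map_zero, add_zero]
    rfl
  rw [h3]
  exact sub_orthP_mem _ _

theorem homotopyEll_one_mem (t : ℝ) (A : Ell V E) :
    homotopyEll o hE Q₀ Q₁ t 1 A ∈ Dir V E o := by
  have hA := A.isEllSymb o hE
  set D := mixOp hE Q₀ Q₁ t (deformSymb o A.symb 1) with hD
  have hop : ∀ u : Sections V E, ∀ x, ((homotopyEll o hE Q₀ Q₁ t 1 A).op u).1 x =
      (D u).1 x - (A.evenPart o hE D u).1 x := fun u x => by
    change (D u).1 x + (((1 - 1 : ℝ) : ℂ) • ((A.op u).1 x + ((-1 : ℝ) : ℂ) •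
      (mixOp hE Q₀ Q₁ t A.symb u).1 x) + ((-1 : ℝ) : ℂ) • (A.evenPart o hE D u).1 x) = _
    push_cast
    module
  have hEm : ∀ x, Eminus o (homotopyEll o hE Q₀ Q₁ t 1 A).symb x = Eminus o A.symb x :=
    Eminus_deformSymb o hA 1
  rw [mem_Dir_iff o hE]
  simp only [hop, hEm]
  exact ⟨deformSymb_one_isDirac o hA, fun u hu => A.sub_evenPart_low o hE D hu,
    fun u hu => A.sub_evenPart_high o hE D hu⟩

/-- On Dirac operators the symbol is constant in s and the path is (1 - s)A + s(D - D_even), where D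
is the quantized symbol: a convex combination of odd operators. -/
theorem homotopyEll_mem (t : ℝ) (s : unitInterval) {A : Ell V E} (h : A ∈ Dir V E o) :
    homotopyEll o hE Q₀ Q₁ t s A ∈ Dir V E o := by
  have hA := A.isEllSymb o hE
  rw [mem_Dir_iff o hE] at h ⊢
  obtain ⟨h1, h2, h3⟩ := h
  set D := mixOp hE Q₀ Q₁ t A.symb with hD
  have hσ : ∀ s : ℝ, deformSymb o A.symb s = A.symb := deformSymb_of_dirac o hA h1
  have hop : ∀ u : Sections V E, ∀ x, ((homotopyEll o hE Q₀ Q₁ t s A).op u).1 x =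
      ((1 - s : ℝ) : ℂ) • (A.op u).1 x +
        ((s : ℝ) : ℂ) • ((D u).1 x - (A.evenPart o hE D u).1 x) := fun u x => by
    change (mixOp hE Q₀ Q₁ t (deformSymb o A.symb s) u).1 x + (((1 - s : ℝ) : ℂ) • ((A.op u).1 x +
      ((-1 : ℝ) : ℂ) • (D u).1 x) + ((-s : ℝ) : ℂ) •
        (A.evenPart o hE (mixOp hE Q₀ Q₁ t (deformSymb o A.symb 1)) u).1 x) = _
    rw [hσ, hσ, ← hD]
    push_cast
    module
  simp only [hop, homotopyEll_symb, hσ]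
  exact ⟨h1, fun u hu x => Submodule.add_mem _ (Submodule.smul_mem _ _ (h2 u hu x))
      (Submodule.smul_mem _ _ (A.sub_evenPart_low o hE D hu x)),
    fun u hu x => Submodule.add_mem _ (Submodule.smul_mem _ _ (h3 u hu x))
      (Submodule.smul_mem _ _ (A.sub_evenPart_high o hE D hu x))⟩

/-- At t = 0 only `Q` is used and at t = 1 only its conjugate, so naturality of each ingredient
gives conjugate operators. -/
theorem homotopyEll_conj {g : UAut V E} (Q : Quantizer V E) {A B : Ell V E} (h : g.ConjOp A B)
    (s : unitInterval) : g.ConjOp (homotopyEll o hE Q (Q.conj g) 0 s A)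
      (homotopyEll o hE Q (Q.conj g) 1 s B) := by
  have hA := A.isEllSymb o hE
  have hB := B.isEllSymb o hE
  have hs := h.conjSymb
  have hP : ∀ x (u : E x), lowP (o.PosCoframe x) (B.symb x) (g.fib x u) =
      g.fib x (lowP (o.PosCoframe x) (A.symb x) u) := fun x u =>
    intertwines_lowP (hA x) (hB x) (o.isConfPlane x) (hs x) u
  have h1 : ∀ u, B.lowOp o hE (g.act u) = g.act (A.lowOp o hE u) := fun u =>
    Subtype.ext (funext fun x => hP x _)
  have h2 : ∀ u, B.highOp o hE (g.act u) = g.act (A.highOp o hE u) := fun u =>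
    Subtype.ext (funext fun x => by
      change g.fib x (u.1 x) - lowP (o.PosCoframe x) (B.symb x) (g.fib x (u.1 x)) =
        g.fib x (u.1 x - lowP (o.PosCoframe x) (A.symb x) (u.1 x))
      rw [hP, map_sub])
  have h3 : ∀ s : ℝ, ∀ u, mixOp hE Q (Q.conj g) 1 (deformSymb o B.symb s) (g.act u) =
      g.act (mixOp hE Q (Q.conj g) 0 (deformSymb o A.symb s) u) := fun s u => by
    have h4 := Q.conj_op hE g (regG_deformSymb o hE (continuous_id (X := Ell V E))
      (continuous_const (y := s))) (regG_deformSymb o hE (continuous_id (X := Ell V E))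
      (continuous_const (y := s))) (a := A) (b := B) (deformSymb_conj o hA hB hs s) u
    simpa [mixOp] using h4
  have h5 : ∀ u, mixOp hE Q (Q.conj g) 1 B.symb (g.act u) =
      g.act (mixOp hE Q (Q.conj g) 0 A.symb u) := fun u => by
    have h6 := h3 0 u
    rwa [deformSymb_zero o hA, deformSymb_zero o hB] at h6
  have h7 : ∀ u, B.op (g.act u) = g.act (A.op u) := h
  intro u
  change homotopyOp o hE Q (Q.conj g) 1 s B (g.act u) =
    g.act (homotopyOp o hE Q (Q.conj g) 0 s A u)
  simp only [homotopyOp, Ell.evenPart, LinearMap.add_apply, LinearMap.smul_apply,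
    LinearMap.comp_apply, map_add, map_smul, h1, h2, h3, h5, h7]

end Deformation

/-! ### Smooth subbundles over the boundary. -/

section BoundarySubbundles

open Set

variable {M : Type*} [TopologicalSpace M] [ChartedSpace (EuclideanHalfSpace 2) M]
  [IsManifold (𝓡∂ 2) ∞ M]

theorem isInteriorPoint_iff_extChartAt {c x : M} (hx : x ∈ (chartAt (EuclideanHalfSpace 2) c).source) :
    x ∈ (𝓡∂ 2).interior M ↔ 0 < (extChartAt (𝓡∂ 2) c x) 0 := by
  refine (ModelWithCorners.isInteriorPoint_iff_of_mem_atlas (n := ∞) (by simp)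
    (chart_mem_atlas (EuclideanHalfSpace 2) c) hx).trans ?_
  change extChartAt (𝓡∂ 2) c x ∈ interior (extChartAt (𝓡∂ 2) c).target ↔ _
  rw [extChartAt_target, interior_inter, ((𝓡∂ 2).continuous_symm.isOpen_preimage _
    (chartAt (EuclideanHalfSpace 2) c).open_target).interior_eq,
    interior_range_modelWithCornersEuclideanHalfSpace]
  refine ⟨fun h => h.2, fun h => ⟨?_, h⟩⟩
  have h1 := (extChartAt (𝓡∂ 2) c).map_source (by rwa [extChartAt_source] : x ∈ _)
  rw [extChartAt_target] at h1
  exact h1.1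

theorem mem_boundary_iff_extChartAt {c x : M}
    (hx : x ∈ (chartAt (EuclideanHalfSpace 2) c).source) :
    x ∈ (𝓡∂ 2).boundary M ↔ (extChartAt (𝓡∂ 2) c x) 0 = 0 := by
  have h1 : extChartAt (𝓡∂ 2) c x ∈ range (𝓡∂ 2) := mem_range_self _
  rw [range_modelWithCornersEuclideanHalfSpace] at h1
  rw [← ModelWithCorners.compl_interior, mem_compl_iff, isInteriorPoint_iff_extChartAt hx]
  exact ⟨fun h => le_antisymm (not_lt.1 h) h1, fun h => by rw [h]; exact lt_irrefl 0⟩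

theorem pt_axis_mem_boundary {c : M} {t : ℝ} (ht : axis t ∈ (extChartAt (𝓡∂ 2) c).target) :
    pt c (axis t) ∈ (𝓡∂ 2).boundary M := by
  have hs : pt c (axis t) ∈ (chartAt (EuclideanHalfSpace 2) c).source := by
    rw [← extChartAt_source (𝓡∂ 2)]; exact (extChartAt (𝓡∂ 2) c).map_target ht
  rw [mem_boundary_iff_extChartAt hs, pt, (extChartAt (𝓡∂ 2) c).right_inv ht, axis_apply]
  rfl

/-- At a boundary point the covectors `dy_0` of all charts are proportional. -/
theorem coordCovec_bdry {c x : M} (hb : x ∈ (𝓡∂ 2).boundary M)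
    (hx : x ∈ (chartAt (EuclideanHalfSpace 2) c).source) :
    ∃ a : ℝ, a ≠ 0 ∧ coordCovec x x 0 = a • coordCovec c x 0 := by
  have hxx := mem_chart_source (EuclideanHalfSpace 2) x
  set y := extChartAt (𝓡∂ 2) c x with hy
  have hyt : y ∈ (extChartAt (𝓡∂ 2) c).target :=
    (extChartAt (𝓡∂ 2) c).map_source (by rwa [extChartAt_source])
  have hpt : pt c y = x := (extChartAt (𝓡∂ 2) c).left_inv (by rwa [extChartAt_source])
  have h1 := hasFDerivWithinAt_tangentCoordChange (I := 𝓡∂ 2) (x := c) (y := x) (z := x)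
    ⟨by rwa [extChartAt_source], mem_extChartAt_source x⟩
  have hl : HasDerivAt (fun t : ℝ => y + axis t) (EuclideanSpace.single 1 1) 0 := by
    have h2 : HasDerivAt axis (axis 1) 0 := axis.hasFDerivAt.hasDerivAt
    rw [show axis 1 = EuclideanSpace.single 1 1 from one_smul ℝ _] at h2
    exact h2.const_add y
  have hm : ∀ t : ℝ, y + axis t ∈ range (𝓡∂ 2) := fun t => by
    have h3 := extChartAt_target_subset_range c hyt
    rw [range_modelWithCornersEuclideanHalfSpace] at h3 ⊢
    simpa [axis_apply] using h3
  have h4 : HasDerivAt (fun t : ℝ => (extChartAt (𝓡∂ 2) x (pt c (y + axis t))) 0)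
      (tangentCoordChange (𝓡∂ 2) c x x (EuclideanSpace.single 1 1) 0) 0 := by
    have h5 : HasFDerivWithinAt (extChartAt (𝓡∂ 2) x ∘ (extChartAt (𝓡∂ 2) c).symm)
        (tangentCoordChange (𝓡∂ 2) c x x) (range (𝓡∂ 2)) (y + axis 0) := by
      rwa [map_zero, add_zero]
    have h6 := h5.comp_hasDerivAt 0 hl (Filter.Eventually.of_forall hm)
    exact (EuclideanSpace.proj 0 : Plane →L[ℝ] ℝ).hasFDerivAt.comp_hasDerivAt 0 h6
  -- The coordinate y_0 of the other chart is non-negative and vanishes at x, so its derivative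
  -- along the boundary direction is zero; hence dy_0 of that chart has no dy_1-component.
  have h7 : IsLocalMin (fun t : ℝ => (extChartAt (𝓡∂ 2) x (pt c (y + axis t))) 0) 0 := by
    refine Filter.Eventually.of_forall fun t => ?_
    simp only [map_zero, add_zero, hpt]
    rw [(mem_boundary_iff_extChartAt hxx).1 hb]
    have h8 : extChartAt (𝓡∂ 2) x (pt c (y + axis t)) ∈ range (𝓡∂ 2) := mem_range_self _
    rwa [range_modelWithCornersEuclideanHalfSpace] at h8
  have h9 : coordCovec x x 0 (coordVec c x 1) = 0 := by
    rw [coordCovec_coordVec_eq hx hxx]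
    exact h7.hasDerivAt_eq_zero h4
  have h10 := eq_sum_coordCovec hx (coordCovec x x 0)
  rw [h9, zero_smul, add_zero] at h10
  refine ⟨_, fun h => coordCovec_ne_zero hxx 0 ?_, h10⟩
  rw [h10, h, zero_smul]

variable [RiemannianBundle (fun x : M => TangentSpace (𝓡∂ 2) x)]

theorem outwardConormal_eq (x : Bdry M) {c : M}
    (hx : (x : M) ∈ (chartAt (EuclideanHalfSpace 2) c).source) :
    ∃ a : ℝ, a ≠ 0 ∧ outwardConormal x = a • coordCovec c (x : M) 0 := by
  obtain ⟨a, ha, h⟩ := coordCovec_bdry x.2 hx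
  have h0 : ‖coordCovec (x : M) (x : M) 0‖ ≠ 0 :=
    (norm_ne_zero_iff (E := Tan (x : M) →L[ℝ] ℝ)).2 (coordCovec_ne_zero (mem_chart_source _ _) 0)
  exact ⟨-(‖coordCovec (x : M) (x : M) 0‖⁻¹ * a), neg_ne_zero.2 (mul_ne_zero (inv_ne_zero h0) ha),
    ContinuousLinearMap.ext fun v => by
      have h1 : coordCovec (x : M) (x : M) 0 v = a * coordCovec c (x : M) 0 v :=
        congrArg (fun f : Tan (x : M) →L[ℝ] ℝ => f v) h
      change -(‖coordCovec (x : M) (x : M) 0‖⁻¹ * coordCovec (x : M) (x : M) 0 v) =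
        -(‖coordCovec (x : M) (x : M) 0‖⁻¹ * a) * coordCovec c (x : M) 0 v
      rw [h1]
      ring⟩

theorem outwardConormal_ne_zero (x : Bdry M) : outwardConormal x ≠ 0 := by
  obtain ⟨a, ha, h⟩ := outwardConormal_eq x (mem_chart_source _ (x : M))
  rw [h]
  exact smul_ne_zero ha (coordCovec_ne_zero (mem_chart_source _ _) 0)

variable {V : Type*} [NormedAddCommGroup V] [NormedSpace ℂ V] [FiniteDimensional ℂ V]
  {E : M → Type*} [TopologicalSpace (TotalSpace V E)]
  [∀ x, NormedAddCommGroup (E x)] [∀ x, InnerProductSpace ℂ (E x)]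
  [FiberBundle V E] [VectorBundle ℂ V E] [VectorBundle ℝ V E]
  [ContMDiffVectorBundle ∞ V E (𝓡∂ 2)]

variable {X : Type*} [TopologicalSpace X]

theorem RegB.comp_axis {B : X → ∀ x, Module.End ℂ (E x)} (hB : RegB V B) (c : M) :
    RegE V c ⊤ univ (bdryDomain V E c) (fun t => pt c (axis t)) fun a t => B a (pt c (axis t)) :=
  RegOn.comp_affine (P' := ℝ) le_top (isRelOpen_coordDomain c) (isRelOpen_bdryDomain c)
    (hB c) axis (fun t _ => axis_mem_range t) (fun _ ht => ht)

open Classical in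
/-- The extension of a field of subspaces over the boundary by zero. -/
def extBdry (L : ∀ x : Bdry M, Submodule ℂ (E x)) (x : M) : Submodule ℂ (E x) :=
  if h : x ∈ (𝓡∂ 2).boundary M then L ⟨x, h⟩ else ⊥

theorem sum_rk_mem_span {W ι : Type*} [NormedAddCommGroup W] [InnerProductSpace ℂ W] [Fintype ι]
    (s : ι → W) (v : W) : (∑ i, rk (s i) (s i)) v ∈ Submodule.span ℂ (range s) := by
  rw [LinearMap.sum_apply]
  exact Submodule.sum_mem _ fun i _ => Submodule.smul_mem _ _ (Submodule.subset_span ⟨i, rfl⟩)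

/-- The projection to the span of the first of two complementary families. -/
theorem sum_rk_inverse {W ι κ : Type*} [NormedAddCommGroup W] [InnerProductSpace ℂ W]
    [FiniteDimensional ℂ W] [Fintype ι] [Fintype κ] {s : ι → W} {r : κ → W}
    (hs : LinearIndependent ℂ s) (hcard : Fintype.card ι + Fintype.card κ = Module.finrank ℂ W)
    (hu : IsUnit (∑ i, rk (s i) (s i) + ∑ j, rk (r j) (r j))) {w : W}
    (hw : w ∈ Submodule.span ℂ (range s)) :
    (∑ i, rk (s i) (s i)) (Ring.inverse (∑ i, rk (s i) (s i) + ∑ j, rk (r j) (r j)) w) = w := by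
  set B := ∑ i, rk (s i) (s i) with hB
  set R := ∑ j, rk (r j) (r j) with hR
  have h1 : ∀ w, w = B (Ring.inverse (B + R) w) + R (Ring.inverse (B + R) w) := fun w =>
    (congrArg (fun f : Module.End ℂ W => f w) (Ring.mul_inverse_cancel _ hu)).symm
  have h2 : Submodule.span ℂ (range s) ⊔ Submodule.span ℂ (range r) = ⊤ := by
    refine eq_top_iff.2 fun w _ => ?_
    rw [h1 w]
    exact Submodule.add_mem_sup (sum_rk_mem_span s _) (sum_rk_mem_span r _)
  have h3 := Submodule.finrank_sup_add_finrank_inf_eq (Submodule.span ℂ (range s))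
    (Submodule.span ℂ (range r))
  rw [h2, finrank_top, finrank_span_eq_card hs] at h3
  have h4 : Module.finrank ℂ (Submodule.span ℂ (range r)) ≤ Fintype.card κ :=
    finrank_range_le_card r
  have h5 : Submodule.span ℂ (range s) ⊓ Submodule.span ℂ (range r) = ⊥ :=
    -- The spans fill the space and their dimensions add up to at most that of W, so they meet in
    -- zero; this forces the second summand of w to vanish.
    Submodule.finrank_eq_zero.1 (by omega)
  have h6 : R (Ring.inverse (B + R) w) ∈ Submodule.span ℂ (range s) ⊓ Submodule.span ℂ (range r) := by
    refine ⟨?_, sum_rk_mem_span r _⟩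
    rw [← add_sub_cancel_left (B (Ring.inverse (B + R) w)) (R _), ← h1 w]
    exact Submodule.sub_mem _ hw (sum_rk_mem_span s _)
  rw [h5, Submodule.mem_bot] at h6
  conv_rhs => rw [h1 w, h6, add_zero]

theorem IsSmoothEnd.sum {ι : Type*} [Fintype ι] {B : ι → ∀ x, Module.End ℂ (E x)}
    (h : ∀ i, IsSmoothEnd V (B i)) : IsSmoothEnd V fun x => ∑ i, B i x := fun u hu => by
  have e : (fun x => (∑ i, B i x) (u x)) = ∑ i, fun x => B i x (u x) := by
    ext x
    rw [LinearMap.sum_apply, Finset.sum_apply]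
  rw [e]
  exact Submodule.sum_mem _ fun i _ => h i u hu

variable [MeasurableSpace M] [BorelSpace M] [CompactSpace M] [T2Space M]
  [IsContMDiffRiemannianBundle (𝓡∂ 2) ∞ Plane (fun x : M => TangentSpace (𝓡∂ 2) x)]

/-- Complete a local frame of L by sections extending a basis of Lᗮ at the given point. With B and R
their frame operators, B + R stays invertible nearby, and B(B + R)⁻¹ is a smooth idempotent with
range L; its orthogonalization is smooth too. -/
theorem IsSmoothBdrySubbundle.contDiffWithinAt (hE : IsSmoothHermitian V E)
    [∀ x, FiniteDimensional ℂ (E x)] {L : ∀ x : Bdry M, Submodule ℂ (E x)}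
    (hL : IsSmoothBdrySubbundle V L) {c : M} {t₀ : ℝ} (ht : t₀ ∈ bdryDomain V E c) :
    ContDiffWithinAt ℝ ∞ (fun t => endInTriv V c (pt c (axis t))
      (orthP (extBdry L (pt c (axis t))))) univ t₀ := by
  have hp := isPlot_axis (V := V) (E := E) c
  have hbd : ∀ t ∈ bdryDomain V E c, pt c (axis t) ∈ (𝓡∂ 2).boundary M := fun t ht =>
    pt_axis_mem_boundary (mem_coordDomain.1 ht).1
  set x₀ : Bdry M := ⟨pt c (axis t₀), hbd t₀ ht⟩ with hx₀
  obtain ⟨k, s, hs⟩ := hL x₀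
  let b := Module.finBasis ℂ (L x₀)ᗮ
  choose r hr using fun j => exists_section_apply_eq (V := V) (x₀ : M) (b j : E x₀)
  let B : ∀ x, Module.End ℂ (E x) := fun x => ∑ i, rk ((s i).1 x) ((s i).1 x)
  let R : ∀ x, Module.End ℂ (E x) := fun x => ∑ j, rk ((r j).1 x) ((r j).1 x)
  have hB : RegB V fun _ : Unit => B := (IsSmoothEnd.sum fun i => isSmoothEnd_rk hE _ _).regB
  have hR : RegB V fun _ : Unit => R := (IsSmoothEnd.sum fun i => isSmoothEnd_rk hE _ _).regB
  obtain ⟨hs1, hs2⟩ := hs.self_of_nhds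
  have hu0 : IsUnit (B x₀ + R x₀) := by
    refine (LinearMap.isUnit_iff_ker_eq_bot _).2 (LinearMap.ker_eq_bot'.2 fun u hu => ?_)
    have e : B x₀ + R x₀ = ∑ a, rk (Sum.elim (fun i => (s i).1 x₀) (fun j => (r j).1 x₀) a)
        (Sum.elim (fun i => (s i).1 x₀) (fun j => (r j).1 x₀) a) := by
      rw [Fintype.sum_sum_type]
      rfl
    rw [e] at hu
    have h1 := inner_rk_sum_eq_zero _ _ u hu
    have h2 : u ∈ (L x₀)ᗮ := by
      rw [Submodule.mem_orthogonal', ← hs2]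
      intro w hw
      refine Submodule.span_induction ?_ (inner_zero_right _) (fun a b _ _ ha hb => by
        rw [inner_add_right, ha, hb, add_zero]) (fun a w _ hw => by
        rw [inner_smul_right, hw, mul_zero]) hw
      rintro _ ⟨i, rfl⟩
      exact inner_eq_zero_symm.1 (h1 (Sum.inl i) (Finset.mem_univ _))
    have h3 : (innerSL ℂ u : E x₀ →ₗ[ℂ] ℂ) ∘ₗ (L x₀)ᗮ.subtype = 0 := b.ext fun j => by
      refine (inner_eq_zero_symm.1 ?_ : (inner ℂ u (b j : E x₀) : ℂ) = 0)
      rw [← hr j]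
      exact h1 (Sum.inr j) (Finset.mem_univ _)
    exact inner_self_eq_zero.1 (LinearMap.congr_fun h3 ⟨u, h2⟩ : (inner ℂ u u : ℂ) = 0)
  have hfr : ∀ x, Module.finrank ℂ (E x) = Module.finrank ℂ V := fun x =>
    ((trivializationAt V E x).linearEquivAt ℂ x (mem_baseSet_trivializationAt V E x)).finrank_eq
  have hcard : ∀ x, Fintype.card (Fin k) + Fintype.card (Fin (Module.finrank ℂ (L x₀)ᗮ)) =
      Module.finrank ℂ (E x) := fun x => by
    rw [hfr x, ← hfr x₀, ← (L x₀).finrank_add_finrank_orthogonal, ← hs2, finrank_span_eq_card hs1,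
      Fintype.card_fin, Fintype.card_fin]
  obtain ⟨U, hU, hUo, htU⟩ : ∃ U : Set ℝ, (∀ t ∈ U, t ∈ bdryDomain V E c ∧
      IsUnit (B (pt c (axis t)) + R (pt c (axis t))) ∧
      ∀ h : pt c (axis t) ∈ (𝓡∂ 2).boundary M,
        LinearIndependent ℂ (fun i => (s i).1 (pt c (axis t))) ∧
        Submodule.span ℂ (range fun i => (s i).1 (pt c (axis t))) = L ⟨pt c (axis t), h⟩) ∧
      IsOpen U ∧ t₀ ∈ U := by
    refine eventually_nhds_iff.1 (Filter.Eventually.and ?_ (Filter.Eventually.and ?_ ?_))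
    · exact nhdsWithin_univ t₀ ▸ hp.relOpen.nhds t₀ ht
    · have h1 := ((((hB.comp_axis c).add hp (hR.comp_axis c)).smooth () t₀ ht).continuousWithinAt)
      rw [continuousWithinAt_univ] at h1
      have h2 : IsUnit (endInTriv V c (pt c (axis t₀)) (B x₀ + R x₀)) := by
        rw [endInTriv_eq (hp.base t₀ ht)]
        exact hu0.map _
      have h3 : ∀ᶠ t in 𝓝 t₀, t ∈ bdryDomain V E c :=
        nhdsWithin_univ t₀ ▸ hp.relOpen.nhds t₀ ht
      haveI : CompleteSpace V := FiniteDimensional.complete ℂ V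
      filter_upwards [h1.eventually (Units.isOpen.mem_nhds h2), h3] with t h4 h5
      have h6 : IsUnit (endInTriv V c (pt c (axis t))
        (B (pt c (axis t)) + R (pt c (axis t)))) := h4
      rw [endInTriv_eq (hp.base t h5)] at h6
      exact (isUnit_map_iff (endAlg (hp.base t h5)) _).1 h6
    · rw [nhds_subtype_eq_comap, Filter.eventually_comap] at hs
      have h1 := (axis.continuous.continuousWithinAt (s := univ) (x := t₀)).tendsto_nhdsWithin
        (t := range (𝓡∂ 2)) fun t _ => axis_mem_range t
      rw [nhdsWithin_univ] at h1
      filter_upwards [h1.eventually (eventually_pt (mem_coordDomain.1 ht).1 hs)] with t h2 h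
      exact h2 ⟨_, h⟩ rfl
  have hp' : IsPlot V E c ⊤ univ U (fun t => pt c (axis t)) :=
    ⟨hp.one_le, ⟨uniqueDiffOn_univ, subset_univ _, fun y hy => mem_nhdsWithin_of_mem_nhds (hUo.mem_nhds hy)⟩,
      fun y hy => hp.source y (hU y hy).1, fun y hy => hp.base y (hU y hy).1,
      fun y hy => hp.smooth y (hU y hy).1⟩
  have hsub : U ⊆ bdryDomain V E c := fun t ht => (hU t ht).1
  have hB' : RegE V c ⊤ univ U (fun t => pt c (axis t)) fun (_ : Unit) t => B (pt c (axis t)) :=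
    RegOn.mono hp.relOpen (hB.comp_axis c) hsub
  have hR' : RegE V c ⊤ univ U (fun t => pt c (axis t)) fun (_ : Unit) t => R (pt c (axis t)) :=
    RegOn.mono hp.relOpen (hR.comp_axis c) hsub
  refine (RegE.orthP_of_idempotent hE hp' (hB'.mul hp' (RegE.inverse hp' (hB'.add hp' hR')
    fun _ t ht => (hU t ht).2.1)) (U := fun _ t => extBdry L (pt c (axis t))) ?_ ?_).smooth () t₀ htU
  · intro _ t ht w
    have h1 := (hU t ht).2.2 (hbd t (hsub ht))
    rw [extBdry, dif_pos (hbd t (hsub ht)), ← h1.2]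
    exact sum_rk_mem_span _ _
  · intro _ t ht w hw
    have h1 := (hU t ht).2.2 (hbd t (hsub ht))
    rw [extBdry, dif_pos (hbd t (hsub ht)), ← h1.2] at hw
    exact sum_rk_inverse h1.1 (hcard _) (hU t ht).2.1 hw

/-- A smooth field of endomorphisms on the coordinate domain takes sections to sections. -/
theorem RegE.exists_section {c x₀ : M} (hx : x₀ ∈ (chartAt (EuclideanHalfSpace 2) c).source)
    (hx' : x₀ ∈ (trivializationAt V E c).baseSet) {B : ∀ x, Module.End ℂ (E x)}
    (hB : RegE V c ⊤ (range (𝓡∂ 2)) (coordDomain V E c) (pt c) fun (_ : Unit) y => B (pt c y))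
    (u : Sections V E) : ∃ t : Sections V E, ∀ᶠ x in 𝓝 x₀, t.1 x = B x (u.1 x) := by
  have hD := isRelOpen_coordDomain (V := V) (E := E) c
  refine exists_section_eventuallyEq ((chartAt (EuclideanHalfSpace 2) c).open_source.inter
    (trivializationAt V E c).open_baseSet) ⟨hx, hx'⟩ fun x hx => ?_
  have hs : x ∈ (extChartAt (𝓡∂ 2) c).source := by rw [extChartAt_source]; exact hx.1
  have hpt : pt c (extChartAt (𝓡∂ 2) c x) = x := (extChartAt (𝓡∂ 2) c).left_inv hs
  have hy : extChartAt (𝓡∂ 2) c x ∈ coordDomain V E c := ⟨x, hx, rfl⟩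
  have h := (contDiffWithinAt_coordSection_iff c (fun x => B x (u.1 x)) hy).1
    ((RegOn.congr hD (RegOn.map₂ hD le_top hB (RegS.of_section (X := Unit) u c) contDiff_apply_end)
      fun _ _ hy => coordSection_end B _ hy).smooth () _ hy)
  rw [hpt] at h
  exact h.contMDiffWithinAt

end BoundarySubbundles

/-! ### The homotopy on boundary value problems. -/

section BoundaryDeformation

open Set

variable {M : Type*} [TopologicalSpace M] [ChartedSpace (EuclideanHalfSpace 2) M]
  [IsManifold (𝓡∂ 2) ∞ M]

variable {V : Type*} [NormedAddCommGroup V] [NormedSpace ℂ V] [FiniteDimensional ℂ V]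
  {E : M → Type*} [TopologicalSpace (TotalSpace V E)]
  [∀ x, NormedAddCommGroup (E x)] [∀ x, InnerProductSpace ℂ (E x)]
  [FiberBundle V E] [VectorBundle ℂ V E] [VectorBundle ℝ V E]
  [ContMDiffVectorBundle ∞ V E (𝓡∂ 2)]

variable [MeasurableSpace M] [BorelSpace M] [CompactSpace M] [T2Space M]
  [RiemannianBundle (fun x : M => TangentSpace (𝓡∂ 2) x)]
  [IsContMDiffRiemannianBundle (𝓡∂ 2) ∞ Plane (fun x : M => TangentSpace (𝓡∂ 2) x)]
  [∀ x, FiniteDimensional ℂ (E x)] {X : Type*} [TopologicalSpace X]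

variable (V) in
/-- A regular family of boundary conditions. -/
def RegL (L : X → ∀ x : Bdry M, Submodule ℂ (E x)) : Prop :=
  ∀ c, RegE V c ⊤ univ (bdryDomain V E c) (fun t => pt c (axis t))
    fun a t => orthP (extBdry (L a) (pt c (axis t)))

theorem coordBdryEnd_eq (c : M) (L : ∀ x : Bdry M, Submodule ℂ (E x)) :
    coordBdryEnd V c (fun x => projAlong (L x) (L x)ᗮ) =
      fun t => endInTriv V c (pt c (axis t)) (orthP (extBdry L (pt c (axis t)))) := by
  funext t
  rw [coordBdryEnd, axis_apply]
  split_ifs with h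
  · rw [extBdry, dif_pos h]
    rfl
  · rw [extBdry, dif_neg h]
    have e : orthP (⊥ : Submodule ℂ (E (pt c !₂[(0 : ℝ), t]))) = 0 :=
      LinearMap.ext fun w => (Submodule.mem_bot ℂ).1 (orthP_mem ⊥ w)
    rw [e]
    refine (ContinuousLinearMap.ext fun v => ?_)
    exact (map_zero ((trivializationAt V E c).linearMapAt ℂ _)).symm

variable {o : SurfaceOrientation M}

theorem EllBar.ext {p q : EllBar V E o} (h1 : p.op = q.op) (h2 : p.bc = q.bc) : p = q := by
  cases p; cases q; cases h1; cases h2; rfl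

theorem continuous_to_ellBar {F : X → EllBar V E o} (h1 : Continuous fun a => (F a).op)
    (h2 : RegL V fun a => (F a).bc) : Continuous F := by
  have hK : ∀ c, ∀ K ∈ coordBdryCompacts V E c, IsCompact K ∧ K ⊆ bdryDomain V E c :=
    fun c K hK => ⟨hK.1, fun t ht => by rw [bdryDomain, mem_preimage, axis_apply]; exact hK.2 t ht⟩
  have h3 : ∀ c, Continuous fun a => UniformOnFun.ofFun (coordBdryCompacts V E c)
      (coordBdryEnd V c fun x => projAlong ((F a).bc x) ((F a).bc x)ᗮ) := fun c => by
    simp only [coordBdryEnd_eq]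
    exact continuous_ofFun (hK c) (h2 c).cont
  have h4 : ∀ c, Continuous fun a => UniformOnFun.ofFun (coordBdryCompacts V E c)
      (deriv (coordBdryEnd V c fun x => projAlong ((F a).bc x) ((F a).bc x)ᗮ)) := fun c => by
    simp only [coordBdryEnd_eq]
    have h5 := (h2 c).dcont
    simp only [fderivWithin_univ] at h5
    exact continuous_ofFun (hK c) (h5.clm_apply (continuousOn_const (c := (1 : ℝ))))
  refine continuous_iff_coinduced_le.2 (le_inf ?_ (le_iInf fun c => le_inf ?_ ?_))
  · exact continuous_iff_coinduced_le.1 (continuous_induced_rng.2 h1)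
  · exact continuous_iff_coinduced_le.1 (continuous_induced_rng.2 (h3 c))
  · exact continuous_iff_coinduced_le.1 (continuous_induced_rng.2 (h4 c))

theorem EllBar.continuous_op : Continuous (EllBar.op : EllBar V E o → Ell V E) :=
  continuous_iff_le_induced.2 inf_le_left

theorem regL_bc (hE : IsSmoothHermitian V E) : RegL V fun p : EllBar V E o => p.bc := by
  intro c
  have hn : ∀ t ∈ bdryDomain V E c, ∃ K ∈ coordBdryCompacts V E c,
      K ∈ 𝓝[bdryDomain V E c] t := by
    intro t ht
    have h := (isRelOpen_bdryDomain (V := V) (E := E) c).nhds t ht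
    rw [nhdsWithin_univ] at h
    obtain ⟨ε, hε, h⟩ := Metric.nhds_basis_closedBall.mem_iff.1 h
    refine ⟨Metric.closedBall t ε, ⟨isCompact_closedBall t ε, fun s hs => ?_⟩,
      mem_nhdsWithin_of_mem_nhds (Metric.closedBall_mem_nhds t hε)⟩
    rw [← axis_apply]
    exact h hs
  have hs : ∀ (p : EllBar V E o), ∀ t ∈ bdryDomain V E c, ContDiffWithinAt ℝ ∞ (fun t =>
      endInTriv V c (pt c (axis t)) (orthP (extBdry p.bc (pt c (axis t))))) univ t :=
    fun p t ht => p.smooth.contDiffWithinAt hE ht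
  have h1 : Continuous fun p : EllBar V E o => UniformOnFun.ofFun (coordBdryCompacts V E c)
      (coordBdryEnd V c fun x => projAlong (p.bc x) (p.bc x)ᗮ) := continuous_iff_le_induced.2
    (inf_le_right.trans ((iInf_le _ c).trans inf_le_left))
  have h2 : Continuous fun p : EllBar V E o => UniformOnFun.ofFun (coordBdryCompacts V E c)
      (deriv (coordBdryEnd V c fun x => projAlong (p.bc x) (p.bc x)ᗮ)) := continuous_iff_le_induced.2
    (inf_le_right.trans ((iInf_le _ c).trans inf_le_right))
  simp only [coordBdryEnd_eq] at h1 h2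
  have h3 := continuousOn_of_continuous_ofFun hn h1 fun p t ht =>
    (hs p t ht).continuousWithinAt.mono (subset_univ _)
  have h4 := continuousOn_of_continuous_ofFun hn h2 fun p t ht => by
    have h5 := (hs p t ht).fderivWithin_right (m := 0) uniqueDiffOn_univ (by simp) (mem_univ t)
    rw [fderivWithin_univ] at h5
    exact (h5.continuousWithinAt.mono (subset_univ _)).clm_apply
      (continuousWithinAt_const (b := (1 : ℝ)))
  refine ⟨hs, h3, ?_⟩
  have h6 : ContinuousOn (fun z : EllBar V E o × ℝ => ContinuousLinearMap.toSpanSingleton ℝ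
      (deriv (fun t => endInTriv V c (pt c (axis t))
        (orthP (extBdry z.1.bc (pt c (axis t))))) z.2)) (univ ×ˢ bdryDomain V E c) :=
    (ContinuousLinearMap.toSpanSingletonCLE (𝕜 := ℝ) (E := V →L[ℂ] V)).continuous.comp_continuousOn h4
  refine h6.congr fun z _ => ?_
  rw [fderivWithin_univ]
  exact (toSpanSingleton_deriv).symm

section Transport

variable (o)

/-- The transport of boundary conditions. -/
def bdryTransport (σ τ : Symb E) (x : Bdry M) : Module.End ℂ (E (x : M)) :=
  transport (o.PosCoframe (x : M)) (σ x) (τ x) (outwardConormal x)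

theorem bdryTransport_eq {σ τ : Symb E} (hτ : ∀ x, IsEllSymb (τ x)) (x : Bdry M) {c : M}
    (hx : (x : M) ∈ (chartAt (EuclideanHalfSpace 2) c).source) : bdryTransport o σ τ x =
      transport (o.PosCoframe (x : M)) (σ x) (τ x) (coordCovec c (x : M) 0) := by
  obtain ⟨a, ha, h⟩ := outwardConormal_eq x hx
  rw [bdryTransport, h, transport_smul (hτ x) (coordCovec_ne_zero hx 0) ha]

variable {σ τ : Symb E} (hσ : ∀ x, IsEllSymb (σ x)) (hτ : ∀ x, IsEllSymb (τ x))
  (hU : ∀ x, Eminus o τ x = Eminus o σ x)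

include hσ hτ hU

theorem IsSmoothBdrySubbundle.map_transport (hE : IsSmoothHermitian V E)
    (hσr : RegG V fun _ : Unit => σ) (hτr : RegG V fun _ : Unit => τ)
    {L : ∀ x : Bdry M, Submodule ℂ (E x)} (hL : IsSmoothBdrySubbundle V L) :
    IsSmoothBdrySubbundle V fun x => (L x).map (bdryTransport o σ τ x) := by
  intro x₀
  obtain ⟨k, s, hs⟩ := hL x₀
  have hx := mem_chart_source (EuclideanHalfSpace 2) (x₀ : M)
  choose r hr using fun i => RegE.exists_section hx (mem_baseSet_trivializationAt V E (x₀ : M))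
    (B := fun x => transport (o.PosCoframe x) (σ x) (τ x) (coordCovec (x₀ : M) x 0))
    (RegSymb.transport o hE (isPlot_pt _) (hσr _) (fun _ _ _ => hσ _) (hτr _) fun _ _ _ => hτ _) (s i)
  refine ⟨k, r, ?_⟩
  have h1 : ∀ᶠ x : Bdry M in 𝓝 x₀, (x : M) ∈ (chartAt (EuclideanHalfSpace 2) (x₀ : M)).source ∧
      ∀ i, (r i).1 x = transport (o.PosCoframe (x : M)) (σ x) (τ x)
        (coordCovec (x₀ : M) (x : M) 0) ((s i).1 x) :=
    continuous_subtype_val.continuousAt.eventually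
      (((chartAt (EuclideanHalfSpace 2) (x₀ : M)).open_source.eventually_mem hx).and
        (Filter.eventually_all.2 hr))
  filter_upwards [hs, h1] with x ⟨hl, hsp⟩ ⟨hxs, hri⟩
  have hinj := transport_injective (hσ x) (hτ x) (o.isConfPlane (x : M)) (hU x)
    (outwardConormal_ne_zero x)
  have e : (fun i => (r i).1 x) = bdryTransport o σ τ x ∘ fun i => (s i).1 x :=
    funext fun i => by rw [hri, ← bdryTransport_eq o hτ x hxs]; rfl
  rw [e]
  refine ⟨hl.map' _ (LinearMap.ker_eq_bot.2 hinj), ?_⟩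
  rw [range_comp, ← Submodule.map_span, hsp]

end Transport

/-- Conjugating the orthogonal projection on L by the transport gives a regular idempotent onto the
transported subspace, which is then orthogonalized. -/
theorem RegL.map_transport (o : SurfaceOrientation M) (hE : IsSmoothHermitian V E)
    {σ τ : X → Symb E} (hσr : RegG V σ) (hτr : RegG V τ)
    (hσ : ∀ a x, IsEllSymb (σ a x)) (hτ : ∀ a x, IsEllSymb (τ a x))
    (hU : ∀ a x, Eminus o (τ a) x = Eminus o (σ a) x) {L : X → ∀ x : Bdry M, Submodule ℂ (E x)}
    (hL : RegL V L) : RegL V fun a x => (L a x).map (bdryTransport o (σ a) (τ a) x) := by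
  intro c
  have hp := isPlot_axis (V := V) (E := E) c
  have hT := RegSymb.transport o hE hp (hσr c).comp_axis (fun a _ _ => hσ a _) (hτr c).comp_axis
    fun a _ _ => hτ a _
  have hu : ∀ a, ∀ t ∈ bdryDomain V E c, IsUnit (transport (o.PosCoframe (pt c (axis t)))
      (σ a (pt c (axis t))) (τ a (pt c (axis t))) (coordCovec c (pt c (axis t)) 0)) := fun a t ht =>
    transport_isUnit (hσ a _) (hτ a _) (o.isConfPlane _) (hU a _)
      (coordCovec_ne_zero (hp.source t ht) 0)
  have he : ∀ a, ∀ t ∈ bdryDomain V E c,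
      extBdry (fun x => (L a x).map (bdryTransport o (σ a) (τ a) x)) (pt c (axis t)) =
      (extBdry (L a) (pt c (axis t))).map (transport (o.PosCoframe (pt c (axis t)))
        (σ a (pt c (axis t))) (τ a (pt c (axis t))) (coordCovec c (pt c (axis t)) 0)) := by
    intro a t ht
    have hb := pt_axis_mem_boundary (mem_coordDomain.1 ht).1
    rw [extBdry, dif_pos hb, extBdry, dif_pos hb,
      bdryTransport_eq o (hτ a) ⟨_, hb⟩ (hp.source t ht)]
  refine RegE.orthP_of_idempotent hE hp ((hT.mul hp (hL c)).mul hp (hT.inverse hp hu)) ?_ ?_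
  · intro a t ht w
    rw [he a t ht]
    exact ⟨_, orthP_mem _ _, rfl⟩
  · intro a t ht w hw
    rw [he a t ht] at hw
    obtain ⟨v, hv, rfl⟩ := hw
    have h1 := congrArg (fun f : Module.End ℂ _ => f v) (Ring.inverse_mul_cancel _ (hu a t ht))
    simp only [Module.End.mul_apply, Module.End.one_apply] at h1 ⊢
    rw [h1, orthP_of_mem hv]

variable (o) (hE : IsSmoothHermitian V E) (Q₀ Q₁ : Quantizer V E)

/-- The homotopy of boundary value problems. -/
def homotopyBar (t : ℝ) (s : unitInterval) (p : EllBar V E o) : EllBar V E o :=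
  have hσ := p.op.isEllSymb o hE
  have hτ := (homotopyEll o hE Q₀ Q₁ t s p.op).isEllSymb o hE
  have hU := Eminus_deformSymb o hσ s
  { op := homotopyEll o hE Q₀ Q₁ t s p.op
    bc := fun x => (p.bc x).map
      (bdryTransport o p.op.symb (homotopyEll o hE Q₀ Q₁ t s p.op).symb x)
    smooth := p.smooth.map_transport o hσ hτ hU hE
      (regG_symb.reparam (continuous_const (y := p.op)))
      (regG_symb.reparam (continuous_const (y := homotopyEll o hE Q₀ Q₁ t s p.op)))
    lagrangian := fun x => map_symb_map_transport (hσ x) (hτ x) (o.isConfPlane (x : M)) (hU x)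
      (outwardConormal_ne_zero x) (p.lagrangian x)
    compl_plus := fun x => by
      have h1 := isCompl_map_transport (hσ x) (hτ x) (o.isConfPlane (x : M)) (hU x)
        (outwardConormal_ne_zero x) (p.compl_plus x)
      have h2 := map_transport_high (hσ x) (hτ x) (o.isConfPlane (x : M)) (hU x)
        (outwardConormal_ne_zero x)
      exact Eq.subst (motive := fun U => IsCompl _ U) h2 h1
    compl_minus := fun x => by
      have h1 := isCompl_map_transport (hσ x) (hτ x) (o.isConfPlane (x : M)) (hU x)
        (outwardConormal_ne_zero x) (p.compl_minus x)
      have h2 := map_transport_low (hσ x) (hτ x) (o.isConfPlane (x : M)) (hU x)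
        (outwardConormal_ne_zero x)
      exact Eq.subst (motive := fun U => IsCompl _ U) h2 h1 }

theorem homotopyBar_bc (t : ℝ) (s : unitInterval) (p : EllBar V E o) (x : Bdry M) :
    (homotopyBar o hE Q₀ Q₁ t s p).bc x =
      (p.bc x).map (bdryTransport o p.op.symb (homotopyEll o hE Q₀ Q₁ t s p.op).symb x) := rfl

theorem continuous_homotopyBar {t : X → ℝ} (ht : Continuous t) {s : X → unitInterval}
    (hs : Continuous s) {F : X → EllBar V E o} (hF : Continuous F) :
    Continuous fun a => homotopyBar o hE Q₀ Q₁ (t a) (s a) (F a) := by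
  have h0 := EllBar.continuous_op.comp hF
  have h1 := continuous_homotopyEll o hE Q₀ Q₁ ht hs h0
  exact continuous_to_ellBar h1 (RegL.map_transport o hE (regG_symb.reparam h0)
    (regG_symb.reparam h1) (fun a x => (F a).op.isEllSymb o hE x)
    (fun a x => (homotopyEll o hE Q₀ Q₁ (t a) (s a) (F a).op).isEllSymb o hE x)
    (fun a x => Eminus_deformSymb o ((F a).op.isEllSymb o hE) (s a) x)
    fun c => (regL_bc hE c).reparam hF)

theorem homotopyBar_F (t : ℝ) (s : unitInterval) (p : EllBar V E o) (x : Bdry M) :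
    (homotopyBar o hE Q₀ Q₁ t s p).F x = p.F x :=
  negBdrySpace_transport (p.op.isEllSymb o hE x)
    ((homotopyEll o hE Q₀ Q₁ t s p.op).isEllSymb o hE x) (o.isConfPlane (x : M))
    (Eminus_deformSymb o (p.op.isEllSymb o hE) s x) (outwardConormal_ne_zero x) (p.compl_plus x)

/-- Transport between equal symbols is the identity, so a pair is fixed as soon as its operator is;
the retraction properties lift from operators to pairs. -/
theorem homotopyBar_of_op_eq (t : ℝ) (s : unitInterval) {p : EllBar V E o}
    (h : homotopyEll o hE Q₀ Q₁ t s p.op = p.op) : homotopyBar o hE Q₀ Q₁ t s p = p := by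
  refine EllBar.ext h (funext fun x => ?_)
  rw [homotopyBar_bc, h, bdryTransport,
    transport_self (p.op.isEllSymb o hE x) (o.isConfPlane (x : M)) (outwardConormal_ne_zero x)]
  exact Submodule.map_id _

theorem homotopyBar_conj {g : UAut V E} (Q : Quantizer V E) {p q : EllBar V E o}
    (h : g.ConjOp p.op q.op)
    (h' : ∀ x, q.bc x = (p.bc x).map (g.fib x).toLinearEquiv.toLinearMap) (s : unitInterval)
    (x : Bdry M) : (homotopyBar o hE Q (Q.conj g) 1 s q).bc x =
      ((homotopyBar o hE Q (Q.conj g) 0 s p).bc x).map (g.fib x).toLinearEquiv.toLinearMap := by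
  rw [homotopyBar_bc, homotopyBar_bc, h', ← Submodule.map_comp, ← Submodule.map_comp]
  congr 1
  refine LinearMap.ext fun v => ?_
  have h1 := h.conjSymb
  exact intertwines_transport (p.op.isEllSymb o hE x)
    (deformSymb_isEllSymb o (p.op.isEllSymb o hE) s x) (q.op.isEllSymb o hE x)
    (deformSymb_isEllSymb o (q.op.isEllSymb o hE) s x) (o.isConfPlane (x : M)) (h1 x)
    (deformSymb_conj o (p.op.isEllSymb o hE) (q.op.isEllSymb o hE) h1 s x)
    (outwardConormal_ne_zero x) v

end BoundaryDeformation

/-! ### Homotopy equivalences from deformation retractions. -/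

section AbstractHomotopy

variable {X : Type*} [TopologicalSpace X] {Y : Set X}

/-- H_1 is the homotopy inverse. One homotopy is H, the other its restriction to Y, which makes
sense because H keeps Y inside itself; so Y may be larger than the image of H_1. -/
theorem inclusionIsHomotopyEquiv (H : C(unitInterval × X, X)) (h0 : ∀ x, H (0, x) = x)
    (h1 : ∀ x, H (1, x) ∈ Y) (hs : ∀ s, ∀ y ∈ Y, H (s, y) ∈ Y) : InclusionIsHomotopyEquiv Y := by
  refine ⟨⟨⟨Subtype.val, continuous_subtype_val⟩,
    ⟨fun x => ⟨H (1, x), h1 x⟩, by fun_prop⟩, ?_, ?_⟩, fun _ => rfl⟩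
  · refine (ContinuousMap.Homotopic.symm ⟨⟨⟨fun z => ⟨H (z.1, z.2), hs z.1 z.2 z.2.2⟩, by fun_prop⟩,
      fun y => Subtype.ext (h0 y), fun y => rfl⟩⟩)
  · exact ContinuousMap.Homotopic.symm ⟨⟨H, h0, fun y => rfl⟩⟩

theorem exists_deformationRetraction {P : C(unitInterval × X, X) → Prop}
    (H : C(unitInterval × X, X)) (h0 : ∀ x, H (0, x) = x) (h1 : ∀ x, H (1, x) ∈ Y)
    (hs : ∀ s, ∀ y ∈ Y, H (s, y) ∈ Y) (h11 : ∀ x, H (1, H (1, x)) = H (1, x)) (hP : P H) :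
    InclusionIsHomotopyEquiv Y ∧ ∃ Y' ⊆ Y, ∃ H : C(unitInterval × X, X),
      IsDeformationRetraction H Y' ∧ P H :=
  ⟨inclusionIsHomotopyEquiv H h0 h1 hs, Set.range fun x => H (1, x),
    Set.range_subset_iff.2 h1, H, ⟨h0, fun x => ⟨x, rfl⟩, by rintro _ ⟨x, rfl⟩; exact h11 x⟩, hP⟩

theorem exists_deformationRetraction_of_isEmpty [IsEmpty X]
    {P : C(unitInterval × X, X) → Prop} (hP : ∀ H, P H) :
    InclusionIsHomotopyEquiv Y ∧ ∃ Y' ⊆ Y, ∃ H : C(unitInterval × X, X),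
      IsDeformationRetraction H Y' ∧ P H :=
  exists_deformationRetraction ⟨Prod.snd, continuous_snd⟩ isEmptyElim isEmptyElim
    (fun _ => isEmptyElim) isEmptyElim (hP _)

end AbstractHomotopy

/-! ### Paths with conjugate ends. -/

section Paths

variable {M : Type*} [TopologicalSpace M] [ChartedSpace (EuclideanHalfSpace 2) M]
  [IsManifold (𝓡∂ 2) ∞ M]

variable {V : Type*} [NormedAddCommGroup V] [NormedSpace ℂ V] [FiniteDimensional ℂ V]
  {E : M → Type*} [TopologicalSpace (TotalSpace V E)]
  [∀ x, NormedAddCommGroup (E x)] [∀ x, InnerProductSpace ℂ (E x)]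
  [FiberBundle V E] [VectorBundle ℂ V E] [VectorBundle ℝ V E]
  [ContMDiffVectorBundle ∞ V E (𝓡∂ 2)]

variable [MeasurableSpace M] [BorelSpace M] [CompactSpace M] [T2Space M]
  [RiemannianBundle (fun x : M => TangentSpace (𝓡∂ 2) x)]
  [IsContMDiffRiemannianBundle (𝓡∂ 2) ∞ Plane (fun x : M => TangentSpace (𝓡∂ 2) x)]
  [∀ x, FiniteDimensional ℂ (E x)] (o : SurfaceOrientation M) (hE : IsSmoothHermitian V E)
  (Q : Quantizer V E) (g : UAut V E)

omit [∀ x, FiniteDimensional ℂ (E x)] [BorelSpace M] [CompactSpace M] [T2Space M]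
  [IsContMDiffRiemannianBundle (𝓡∂ 2) ∞ Plane (fun x : M => TangentSpace (𝓡∂ 2) x)] in
theorem gluedEminus_congr {γ γ' : unitInterval → Ell V E}
    (h : ∀ t x, Eminus o (γ t).symb x = Eminus o (γ' t).symb x) :
    gluedEminus o g γ = gluedEminus o g γ' := by
  simp only [gluedEminus, h]

omit [∀ x, FiniteDimensional ℂ (E x)] [BorelSpace M] [CompactSpace M] [T2Space M]
  [IsContMDiffRiemannianBundle (𝓡∂ 2) ∞ Plane (fun x : M => TangentSpace (𝓡∂ 2) x)] in
theorem gluedF_congr {o : SurfaceOrientation M} {γ γ' : unitInterval → EllBar V E o}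
    (h : ∀ t x, (γ t).F x = (γ' t).F x) : gluedF g γ = gluedF g γ' := by
  simp only [gluedF, h]

/-- The homotopy on paths of operators. -/
def homotopyPath (s : unitInterval) (γ : PathEll g) : PathEll g :=
  -- The path parameter t is also the mixing parameter of the quantizers, which keeps the ends
  -- conjugate.
  ⟨⟨fun t => homotopyEll o hE Q (Q.conj g) t s (γ.1 t), continuous_homotopyEll o hE Q (Q.conj g)
    continuous_subtype_val continuous_const γ.1.continuous⟩, homotopyEll_conj o hE Q γ.2 s⟩

theorem continuous_homotopyPath : Continuous fun z : unitInterval × PathEll g =>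
    homotopyPath o hE Q g z.1 z.2 := by
  refine continuous_induced_rng.2 (ContinuousMap.continuous_of_continuous_uncurry _ ?_)
  exact continuous_homotopyEll o hE Q (Q.conj g)
    (t := fun z : (unitInterval × PathEll g) × unitInterval => (z.2 : ℝ))
    (continuous_subtype_val.comp continuous_snd) (continuous_fst.comp continuous_fst)
    (F := fun z => z.1.2.1 z.2) (by fun_prop)

/-- The homotopy on paths of boundary value problems. -/
def homotopyPathBar (s : unitInterval) (γ : PathEllBar o g) : PathEllBar o g :=
  ⟨⟨fun t => homotopyBar o hE Q (Q.conj g) t s (γ.1 t), continuous_homotopyBar o hE Q (Q.conj g)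
    continuous_subtype_val continuous_const γ.1.continuous⟩, homotopyEll_conj o hE Q γ.2.1 s,
    homotopyBar_conj o hE Q γ.2.1 γ.2.2 s⟩

theorem continuous_homotopyPathBar : Continuous fun z : unitInterval × PathEllBar o g =>
    homotopyPathBar o hE Q g z.1 z.2 := by
  refine continuous_induced_rng.2 (ContinuousMap.continuous_of_continuous_uncurry _ ?_)
  exact continuous_homotopyBar o hE Q (Q.conj g)
    (t := fun z : (unitInterval × PathEllBar o g) × unitInterval => (z.2 : ℝ))
    (continuous_subtype_val.comp continuous_snd) (continuous_fst.comp continuous_fst)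
    (F := fun z => z.1.2.1 z.2) (by fun_prop)

end Paths

end BVP

end

/-! ### Assembly of the homotopies. -/

theorem mainTheorem4
    {M : Type*} [TopologicalSpace M] [ChartedSpace (EuclideanHalfSpace 2) M]
    [IsManifold (𝓡∂ 2) ∞ M] [CompactSpace M] [T2Space M] [ConnectedSpace M]
    [MeasurableSpace M] [BorelSpace M]
    (hM : ((𝓡∂ 2).boundary M).Nonempty)
    [RiemannianBundle (fun x : M => TangentSpace (𝓡∂ 2) x)]
    [IsContMDiffRiemannianBundle (𝓡∂ 2) ∞ (EuclideanSpace ℝ (Fin 2))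
      (fun x : M => TangentSpace (𝓡∂ 2) x)]
    (o : BVP.SurfaceOrientation M)
    {V : Type*} [NormedAddCommGroup V] [NormedSpace ℂ V] [FiniteDimensional ℂ V]
    {E : M → Type*} [TopologicalSpace (TotalSpace V E)]
    [∀ x, NormedAddCommGroup (E x)] [∀ x, InnerProductSpace ℂ (E x)]
    [FiberBundle V E] [VectorBundle ℂ V E] [VectorBundle ℝ V E]
    [ContMDiffVectorBundle ∞ V E (𝓡∂ 2)] (hE : BVP.IsSmoothHermitian V E) :
    -- operators
    (BVP.InclusionIsHomotopyEquiv (BVP.Dir V E o) ∧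
      ∃ Y ⊆ BVP.Dir V E o, ∃ H : C(unitInterval × BVP.Ell V E, BVP.Ell V E),
        BVP.IsDeformationRetraction H Y ∧
        (∀ s A x, BVP.Eminus o (H (s, A)).symb x = BVP.Eminus o A.symb x) ∧
        (∀ s A B, A.symb = B.symb → (H (s, A)).symb = (H (s, B)).symb) ∧
        (∀ (g : BVP.UAut V E) s A B, g.ConjSymb A.symb B.symb →
          g.ConjSymb (H (s, A)).symb (H (s, B)).symb) ∧
        (∀ s, ∀ A ∈ BVP.Dir V E o, (H (s, A)).symb = A.symb) ∧
        (∀ A ∈ Set.range (fun A => H (1, A)), ∀ B ∈ Set.range (fun A => H (1, A)),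
          A.symb = B.symb → A = B)) ∧
    -- boundary value problems
    (BVP.InclusionIsHomotopyEquiv (BVP.DirBar V E o) ∧
      ∃ Y ⊆ BVP.DirBar V E o, ∃ H : C(unitInterval × BVP.EllBar V E o, BVP.EllBar V E o),
        BVP.IsDeformationRetraction H Y ∧
        (∀ s p x, BVP.Eminus o (H (s, p)).op.symb x = BVP.Eminus o p.op.symb x) ∧
        (∀ s p x, (H (s, p)).F x = p.F x)) ∧
    -- paths with conjugate ends
    (∀ g : BVP.UAut V E,
      (BVP.InclusionIsHomotopyEquiv (BVP.PathDir o g) ∧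
        ∃ Y ⊆ BVP.PathDir o g, ∃ H : C(unitInterval × BVP.PathEll g, BVP.PathEll g),
          BVP.IsDeformationRetraction H Y ∧
          (∀ s γ, BVP.gluedEminus o g (H (s, γ)).1 = BVP.gluedEminus o g γ.1)) ∧
      (BVP.InclusionIsHomotopyEquiv (BVP.PathDirBar o g) ∧
        ∃ Y ⊆ BVP.PathDirBar o g, ∃ H : C(unitInterval × BVP.PathEllBar o g, BVP.PathEllBar o g),
          BVP.IsDeformationRetraction H Y ∧
          (∀ s γ, BVP.gluedEminus o g (fun t => ((H (s, γ)).1 t).op) =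
            BVP.gluedEminus o g (fun t => (γ.1 t).op)) ∧
          (∀ s γ, BVP.gluedF g (H (s, γ)).1 = BVP.gluedF g γ.1))) := by
  haveI : ∀ x, FiniteDimensional ℂ (E x) := BVP.finiteDimensional_fibre V
  -- A quantizer needs some elliptic operator to start from; without one, all the spaces are empty.
  rcases isEmpty_or_nonempty (BVP.Ell V E) with hemp | hne
  · haveI : IsEmpty (BVP.EllBar V E o) := ⟨fun p => hemp.false p.op⟩
    haveI : ∀ g : BVP.UAut V E, IsEmpty (BVP.PathEll g) := fun g => ⟨fun γ => hemp.false (γ.1 0)⟩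
    haveI : ∀ g : BVP.UAut V E, IsEmpty (BVP.PathEllBar o g) := fun g =>
      ⟨fun γ => hemp.false (γ.1 0).op⟩
    exact ⟨BVP.exists_deformationRetraction_of_isEmpty fun H => ⟨fun _ => isEmptyElim,
        fun _ => isEmptyElim, fun _ _ => isEmptyElim, fun _ => isEmptyElim, isEmptyElim⟩,
      BVP.exists_deformationRetraction_of_isEmpty fun H => ⟨fun _ => isEmptyElim,
        fun _ => isEmptyElim⟩,
      fun g => ⟨BVP.exists_deformationRetraction_of_isEmpty fun H _ => isEmptyElim,
        BVP.exists_deformationRetraction_of_isEmpty fun H => ⟨fun _ => isEmptyElim,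
          fun _ => isEmptyElim⟩⟩⟩
  obtain ⟨Q⟩ := BVP.exists_quantizer o hE
  have hell : ∀ (A : BVP.Ell V E) x, BVP.IsEllSymb (A.symb x) := fun A => A.isEllSymb o hE
  refine ⟨?_, ?_, fun g => ⟨?_, ?_⟩⟩
  -- Without a prescribed g no interpolation is needed: both quantizers are `Q` and the mixing
  -- parameter is 0.
  · refine BVP.exists_deformationRetraction
      ⟨fun z => BVP.homotopyEll o hE Q Q 0 z.1 z.2, BVP.continuous_homotopyEll o hE Q Q
        continuous_const continuous_fst continuous_snd⟩ (BVP.homotopyEll_zero o hE Q Q 0)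
      (BVP.homotopyEll_one_mem o hE Q Q 0) (fun s A hA => BVP.homotopyEll_mem o hE Q Q 0 s hA)
      (BVP.homotopyEll_one_one o hE Q Q 0)
      ⟨fun s A x => BVP.Eminus_deformSymb o (hell A) s x,
        fun s A B h => congrArg (fun σ => BVP.deformSymb o σ s) h,
        fun g s A B h => BVP.deformSymb_conj o (hell A) (hell B) h s,
        fun s A hA => BVP.deformSymb_of_dirac o (hell A) hA.1 s, ?_⟩
    rintro _ ⟨A, rfl⟩ _ ⟨B, rfl⟩ h
    -- Equal final symbols have equal E⁻, and E⁻ of the final symbol is that of the original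
    -- operator.
    refine BVP.homotopyEll_one_congr o hE Q Q 0 h fun x => ?_
    rw [← BVP.Eminus_deformSymb o (hell A) 1 x, ← BVP.Eminus_deformSymb o (hell B) 1 x]
    exact congrArg (fun σ => BVP.Eminus o σ x) h
  · exact BVP.exists_deformationRetraction
      ⟨fun z => BVP.homotopyBar o hE Q Q 0 z.1 z.2, BVP.continuous_homotopyBar o hE Q Q
        continuous_const continuous_fst continuous_snd⟩
      (fun p => BVP.homotopyBar_of_op_eq o hE Q Q 0 0 (BVP.homotopyEll_zero o hE Q Q 0 p.op))
      (fun p => BVP.homotopyEll_one_mem o hE Q Q 0 p.op)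
      (fun s p hp => BVP.homotopyEll_mem o hE Q Q 0 s hp)
      (fun p => BVP.homotopyBar_of_op_eq o hE Q Q 0 1 (BVP.homotopyEll_one_one o hE Q Q 0 p.op))
      ⟨fun s p x => BVP.Eminus_deformSymb o (hell p.op) s x,
        fun s p x => BVP.homotopyBar_F o hE Q Q 0 s p x⟩
  · exact BVP.exists_deformationRetraction
      ⟨fun z => BVP.homotopyPath o hE Q g z.1 z.2, BVP.continuous_homotopyPath o hE Q g⟩
      (fun γ => Subtype.ext (ContinuousMap.ext fun t =>
        BVP.homotopyEll_zero o hE Q (Q.conj g) t (γ.1 t)))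
      (fun γ t => BVP.homotopyEll_one_mem o hE Q (Q.conj g) t (γ.1 t))
      (fun s γ hγ t => BVP.homotopyEll_mem o hE Q (Q.conj g) t s (hγ t))
      (fun γ => Subtype.ext (ContinuousMap.ext fun t =>
        BVP.homotopyEll_one_one o hE Q (Q.conj g) t (γ.1 t)))
      fun s γ => BVP.gluedEminus_congr o g fun t x =>
        BVP.Eminus_deformSymb o (hell (γ.1 t)) s x
  · exact BVP.exists_deformationRetraction
      ⟨fun z => BVP.homotopyPathBar o hE Q g z.1 z.2, BVP.continuous_homotopyPathBar o hE Q g⟩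
      (fun γ => Subtype.ext (ContinuousMap.ext fun t =>
        BVP.homotopyBar_of_op_eq o hE Q (Q.conj g) t 0
          (BVP.homotopyEll_zero o hE Q (Q.conj g) t (γ.1 t).op)))
      (fun γ t => BVP.homotopyEll_one_mem o hE Q (Q.conj g) t (γ.1 t).op)
      (fun s γ hγ t => BVP.homotopyEll_mem o hE Q (Q.conj g) t s (hγ t))
      (fun γ => Subtype.ext (ContinuousMap.ext fun t =>
        BVP.homotopyBar_of_op_eq o hE Q (Q.conj g) t 1
          (BVP.homotopyEll_one_one o hE Q (Q.conj g) t (γ.1 t).op)))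
      ⟨fun s γ => BVP.gluedEminus_congr o g fun t x =>
          BVP.Eminus_deformSymb o (hell (γ.1 t).op) s x,
        fun s γ => BVP.gluedF_congr g fun t x =>
          BVP.homotopyBar_F o hE Q (Q.conj g) t s (γ.1 t) x⟩
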